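/- **Setup.** Fix a ground field $\mathbb k$. A *weight* is a labelling of a set of consecutive integers (the vertices) by $\circ,\times,\vee,\wedge$ such that outside some finite set of vertices one cannot find two vertices labelled $\vee\,\wedge$ in that order from left to right. The *Bruhat order* on weights is generated by swapping a $\vee$ and a $\wedge$, a weight getting bigger when $\vee$'s move to the right; a *block* $\Lambda$ is an equivalence class of weights for the relation "having a common upper bound". For a weight $\lambda$, the cup diagram $\underline\lambda$ is obtained by repeatedly joining by a cup a pair of vertices $\vee\,\wedge$ (in this order) having only $\circ$'s, $\times$'s and already joined vertices between them, and finally drawing rays down at the remaining $\vee$'s and $\wedge$'s; $\overline\lambda$ is its mirror image. Write $\mu\subset\lambda$ (or $\lambda\supset\mu$) if $\lambda,\mu$ lie in the same block and $\underline\mu\lambda$ is oriented, i.e. each cup of $\underline\mu$ has one end labelled $\vee$ and one labelled $\wedge$ in $\lambda$, and no two rays are labelled $\vee\,\wedge$ from left to right; $\deg(\underline\mu\lambda)=\deg(\lambda\overline\mu)$ is the number of cups whose left end is labelled $\wedge$ in $\lambda$. The *defect* of $\Lambda$ is the supremum over $\lambda\in\Lambda$ of the number of cups of $\underline\lambda$.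 $K_\Lambda$ is the graded algebra with basis $(\underline\alpha\lambda\overline\beta)$, $\alpha\subset\lambda\supset\beta$ in $\Lambda$, of degree $\deg(\underline\alpha\lambda)+\deg(\lambda\overline\beta)$. The product $(\underline\alpha\lambda\overline\beta)(\underline\gamma\mu\overline\delta)$ is $0$ if $\beta\ne\gamma$. If $\beta=\gamma$ it is $\sum_\nu c_\nu(\underline\alpha\nu\overline\delta)$ over $\nu\in\Lambda$ with $\alpha\subset\nu\supset\delta$, where $c_\nu\in\mathbb Z_{\ge0}$ is computed as follows. Truncate $\alpha,\lambda,\beta,\mu,\delta,\nu$ to a common bounded part of the number line, large enough to contain all places where they differ and such that no weight has $\vee\,\wedge$ in this order outside of it. If the truncated weights have $p$ labels $\wedge$ and $q$ labels $\vee$, add $p$ new vertices labelled $\vee$ at the left end and $q$ new vertices labelled $\wedge$ at the right end, so that all cup diagrams are closed. Draw the first oriented circle diagram under the second and apply Khovanov's surgery procedure to all cap–cup pairs in the middle, with $1\otimes1\mapsto1$, $1\otimes x,\ x\otimes1\mapsto x$, $x\otimes x\mapsto0$, $1\mapsto1\otimes x+x\otimes1$, $x\mapsto x\otimes x$, where $1$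 (resp. $x$) stands for a circle whose leftmost vertex is labelled $\vee$ (resp. $\wedge$); $c_\nu$ is the multiplicity of the closure of $\nu$ as the resulting weight. Let $e_\lambda=(\underline\lambda\lambda\overline\lambda)$ and let $*$ be the linear map $(\underline\alpha\lambda\overline\beta)\mapsto(\underline\beta\lambda\overline\alpha)$. Modules are left modules $M$ with $M=\bigoplus_{\lambda\in\Lambda}e_\lambda M$; morphisms of graded modules are homogeneous of degree $0$; $M\langle j\rangle_i=M_{i-j}$. The graded dual $M^\circledast$ has $(M^\circledast)_j=\operatorname{Hom}(M_{-j},\mathbb k)$ with $(xf)(m)=f(x^*m)$. For $\lambda\in\Lambda$: $L(\lambda)$ is $\mathbb k$ in degree $0$, on which $e_\lambda$ acts as $1$ and all other basis vectors as $0$; $P(\lambda)=K_\Lambda e_\lambda$; and $V(\lambda)$ is the cell module with homogeneous basis $(\underline\gamma\lambda|$, $\gamma\subset\lambda$, of degree $\deg(\underline\gamma\lambda)$, where $(\underline\alpha\mu\overline\beta)(\underline\gamma\lambda|$ equals $s\,(\underline\alpha\lambda|$ if $\beta=\gamma$ and $\alpha\subset\lambda$, and $0$ otherwise, $s$ being the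 coefficient of $(\underline\alpha\lambda\overline\lambda)$ in $(\underline\alpha\mu\overline\beta)(\underline\beta\lambda\overline\lambda)$. **Theorem.** Let $\Lambda$ be a block with $\operatorname{defect}(\Lambda)<\infty$. The above formulas for $L(\lambda),V(\lambda),P(\lambda)$ and $\circledast$ define finite-dimensional graded $K_\Lambda$-modules and a duality, and the category $\mathcal C$ of finite-dimensional graded $K_\Lambda$-modules, with the shifts $\langle j\rangle$ $(j\in\mathbb Z)$ and the weight poset $\Lambda$ (with the Bruhat order), is a positively graded highest weight category with duality in the sense of Cline, Parshall and Scott. That is: 0. the poset $\Lambda$ is interval-finite; 1. $\mathcal C$ is a $\mathbb k$-linear abelian category with finite-dimensional morphism spaces in which all objects have finite length, the shifts are $\mathbb k$-linear, and $\circledast:\mathcal C\to\mathcal C^{\mathrm{op}}$ is a $\mathbb k$-linear equivalence with $(M\langle j\rangle)^\circledast\cong M^\circledast\langle-j\rangle$; 2. $L(\lambda)\cong L(\lambda)^\circledast$, and the $L(\lambda)\langle j\rangle$ $(\lambda\in\Lambda,\ j\in\mathbb Z)$ form a complete irredundant list of the irreducible objects up to isomorphism; 3. $P(\lambda)$ is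 a projective cover of $L(\lambda)$, and all its composition factors are of the form $L(\mu)\langle j\rangle$ with $\mu\in\Lambda$, $j\ge0$; 4. $V(\lambda)$ is the largest quotient of $P(\lambda)$ such that all composition factors of its radical are of the form $L(\mu)\langle j\rangle$ with $\mu<\lambda$, and the kernel of $P(\lambda)\to V(\lambda)$ has a finite filtration with all factors of the form $V(\nu)\langle j\rangle$ with $\nu>\lambda$. Moreover, the $P(\lambda)\langle j\rangle$ and the $P(\lambda)^\circledast\langle j\rangle$ are complete irredundant lists of the indecomposable projective and of the indecomposable injective objects of $\mathcal C$ up to isomorphism; $P(\lambda)^\circledast$ is an injective hull of $L(\lambda)$; and $V(\lambda)^\circledast$ is the costandard object, i.e. the largest subobject of $P(\lambda)^\circledast$ such that all composition factors of its quotient by its socle are of the form $L(\mu)\langle j\rangle$ with $\mu<\lambda$. -/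

import Mathlib

open CategoryTheory CategoryTheory.Limits

universe u v

namespace ArcAlgebra

/-! ## Weights, Bruhat order, blocks -/

/-- The four possible labels of a vertex: nought, cross, down, up. -/
inductive Label : Type
  | nought
  | cross
  | down
  | up

/-- A labelled number line inside `ℤ`; the value `none` means that there is no vertex at that
position. -/
abbrev Labelling : Type := ℤ → Option Label

/-- The vertices of a labelled number line. -/
def vertices (f : Labelling) : Set ℤ := {i | f i ≠ none}

/-- A weight: a labelling of a set of consecutive integers such that, outside of some finite set,
one cannot find two vertices labelled down, up in that order from left to right. -/
structure Weight : Type where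
  lab : Labelling
  consecutive : (vertices lab).OrdConnected
  ultimately : ∃ F : Set ℤ, F.Finite ∧ ∀ i j : ℤ, i ∉ F → j ∉ F → i < j →
    ¬ (lab i = some .down ∧ lab j = some .up)

theorem Weight.ext' {a b : Weight} (h : a.lab = b.lab) : a = b := by
  cases a; cases b; cases h; rfl

/-- The basic Bruhat operation: swap a down at `i` and an up at `j`, `i < j`, so that the down
moves to the right. -/
def BruhatStep (a b : Weight) : Prop :=
  ∃ i j : ℤ, i < j ∧ a.lab i = some .down ∧ a.lab j = some .up ∧
    b.lab i = some .up ∧ b.lab j = some .down ∧ ∀ k, k ≠ i → k ≠ j → b.lab k = a.lab k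

theorem bruhat_lex {a b : Weight} (h : Relation.ReflTransGen BruhatStep a b) :
    a = b ∨ ∃ i, a.lab i = some .down ∧ b.lab i = some .up ∧ ∀ k < i, a.lab k = b.lab k := by
  induction h with
  | refl => exact Or.inl rfl
  | @tail b c _ hbc ih =>
    obtain ⟨i, j, hij, h1, h2, h3, h4, h5⟩ := hbc
    right
    have key : ∀ k < i, b.lab k = c.lab k := fun k hk => (h5 k (by omega) (by omega)).symm
    rcases ih with rfl | ⟨m, hm1, hm2, hm3⟩
    · exact ⟨i, h1, h3, key⟩
    · rcases lt_trichotomy m i with h | h | h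
      · exact ⟨m, hm1, by rw [← key m h, hm2], fun k hk => by rw [hm3 k hk, key k (by omega)]⟩
      · subst h; rw [hm2] at h1; cases h1
      · exact ⟨i, by rw [hm3 i h, h1], h3, fun k hk => by rw [hm3 k (by omega), key k hk]⟩

/-- The Bruhat order on weights. -/
instance : PartialOrder Weight where
  le := Relation.ReflTransGen BruhatStep
  le_refl _ := Relation.ReflTransGen.refl
  le_trans _ _ _ h1 h2 := Relation.ReflTransGen.trans h1 h2
  le_antisymm a b h1 h2 := by
    rcases bruhat_lex h1 with h | ⟨i, hi1, hi2, hi3⟩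
    · exact h
    rcases bruhat_lex h2 with h | ⟨j, hj1, hj2, hj3⟩
    · exact h.symm
    exfalso
    rcases lt_trichotomy i j with h | h | h
    · rw [hj3 i h, hi1] at hi2; cases hi2
    · subst h; rw [hi1] at hj2; cases hj2
    · rw [hi3 j h, hj1] at hj2; cases hj2

/-- Two weights are in the same block if they have a common upper bound in the Bruhat order. -/
def SameBlock (a b : Weight) : Prop := ∃ c : Weight, a ≤ c ∧ b ≤ c

/-- Blocks are the equivalence classes of `SameBlock`. -/
def IsBlock (Λ : Set Weight) : Prop := ∃ a : Weight, Λ = {b | SameBlock a b}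

/-! ## The cup diagram of a weight, orientations, degree, defect -/

/-- `IsCup f i j`: the vertices `i < j` are joined by a cup in the cup diagram of `f`.  This is the
standard procedure: join a down at `i` with an up at `j` as soon as each down or up `k` strictly
between them has already been joined by a cup to some other vertex `g k` between them. -/
inductive IsCup (f : Labelling) : ℤ → ℤ → Prop
  | mk (i j : ℤ) (g : ℤ → ℤ) : i < j → f i = some .down → f j = some .up →
      (∀ k, i < k → k < j → (f k = some .down ∨ f k = some .up) → i < g k ∧ g k < j) →
      (∀ k, i < k → k < j → f k = some .down → IsCup f k (g k)) →
      (∀ k, i < k → k < j → f k = some .up → IsCup f (g k) k) → IsCup f i j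

/-- `IsRay f i`: there is a ray at the vertex `i` in the cup diagram of `f`. -/
def IsRay (f : Labelling) (i : ℤ) : Prop :=
  (f i = some .down ∨ f i = some .up) ∧ ∀ j, ¬ IsCup f i j ∧ ¬ IsCup f j i

/-- Gluing the cup diagram of `a` under the weight `f` gives an oriented cup diagram. (By
reflection, this also says that gluing `f` under the cap diagram of `a` gives an oriented
cap diagram.) -/
structure IsOrientedCupDiagram (a f : Labelling) : Prop where
  line : vertices a = vertices f
  free : ∀ i, (a i = some .nought ∨ a i = some .cross) →
    (f i = some .nought ∨ f i = some .cross)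
  cup : ∀ i j, IsCup a i j →
    (f i = some .down ∧ f j = some .up) ∨ (f i = some .up ∧ f j = some .down)
  ray : ∀ i, IsRay a i → (f i = some .down ∨ f i = some .up)
  rays : ∀ i j, IsRay a i → IsRay a j → i < j → ¬ (f i = some .down ∧ f j = some .up)

/-- The relation `a ⊂ w` on weights. -/
def Weight.Sub (a w : Weight) : Prop := SameBlock a w ∧ IsOrientedCupDiagram a.lab w.lab

/-- The degree of the cup diagram of `a` (or its mirror image cap diagram) oriented by `w`:
the number of clockwise cups, that is, of those whose leftmost vertex is labelled up. -/
noncomputable def cupDegree (a w : Weight) : ℕ :=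
  Set.ncard {p : ℤ × ℤ | IsCup a.lab p.1 p.2 ∧ w.lab p.1 = some .up}

/-- The defect of a weight: the number of cups in its cup diagram. -/
noncomputable def Weight.defect (a : Weight) : ℕ∞ :=
  Set.encard {p : ℤ × ℤ | IsCup a.lab p.1 p.2}

/-- The defect of a block. -/
noncomputable def defect (Λ : Set Weight) : ℕ∞ := ⨆ a ∈ Λ, a.defect

/-! ## The surgery procedure for closed diagrams

A two-line diagram has a bottom number line (`false`) and a top number line (`true`), with the cup
diagram of `a` at the bottom, the cap diagram of `d` at the top and a symmetric middle section made
from the cap diagram of `b` below its mirror image.  The cap-cup pairs of the middle section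
are cut in the order of their left ends from left to right; an outer pair is thus cut before the
pairs nested inside it, so that the pair being cut can always be connected without crossings.
The stage of the procedure is recorded by `t : ℤ`: the pairs with left end `< t` have already
been replaced by two vertical line segments. -/

/-- Vertices of a two-line diagram. -/
abbrev Vertex : Type := ℤ × Bool

/-- Labels on the vertices of a two-line diagram. -/
abbrev TwoLine : Type := Vertex → Option Label

/-- Two vertices joined by a cup or a cap at stage `t`. -/
inductive Arc (a b d : Labelling) (t : ℤ) : Vertex → Vertex → Prop
  | bottom (i j : ℤ) : IsCup a i j → Arc a b d t (i, false) (j, false)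
  | top (i j : ℤ) : IsCup d i j → Arc a b d t (i, true) (j, true)
  | middle (i j : ℤ) (e : Bool) : IsCup b i j → t ≤ i → Arc a b d t (i, e) (j, e)

/-- Two vertices joined by a vertical line segment at stage `t`. -/
inductive Segment (b : Labelling) (t : ℤ) : Vertex → Vertex → Prop
  | left (i j : ℤ) : IsCup b i j → i < t → Segment b t (i, false) (i, true)
  | right (i j : ℤ) : IsCup b i j → i < t → Segment b t (j, false) (j, true)

/-- Two vertices lie on the same circle at stage `t`. -/
def SameCircle (a b d : Labelling) (t : ℤ) : Vertex → Vertex → Prop :=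
  Relation.EqvGen fun x y => Arc a b d t x y ∨ Segment b t x y

/-- The labels `w` orient the diagram at stage `t` consistently. -/
def IsOrientation (a b d : Labelling) (t : ℤ) (w : TwoLine) : Prop :=
  (∀ x y, Arc a b d t x y →
    (w x = some .down ∧ w y = some .up) ∨ (w x = some .up ∧ w y = some .down)) ∧
  ∀ x y, Segment b t x y → w x = w y

/-- The type of an oriented circle: `one` is anti-clockwise, `x` is clockwise. -/
inductive CircleType : Type
  | one
  | x

open Classical in
/-- The type of the circle through the vertex `y`: it is anti-clockwise if its leftmost vertex is
labelled down, and clockwise otherwise. -/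
noncomputable def circleType (a b d : Labelling) (t : ℤ) (w : TwoLine) (y : Vertex) : CircleType :=
  if ∃ z, SameCircle a b d t y z ∧ (∀ z', SameCircle a b d t y z' → z.1 ≤ z'.1) ∧
    w z = some .down then .one else .x

/-- Reorientation when two circles are combined into one:
`1 ⊗ 1 ↦ 1`, `1 ⊗ x ↦ x`, `x ⊗ 1 ↦ x`, `x ⊗ x ↦ 0`. -/
inductive MergeRule : CircleType → CircleType → CircleType → Prop
  | one_one : MergeRule .one .one .one
  | one_x : MergeRule .one .x .x
  | x_one : MergeRule .x .one .x

/-- Reorientation when a circle is split into two: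
`1 ↦ 1 ⊗ x + x ⊗ 1`, `x ↦ x ⊗ x`. -/
inductive SplitRule : CircleType → CircleType → CircleType → Prop
  | one_one_x : SplitRule .one .one .x
  | one_x_one : SplitRule .one .x .one
  | x_x_x : SplitRule .x .x .x

/-- `SurgeryStep a b d t w w'`: there is a cap-cup pair of the middle section with left end `t`, and
cutting it turns the diagram oriented by `w` into a sum of diagrams one of which is oriented by
`w'`. -/
def SurgeryStep (a b d : Labelling) (t : ℤ) (w w' : TwoLine) : Prop :=
  ∃ j, IsCup b t j ∧ IsOrientation a b d (t + 1) w' ∧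
    (∀ y, ¬ SameCircle a b d t (t, false) y → ¬ SameCircle a b d t (t, true) y → w' y = w y) ∧
    (¬ SameCircle a b d t (t, false) (t, true) →
      MergeRule (circleType a b d t w (t, false)) (circleType a b d t w (t, true))
        (circleType a b d (t + 1) w' (t, false))) ∧
    (SameCircle a b d t (t, false) (t, true) →
      SplitRule (circleType a b d t w (t, false))
        (circleType a b d (t + 1) w' (t, false)) (circleType a b d (t + 1) w' (j, false)))

open Classical in
/-- The multiplicity of the diagram oriented by `z` in the result of iterating the surgery procedure
over the `n` columns `t, t + 1, …, t + n - 1`, starting from the diagram oriented by `w`. -/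
noncomputable def surgeryCount (a b d : Labelling) : ℕ → ℤ → TwoLine → TwoLine → ℕ
  | 0, _, w, z => if w = z then 1 else 0
  | n + 1, t, w, z =>
    if ∃ j, IsCup b t j then
      ∑ᶠ (w' : TwoLine) (_ : SurgeryStep a b d t w w'), surgeryCount a b d n (t + 1) w' z
    else surgeryCount a b d n (t + 1) w z

/-- The two-line diagram labels with bottom weight `f` and top weight `g`. -/
def stack (f g : Labelling) : TwoLine := fun y => if y.2 then g y.1 else f y.1

/-- Structure constants of Khovanov's algebra: for bounded weights whose cup diagrams are closed,
the coefficient of `(a ν d)` in the product `(a σ b)(b τ d)` of closed oriented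
circle diagrams; here `a`, `b`, `d` stand for the cup diagrams of these weights or their mirror
images. -/
noncomputable def closedCoeff (a σ b τ d ν : Labelling) : ℕ :=
  surgeryCount a b d (vertices b).ncard (sInf (vertices b)) (stack σ τ) (stack ν ν)

open Classical in
/-- The closure of a bounded weight with `p` ups and `q` downs: add `p` new vertices labelled down
at the left end and `q` new vertices labelled up at the right end of the number line. -/
noncomputable def closure (f : Labelling) : Labelling := fun i =>
  if f i ≠ none then f i
  else if sInf (vertices f) - ({k | f k = some .up}.ncard : ℤ) ≤ i ∧ i < sInf (vertices f) then
    some .down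
  else if sSup (vertices f) < i ∧ i ≤ sSup (vertices f) + ({k | f k = some .down}.ncard : ℤ) then
    some .up
  else none

/-- Structure constants for bounded weights: the coefficient of `(a ν d)` in `(a σ b)(b τ d)`,
computed by closing all the diagrams and multiplying in Khovanov's algebra, modulo the span of
the diagrams whose weight is not a closure. -/
noncomputable def boundedCoeff (a σ b τ d ν : Labelling) : ℕ :=
  closedCoeff (closure a) (closure σ) (closure b) (closure τ) (closure d) (closure ν)

/-- Truncation of a labelled number line to the vertices in `[-N, N]`. -/
def truncate (N : ℕ) (f : Labelling) : Labelling := fun i => if |i| ≤ (N : ℤ) then f i else none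

open Classical in
/-- The eventual value of an eventually constant sequence. -/
noncomputable def eventualValue (f : ℕ → ℕ) : ℕ :=
  if h : ∃ c, ∀ᶠ N in Filter.atTop, f N = c then h.choose else 0

/-- Structure constants in general: the coefficient of `(a ν d)` in `(a σ b)(b τ d)`, computed after
truncating all the weights to a sufficiently large bounded part of the number line (the result does
not depend on `N` once `[-N, N]` contains all places where the six weights differ or have
a down to the left of an up). If the number line is bounded, no truncation takes place for
large `N`. -/
noncomputable def structCoeff (a σ b τ d ν : Weight) : ℕ :=
  eventualValue fun N => boundedCoeff (truncate N a.lab) (truncate N σ.lab) (truncate N b.lab)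
    (truncate N τ.lab) (truncate N d.lab) (truncate N ν.lab)

/-! ## The graded algebra `K` of a block -/

/-- The basis vectors of `K`: oriented circle diagrams, made of the cup diagram of
`bot`, the weight `wt` and the cap diagram of `top`, with `bot ⊂ wt ⊃ top`. -/
structure CircleDiagram (Λ : Set Weight) : Type where
  bot : Λ
  wt : Λ
  top : Λ
  bot_sub : bot.1.Sub wt.1
  top_sub : top.1.Sub wt.1

/-- The degree of an oriented circle diagram. -/
noncomputable def CircleDiagram.degree {Λ : Set Weight} (x : CircleDiagram Λ) : ℤ :=
  cupDegree x.bot.1 x.wt.1 + cupDegree x.top.1 x.wt.1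

/-- The mirror image of an oriented circle diagram in the number line. -/
def CircleDiagram.mirror {Λ : Set Weight} (x : CircleDiagram Λ) : CircleDiagram Λ :=
  ⟨x.top, x.wt, x.bot, x.top_sub, x.bot_sub⟩

/-- The vector space `K` with basis the oriented circle diagrams. -/
abbrev KAlg (𝕜 : Type u) [Field 𝕜] (Λ : Set Weight) : Type u := CircleDiagram Λ →₀ 𝕜

section Algebra

variable (𝕜 : Type u) [Field 𝕜] (Λ : Set Weight)

open Classical in
/-- The product of two basis vectors. -/
noncomputable def basisMul (x y : CircleDiagram Λ) : KAlg 𝕜 Λ :=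
  if x.top = y.bot then
    ∑ᶠ (z : CircleDiagram Λ) (_ : z.bot = x.bot ∧ z.top = y.top),
      Finsupp.single z
        (structCoeff x.bot.1 x.wt.1 x.top.1 y.wt.1 y.top.1 z.wt.1 : 𝕜)
  else 0

/-- The multiplication of `K`. -/
noncomputable def kmul : KAlg 𝕜 Λ →ₗ[𝕜] KAlg 𝕜 Λ →ₗ[𝕜] KAlg 𝕜 Λ :=
  Finsupp.linearCombination 𝕜 fun x => Finsupp.linearCombination 𝕜 fun y => basisMul 𝕜 Λ x y

/-- The homogeneous component of degree `j` of `K`. -/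
def kdeg (j : ℤ) : Submodule 𝕜 (KAlg 𝕜 Λ) := Finsupp.supported 𝕜 𝕜 {x | x.degree = j}

/-- The linear map `*` on `K`, reflecting oriented circle diagrams in the number line. -/
noncomputable def kstar : KAlg 𝕜 Λ →ₗ[𝕜] KAlg 𝕜 Λ :=
  Finsupp.lmapDomain 𝕜 𝕜 CircleDiagram.mirror

/-- `IsIdem a x`: the diagram `x` is made of the weight `a`, its cup diagram and its
cap diagram. -/
def IsIdem {Λ : Set Weight} (a : Λ) (x : CircleDiagram Λ) : Prop :=
  x.bot = a ∧ x.wt = a ∧ x.top = a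

open Classical in
/-- The idempotent `e_a` of `K`. -/
noncomputable def idem (a : Λ) : KAlg 𝕜 Λ :=
  if h : ∃ x : CircleDiagram Λ, IsIdem a x then Finsupp.single h.choose 1 else 0

end Algebra

/-! ## Finite dimensional graded modules -/

/-- A finite dimensional graded (left, locally unital) `K`-module: a graded vector space with a
bilinear action satisfying `(x y) m = x (y m)`. -/
structure FinGrMod (𝕜 : Type u) [Field 𝕜] (Λ : Set Weight) : Type (u + 1) where
  carrier : Type u
  [addCommGroup : AddCommGroup carrier]
  [module : Module 𝕜 carrier]
  finite : FiniteDimensional 𝕜 carrier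
  /-- the action of `K` -/
  act : KAlg 𝕜 Λ →ₗ[𝕜] carrier →ₗ[𝕜] carrier
  act_mul : ∀ x y m, act (kmul 𝕜 Λ x y) m = act x (act y m)
  /-- the module is the direct sum of the images of the idempotents -/
  idem_indep : iSupIndep fun a : Λ => LinearMap.range (act (idem 𝕜 Λ a))
  idem_top : ⨆ a : Λ, LinearMap.range (act (idem 𝕜 Λ a)) = ⊤
  /-- the homogeneous components, of which the module is the direct sum -/
  deg : ℤ → Submodule 𝕜 carrier
  deg_indep : iSupIndep deg
  deg_top : ⨆ j, deg j = ⊤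
  act_deg : ∀ i j, ∀ x ∈ kdeg 𝕜 Λ i, ∀ m ∈ deg j, act x m ∈ deg (i + j)

attribute [instance] FinGrMod.addCommGroup FinGrMod.module FinGrMod.finite

namespace FinGrMod

variable {𝕜 : Type u} [Field 𝕜] {Λ : Set Weight}

/-- Morphisms: homogeneous `K`-module homomorphisms of degree zero. -/
@[ext]
structure Hom (M N : FinGrMod 𝕜 Λ) : Type u where
  lin : M.carrier →ₗ[𝕜] N.carrier
  map_act : ∀ x m, lin (M.act x m) = N.act x (lin m)
  map_deg : ∀ j, ∀ m ∈ M.deg j, lin m ∈ N.deg j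

instance : Category.{u} (FinGrMod 𝕜 Λ) where
  Hom := Hom
  id M := ⟨LinearMap.id, fun _ _ => rfl, fun _ _ h => h⟩
  comp f g := ⟨g.lin ∘ₗ f.lin, fun x m => by simp [f.map_act, g.map_act],
    fun j m h => g.map_deg j _ (f.map_deg j m h)⟩

/-- The linear map underlying a morphism. -/
def lin {M N : FinGrMod 𝕜 Λ} (f : M ⟶ N) : M.carrier →ₗ[𝕜] N.carrier := Hom.lin f

@[ext]
theorem hom_ext {M N : FinGrMod 𝕜 Λ} {f g : M ⟶ N} (h : lin f = lin g) : f = g := Hom.ext h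

@[simp] theorem lin_id (M : FinGrMod 𝕜 Λ) : lin (𝟙 M) = LinearMap.id := rfl

@[simp] theorem lin_comp {M N P : FinGrMod 𝕜 Λ} (f : M ⟶ N) (g : N ⟶ P) :
    lin (f ≫ g) = lin g ∘ₗ lin f := rfl

variable (M N : FinGrMod 𝕜 Λ)

/-- The morphisms as a subspace of the space of linear maps. -/
def homSubmodule : Submodule 𝕜 (M.carrier →ₗ[𝕜] N.carrier) where
  carrier := {f | (∀ x m, f (M.act x m) = N.act x (f m)) ∧ ∀ j, ∀ m ∈ M.deg j, f m ∈ N.deg j}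
  add_mem' hf hg := ⟨fun x m => by simp [hf.1, hg.1],
    fun j m h => (N.deg j).add_mem (hf.2 j m h) (hg.2 j m h)⟩
  zero_mem' := ⟨fun x m => by simp, fun j m _ => (N.deg j).zero_mem⟩
  smul_mem' c f hf := ⟨fun x m => by simp [hf.1],
    fun j m h => (N.deg j).smul_mem c (hf.2 j m h)⟩

/-- Morphisms are the elements of `homSubmodule`. -/
def homEquiv : (M ⟶ N) ≃ homSubmodule M N where
  toFun f := ⟨Hom.lin f, Hom.map_act f, Hom.map_deg f⟩
  invFun f := ⟨f.1, f.2.1, f.2.2⟩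
  left_inv _ := rfl
  right_inv _ := rfl

instance : AddCommGroup (M ⟶ N) := (homEquiv M N).addCommGroup

instance : Module 𝕜 (M ⟶ N) := (homEquiv M N).module 𝕜

variable {M N}

@[simp] theorem lin_add (f g : M ⟶ N) : lin (f + g) = lin f + lin g := rfl

@[simp] theorem lin_zero : lin (0 : M ⟶ N) = 0 := rfl

@[simp] theorem lin_smul (c : 𝕜) (f : M ⟶ N) : lin (c • f) = c • lin f := rfl

instance : Preadditive (FinGrMod 𝕜 Λ) where
  add_comp _ _ _ f f' g := by ext m; simp
  comp_add _ _ _ f g g' := by ext m; simp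

instance : Linear 𝕜 (FinGrMod 𝕜 Λ) where
  smul_comp _ _ _ r f g := by ext m; simp
  comp_smul _ _ _ f r g := by ext m; simp

/-- The shifted module `M⟨j⟩`, with `M⟨j⟩_i = M_{i - j}`. -/
def shift (j : ℤ) (M : FinGrMod 𝕜 Λ) : FinGrMod 𝕜 Λ where
  carrier := M.carrier
  finite := M.finite
  act := M.act
  act_mul := M.act_mul
  idem_indep := M.idem_indep
  idem_top := M.idem_top
  deg i := M.deg (i - j)
  deg_indep := M.deg_indep.comp (sub_left_injective)
  deg_top := by
    rw [← M.deg_top]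
    exact (Equiv.subRight j).iSup_comp (g := M.deg)
  act_deg i k x hx m hm := by
    have h := M.act_deg i (k - j) x hx m hm
    rwa [show i + (k - j) = i + k - j by ring] at h

/-- The functor `M ↦ M⟨j⟩`. -/
def shiftF (j : ℤ) : FinGrMod 𝕜 Λ ⥤ FinGrMod 𝕜 Λ where
  obj M := M.shift j
  map {M N} f := Hom.mk (M := M.shift j) (N := N.shift j) (Hom.lin (M := M) (N := N) f)
    (Hom.map_act (M := M) (N := N) f) (fun i m h => Hom.map_deg (M := M) (N := N) f (i - j) m h)
  map_id _ := rfl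
  map_comp _ _ := rfl

/-- A homogeneous linear isomorphism of degree zero commuting with the action is an isomorphism. -/
def isoMk {M N : FinGrMod 𝕜 Λ} (e : M.carrier ≃ₗ[𝕜] N.carrier)
    (h1 : ∀ x m, e (M.act x m) = N.act x (e m)) (h2 : ∀ j m, m ∈ M.deg j ↔ e m ∈ N.deg j) :
    M ≅ N where
  hom := ⟨e.toLinearMap, h1, fun j m h => (h2 j m).1 h⟩
  inv := ⟨e.symm.toLinearMap, fun x m => by
      apply e.injective
      simp [h1], fun j m h => (h2 j _).2 (by simpa using h)⟩
  hom_inv_id := by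
    apply Hom.ext
    exact LinearMap.ext fun m => e.symm_apply_apply m
  inv_hom_id := by
    apply Hom.ext
    exact LinearMap.ext fun m => e.apply_symm_apply m

theorem lin_eqToHom_shift {i j : ℤ} (h : i = j) (M : FinGrMod 𝕜 Λ)
    (h' : (shiftF i).obj M = (shiftF j).obj M) (m : ((shiftF i).obj M).carrier) :
    @Eq M.carrier (lin (eqToHom h') m) m := by
  subst h; rfl

/-- The data making `FinGrMod` a category with shifts; all the isomorphisms are the identity map
on underlying vector spaces. -/
def shiftCore : ShiftMkCore (FinGrMod 𝕜 Λ) ℤ where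
  F := shiftF
  zero := NatIso.ofComponents (fun M => isoMk (M := M.shift 0) (N := M)
    (LinearEquiv.refl 𝕜 M.carrier) (fun _ _ => rfl)
    (fun j m => by
      change m ∈ M.deg (j - 0) ↔ m ∈ M.deg j
      rw [sub_zero])) (fun _ => rfl)
  add i j := NatIso.ofComponents (fun M => isoMk (M := M.shift (i + j))
    (N := (M.shift i).shift j)
    (LinearEquiv.refl 𝕜 M.carrier) (fun _ _ => rfl)
    (fun k m => by
      change m ∈ M.deg (k - (i + j)) ↔ m ∈ M.deg (k - j - i)
      rw [show k - (i + j) = k - j - i by ring])) (fun _ => rfl)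
  assoc_hom_app i j k M := by
    apply hom_ext
    refine LinearMap.ext fun m => ?_
    exact (lin_eqToHom_shift (add_assoc i j k) M _ m).symm
  zero_add_hom_app i M := by
    apply hom_ext
    refine LinearMap.ext fun m => ?_
    exact (lin_eqToHom_shift (zero_add i) M _ m).symm
  add_zero_hom_app i M := by
    apply hom_ext
    refine LinearMap.ext fun m => ?_
    exact (lin_eqToHom_shift (add_zero i) M _ m).symm

/-- The shift functors `M ↦ M⟨j⟩` on the category of finite dimensional graded modules. -/
instance : HasShift (FinGrMod 𝕜 Λ) ℤ := hasShiftMk _ _ shiftCore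

/-- `M` is the one dimensional module `L(a)`, concentrated in degree zero, on which
`e_a` acts as `1` and all other basis vectors act as `0`. -/
def IsIrr (a : Λ) (M : FinGrMod 𝕜 Λ) : Prop :=
  ∃ m : M.carrier, m ≠ 0 ∧ Submodule.span 𝕜 {m} = ⊤ ∧ m ∈ M.deg 0 ∧
    ∀ x : CircleDiagram Λ,
      (IsIdem a x → M.act (Finsupp.single x 1) m = m) ∧
      (¬ IsIdem a x → M.act (Finsupp.single x 1) m = 0)

/-- `M` is the left ideal `P(a) = K e_a`, as a graded module. -/
def IsProj (a : Λ) (M : FinGrMod 𝕜 Λ) : Prop :=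
  ∃ f : M.carrier →ₗ[𝕜] KAlg 𝕜 Λ, Function.Injective f ∧
    LinearMap.range f = LinearMap.range ((kmul 𝕜 Λ).flip (idem 𝕜 Λ a)) ∧
    (∀ x m, f (M.act x m) = kmul 𝕜 Λ x (f m)) ∧ ∀ j, ∀ m ∈ M.deg j, f m ∈ kdeg 𝕜 Λ j

/-- `M` is the cell module `V(μ)`: it has a homogeneous basis `(c μ|`, indexed by the weights
`c ⊂ μ`, on which the basis vector `x = (a w b)` of `K` acts as follows: if
`b = c` and `a ⊂ μ` then it maps `(c μ|` to `s (a μ|`, where `s` is the coefficient of `(a μ d)` in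
the product `(a w b)(b μ d)` for the cap diagram `d` of `μ`; otherwise it maps `(c μ|` to `0`. -/
def IsCell (μ : Λ) (M : FinGrMod 𝕜 Λ) : Prop :=
  ∃ v : Module.Basis {c : Λ // c.1.Sub μ.1} 𝕜 M.carrier,
    (∀ c, v c ∈ M.deg (cupDegree c.1.1 μ.1 : ℤ)) ∧
    ∀ (x : CircleDiagram Λ) (c : {c : Λ // c.1.Sub μ.1}),
      (∀ h : x.bot.1.Sub μ.1, x.top = c.1 → M.act (Finsupp.single x 1) (v c) =
        (structCoeff x.bot.1 x.wt.1 x.top.1 μ.1 μ.1 μ.1 : 𝕜) • v ⟨x.bot, h⟩) ∧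
      (¬ (x.bot.1.Sub μ.1 ∧ x.top = c.1) → M.act (Finsupp.single x 1) (v c) = 0)

/-- The equivalence `D` is the graded duality: naturally in `M`, the object `D M` is the
dual vector space of `M` with `K` acting by `(x f)(m) = f(x^* m)`, and its component of degree `j`
consists of the functionals on the component of degree `-j` of `M`. -/
def IsGradedDuality (D : FinGrMod 𝕜 Λ ≌ (FinGrMod 𝕜 Λ)ᵒᵖ) : Prop :=
  ∃ φ : ∀ M : FinGrMod 𝕜 Λ, (D.functor.obj M).unop.carrier ≃ₗ[𝕜] Module.Dual 𝕜 M.carrier,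
    (∀ M x f m, φ M ((D.functor.obj M).unop.act x f) m = φ M f (M.act (kstar 𝕜 Λ x) m)) ∧
    (∀ M j f, f ∈ (D.functor.obj M).unop.deg j ↔ ∀ i, i ≠ -j → ∀ m ∈ M.deg i, φ M f m = 0) ∧
    ∀ (M N : FinGrMod 𝕜 Λ) (g : M ⟶ N) (f : (D.functor.obj N).unop.carrier),
      φ M (lin (D.functor.map g).unop f) = φ N f ∘ₗ lin g

end FinGrMod

/-! ## Positively graded highest weight categories with duality -/

section HighestWeight

variable {C : Type u} [Category.{v} C]

/-- `S` is a composition factor of `X`: a simple quotient of a subobject of `X`. -/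
def IsCompFactor [HasZeroMorphisms C] (S X : C) : Prop :=
  Simple S ∧ ∃ (Y : C) (i : Y ⟶ X) (p : Y ⟶ S), Mono i ∧ Epi p

/-- `S` is a composition factor of the radical of `X`, that is, of a subobject of `X` which is
killed by all morphisms from `X` to simple objects. -/
def IsRadicalFactor [HasZeroMorphisms C] (S X : C) : Prop :=
  ∃ (R : C) (i : R ⟶ X), Mono i ∧ (∀ (T : C) (f : X ⟶ T), Simple T → i ≫ f = 0) ∧
    IsCompFactor S R

/-- `S` is a composition factor of the quotient of `X` by its socle, that is, of a quotient of
`X` which kills all morphisms from simple objects to `X`. -/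
def IsSocleQuotientFactor [HasZeroMorphisms C] (S X : C) : Prop :=
  ∃ (Q : C) (p : X ⟶ Q), Epi p ∧ (∀ (T : C) (f : T ⟶ X), Simple T → f ≫ p = 0) ∧
    IsCompFactor S Q

/-- `p : P ⟶ V` is the largest quotient of `P` such that all composition factors of its
radical satisfy `F`. -/
def IsLargestQuotient [HasZeroMorphisms C] (F : C → Prop) {P V : C} (p : P ⟶ V) : Prop :=
  Epi p ∧ (∀ S, IsRadicalFactor S V → F S) ∧
    ∀ (Q : C) (q : P ⟶ Q), Epi q → (∀ S, IsRadicalFactor S Q → F S) → ∃ h : V ⟶ Q, p ≫ h = q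

/-- `i : A ⟶ I` is the largest subobject of `I` such that all composition factors of its quotient by
its socle satisfy `F`. -/
def IsLargestSubobject [HasZeroMorphisms C] (F : C → Prop) {A I : C} (i : A ⟶ I) : Prop :=
  Mono i ∧ (∀ S, IsSocleQuotientFactor S A → F S) ∧
    ∀ (B : C) (j : B ⟶ I), Mono j → (∀ S, IsSocleQuotientFactor S B → F S) → ∃ h : B ⟶ A, h ≫ i = j

/-- `X` has a finite filtration all of whose factors satisfy `F`. -/
inductive HasFiltration [HasZeroMorphisms C] (F : C → Prop) : C → Prop
  | zero (X : C) : IsZero X → HasFiltration F X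
  | step (Y X Z : C) (i : Y ⟶ X) (p : X ⟶ Z) (w : i ≫ p = 0) :
      (ShortComplex.mk i p w).ShortExact → HasFiltration F Y → F Z → HasFiltration F X

/-- `p : P ⟶ L` is a projective cover. -/
def IsProjectiveCover {P L : C} (p : P ⟶ L) : Prop :=
  Projective P ∧ Epi p ∧ ∀ (Y : C) (f : Y ⟶ P), Epi (f ≫ p) → Epi f

/-- `i : L ⟶ I` is an injective hull. -/
def IsInjectiveHull {L I : C} (i : L ⟶ I) : Prop :=
  Injective I ∧ Mono i ∧ ∀ (Y : C) (f : I ⟶ Y), Mono (i ≫ f) → Mono f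

/-- An indecomposable object: nonzero, and not a direct sum of two nonzero objects. -/
def IsIndecomposable [HasZeroMorphisms C] (X : C) : Prop :=
  ¬ IsZero X ∧ ∀ (Y Z : C) (b : BinaryBicone Y Z), Nonempty b.IsBilimit → Nonempty (b.pt ≅ X) →
    IsZero Y ∨ IsZero Z

/-- The shifts of the objects `f x` form a complete set of representatives for the isomorphism
classes of the objects satisfying `F`. -/
def IsCompleteUpToShift [HasShift C ℤ] {X : Type*} (F : C → Prop) (f : X → C) : Prop :=
  (∀ x (j : ℤ), F ((f x)⟦j⟧)) ∧ (∀ S, F S → ∃ x, ∃ j : ℤ, Nonempty (S ≅ (f x)⟦j⟧)) ∧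
    ∀ x y (j k : ℤ), Nonempty ((f x)⟦j⟧ ≅ (f y)⟦k⟧) → x = y ∧ j = k

/-- `C`, with its shift functors, the weight poset `X`, the duality `D` and the families `L`, `P`,
`V` of irreducible, projective and standard objects, is a positively graded highest weight
category with duality over the field `𝕜`. -/
structure IsPosGradedHighestWeightCategory (𝕜 : Type*) [Field 𝕜] (C : Type u) [Category.{v} C]
    [Preadditive C] [Linear 𝕜 C] [HasShift C ℤ] (X : Type*) [PartialOrder X]
    (D : C ≌ Cᵒᵖ) (L P V : X → C) : Prop where
  /-- the weight poset is interval-finite -/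
  interval_finite : ∀ x y : X, (Set.Icc x y).Finite
  /-- `C` is an abelian category (the next five fields) -/
  finite_products : HasFiniteProducts C
  kernels : HasKernels C
  cokernels : HasCokernels C
  normal_mono : IsNormalMonoCategory C
  normal_epi : IsNormalEpiCategory C
  /-- all objects have finite length (the next two fields) -/
  artinian : ∀ M : C, IsArtinianObject M
  noetherian : ∀ M : C, IsNoetherianObject M
  hom_finite : ∀ M N : C, FiniteDimensional 𝕜 (M ⟶ N)
  /-- the shift functors are `𝕜`-linear (the next two fields) -/
  shift_add : ∀ (j : ℤ) (M N : C) (f g : M ⟶ N), (f + g)⟦j⟧' = f⟦j⟧' + g⟦j⟧'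
  shift_smul : ∀ (j : ℤ) (M N : C) (c : 𝕜) (f : M ⟶ N), (c • f)⟦j⟧' = c • f⟦j⟧'
  /-- the duality is `𝕜`-linear and inverts shifts (the next three fields) -/
  dual_add : ∀ (M N : C) (f g : M ⟶ N),
    (D.functor.map (f + g)).unop = (D.functor.map f).unop + (D.functor.map g).unop
  dual_smul : ∀ (M N : C) (c : 𝕜) (f : M ⟶ N),
    (D.functor.map (c • f)).unop = c • (D.functor.map f).unop
  dual_shift : ∀ (M : C) (j : ℤ),
    Nonempty ((D.functor.obj (M⟦j⟧)).unop ≅ (D.functor.obj M).unop⟦-j⟧)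
  /-- the `L x` are self-dual -/
  irr_dual : ∀ x, Nonempty ((D.functor.obj (L x)).unop ≅ L x)
  /-- the shifts of the `L x` are the irreducible objects -/
  irr_complete : IsCompleteUpToShift (fun S : C => Simple S) L
  /-- `P x` is the projective cover of `L x` -/
  proj_cover : ∀ x, ∃ p : P x ⟶ L x, IsProjectiveCover p
  /-- positivity of the grading -/
  proj_pos : ∀ x S, IsCompFactor S (P x) → ∃ y, ∃ j : ℤ, 0 ≤ j ∧ Nonempty (S ≅ (L y)⟦j⟧)
  /-- `V x` is the largest quotient of `P x` such that all composition factors of its radical are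
  shifts of `L y` with `y < x`, and the kernel of `P x ⟶ V x` has a filtration
  by shifts of `V y` with `x < y` -/
  standard : ∀ x, ∃ (M : C) (i : M ⟶ P x) (p : P x ⟶ V x) (w : i ≫ p = 0),
    IsLargestQuotient (fun S => ∃ y < x, ∃ j : ℤ, Nonempty (S ≅ (L y)⟦j⟧)) p ∧
    (ShortComplex.mk i p w).ShortExact ∧
    HasFiltration (fun Z => ∃ y > x, ∃ j : ℤ, Nonempty (Z ≅ (V y)⟦j⟧)) M

end HighestWeight

end ArcAlgebra

open ArcAlgebra

namespace ArcAlgebra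

open Finset (add_sum_erase card_filter card_insert_of_notMem card_pos coe_filter filter_congr
  filter_filter filter_subset filter_true finite_toSet le_max' max'_mem mem_Icc mem_coe mem_erase
  mem_filter mem_image mem_image_of_mem mem_insert mem_inter mem_map mem_powerset mem_singleton
  mem_union mem_union_left mem_union_right min'_le min'_mem mul_prod_erase mul_sum prod_congr
  prod_const prod_filter prod_map subset_union_left subset_union_right sum_add_distrib sum_bij
  sum_bij' sum_boole sum_comm sum_congr sum_const sum_eq_single sum_eq_single_of_mem sum_eq_zero
  sum_filter sum_insert sum_ite_eq' sum_map sum_mul sum_neg_distrib sum_pair sum_singleton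
  sum_sub_distrib sum_subset)
open Finsupp (lcomapDomain lmapDomain mapDomain_of_notMem_range single single_eq_of_ne
  single_eq_of_ne' smul_single)
open Function (Surjective iterate_succ_apply' update update_of_ne)
open LinearMap (mem_ker)
open Set (Ici mem_ofPred_eq ncard_coe_finset ncard_le_ncard ordConnected_Ici
  ordConnected_singleton)
open Module (Dual forall_dual_apply_eq_zero_iff)
open Submodule (mem_iInf)

noncomputable section

/-! ## Combinatorics of cup diagrams -/

/-- The vertex `i` is labelled down or up. -/
def Act (f : Labelling) (i : ℤ) : Prop := f i = some .down ∨ f i = some .up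

/-- The vertex `i` is an end of a cup. -/
def OnCup (f : Labelling) (i : ℤ) : Prop := ∃ j, IsCup f i j ∨ IsCup f j i

theorem IsCup.lt {f : Labelling} {i j : ℤ} (h : IsCup f i j) : i < j := by
  cases h; assumption

theorem IsCup.left {f : Labelling} {i j : ℤ} (h : IsCup f i j) : f i = some .down := by
  cases h; assumption

theorem IsCup.right {f : Labelling} {i j : ℤ} (h : IsCup f i j) : f j = some .up := by
  cases h; assumption

theorem IsCup.inside {f : Labelling} {i j k : ℤ} (h : IsCup f i j) (hik : i < k) (hkj : k < j)
    (hk : Act f k) : ∃ l, i < l ∧ l < j ∧ (IsCup f k l ∨ IsCup f l k) := by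
  cases h with
  | mk _ _ g _ _ _ h1 h2 h3 =>
    obtain ⟨ha, hb⟩ := h1 k hik hkj hk
    exact ⟨g k, ha, hb, hk.imp (h2 k hik hkj) (h3 k hik hkj)⟩

theorem OnCup.act {f : Labelling} {i : ℤ} (h : OnCup f i) : Act f i := by
  obtain ⟨j, h | h⟩ := h
  · exact Or.inl h.left
  · exact Or.inr h.right

theorem IsCup.unique_aux {f : Labelling} (n : ℕ) : ∀ i j i' j' : ℤ, j - i < n → j' - i' < n →
    IsCup f i j → IsCup f i' j' → (i = i' ∨ j = j') → i = i' ∧ j = j' := by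
  induction n with
  | zero => intro i j i' j' h1 _ h3; have := h3.lt; simp at h1; omega
  | succ n ih =>
    have key : ∀ i j j' : ℤ, j' - i < n + 1 → IsCup f i j → IsCup f i j' → j < j' → False := by
      intro i j j' hn h1 h2 hlt
      obtain ⟨l, hl1, hl2, hl⟩ := h2.inside h1.lt hlt (Or.inr h1.right)
      rcases hl with hl | hl
      · have := hl.left; rw [h1.right] at this; cases this
      · obtain ⟨m, hm1, hm2, hm⟩ := h1.inside hl1 hl.lt (Or.inl hl.left)
        rcases hm with hm | hm
        · have := (ih l j l m (by omega) (by omega) hl hm (Or.inl rfl)).2; omega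
        · have := hm.right; rw [hl.left] at this; cases this
    have key2 : ∀ i i' j : ℤ, j - i < n + 1 → IsCup f i j → IsCup f i' j → i < i' → False := by
      intro i i' j hn h1 h2 hlt
      obtain ⟨l, hl1, hl2, hl⟩ := h1.inside hlt h2.lt (Or.inl h2.left)
      rcases hl with hl | hl
      · obtain ⟨m, hm1, hm2, hm⟩ := h2.inside hl.lt hl2 (Or.inr hl.right)
        rcases hm with hm | hm
        · have := hm.left; rw [hl.right] at this; cases this
        · have := (ih i' l m l (by omega) (by omega) hl hm (Or.inr rfl)).1; omega
      · have := hl.right; rw [h2.left] at this; cases this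
    intro i j i' j' hn hn' h1 h2 h
    push_cast at hn hn'
    rcases h with rfl | rfl
    · refine ⟨rfl, ?_⟩
      rcases lt_trichotomy j j' with h | h | h
      · exact (key i j j' hn' h1 h2 h).elim
      · exact h
      · exact (key i j' j hn h2 h1 h).elim
    · refine ⟨?_, rfl⟩
      rcases lt_trichotomy i i' with h | h | h
      · exact (key2 i i' j hn h1 h2 h).elim
      · exact h
      · exact (key2 i' i j hn' h2 h1 h).elim

theorem IsCup.right_unique {f : Labelling} {i j j' : ℤ} (h : IsCup f i j) (h' : IsCup f i j') :
    j = j' :=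
  (IsCup.unique_aux ((j - i).toNat + (j' - i).toNat + 1) i j i j' (by have := h.lt; omega)
    (by have := h'.lt; omega) h h' (Or.inl rfl)).2

theorem IsCup.left_unique {f : Labelling} {i i' j : ℤ} (h : IsCup f i j) (h' : IsCup f i' j) :
    i = i' :=
  (IsCup.unique_aux ((j - i).toNat + (j - i').toNat + 1) i j i' j (by have := h.lt; omega)
    (by have := h'.lt; omega) h h' (Or.inr rfl)).1

theorem IsCup.not_chain {f : Labelling} {i j k : ℤ} (h : IsCup f i j) (h' : IsCup f j k) :
    False := by
  have := h.right; rw [h'.left] at this; cases this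

theorem IsCup.noncrossing {f : Labelling} {i j k l : ℤ} (h : IsCup f i j) (h' : IsCup f k l) :
    (i < k ∧ k < j) ↔ (i < l ∧ l < j) := by
  constructor
  · rintro ⟨h1, h2⟩
    obtain ⟨m, hm1, hm2, hm | hm⟩ := h.inside h1 h2 (Or.inl h'.left)
    · rw [h'.right_unique hm]; exact ⟨hm1, hm2⟩
    · exact (hm.not_chain h').elim
  · rintro ⟨h1, h2⟩
    obtain ⟨m, hm1, hm2, hm | hm⟩ := h.inside h1 h2 (Or.inr h'.right)
    · exact (h'.not_chain hm).elim
    · rw [h'.left_unique hm]; exact ⟨hm1, hm2⟩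

theorem IsCup.congr {f f' : Labelling} {i j : ℤ} (h : IsCup f i j)
    (hf : ∀ k, i ≤ k → k ≤ j → f k = f' k) : IsCup f' i j := by
  induction h with
  | mk i j g hij hi hj h1 h2 h3 ih2 ih3 =>
    refine IsCup.mk i j g hij (by rw [← hf i le_rfl hij.le, hi])
      (by rw [← hf j hij.le le_rfl, hj]) ?_ ?_ ?_
    · intro k hik hkj hk
      rw [← hf k hik.le hkj.le] at hk
      exact h1 k hik hkj hk
    · intro k hik hkj hk
      rw [← hf k hik.le hkj.le] at hk
      have := h1 k hik hkj (Or.inl hk)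
      exact ih2 k hik hkj hk fun m hm hm' => hf m (by omega) (by omega)
    · intro k hik hkj hk
      rw [← hf k hik.le hkj.le] at hk
      have := h1 k hik hkj (Or.inr hk)
      exact ih3 k hik hkj hk fun m hm hm' => hf m (by omega) (by omega)

theorem isCup_congr {f f' : Labelling} {i j : ℤ} (hf : ∀ k, i ≤ k → k ≤ j → f k = f' k) :
    IsCup f i j ↔ IsCup f' i j :=
  ⟨fun h => h.congr hf, fun h => h.congr fun k h1 h2 => (hf k h1 h2).symm⟩

theorem isRay_iff {f : Labelling} {i : ℤ} : IsRay f i ↔ Act f i ∧ ¬ OnCup f i := by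
  unfold IsRay Act OnCup
  refine and_congr_right fun _ => ?_
  push Not
  rfl

/-- There is no ray labelled down to the left of a ray labelled up. -/
theorem no_down_up_rays {f : Labelling} {i j : ℤ} (hi : ¬ OnCup f i) (hj : ¬ OnCup f j)
    (hij : i < j) (hfi : f i = some .down) (hfj : f j = some .up) : False := by
  obtain ⟨n, hn⟩ : ∃ n : ℕ, j - i < n := ⟨(j - i).toNat + 1, by omega⟩
  induction n generalizing i j with
  | zero => simp at hn; omega
  | succ n ih =>
    push_cast at hn
    by_cases hex : ∃ k, i < k ∧ k < j ∧ Act f k ∧ ¬ OnCup f k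
    · obtain ⟨k, h1, h2, h3 | h3, h4⟩ := hex
      · exact ih h4 hj h2 h3 hfj (by omega)
      · exact ih hi h4 h1 hfi h3 (by omega)
    · push Not at hex
      have hg : ∀ k, ∃ l, i < k → k < j → Act f k → (IsCup f k l ∨ IsCup f l k) := by
        intro k
        by_cases h : i < k ∧ k < j ∧ Act f k
        · obtain ⟨l, hl⟩ := hex k h.1 h.2.1 h.2.2
          exact ⟨l, fun _ _ _ => hl⟩
        · exact ⟨0, fun h1 h2 h3 => (h ⟨h1, h2, h3⟩).elim⟩
      choose g hg using hg
      refine hi ⟨j, Or.inl (IsCup.mk i j g hij hfi hfj ?_ ?_ ?_)⟩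
      · intro k hik hkj hk
        have hki : g k ≠ i := by
          intro e
          refine hi ⟨k, ?_⟩
          have := hg k hik hkj hk; rw [e] at this; exact this.symm
        have hkj' : g k ≠ j := by
          intro e
          refine hj ⟨k, ?_⟩
          have := hg k hik hkj hk; rw [e] at this; exact this.symm
        rcases hg k hik hkj hk with h | h
        · refine ⟨by have := h.lt; omega, ?_⟩
          by_contra hc
          obtain ⟨m, _, _, hm⟩ := h.inside hkj (by omega) (Or.inr hfj)
          exact hj ⟨m, hm⟩
        · refine ⟨?_, by have := h.lt; omega⟩
          by_contra hc
          obtain ⟨m, _, _, hm⟩ := h.inside (by omega) hik (Or.inl hfi)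
          exact hi ⟨m, hm⟩
      · intro k hik hkj hk
        refine (hg k hik hkj (Or.inl hk)).resolve_right fun h => ?_
        have := h.right; rw [hk] at this; cases this
      · intro k hik hkj hk
        refine (hg k hik hkj (Or.inr hk)).resolve_left fun h => ?_
        have := h.left; rw [hk] at this; cases this

open Classical in
/-- The other end of the cup at `i`, or `i` if there is none. -/
def mate (f : Labelling) (i : ℤ) : ℤ := if h : OnCup f i then h.choose else i

theorem mate_spec {f : Labelling} {i : ℤ} (h : OnCup f i) :
    IsCup f i (mate f i) ∨ IsCup f (mate f i) i := by
  unfold mate; rw [dif_pos h]; exact h.choose_spec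

theorem mate_eq {f : Labelling} {i j : ℤ} (h : IsCup f i j ∨ IsCup f j i) : mate f i = j := by
  have h1 := mate_spec (f := f) ⟨j, h⟩
  rcases h with h | h <;> rcases h1 with h1 | h1
  · exact h1.right_unique h
  · exact (h1.not_chain h).elim
  · exact (h.not_chain h1).elim
  · exact h1.left_unique h

theorem mate_of_not {f : Labelling} {i : ℤ} (h : ¬ OnCup f i) : mate f i = i := by
  unfold mate; rw [dif_neg h]

theorem onCup_mate {f : Labelling} {i : ℤ} (h : OnCup f i) : OnCup f (mate f i) :=
  ⟨i, (mate_spec h).symm⟩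

theorem mate_mate (f : Labelling) (i : ℤ) : mate f (mate f i) = i := by
  by_cases h : OnCup f i
  · exact mate_eq (mate_spec h).symm
  · rw [mate_of_not h, mate_of_not h]

theorem mate_ne {f : Labelling} {i : ℤ} (h : OnCup f i) : mate f i ≠ i := by
  rcases mate_spec h with h | h <;> have := h.lt <;> omega

theorem isCup_mate {f : Labelling} {i : ℤ} (h : OnCup f i) (hi : i < mate f i) :
    IsCup f i (mate f i) :=
  (mate_spec h).resolve_right fun h => by have := h.lt; omega

/-- Cups do not cross. -/
theorem mate_noncrossing {f : Labelling} {i k : ℤ} (hi : OnCup f i) (hk : OnCup f k) (h1 : i < k)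
    (h2 : k < mate f i) : i < mate f k ∧ mate f k < mate f i := by
  have h := isCup_mate hi (by omega)
  rcases mate_spec hk with h' | h'
  · exact (h.noncrossing h').1 ⟨h1, h2⟩
  · exact (h.noncrossing h').2 ⟨h1, h2⟩

/-! ## The Bruhat order through prefix sums -/

/-- The indicator function of the downs. -/
def downInd (f : Labelling) (i : ℤ) : ℤ :=
  match f i with
  | some .down => 1
  | _ => 0

theorem downInd_down {f : Labelling} {i : ℤ} (h : f i = some .down) : downInd f i = 1 := by
  simp [downInd, h]

theorem downInd_up {f : Labelling} {i : ℤ} (h : f i = some .up) : downInd f i = 0 := by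
  simp [downInd, h]

theorem downInd_congr {f g : Labelling} {i : ℤ} (h : f i = g i) : downInd f i = downInd g i := by
  simp [downInd, h]

/-- The labellings agree except for finitely many downs and ups. -/
structure FinDiff (S : Finset ℤ) (a b : Labelling) : Prop where
  eq : ∀ k, k ∉ S → a k = b k
  act : ∀ k, Act a k ↔ Act b k
  free : ∀ k, ¬ Act a k → a k = b k

theorem FinDiff.mono {S T : Finset ℤ} {a b : Labelling} (h : FinDiff S a b) (hST : S ⊆ T) :
    FinDiff T a b := ⟨fun k hk => h.eq k fun h => hk (hST h), h.act, h.free⟩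

theorem FinDiff.symm {S : Finset ℤ} {a b : Labelling} (h : FinDiff S a b) : FinDiff S b a :=
  ⟨fun k hk => (h.eq k hk).symm, fun k => (h.act k).symm,
    fun k hk => (h.free k (by rwa [h.act k])).symm⟩

theorem FinDiff.trans {S : Finset ℤ} {a b c : Labelling} (h : FinDiff S a b)
    (h' : FinDiff S b c) : FinDiff S a c :=
  ⟨fun k hk => (h.eq k hk).trans (h'.eq k hk), fun k => (h.act k).trans (h'.act k),
    fun k hk => (h.free k hk).trans (h'.free k (by rwa [← h.act k]))⟩

theorem FinDiff.eq_of_downInd {S : Finset ℤ} {a b : Labelling} (h : FinDiff S a b) {k : ℤ}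
    (hk : downInd a k = downInd b k) : a k = b k := by
  by_cases ha : Act a k
  · have hb := (h.act k).1 ha
    rcases ha with ha | ha <;> rcases hb with hb | hb
    · rw [ha, hb]
    · rw [downInd_down ha, downInd_up hb] at hk; cases hk
    · rw [downInd_up ha, downInd_down hb] at hk; cases hk
    · rw [ha, hb]
  · exact h.free k ha

/-- Dominance order in terms of prefix sums. -/
structure Dom (S : Finset ℤ) (a b : Labelling) : Prop extends FinDiff S a b where
  prefix_nonneg : ∀ i, 0 ≤ ∑ k ∈ S with k ≤ i, (downInd a k - downInd b k)
  total : ∑ k ∈ S, (downInd a k - downInd b k) = 0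

theorem sum_downInd_mono {S T : Finset ℤ} {a b : Labelling} (h : ∀ k, k ∉ S → a k = b k)
    (hST : S ⊆ T) (q : ℤ → Prop) [DecidablePred q] :
    ∑ k ∈ T with q k, (downInd a k - downInd b k) =
      ∑ k ∈ S with q k, (downInd a k - downInd b k) := by
  symm
  refine sum_subset (Finset.filter_subset_filter _ hST) fun k hk hk' => ?_
  rw [downInd_congr (h k fun hS => hk' ?_), sub_self]
  exact mem_filter.2 ⟨hS, (mem_filter.1 hk).2⟩

theorem sum_downInd_mono' {S T : Finset ℤ} {a b : Labelling} (h : ∀ k, k ∉ S → a k = b k)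
    (hST : S ⊆ T) : ∑ k ∈ T, (downInd a k - downInd b k) =
      ∑ k ∈ S, (downInd a k - downInd b k) := by
  have := sum_downInd_mono h hST (fun _ => True)
  simpa using this

theorem Dom.mono {S T : Finset ℤ} {a b : Labelling} (h : Dom S a b) (hST : S ⊆ T) : Dom T a b :=
  { h.toFinDiff.mono hST with
    prefix_nonneg := fun i => by rw [sum_downInd_mono h.eq hST]; exact h.prefix_nonneg i
    total := by rw [sum_downInd_mono' h.eq hST]; exact h.total }

theorem Dom.trans {S : Finset ℤ} {a b c : Labelling} (h : Dom S a b)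
    (h' : Dom S b c) : Dom S a c :=
  { h.toFinDiff.trans h'.toFinDiff with
    prefix_nonneg := fun i => by
      have := add_nonneg (h.prefix_nonneg i) (h'.prefix_nonneg i)
      rw [← sum_add_distrib] at this
      simpa using this
    total := by
      have := congrArg₂ (· + ·) h.total h'.total
      simp only [← sum_add_distrib] at this
      simpa using this }

theorem dom_refl (a : Labelling) : Dom ∅ a a :=
  ⟨⟨fun _ _ => rfl, fun _ => Iff.rfl, fun _ _ => rfl⟩, fun _ => by simp, by simp⟩

theorem dom_of_swap {a b : Labelling} {i j : ℤ} (hij : i < j) (h1 : a i = some .down)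
    (h2 : a j = some .up) (h3 : b i = some .up) (h4 : b j = some .down)
    (h5 : ∀ k, k ≠ i → k ≠ j → b k = a k) : Dom {i, j} a b := by
  have hne : i ≠ j := hij.ne
  refine ⟨⟨?_, ?_, ?_⟩, ?_, ?_⟩
  · grind
  · grind [Act]
  · grind [Act]
  · intro m
    rw [sum_filter, sum_pair hne, downInd_down h1, downInd_up h2, downInd_up h3,
      downInd_down h4]
    split_ifs <;> omega
  · rw [sum_pair hne, downInd_down h1, downInd_up h2, downInd_up h3, downInd_down h4]
    rfl

theorem exists_dom_of_le {a b : Weight} (h : a ≤ b) : ∃ S, Dom S a.lab b.lab := by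
  change Relation.ReflTransGen BruhatStep a b at h
  induction h with
  | refl => exact ⟨∅, dom_refl _⟩
  | tail _ hbc ih =>
    obtain ⟨i, j, hij, h1, h2, h3, h4, h5⟩ := hbc
    obtain ⟨S, hS⟩ := ih
    exact ⟨S ∪ {i, j}, (hS.mono subset_union_left).trans
      ((dom_of_swap hij h1 h2 h3 h4 h5).mono subset_union_right)⟩

theorem vertices_eq_of_finDiff {S : Finset ℤ} {a b : Labelling} (h : FinDiff S a b) :
    vertices a = vertices b := by
  ext i
  simp only [vertices, mem_ofPred_eq]
  by_cases ha : Act a i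
  · have hb := (h.act i).1 ha
    rcases ha with ha | ha <;> rcases hb with hb | hb <;> simp [ha, hb]
  · rw [h.free i ha]

/-- Changing finitely many downs and ups gives a weight. -/
def Weight.modify (a : Weight) (f : Labelling) (S : Finset ℤ) (h : FinDiff S a.lab f) : Weight where
  lab := f
  consecutive := by rw [← vertices_eq_of_finDiff h]; exact a.consecutive
  ultimately := by
    obtain ⟨F, hF, h1⟩ := a.ultimately
    refine ⟨F ∪ S, hF.union S.finite_toSet, fun i j hi hj hij => ?_⟩
    simp only [Set.mem_union, not_or, mem_coe] at hi hj
    rw [← h.eq i hi.2, ← h.eq j hj.2]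
    exact h1 i j hi.1 hj.1 hij

theorem le_of_dom {a b : Weight} {S : Finset ℤ} (h : Dom S a.lab b.lab) : a ≤ b := by
  classical
  generalize hn : (S.filter fun k => a.lab k ≠ b.lab k).card = n
  induction n using Nat.strong_induction_on generalizing a with
  | _ n ih =>
    by_cases hab : ∀ k ∈ S, a.lab k = b.lab k
    · have : a = b := Weight.ext' (funext fun k => by
        by_cases hk : k ∈ S
        · exact hab k hk
        · exact h.eq k hk)
      rw [this]
    push Not at hab
    have hmin : ∀ T : Finset ℤ, T.Nonempty → ∃ i ∈ T, ∀ k ∈ T, i ≤ k := fun T hT =>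
      ⟨_, T.min'_mem hT, fun k => T.min'_le k⟩
    obtain ⟨i, hiD, hi⟩ := hmin _ (hab.imp fun _ => mem_filter.2)
    rw [mem_filter] at hiD
    have hlt : ∀ k < i, a.lab k = b.lab k := by
      intro k hk
      have := h.eq k
      have := hi k
      grind
    have hdiff : ∀ k, a.lab k ≠ b.lab k →
        (a.lab k = some .down ∧ b.lab k = some .up) ∨
          (a.lab k = some .up ∧ b.lab k = some .down) := by
      have := h.free
      have := h.act
      grind [Act]
    have hai : a.lab i = some .down ∧ b.lab i = some .up := by
      refine (hdiff i hiD.2).resolve_right fun hc => ?_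
      have h0 := h.prefix_nonneg i
      rw [sum_eq_single_of_mem (s := S.filter (· ≤ i)) i (mem_filter.2 ⟨hiD.1, le_refl i⟩),
        downInd_up hc.1, downInd_down hc.2] at h0
      · omega
      · intro k hk hki
        have := (mem_filter.1 hk).2
        rw [downInd_congr (hlt k (by omega)), sub_self]
    -- the first place where an up has to become a down
    have hne2 : (S.filter fun k => a.lab k = some .up ∧ b.lab k = some .down).Nonempty := by
      by_contra hc
      rw [Finset.not_nonempty_iff_eq_empty] at hc
      have : 0 < ∑ k ∈ S, (downInd a.lab k - downInd b.lab k) := by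
        refine Finset.sum_pos' (fun k hk => ?_) ⟨i, hiD.1, ?_⟩
        · by_cases hk' : a.lab k = b.lab k
          · rw [downInd_congr hk', sub_self]
          · rcases hdiff k hk' with hd | hd
            · rw [downInd_down hd.1, downInd_up hd.2]; simp
            · have : k ∈ (∅ : Finset ℤ) := hc ▸ mem_filter.2 ⟨hk, hd⟩
              simp at this
        · rw [downInd_down hai.1, downInd_up hai.2]; simp
      rw [h.total] at this
      exact lt_irrefl _ this
    obtain ⟨j, hjD, hj⟩ := hmin _ hne2
    rw [mem_filter] at hjD
    have hij : i < j := by grind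
    have hbefore : ∀ k < j, 0 ≤ downInd a.lab k - downInd b.lab k := by
      intro k hk
      by_cases hk' : a.lab k = b.lab k
      · rw [downInd_congr hk', sub_self]
      · rcases hdiff k hk' with hd | hd
        · rw [downInd_down hd.1, downInd_up hd.2]; simp
        · have := h.eq k
          have := hj k
          grind
    let f : Labelling := fun k => if k = i then some .up else if k = j then some .down else a.lab k
    have hfi : f i = some .up := by simp [f]
    have hfj : f j = some .down := by simp [f, hij.ne']
    have hfk : ∀ k, k ≠ i → k ≠ j → f k = a.lab k := fun k h1 h2 => by simp [f, h1, h2]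
    have hsw := dom_of_swap hij hai.1 hjD.2.1 hfi hfj hfk
    let a' := a.modify f {i, j} hsw.toFinDiff
    have hstep : a ≤ a' := Relation.ReflTransGen.single
      ⟨i, j, hij, hai.1, hjD.2.1, hfi, hfj, hfk⟩
    refine hstep.trans ?_
    have hsub : ({i, j} : Finset ℤ) ⊆ S := by grind
    have hsw' := hsw.mono hsub
    have hsum : ∀ q : ℤ → Prop, ∀ [DecidablePred q], ∑ k ∈ S with q k, (downInd f k - downInd b.lab k) =
        ∑ k ∈ S with q k, (downInd a.lab k - downInd b.lab k) -
          ((if q i then 1 else 0) - (if q j then 1 else 0)) := by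
      intro q _
      have e1 := sum_downInd_mono hsw.eq hsub q
      rw [sum_filter (s := {i, j}), sum_pair hij.ne, downInd_down hai.1, downInd_up hfi,
        downInd_up hjD.2.1, downInd_down hfj] at e1
      have e2 : ∑ k ∈ S with q k, (downInd f k - downInd b.lab k) =
        ∑ k ∈ S with q k, (downInd a.lab k - downInd b.lab k) -
         ∑ k ∈ S with q k, (downInd a.lab k - downInd f k) := by
        rw [← sum_sub_distrib]; exact sum_congr rfl fun _ _ => by ring
      rw [e2, e1]
      split_ifs <;> simp
    have hfd : FinDiff S f b.lab := hsw'.toFinDiff.symm.trans h.toFinDiff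
    have hdom : Dom S a'.lab b.lab := by
      refine { hfd with prefix_nonneg := ?_, total := ?_ }
      · intro m
        change 0 ≤ ∑ k ∈ S with k ≤ m, (downInd f k - downInd b.lab k)
        rw [hsum]
        have h0 := h.prefix_nonneg m
        by_cases h1 : i ≤ m
        · by_cases h2 : j ≤ m
          · simp only [h1, h2, if_true]; omega
          · have : downInd a.lab i - downInd b.lab i ≤
                ∑ k ∈ S with k ≤ m, (downInd a.lab k - downInd b.lab k) :=
              Finset.single_le_sum (f := fun k => downInd a.lab k - downInd b.lab k)
                (fun k hk => hbefore k (by have := (mem_filter.1 hk).2; omega))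
                (mem_filter.2 ⟨hiD.1, h1⟩)
            rw [downInd_down hai.1, downInd_up hai.2] at this
            simp only [h1, h2, if_true, if_false]; omega
        · have h2 : ¬ j ≤ m := by omega
          simp only [h1, h2, if_false]; omega
      · have := hsum (fun _ => True)
        simp only [filter_true, if_true, sub_self, sub_zero] at this
        change ∑ k ∈ S, (downInd f k - downInd b.lab k) = 0
        rw [this, h.total]
    refine ih _ ?_ hdom rfl
    rw [← hn]
    refine Finset.card_lt_card ?_
    change (S.filter fun k => f k ≠ b.lab k) ⊂ _
    refine (Finset.ssubset_iff_of_subset fun k => ?_).2 ⟨i, by simp [hiD.1, hai], by simp [hfi, hai]⟩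
    have := hfk k
    simp only [mem_filter]
    grind

theorem finite_finDiff (S : Finset ℤ) (a : Weight) :
    {z : Weight | FinDiff S a.lab z.lab}.Finite := by
  classical
  refine Set.Finite.of_injOn (f := fun z : Weight => S.filter fun k => z.lab k = some .down)
    (t := (S.powerset : Set (Finset ℤ))) ?_ ?_ (finite_toSet _)
  · intro z _
    rw [mem_coe, mem_powerset]
    exact filter_subset _ _
  · intro z hz w hw hzw
    have h := hz.symm.trans hw
    refine Weight.ext' (funext fun k => ?_)
    by_cases hk : k ∈ S
    · have := congrArg (k ∈ ·) hzw
      simp only [mem_filter, hk, true_and, eq_iff_iff] at this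
      have := h.free k
      have := h.act k
      grind [Act]
    · exact h.eq k hk

theorem exists_Icc_superset (S : Finset ℤ) : ∃ M : ℕ, S ⊆ Finset.Icc (-(M : ℤ)) M := by
  refine ⟨∑ k ∈ S, k.natAbs, fun k hk => ?_⟩
  have : k.natAbs ≤ ∑ k ∈ S, k.natAbs := Finset.single_le_sum (f := Int.natAbs) (by simp) hk
  rw [mem_Icc]
  omega

theorem interval_finite_weight (a b : Weight) : (Set.Icc a b).Finite := by
  by_cases hab : a ≤ b
  swap
  · rw [Set.Icc_eq_empty hab]; exact Set.finite_empty
  obtain ⟨S', hS'⟩ := exists_dom_of_le hab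
  obtain ⟨M, hM⟩ := exists_Icc_superset S'
  set S := Finset.Icc (-(M : ℤ)) M with hSdef
  have hS := hS'.mono hM
  refine (finite_finDiff S a).subset ?_
  rintro z ⟨hz1, hz2⟩
  obtain ⟨S1, h1⟩ := exists_dom_of_le hz1
  obtain ⟨S2, h2⟩ := exists_dom_of_le hz2
  set T := S ∪ S1 ∪ S2 with hTdef
  have hT1 := h1.mono (T := T) (by intro; simp [T]; tauto)
  have hT2 := h2.mono (T := T) (by intro; simp [T]; tauto)
  have hST : S ⊆ T := by intro; simp [T]; tauto
  have hout : ∀ i : ℤ, (i < -M ∨ M ≤ i) →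
      ∑ k ∈ T with k ≤ i, (downInd a.lab k - downInd z.lab k) = 0 := by
    intro i hi
    have e : ∑ k ∈ T with k ≤ i, (downInd a.lab k - downInd b.lab k) = 0 := by
      rw [sum_downInd_mono hS.eq hST]
      rcases hi with hi | hi
      · rw [Finset.filter_false_of_mem, Finset.sum_empty]
        intro k hk; rw [hSdef, mem_Icc] at hk; omega
      · rw [Finset.filter_true_of_mem, hS.total]
        intro k hk; rw [hSdef, mem_Icc] at hk; omega
    have e2 := hT1.prefix_nonneg i
    have e3 := hT2.prefix_nonneg i
    have e4 : ∑ k ∈ T with k ≤ i, (downInd a.lab k - downInd z.lab k) +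
        ∑ k ∈ T with k ≤ i, (downInd z.lab k - downInd b.lab k) = 0 := by
      rw [← e, ← sum_add_distrib]
      exact sum_congr rfl fun _ _ => by ring
    omega
  refine ⟨fun k hk => ?_, h1.act, h1.free⟩
  by_cases hkT : k ∈ T
  swap
  · exact hT1.eq k hkT
  apply h1.toFinDiff.eq_of_downInd
  rw [hSdef, mem_Icc] at hk
  have hk1 := hout k (by omega)
  have hk2 := hout (k - 1) (by omega)
  have e : T.filter (· ≤ k) = insert k (T.filter (· ≤ k - 1)) := by
    ext m
    simp only [mem_filter, mem_insert]
    constructor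
    · rintro ⟨hm, hm'⟩
      by_cases h : m = k
      · exact Or.inl h
      · exact Or.inr ⟨hm, by omega⟩
    · rintro (rfl | ⟨hm, hm'⟩)
      · exact ⟨hkT, le_rfl⟩
      · exact ⟨hm, by omega⟩
  rw [e, sum_insert (by simp), hk2] at hk1
  omega

/-! ## Crossingless matchings on finite sets of integers -/

/-- `α` is a crossingless perfect matching of the points of `C`. -/
structure Matching (C : Finset ℤ) (α : ℤ → ℤ) : Prop where
  maps : ∀ x ∈ C, α x ∈ C
  invol : ∀ x ∈ C, α (α x) = x
  ne : ∀ x ∈ C, α x ≠ x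
  nc : ∀ i ∈ C, ∀ k ∈ C, i < k → k < α i → i < α k ∧ α k < α i

/-- `C` is a single circle. -/
def Connected (C : Finset ℤ) (α β : ℤ → ℤ) : Prop :=
  ∀ S ⊆ C, S.Nonempty → (∀ x ∈ S, α x ∈ S) → (∀ x ∈ S, β x ∈ S) → S = C

theorem Matching.even_between {C : Finset ℤ} {α : ℤ → ℤ} (h : Matching C α) {v : ℤ} (hv : v ∈ C) :
    (-1 : ℤ) ^ (C.filter fun x => v < x ∧ x < α v).card = 1 := by
  rw [← prod_const]
  refine Finset.prod_involution (fun x _ => α x) ?_ ?_ ?_ ?_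
  · intro x _; norm_num
  · intro x hx _; exact h.ne x (mem_filter.1 hx).1
  · intro x hx
    have hx := mem_filter.1 hx
    exact mem_filter.2 ⟨h.maps x hx.1, h.nc v hv x hx.1 hx.2.1 hx.2.2⟩
  · intro x hx; exact h.invol x (mem_filter.1 hx).1

/-- The sign of a point: the parity of the number of points to the left of it. -/
def rankSign (C : Finset ℤ) (v : ℤ) : ℤ := (-1) ^ (C.filter (· < v)).card

theorem Matching.rankSign_of_lt {C : Finset ℤ} {α : ℤ → ℤ} (h : Matching C α) {v : ℤ} (hv : v ∈ C)
    (hlt : v < α v) : rankSign C (α v) = - rankSign C v := by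
  unfold rankSign
  have e : C.filter (· < α v) =
      insert v (C.filter (· < v) ∪ C.filter fun x => v < x ∧ x < α v) := by
    ext x
    simp only [mem_filter, mem_insert, mem_union]
    constructor
    · rintro ⟨h1, h2⟩
      rcases lt_trichotomy x v with h3 | h3 | h3
      · exact Or.inr (Or.inl ⟨h1, h3⟩)
      · exact Or.inl h3
      · exact Or.inr (Or.inr ⟨h1, h3, h2⟩)
    · rintro (rfl | ⟨h1, h2⟩ | ⟨h1, h2, h3⟩)
      · exact ⟨hv, hlt⟩
      · exact ⟨h1, by omega⟩
      · exact ⟨h1, h3⟩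
  rw [e, card_insert_of_notMem (by simp), Finset.card_union_of_disjoint, pow_succ, pow_add,
    h.even_between hv]
  · ring
  · rw [Finset.disjoint_left]
    intro x h1 h2
    rw [mem_filter] at h1 h2
    omega

theorem Matching.rankSign_flip {C : Finset ℤ} {α : ℤ → ℤ} (h : Matching C α) {v : ℤ} (hv : v ∈ C) :
    rankSign C (α v) = - rankSign C v := by
  rcases lt_or_gt_of_ne (h.ne v hv) with h1 | h1
  · have := h.rankSign_of_lt (h.maps v hv) (by rwa [h.invol v hv])
    rw [h.invol v hv] at this
    rw [this, neg_neg]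
  · exact h.rankSign_of_lt hv h1

theorem sum_rankSign (C : Finset ℤ) : ∑ x ∈ C, rankSign C x = ((C.card % 2 : ℕ) : ℤ) := by
  classical
  induction C using Finset.induction_on_max with
  | empty => simp
  | insert a s hs ih =>
    have ha : a ∉ s := fun h => lt_irrefl _ (hs a h)
    rw [sum_insert ha, card_insert_of_notMem ha]
    have e1 : ∑ x ∈ s, rankSign (insert a s) x = ∑ x ∈ s, rankSign s x := by
      refine sum_congr rfl fun x hx => ?_
      unfold rankSign
      rw [Finset.filter_insert, if_neg (by have := hs x hx; omega)]
    have e2 : rankSign (insert a s) a = (-1) ^ s.card := by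
      unfold rankSign
      rw [Finset.filter_insert, if_neg (lt_irrefl _), Finset.filter_true_of_mem hs]
    rw [e1, ih, e2]
    rcases Nat.even_or_odd s.card with h | h
    · rw [h.neg_one_pow, Nat.even_iff.1 h, Nat.add_mod, Nat.even_iff.1 h]; rfl
    · rw [h.neg_one_pow, Nat.odd_iff.1 h, Nat.add_mod, Nat.odd_iff.1 h]; rfl

theorem rankSign_filter_le (C : Finset ℤ) {i x : ℤ} (hx : x ≤ i) :
    rankSign (C.filter (· ≤ i)) x = rankSign C x := by
  unfold rankSign
  rw [filter_filter]
  congr 2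
  ext y
  simp only [mem_filter]
  constructor <;> rintro ⟨h1, h2⟩ <;> refine ⟨h1, ?_⟩ <;> omega

section Circle

variable {C : Finset ℤ} {α β lam : ℤ → ℤ}

/-- Along a circle the labels alternate from left to right. -/
theorem label_eq_rankSign (hα : Matching C α) (hβ : Matching C β) (hc : Connected C α β)
    (hlα : ∀ x ∈ C, lam (α x) = - lam x) (hlβ : ∀ x ∈ C, lam (β x) = - lam x) {m : ℤ} (hm : m ∈ C)
    (hmin : ∀ x ∈ C, m ≤ x) {v : ℤ} (hv : v ∈ C) : lam v = lam m * rankSign C v := by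
  classical
  have h := hc (C.filter fun v => lam v = lam m * rankSign C v) (filter_subset _ _)
    ⟨m, mem_filter.2 ⟨hm, ?_⟩⟩ ?_ ?_
  · rw [← h] at hv; exact (mem_filter.1 hv).2
  · unfold rankSign
    rw [Finset.filter_false_of_mem fun x hx => not_lt.2 (hmin x hx)]; simp
  · intro x hx
    obtain ⟨h1, h2⟩ := mem_filter.1 hx
    refine mem_filter.2 ⟨hα.maps x h1, ?_⟩
    rw [hlα x h1, hα.rankSign_flip h1, h2]; ring
  · intro x hx
    obtain ⟨h1, h2⟩ := mem_filter.1 hx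
    refine mem_filter.2 ⟨hβ.maps x h1, ?_⟩
    rw [hlβ x h1, hβ.rankSign_flip h1, h2]; ring

theorem prefix_sum_circle (hα : Matching C α) (hβ : Matching C β) (hc : Connected C α β)
    (hlα : ∀ x ∈ C, lam (α x) = - lam x) (hlβ : ∀ x ∈ C, lam (β x) = - lam x) {m : ℤ} (hm : m ∈ C)
    (hmin : ∀ x ∈ C, m ≤ x) (i : ℤ) : ∃ n : ℕ,
      ∑ x ∈ C with x ≤ i, lam x = lam m * n := by
  refine ⟨(C.filter (· ≤ i)).card % 2, ?_⟩
  rw [← sum_rankSign, mul_sum]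
  refine sum_congr rfl fun x hx => ?_
  obtain ⟨h1, h2⟩ := mem_filter.1 hx
  rw [rankSign_filter_le C h2]
  exact label_eq_rankSign hα hβ hc hlα hlβ hm hmin h1

theorem Matching.sum_eq_zero (hα : Matching C α) (hlα : ∀ x ∈ C, lam (α x) = - lam x) :
    ∑ x ∈ C, lam x = 0 := by
  have h : ∑ x ∈ C, lam x = ∑ x ∈ C, lam (α x) :=
    sum_bij' (fun x _ => α x) (fun x _ => α x) hα.maps hα.maps hα.invol hα.invol
      fun x hx => by rw [hα.invol x hx]
  have h2 : ∑ x ∈ C, lam (α x) = - ∑ x ∈ C, lam x := by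
    rw [← sum_neg_distrib]; exact sum_congr rfl hlα
  omega

theorem label_max (hα : Matching C α) (hβ : Matching C β) (hc : Connected C α β)
    (hlα : ∀ x ∈ C, lam (α x) = - lam x) (hlβ : ∀ x ∈ C, lam (β x) = - lam x) {m M : ℤ} (hm : m ∈ C)
    (hmin : ∀ x ∈ C, m ≤ x) (hM : M ∈ C) (hmax : ∀ x ∈ C, x ≤ M) : lam M = - lam m := by
  rw [label_eq_rankSign hα hβ hc hlα hlβ hm hmin hM]
  have he : (-1 : ℤ) ^ C.card = 1 := by
    rw [← prod_const]
    exact Finset.prod_involution (fun x _ => α x) (fun x _ => by norm_num)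
      (fun x hx _ => hα.ne x hx) hα.maps hα.invol
  have : C = insert M (C.filter (· < M)) := by
    ext x
    simp only [mem_filter, mem_insert]
    constructor
    · intro hx
      rcases (hmax x hx).lt_or_eq with h | h
      · exact Or.inr ⟨hx, h⟩
      · exact Or.inl h
    · rintro (rfl | h)
      · exact hM
      · exact h.1
  rw [this, card_insert_of_notMem (by simp), pow_succ] at he
  unfold rankSign
  rw [show (-1 : ℤ) ^ (C.filter (· < M)).card = -1 by linarith]
  ring

theorem exists_adjacent (hα : Matching C α) {m w : ℤ} (hmin : ∀ x ∈ C, m ≤ x)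
    (hw : w ∈ C) (hwm : w ≠ m) (hwm' : w ≠ α m) :
    ∃ u ∈ C, u ≠ m ∧ u < α u ∧ ∀ k ∈ C, ¬ (u < k ∧ k < α u) := by
  classical
  set A := C.filter fun u => u ≠ m ∧ u < α u with hA
  have hAne : A.Nonempty := by
    rcases lt_or_gt_of_ne (hα.ne w hw) with h | h
    · refine ⟨α w, mem_filter.2 ⟨hα.maps w hw, ?_, by rwa [hα.invol w hw]⟩⟩
      intro e; apply hwm'; rw [← e, hα.invol w hw]
    · exact ⟨w, mem_filter.2 ⟨hw, hwm, h⟩⟩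
  obtain ⟨u, hu, hlen⟩ := A.exists_min_image (fun u => α u - u) hAne
  obtain ⟨hu1, hu2, hu3⟩ := mem_filter.1 hu
  refine ⟨u, hu1, hu2, hu3, fun k hk ⟨hk1, hk2⟩ => ?_⟩
  obtain ⟨h1, h2⟩ := hα.nc u hu1 k hk hk1 hk2
  have hmu := hmin u hu1
  rcases lt_or_gt_of_ne (hα.ne k hk) with h | h
  · have := hlen (α k) (mem_filter.2 ⟨hα.maps k hk, by omega, by rwa [hα.invol k hk]⟩)
    rw [hα.invol k hk] at this
    omega
  · have := hlen k (mem_filter.2 ⟨hk, by omega, h⟩)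
    omega

/-- The contribution of a left end of an arc. -/
def leftEnd (α lam : ℤ → ℤ) (x : ℤ) : ℤ := if x < α x then lam x else 0

theorem leftEnd_of_lt {α lam : ℤ → ℤ} {x : ℤ} (h : x < α x) : leftEnd α lam x = lam x := if_pos h

theorem leftEnd_of_not_lt {α lam : ℤ → ℤ} {x : ℤ} (h : ¬ x < α x) : leftEnd α lam x = 0 := if_neg h

/-- Removing two adjacent points joined by an arc on one side. -/
def rejoin (β : ℤ → ℤ) (u v x : ℤ) : ℤ :=
  if x = β u then β v else if x = β v then β u else β x

end Circle

set_option maxHeartbeats 400000 in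
theorem turning_number_aux (n : ℕ) : ∀ (C : Finset ℤ) (α β lam : ℤ → ℤ), C.card = n →
    Matching C α → Matching C β → Connected C α β →
    (∀ x ∈ C, lam (α x) = - lam x) → (∀ x ∈ C, lam (β x) = - lam x) →
    ∀ m ∈ C, (∀ x ∈ C, m ≤ x) →
    ∑ x ∈ C, leftEnd α lam x + ∑ x ∈ C, leftEnd β lam x = 2 * lam m := by
  classical
  induction n using Nat.strong_induction_on with
  | _ n ih =>
  intro C α β lam hn hα hβ hc hlα hlβ m hm hmin
  by_cases hw : ∃ w ∈ C, w ≠ m ∧ w ≠ α m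
  swap
  · push Not at hw
    have hαm := hα.maps m hm
    have hne := hα.ne m hm
    have hlt : m < α m := lt_of_le_of_ne (hmin _ hαm) hne.symm
    have hC : C = {m, α m} := by
      ext x
      grind
    have hβm : β m = α m := hw _ (hβ.maps m hm) (hβ.ne m hm)
    have hsum : ∀ γ : ℤ → ℤ, γ m = α m → γ (α m) = m →
        ∑ x ∈ C, leftEnd γ lam x = lam m := by
      intro γ h1 h2
      rw [hC, sum_pair hne.symm, leftEnd_of_lt (by rwa [h1]),
        leftEnd_of_not_lt (by rw [h2]; omega), add_zero]
    rw [hsum α rfl (hα.invol m hm), hsum β hβm (by rw [← hβm, hβ.invol m hm])]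
    ring
  obtain ⟨w, hwC, hwm, hwm'⟩ := hw
  obtain ⟨u, huC, hum, huv, hadj⟩ := exists_adjacent hα hmin hwC hwm hwm'
  obtain ⟨v, hv⟩ : ∃ v, v = α u := ⟨_, rfl⟩
  rw [← hv] at huv hadj
  have hvC : v ∈ C := hv ▸ hα.maps u huC
  have hαv : α v = u := by rw [hv, hα.invol u huC]
  have hmu := hmin u huC
  have hβu := hβ.maps u huC
  have hβv := hβ.maps v hvC
  have hβuu := hβ.invol u huC
  have hβvv := hβ.invol v hvC
  have hu'v : β u ≠ v := by
    intro e
    have : ({u, v} : Finset ℤ) = C :=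
      hc _ (by grind) ⟨u, by simp⟩ (by grind) (by grind)
    grind
  have hu'u : β u ≠ u := hβ.ne u huC
  have hv'v : β v ≠ v := hβ.ne v hvC
  have hv'u : β v ≠ u := by intro e; apply hu'v; rw [← e, hβvv]
  have hu'v' : β u ≠ β v := by
    intro e; have := congrArg β e; rw [hβuu, hβvv] at this; omega
  have inj : ∀ x ∈ C, ∀ y ∈ C, β x = β y → x = y := fun x hx y hy e => by
    rw [← hβ.invol x hx, e, hβ.invol y hy]
  set C' := (C.erase u).erase v with hC'
  have memC' : ∀ x, x ∈ C' ↔ x ≠ v ∧ x ≠ u ∧ x ∈ C := by intro x; simp [hC']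
  set β' := rejoin β u v with hβ'
  have b1 : β' (β u) = β v := by simp [hβ', rejoin]
  have b2 : β' (β v) = β u := by simp [hβ', rejoin, hu'v'.symm]
  have b3 : ∀ x, x ≠ β u → x ≠ β v → β' x = β x := by
    intro x h1 h2; simp [hβ', rejoin, h1, h2]
  have hα' : Matching C' α :=
    ⟨by grind [hα.maps, hα.invol], by grind [hα.invol], by grind [hα.ne],
      fun i hi k hk => hα.nc i ((memC' i).1 hi).2.2 k ((memC' k).1 hk).2.2⟩
  have hβ'M : Matching C' β' := by
    have ordne : ∀ x ∈ C', x ≠ β u → x ≠ β v → β x ≠ u ∧ β x ≠ v ∧ β x ≠ β u ∧ β x ≠ β v := by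
      grind [hβ.invol]
    refine ⟨fun x hx => ?_, fun x hx => ?_, fun x hx => ?_, ?_⟩
    · have := ordne x hx
      have := hβ.maps x ((memC' x).1 hx).2.2
      grind
    · have := ordne x hx
      have := hβ.invol x ((memC' x).1 hx).2.2
      by_cases h1 : x = β u
      · rw [h1, b1, b2]
      by_cases h2 : x = β v
      · rw [h2, b2, b1]
      grind
    · have := hβ.ne x ((memC' x).1 hx).2.2
      grind
    · intro i hi k hk
      obtain ⟨hiv, hiu, hiC⟩ := (memC' i).1 hi
      obtain ⟨hkv, hku, hkC⟩ := (memC' k).1 hk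
      have hβk := hβ.maps k hkC
      have hβi := hβ.maps i hiC
      have a1 := hadj k hkC
      have a2 := hadj _ hβk
      have a3 := hadj _ hβu
      have a4 := hadj _ hβv
      have a5 := hadj i hiC
      have a6 := hadj _ hβi
      have q1 := hβ.nc u huC v hvC
      have q2 := hβ.nc _ hβv u huC
      have q3 := hβ.nc _ hβu k hkC
      have q4 := hβ.nc v hvC k hkC
      have q5 := hβ.nc _ hβv k hkC
      have q6 := hβ.nc u huC k hkC
      have q7 := hβ.nc _ hβu _ hβk
      have q8 := hβ.nc v hvC _ hβk
      have q9 := hβ.nc i hiC u huC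
      have q10 := hβ.nc i hiC v hvC
      have q11 := hβ.nc i hiC _ hβu
      have q12 := hβ.nc i hiC _ hβv
      have hkk := hβ.invol k hkC
      rw [hβvv] at q2 q5 q12
      rw [hβuu] at q3 q7 q11
      rw [hkk] at q7 q8
      by_cases i1 : i = β u
      · rw [i1, b1]
        by_cases k2 : k = β v
        · rw [k2]; omega
        by_cases k1 : k = β u
        · rw [k1]; omega
        have := ordne k hk k1 k2
        rw [b3 k k1 k2]
        clear q9 q10 q11 q12 a5 a6
        omega
      by_cases i2 : i = β v
      · rw [i2, b2]
        by_cases k1 : k = β u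
        · rw [k1]; omega
        by_cases k2 : k = β v
        · rw [k2]; omega
        have := ordne k hk k1 k2
        rw [b3 k k1 k2]
        clear q9 q10 q11 q12 a5 a6
        omega
      have oi := ordne i hi i1 i2
      rw [b3 i i1 i2]
      by_cases k1 : k = β u
      · rw [k1, b1]; clear q1 q2 q3 q4 q5 q6 q7 q8; omega
      by_cases k2 : k = β v
      · rw [k2, b2]; clear q1 q2 q3 q4 q5 q6 q7 q8; omega
      rw [b3 k k1 k2]
      exact hβ.nc i hiC k hkC
  have hlt : C'.card < n := by
    rw [← hn, hC']
    exact (Finset.card_erase_lt_of_mem (by simp [huv.ne', hvC])).trans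
      (Finset.card_erase_lt_of_mem huC)
  have hc' : Connected C' α β' := by
    intro S hS hne hSα hSβ
    have hSC : ∀ x ∈ S, x ≠ v ∧ x ≠ u ∧ x ∈ C := fun x hx => (memC' x).1 (hS hx)
    by_cases hu'S : β u ∈ S
    · have hT : insert u (insert v S) = C := hc _ (by grind) ⟨u, by simp⟩ (by grind) (by grind)
      refine hS.antisymm fun x hx => ?_
      have h1 := (memC' x).1 hx
      rw [← hT] at h1
      simpa [h1.1, h1.2.1] using h1.2.2
    · have hT : S = C := hc _ (by grind) hne hSα (by grind)
      exact ((hSC u (hT ▸ huC)).2.1 rfl).elim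
  have hlu' : lam (β u) = - lam u := hlβ u huC
  have hlv : lam v = - lam u := by rw [hv, hlα u huC]
  have hlv' : lam (β v) = lam u := by rw [hlβ v hvC, hlv, neg_neg]
  have hmC' : m ∈ C' := (memC' m).2 ⟨by omega, by omega, hm⟩
  have IH := ih _ hlt C' α β' lam rfl hα' hβ'M hc' (fun x hx => hlα x ((memC' x).1 hx).2.2)
    (by grind) m hmC' (fun x hx => hmin x ((memC' x).1 hx).2.2)
  rw [← IH]
  have s1 : ∀ F : ℤ → ℤ, ∑ x ∈ C, F x = F u + (F v + ∑ x ∈ C', F x) := by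
    intro F
    rw [← add_sum_erase C F huC,
      ← add_sum_erase (C.erase u) F (a := v) (by simp [huv.ne', hvC])]
  have hu'C' : β u ∈ C' := (memC' _).2 ⟨hu'v, hu'u, hβu⟩
  have hv'C' : β v ∈ C' := (memC' _).2 ⟨hv'v, hv'u, hβv⟩
  have s2 : ∀ F : ℤ → ℤ, ∑ x ∈ C', F x =
      F (β u) + (F (β v) + ∑ x ∈ (C'.erase (β u)).erase (β v), F x) := by
    intro F
    rw [← add_sum_erase C' F hu'C',
      ← add_sum_erase (C'.erase (β u)) F (a := β v) (by simp [hu'v'.symm, hv'C'])]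
  have s3 : ∑ x ∈ (C'.erase (β u)).erase (β v), leftEnd β' lam x =
      ∑ x ∈ (C'.erase (β u)).erase (β v), leftEnd β lam x := by
    refine sum_congr rfl fun x hx => ?_
    simp only [mem_erase] at hx
    unfold leftEnd
    rw [b3 x hx.2.1 hx.1]
  rw [s1 (leftEnd α lam), s1 (leftEnd β lam), s2 (leftEnd β lam), s2 (leftEnd β' lam), s3,
    leftEnd_of_lt (by rwa [← hv]), leftEnd_of_not_lt (α := α) (x := v) (by rw [hαv]; omega)]
  have q1 := hβ.nc u huC v hvC
  have q2 := hβ.nc _ hβv u huC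
  rw [hβvv] at q2
  have a3 := hadj _ hβu
  have a4 := hadj _ hβv
  unfold leftEnd
  rw [hβuu, hβvv, b1, b2, hlu', hlv, hlv']
  split_ifs <;> omega

/-- The turning number of a circle: the labels of the left ends of its arcs add up to twice the
label of its leftmost point. -/
theorem turning_number {C : Finset ℤ} {α β lam : ℤ → ℤ} (hα : Matching C α) (hβ : Matching C β)
    (hc : Connected C α β) (hlα : ∀ x ∈ C, lam (α x) = - lam x)
    (hlβ : ∀ x ∈ C, lam (β x) = - lam x) {m : ℤ} (hm : m ∈ C) (hmin : ∀ x ∈ C, m ≤ x) :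
    ∑ x ∈ C, leftEnd α lam x + ∑ x ∈ C, leftEnd β lam x = 2 * lam m :=
  turning_number_aux _ C α β lam rfl hα hβ hc hlα hlβ m hm hmin

/-! ## Circles in one-line diagrams -/

/-- Two vertices are connected by cups of `a` and caps of `b`. -/
def Conn (a b : Labelling) : ℤ → ℤ → Prop :=
  Relation.EqvGen fun i j => IsCup a i j ∨ IsCup b i j

/-- The vertex `m` is the leftmost vertex of a circle. -/
def IsRoot (a b : Labelling) (m : ℤ) : Prop :=
  ∀ k, Conn a b m k → m ≤ k ∧ OnCup a k ∧ OnCup b k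

theorem conn_comm {a b : Labelling} {i j : ℤ} : Conn a b i j ↔ Conn b a i j := by
  unfold Conn
  simp only [or_comm]

theorem isRoot_comm {a b : Labelling} {m : ℤ} : IsRoot a b m ↔ IsRoot b a m := by
  unfold IsRoot
  simp only [conn_comm (a := a) (b := b)]
  exact forall_congr' fun k => by tauto

theorem conn_mate_left (a b : Labelling) (i : ℤ) : Conn a b i (mate a i) := by
  by_cases h : OnCup a i
  · rcases mate_spec h with h | h
    · exact .rel _ _ (Or.inl h)
    · exact .symm _ _ (.rel _ _ (Or.inl h))
  · rw [mate_of_not h]; exact .refl _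

theorem conn_mate_right (a b : Labelling) (i : ℤ) : Conn a b i (mate b i) :=
  conn_comm.1 (conn_mate_left b a i)

/-- A property invariant along cups is constant on connected components. -/
theorem Conn.iff_of_invariant {a b : Labelling} {q : ℤ → Prop}
    (ha : ∀ i j, IsCup a i j → (q i ↔ q j)) (hb : ∀ i j, IsCup b i j → (q i ↔ q j)) {i j : ℤ}
    (h : Conn a b i j) : q i ↔ q j := by
  induction h with
  | rel x y h => exact h.elim (ha x y) (hb x y)
  | refl => exact Iff.rfl
  | symm _ _ _ ih => exact ih.symm
  | trans _ _ _ _ _ ih1 ih2 => exact ih1.trans ih2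

theorem Conn.mate_closed {a b : Labelling} {q : ℤ → Prop} (ha : ∀ i, q i → q (mate a i))
    (hb : ∀ i, q i → q (mate b i)) {i j : ℤ} (h : Conn a b i j) : q i ↔ q j := by
  refine h.iff_of_invariant (fun i j hij => ⟨fun h => ?_, fun h => ?_⟩)
    fun i j hij => ⟨fun h => ?_, fun h => ?_⟩
  · rw [← mate_eq (Or.inl hij)]; exact ha i h
  · rw [← mate_eq (Or.inr hij)]; exact ha j h
  · rw [← mate_eq (Or.inl hij)]; exact hb i h
  · rw [← mate_eq (Or.inr hij)]; exact hb j h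

section Component

variable {a b : Labelling} {C : Finset ℤ} {m : ℤ}

/-- A finite component all of whose points are on cups on both sides is a circle. -/
theorem component_matching (hC : ∀ k, k ∈ C ↔ Conn a b m k) (hm : ∀ k ∈ C, OnCup a k) :
    Matching C (mate a) where
  maps x hx := (hC _).2 (((hC x).1 hx).trans _ _ _ (conn_mate_left a b x))
  invol x _ := mate_mate a x
  ne x hx := mate_ne (hm x hx)
  nc i hi k hk := mate_noncrossing (hm i hi) (hm k hk)

theorem component_connected (hC : ∀ k, k ∈ C ↔ Conn a b m k) :
    Connected C (mate a) (mate b) := by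
  rintro S hS ⟨x, hx⟩ ha hb
  refine Finset.Subset.antisymm hS fun y hy => ?_
  have hxy : Conn a b x y :=
    Relation.EqvGen.trans _ _ _ (((hC x).1 (hS hx)).symm) ((hC y).1 hy)
  exact (Conn.mate_closed (q := (· ∈ S)) ha hb hxy).1 hx

end Component

theorem IsRoot.eq_of_conn {a b : Labelling} {m m' : ℤ} (h : IsRoot a b m) (h' : IsRoot a b m')
    (hc : Conn a b m m') : m = m' :=
  le_antisymm (h m' hc).1 (h' m hc.symm).1

/-- All active vertices are on cups. -/
structure Closed (E : Finset ℤ) (a : Labelling) : Prop where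
  onCup : ∀ i, OnCup a i ↔ i ∈ E

theorem Closed.mate_mem {E : Finset ℤ} {a : Labelling} (h : Closed E a) {i : ℤ} (hi : i ∈ E) :
    mate a i ∈ E := (h.onCup _).1 (onCup_mate ((h.onCup i).2 hi))

theorem Closed.matching {E : Finset ℤ} {a : Labelling} (h : Closed E a) : Matching E (mate a) where
  maps _ hx := h.mate_mem hx
  invol x _ := mate_mate a x
  ne x hx := mate_ne ((h.onCup x).2 hx)
  nc i hi k hk := mate_noncrossing ((h.onCup i).2 hi) ((h.onCup k).2 hk)

section ClosedPair

variable {E : Finset ℤ} {a b : Labelling}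

theorem Closed.conn_mem (ha : Closed E a) (hb : Closed E b) {i j : ℤ} (h : Conn a b i j) :
    i ∈ E ↔ j ∈ E :=
  Conn.mate_closed (q := (· ∈ E)) (fun _ => ha.mate_mem) (fun _ => hb.mate_mem) h

theorem Closed.exists_root (ha : Closed E a) (hb : Closed E b) {i : ℤ} (hi : i ∈ E) :
    ∃ m ∈ E, IsRoot a b m ∧ Conn a b m i := by
  classical
  have hne : (E.filter fun k => Conn a b i k).Nonempty :=
    ⟨i, mem_filter.2 ⟨hi, .refl _⟩⟩
  obtain ⟨h1, h2⟩ := mem_filter.1 (min'_mem _ hne)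
  refine ⟨_, h1, fun k hk => ?_, h2.symm⟩
  have hkE := (ha.conn_mem hb hk).1 h1
  exact ⟨min'_le _ _ (mem_filter.2 ⟨hkE, h2.trans _ _ _ hk⟩), (ha.onCup k).2 hkE,
    (hb.onCup k).2 hkE⟩

open Classical in
theorem Closed.sum_circles (ha : Closed E a) (hb : Closed E b) (F : ℤ → ℤ) :
    ∑ v ∈ E, F v = ∑ m ∈ E with IsRoot a b m, ∑ v ∈ E with Conn a b m v, F v := by
  have h : ∀ i, ∃ m, i ∈ E → m ∈ E ∧ IsRoot a b m ∧ Conn a b m i := by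
    intro i
    by_cases hi : i ∈ E
    · obtain ⟨m, h⟩ := ha.exists_root hb hi
      exact ⟨m, fun _ => h⟩
    · exact ⟨0, fun h => (hi h).elim⟩
  choose rt hrt using h
  rw [← Finset.sum_fiberwise_of_maps_to (g := rt) (t := E.filter (IsRoot a b))
    fun i hi => mem_filter.2 ⟨(hrt i hi).1, (hrt i hi).2.1⟩]
  refine sum_congr rfl fun m hm => ?_
  refine sum_congr ?_ fun _ _ => rfl
  ext i
  simp only [mem_filter]
  refine and_congr_right fun hi => ⟨?_, fun h => ?_⟩
  · rintro rfl; exact (hrt i hi).2.2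
  · exact ((hrt i hi).2.1).eq_of_conn (mem_filter.1 hm).2
      (((hrt i hi).2.2).trans _ _ _ h.symm)

open Classical in
/-- The turning number formula for all the circles satisfying `q`. -/
theorem Closed.turning (ha : Closed E a) (hb : Closed E b) {lam : ℤ → ℤ}
    (hla : ∀ x ∈ E, lam (mate a x) = - lam x) (hlb : ∀ x ∈ E, lam (mate b x) = - lam x)
    (q : ℤ → Prop) [DecidablePred q] (hq : ∀ i j, Conn a b i j → (q i ↔ q j)) :
    ∑ v ∈ E with q v, leftEnd (mate a) lam v + ∑ v ∈ E with q v, leftEnd (mate b) lam v =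
      2 * ∑ m ∈ E with IsRoot a b m ∧ q m, lam m := by
  rw [sum_filter, sum_filter, ha.sum_circles hb, ha.sum_circles hb,
    ← filter_filter, sum_filter (p := q) (s := E.filter (IsRoot a b)), ← sum_add_distrib, mul_sum]
  refine sum_congr rfl fun m hm => ?_
  obtain ⟨hmE, hmr⟩ := mem_filter.1 hm
  have hC : ∀ k, k ∈ E.filter (Conn a b m) ↔ Conn a b m k := fun k => by
    rw [mem_filter, and_iff_right_iff_imp]
    exact fun h => (ha.conn_mem hb h).1 hmE
  have hCE : ∀ k ∈ E.filter (Conn a b m), k ∈ E := fun k hk => (mem_filter.1 hk).1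
  by_cases hqm : q m
  · rw [if_pos hqm, ← turning_number (component_matching hC fun k hk => (ha.onCup k).2 (hCE k hk))
      (component_matching (a := b) (b := a) (m := m) (fun k => (hC k).trans conn_comm)
        fun k hk => (hb.onCup k).2 (hCE k hk))
      (component_connected hC) (fun x hx => hla x (hCE x hx)) (fun x hx => hlb x (hCE x hx))
      ((hC m).2 (.refl _)) (fun x hx => (hmr x ((hC x).1 hx)).1)]
    congr 1 <;> refine sum_congr rfl fun v hv => ?_ <;>
      rw [if_pos ((hq m v ((hC v).1 hv)).1 hqm)]
  · rw [if_neg hqm, mul_zero, sum_eq_zero, sum_eq_zero, add_zero] <;>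
      exact fun v hv => if_neg fun h => hqm ((hq m v ((hC v).1 hv)).2 h)

end ClosedPair

/-! ## Surgery on pairs of involutions -/

section Dichotomy

variable {V : Type*} (W : Finset V)

/-- The components of the graph on `W` with edges given by `α` and `β`. -/
def Joined (α β : V → V) : V → V → Prop :=
  Relation.EqvGen fun x y => x ∈ W ∧ (y = α x ∨ y = β x)

variable {W}

theorem Joined.closed {α β : V → V} {q : V → Prop} (hα : ∀ x ∈ W, (q x ↔ q (α x)))
    (hβ : ∀ x ∈ W, (q x ↔ q (β x))) {x y : V} (h : Joined W α β x y) : q x ↔ q y := by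
  induction h with
  | rel x y h =>
    obtain ⟨hx, rfl | rfl⟩ := h
    · exact hα x hx
    · exact hβ x hx
  | refl => exact Iff.rfl
  | symm _ _ _ ih => exact ih.symm
  | trans _ _ _ _ _ ih1 ih2 => exact ih1.trans ih2

/-- Involutions on `W` which change the sign of `u`. -/
structure SignInvol (W : Finset V) (u : V → ℤ) (α : V → V) : Prop where
  maps : ∀ x ∈ W, α x ∈ W
  invol : ∀ x ∈ W, α (α x) = x
  flip : ∀ x ∈ W, u (α x) = - u x

/-- `β'` arises from `β` by replacing the edges `v1 y1`, `v2 y2` by `v1 v2`, `y1 y2`. -/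
structure Rewire (W : Finset V) (u : V → ℤ) (α β β' : V → V) (v1 y1 v2 y2 : V) : Prop where
  hα : SignInvol W u α
  hβ : SignInvol W u β
  hβ' : SignInvol W u β'
  hu : ∀ x ∈ W, u x ≠ 0
  v1_mem : v1 ∈ W
  y2_mem : y2 ∈ W
  b1 : β v1 = y1
  b2 : β y2 = v2
  c1 : β' v1 = v2
  c2 : β' y2 = y1
  sign : u v1 = u y2
  ne : v1 ≠ y2
  other : ∀ x ∈ W, x ≠ v1 → x ≠ y1 → x ≠ v2 → x ≠ y2 → β' x = β x

theorem Rewire.swap {u : V → ℤ} {α β β' : V → V} {v1 y1 v2 y2 : V}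
    (h : Rewire W u α β β' v1 y1 v2 y2) : Rewire W u α β' β v1 v2 y1 y2 where
  hα := h.hα
  hβ := h.hβ'
  hβ' := h.hβ
  hu := h.hu
  v1_mem := h.v1_mem
  y2_mem := h.y2_mem
  b1 := h.c1
  b2 := h.c2
  c1 := h.b1
  c2 := h.b2
  sign := h.sign
  ne := h.ne
  other x hx h1 h2 h3 h4 := (h.other x hx h1 h3 h2 h4).symm

section

variable {u : V → ℤ} {α β β' : V → V} {v1 y1 v2 y2 : V} (h : Rewire W u α β β' v1 y1 v2 y2)

include h

theorem Rewire.y1_mem : y1 ∈ W := h.b1 ▸ h.hβ.maps _ h.v1_mem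

theorem Rewire.v2_mem : v2 ∈ W := h.b2 ▸ h.hβ.maps _ h.y2_mem

theorem Rewire.b1' : β y1 = v1 := by rw [← h.b1, h.hβ.invol _ h.v1_mem]

theorem Rewire.b2' : β v2 = y2 := by rw [← h.b2, h.hβ.invol _ h.y2_mem]

theorem Rewire.eq_or {x : V} (hx : x ∈ W) :
    x = v1 ∨ x = y1 ∨ x = v2 ∨ x = y2 ∨ β' x = β x := by
  have := h.other x hx
  tauto

theorem Rewire.aux :
    (Joined W α β' v1 y1 ∧ ¬ Joined W α β v1 v2) ∨ (¬ Joined W α β' v1 y1 ∧ Joined W α β v1 v2) := by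
  classical
  have uy1 : u y1 = - u v1 := by rw [← h.b1, h.hβ.flip _ h.v1_mem]
  have uv2 : u v2 = - u v1 := by rw [← h.b2, h.hβ.flip _ h.y2_mem, h.sign]
  have u0 := h.hu v1 h.v1_mem
  have uy2 := h.sign
  have y1v2 : y1 ≠ v2 := by intro e; apply h.ne; rw [← h.b1', e, h.b2']
  set ρ : V → V := fun x => β (α x) with hρ
  have ρmem : ∀ n, ∀ x ∈ W, ρ^[n] x ∈ W := by
    intro n
    induction n with
    | zero => exact fun x hx => hx
    | succ n ih => intro x hx; rw [iterate_succ_apply']; exact h.hβ.maps _ (h.hα.maps _ (ih x hx))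
  have ρu : ∀ n, u (ρ^[n] y1) = - u v1 := by
    intro n
    induction n with
    | zero => exact uy1
    | succ n ih =>
      rw [iterate_succ_apply', hρ]
      have hm := ρmem n y1 h.y1_mem
      change u (β (α (ρ^[n] y1))) = _
      rw [h.hβ.flip _ (h.hα.maps _ hm), h.hα.flip _ hm, ih, neg_neg]
  have αu : ∀ n, u (α (ρ^[n] y1)) = u v1 := fun n => by
    rw [h.hα.flip _ (ρmem n y1 h.y1_mem), ρu, neg_neg]
  have ρinj : ∀ x ∈ W, ∀ y ∈ W, ρ x = ρ y → x = y := by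
    intro x hx y hy hxy
    have := congrArg β hxy
    simp only [hρ] at this
    rw [h.hβ.invol _ (h.hα.maps _ hx), h.hβ.invol _ (h.hα.maps _ hy)] at this
    rw [← h.hα.invol x hx, this, h.hα.invol y hy]
  have hper : ∃ k, 1 ≤ k ∧ ρ^[k] y1 = y1 := by
    have : ∃ m n : ℕ, m < n ∧ ρ^[m] y1 = ρ^[n] y1 := by
      obtain ⟨m, n, hmn, he⟩ := Finite.exists_ne_map_eq_of_infinite
        (fun n : ℕ => (⟨ρ^[n] y1, ρmem n y1 h.y1_mem⟩ : W))
      have he := congrArg Subtype.val he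
      rcases lt_or_gt_of_ne hmn with h1 | h1
      · exact ⟨m, n, h1, he⟩
      · exact ⟨n, m, h1, he.symm⟩
    obtain ⟨m, n, hmn, he⟩ := this
    induction m generalizing n with
    | zero => exact ⟨n, hmn, he.symm⟩
    | succ m ih =>
      obtain ⟨n, rfl⟩ : ∃ n', n = n' + 1 := ⟨n - 1, by omega⟩
      refine ih n (by omega) ?_
      rw [iterate_succ_apply', iterate_succ_apply'] at he
      exact ρinj _ (ρmem _ _ h.y1_mem) _ (ρmem _ _ h.y1_mem) he
  have hex : ∃ k, 1 ≤ k ∧ (ρ^[k] y1 = y1 ∨ ρ^[k] y1 = v2) := by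
    obtain ⟨k, h1, h2⟩ := hper; exact ⟨k, h1, Or.inl h2⟩
  obtain ⟨k, ⟨hk1, hk2⟩, hkmin⟩ : ∃ k, (1 ≤ k ∧ (ρ^[k] y1 = y1 ∨ ρ^[k] y1 = v2)) ∧
      ∀ l, 1 ≤ l → l < k → ρ^[l] y1 ≠ y1 ∧ ρ^[l] y1 ≠ v2 := by
    refine ⟨Nat.find hex, Nat.find_spec hex, fun l hl hlk => ?_⟩
    have := Nat.find_min hex hlk
    push Not at this
    exact this hl
  have step : ∀ l, ρ^[l + 1] y1 = β (α (ρ^[l] y1)) := fun l => iterate_succ_apply' _ _ _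
  have join : ∀ n, Joined W α β y1 (ρ^[n] y1) := by
    intro n
    induction n with
    | zero => exact .refl _
    | succ n ih =>
      have hm := ρmem n y1 h.y1_mem
      rw [step]
      exact ih.trans _ _ _ ((Relation.EqvGen.rel _ _ ⟨hm, Or.inl rfl⟩).trans _ _ _
        (.rel _ _ ⟨h.hα.maps _ hm, Or.inr rfl⟩))
  have join₁ : Joined W α β v1 y1 := .rel _ _ ⟨h.v1_mem, Or.inr h.b1.symm⟩
  have αne : ∀ l, l + 1 < k → β' (α (ρ^[l] y1)) = ρ^[l + 1] y1 := by
    intro l hl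
    have hm := ρmem l y1 h.y1_mem
    obtain ⟨m1, m2⟩ := hkmin (l + 1) (by omega) hl
    rw [step] at m1 m2 ⊢
    refine h.other _ (h.hα.maps _ hm) ?_ ?_ ?_ ?_
    · intro e; rw [e, h.b1] at m1; exact m1 rfl
    · intro e; have := αu l; rw [e] at this; omega
    · intro e; have := αu l; rw [e] at this; omega
    · intro e; rw [e, h.b2] at m2; exact m2 rfl
  -- the points on the path starting at `y1`
  have hS : ∀ γ : V → V, (∀ x ∈ W, γ (γ x) = x) →
      (∀ l, l + 1 < k → γ (α (ρ^[l] y1)) = ρ^[l + 1] y1) → γ (α (ρ^[k - 1] y1)) = y1 →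
      ∀ x, Joined W α γ y1 x → ∃ l, l < k ∧ (x = ρ^[l] y1 ∨ x = α (ρ^[l] y1)) := by
    intro γ γi g1 g2 x hx
    have hγα : ∀ l, l < k → ∃ l', l' < k ∧ γ (α (ρ^[l] y1)) = ρ^[l'] y1 := by
      intro l hl
      by_cases hl' : l + 1 < k
      · exact ⟨l + 1, hl', g1 l hl'⟩
      · obtain rfl : l = k - 1 := by omega
        exact ⟨0, by omega, g2⟩
    have hγρ : ∀ l, l < k → ∃ l', l' < k ∧ γ (ρ^[l] y1) = α (ρ^[l'] y1) := by
      intro l hl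
      cases l with
      | zero =>
        refine ⟨k - 1, by omega, ?_⟩
        change γ y1 = _
        have e := congrArg γ g2
        rwa [γi _ (h.hα.maps _ (ρmem _ _ h.y1_mem)), eq_comm] at e
      | succ l =>
        refine ⟨l, by omega, ?_⟩
        rw [← g1 l hl, γi _ (h.hα.maps _ (ρmem _ _ h.y1_mem))]
    have c1 : ∀ x, (∃ l, l < k ∧ (x = ρ^[l] y1 ∨ x = α (ρ^[l] y1))) →
        ∃ l, l < k ∧ (α x = ρ^[l] y1 ∨ α x = α (ρ^[l] y1)) := by
      rintro x ⟨l, hl, rfl | rfl⟩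
      · exact ⟨l, hl, Or.inr rfl⟩
      · exact ⟨l, hl, Or.inl (h.hα.invol _ (ρmem _ _ h.y1_mem))⟩
    have c2 : ∀ x, (∃ l, l < k ∧ (x = ρ^[l] y1 ∨ x = α (ρ^[l] y1))) →
        ∃ l, l < k ∧ (γ x = ρ^[l] y1 ∨ γ x = α (ρ^[l] y1)) := by
      rintro x ⟨l, hl, rfl | rfl⟩
      · obtain ⟨l', h1, h2⟩ := hγρ l hl
        exact ⟨l', h1, Or.inr h2⟩
      · obtain ⟨l', h1, h2⟩ := hγα l hl
        exact ⟨l', h1, Or.inl h2⟩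
    refine (Joined.closed (q := fun x => ∃ l, l < k ∧ (x = ρ^[l] y1 ∨ x = α (ρ^[l] y1)))
      (fun x hx => ⟨c1 x, fun hc => ?_⟩) (fun x hx => ⟨c2 x, fun hc => ?_⟩) hx).1
      ⟨0, by omega, Or.inl rfl⟩
    · have := c1 _ hc; rwa [h.hα.invol x hx] at this
    · have := c2 _ hc; rwa [γi x hx] at this
  rcases hk2 with hk2 | hk2
  · left
    have hlast : α (ρ^[k - 1] y1) = v1 := by
      have e := step (k - 1)
      rw [Nat.sub_add_cancel hk1, hk2] at e
      have := congrArg β e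
      rwa [h.hβ.invol _ (h.hα.maps _ (ρmem _ _ h.y1_mem)), h.b1', eq_comm] at this
    constructor
    · have hj : ∀ l, l < k → Joined W α β' y1 (ρ^[l] y1) := by
        intro l
        induction l with
        | zero => exact fun _ => .refl _
        | succ l ih =>
          intro hl
          have hm := ρmem l y1 h.y1_mem
          rw [← αne l hl]
          exact (ih (by omega)).trans _ _ _ ((Relation.EqvGen.rel _ _ ⟨hm, Or.inl rfl⟩).trans _ _ _
            (.rel _ _ ⟨h.hα.maps _ hm, Or.inr rfl⟩))
      refine Relation.EqvGen.symm _ _ ((hj (k - 1) (by omega)).trans _ _ _ ?_)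
      exact .rel _ _ ⟨ρmem _ _ h.y1_mem, Or.inl hlast.symm⟩
    · intro hc
      obtain ⟨l, hl, hl' | hl'⟩ := hS β h.hβ.invol (fun l _ => (step l).symm)
        (by rw [hlast, h.b1]) v2 (join₁.symm.trans _ _ _ hc)
      · cases l with
        | zero => exact y1v2 hl'.symm
        | succ l => exact (hkmin (l + 1) (by omega) hl).2 hl'.symm
      · have := αu l; rw [← hl'] at this; omega
  · right
    have hlast : α (ρ^[k - 1] y1) = y2 := by
      have e := step (k - 1)
      rw [Nat.sub_add_cancel hk1, hk2] at e
      have := congrArg β e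
      rwa [h.hβ.invol _ (h.hα.maps _ (ρmem _ _ h.y1_mem)), h.b2', eq_comm] at this
    refine ⟨fun hc => ?_, join₁.trans _ _ _ (hk2 ▸ join k)⟩
    obtain ⟨l, hl, hl' | hl'⟩ := hS β' h.hβ'.invol αne (by rw [hlast, h.c2]) v1 hc.symm
    · have := ρu l; rw [← hl'] at this; omega
    · have e := step l
      rw [← hl', h.b1] at e
      by_cases hlk : l + 1 < k
      · exact (hkmin (l + 1) (by omega) hlk).1 e
      · obtain rfl : l = k - 1 := by omega
        rw [Nat.sub_add_cancel hk1, hk2] at e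
        exact y1v2 e.symm

/-- If the two edges belong to different components, these are merged. -/
theorem Rewire.merge (hn : ¬ Joined W α β v1 v2) (x y : V) :
    Joined W α β' x y ↔ Joined W α β x y ∨
      ((Joined W α β v1 x ∨ Joined W α β v2 x) ∧ (Joined W α β v1 y ∨ Joined W α β v2 y)) := by
  have hj : Joined W α β' v1 y1 := by
    rcases h.aux with h1 | h1
    · exact h1.1
    · exact (hn h1.2).elim
  have cy1 := h.swap.b2'
  have cv2 := h.swap.b1'
  have j1 : Joined W α β v1 y1 := .rel _ _ ⟨h.v1_mem, Or.inr h.b1.symm⟩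
  have j2 : Joined W α β v2 y2 := .rel _ _ ⟨h.v2_mem, Or.inr h.b2'.symm⟩
  have j3 : Joined W α β' v1 v2 := .rel _ _ ⟨h.v1_mem, Or.inr h.c1.symm⟩
  have j4 : Joined W α β' y1 y2 := .rel _ _ ⟨h.y1_mem, Or.inr cy1.symm⟩
  have up : ∀ x y, Joined W α β x y → Joined W α β' x y := by
    intro x y hxy
    induction hxy with
    | rel x y hr =>
      obtain ⟨hx, rfl | rfl⟩ := hr
      · exact .rel _ _ ⟨hx, Or.inl rfl⟩
      have j5 : Joined W α β' v2 y2 := (j3.symm.trans _ _ _ hj).trans _ _ _ j4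
      have j6 : Joined W α β' y2 v2 := j5.symm
      have j7 : Joined W α β' y1 v1 := hj.symm
      have j8 : Joined W α β' x (β' x) := .rel _ _ ⟨hx, Or.inr rfl⟩
      have := h.eq_or hx
      grind [h.b1, h.b2, h.b1', h.b2']
    | refl => exact .refl _
    | symm _ _ _ ih => exact ih.symm
    | trans _ _ _ _ _ ih1 ih2 => exact ih1.trans _ _ _ ih2
  have tr : ∀ x y, Joined W α β x y → (Joined W α β v1 x ∨ Joined W α β v2 x) →
      (Joined W α β v1 y ∨ Joined W α β v2 y) :=
    fun x y hxy hx => hx.imp (fun h => h.trans _ _ _ hxy) (fun h => h.trans _ _ _ hxy)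
  constructor
  · intro hxy
    induction hxy with
    | rel x y hr =>
      obtain ⟨hx, rfl | rfl⟩ := hr
      · exact Or.inl (.rel _ _ ⟨hx, Or.inl rfl⟩)
      have j5 : Joined W α β v1 v1 := .refl _
      have j6 : Joined W α β v2 v2 := .refl _
      have j7 : Joined W α β x (β x) := .rel _ _ ⟨hx, Or.inr rfl⟩
      have := h.eq_or hx
      grind [h.c1, h.c2]
    | refl => exact Or.inl (.refl _)
    | symm _ _ _ ih => exact ih.imp (fun h => h.symm) And.symm
    | trans x y z _ _ ih1 ih2 =>
      rcases ih1 with ih1 | ih1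
      · rcases ih2 with ih2 | ih2
        · exact Or.inl (ih1.trans _ _ _ ih2)
        · exact Or.inr ⟨tr _ _ ih1.symm ih2.1, ih2.2⟩
      · rcases ih2 with ih2 | ih2
        · exact Or.inr ⟨ih1.1, tr _ _ ih2 ih1.2⟩
        · exact Or.inr ⟨ih1.1, ih2.2⟩
  · rintro (hxy | ⟨hx, hy⟩)
    · exact up x y hxy
    · have key : ∀ z, (Joined W α β v1 z ∨ Joined W α β v2 z) → Joined W α β' v1 z := by
        rintro z (hz | hz)
        · exact up _ _ hz
        · exact j3.trans _ _ _ (up _ _ hz)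
      exact (key x hx).symm.trans _ _ _ (key y hy)

/-- If the two edges belong to the same component, it is split. -/
theorem Rewire.split (hn : Joined W α β v1 v2) : ¬ Joined W α β' v1 y1 := by
  rcases h.aux with h1 | h1
  · exact (h1.2 hn).elim
  · exact h1.1

end

end Dichotomy

/-! ## Circles of two-line diagrams and their orientations -/

instance : DecidableEq Label := fun a b => by
  cases a <;> cases b <;> first | exact isTrue rfl | exact isFalse (by intro h; cases h)

/-- A key ordering the vertices of a two-line diagram from left to right. -/
def vkey (v : Vertex) : ℤ := 2 * v.1 + if v.2 then 1 else 0

theorem vkey_injective : Function.Injective vkey := by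
  rintro ⟨i, e⟩ ⟨j, f⟩ h
  unfold vkey at h
  cases e <;> cases f <;> simp at h ⊢ <;> omega

theorem vkey_le_fst {v w : Vertex} (h : vkey v ≤ vkey w) : v.1 ≤ w.1 := by
  unfold vkey at h
  split_ifs at h <;> omega

/-- An equivalence relation whose classes meeting `W` are contained in `W`. -/
structure Circ (W : Finset Vertex) (r : Vertex → Vertex → Prop) : Prop where
  equiv : Equivalence r
  mem : ∀ x y, r x y → x ∈ W → y ∈ W

section Circles

variable {W : Finset Vertex} {r r' : Vertex → Vertex → Prop}

open Classical in
/-- The leftmost vertices of the circles. -/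
def roots (W : Finset Vertex) (r : Vertex → Vertex → Prop) : Finset Vertex :=
  W.filter fun v => ∀ y, r v y → vkey v ≤ vkey y

open Classical in
theorem mem_roots {v : Vertex} : v ∈ roots W r ↔ v ∈ W ∧ ∀ y, r v y → vkey v ≤ vkey y :=
  mem_filter

theorem Circ.exists_root (h : Circ W r) {v : Vertex} (hv : v ∈ W) : ∃ m ∈ roots W r, r v m := by
  classical
  obtain ⟨m, hm, hmin⟩ := (W.filter fun y => r v y).exists_min_image vkey
    ⟨v, mem_filter.2 ⟨hv, h.equiv.refl v⟩⟩
  obtain ⟨h1, h2⟩ := mem_filter.1 hm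
  exact ⟨m, mem_roots.2 ⟨h1, fun y hy =>
    hmin y (mem_filter.2 ⟨h.mem _ _ hy h1, h.equiv.trans h2 hy⟩)⟩, h2⟩

theorem Circ.root_unique (h : Circ W r) {m m' : Vertex} (hm : m ∈ roots W r)
    (hm' : m' ∈ roots W r) (hr : r m m') : m = m' :=
  vkey_injective (le_antisymm ((mem_roots.1 hm).2 _ hr) ((mem_roots.1 hm').2 _ (h.equiv.symm hr)))

open Classical in
/-- The leftmost vertex of the circle through `v`. -/
def rootOf (W : Finset Vertex) (r : Vertex → Vertex → Prop) (v : Vertex) : Vertex :=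
  if h : ∃ m ∈ roots W r, r v m then h.choose else v

theorem Circ.rootOf_spec (h : Circ W r) {v : Vertex} (hv : v ∈ W) :
    rootOf W r v ∈ roots W r ∧ r v (rootOf W r v) := by
  have hex := h.exists_root hv
  unfold rootOf
  rw [dif_pos hex]
  exact hex.choose_spec

theorem Circ.rootOf_eq (h : Circ W r) {v m : Vertex} (hm : m ∈ roots W r) (hr : r v m) :
    rootOf W r v = m := by
  have hv : v ∈ W := h.mem _ _ (h.equiv.symm hr) (mem_roots.1 hm).1
  obtain ⟨h1, h2⟩ := h.rootOf_spec hv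
  exact h.root_unique h1 hm (h.equiv.trans (h.equiv.symm h2) hr)

/-- The color of a label: the sign of the vertex, negated at an up. -/
def color (p : ℤ → ℤ) (w : TwoLine) (v : Vertex) : ℤ :=
  match w v with
  | some .down => p v.1
  | some .up => - p v.1
  | _ => 0

variable {p : ℤ → ℤ}

theorem color_down {w : TwoLine} {v : Vertex} (h : w v = some .down) : color p w v = p v.1 := by
  simp [color, h]

theorem color_up {w : TwoLine} {v : Vertex} (h : w v = some .up) : color p w v = - p v.1 := by
  simp [color, h]

/-- The labels `w` orient all the circles, that is, the color is constant along circles. -/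
structure Orient (W : Finset Vertex) (p : ℤ → ℤ) (r : Vertex → Vertex → Prop) (w : TwoLine) :
    Prop where
  act : ∀ v ∈ W, w v = some .down ∨ w v = some .up
  const : ∀ x ∈ W, ∀ y, r x y → color p w x = color p w y

theorem label_eq_of_color (hp : ∀ i, p i = 1 ∨ p i = -1) {w w' : TwoLine} {v : Vertex}
    (h : w v = some .down ∨ w v = some .up) (h' : w' v = some .down ∨ w' v = some .up)
    (hc : color p w v = color p w' v) : w v = w' v := by
  have := hp v.1
  rcases h with h | h <;> rcases h' with h' | h'
  · rw [h, h']
  · rw [color_down h, color_up h'] at hc; omega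
  · rw [color_up h, color_down h'] at hc; omega
  · rw [h, h']

theorem color_congr {w w' : TwoLine} {v : Vertex} (h : w v = w' v) :
    color p w v = color p w' v := by simp [color, h]

theorem Orient.ext (hp : ∀ i, p i = 1 ∨ p i = -1) (h : Circ W r) {w w' : TwoLine}
    (hw : Orient W p r w) (hw' : Orient W p r w') (hoff : ∀ v, v ∉ W → w v = w' v)
    (hroots : ∀ m ∈ roots W r, w m = w' m) : w = w' := by
  funext v
  by_cases hv : v ∈ W
  · obtain ⟨h1, h2⟩ := h.rootOf_spec hv
    refine label_eq_of_color hp (hw.act v hv) (hw'.act v hv) ?_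
    rw [hw.const v hv _ h2, hw'.const v hv _ h2, color_congr (hroots _ h1)]
  · exact hoff v hv

open Classical in
/-- The orientation with given labels at the leftmost vertices (`true` means up). -/
def orient (W : Finset Vertex) (p : ℤ → ℤ) (r : Vertex → Vertex → Prop) (w0 : TwoLine)
    (g : Vertex → Bool) : TwoLine := fun v =>
  if v ∈ W then
    if (p v.1 = p (rootOf W r v).1 ↔ g (rootOf W r v) = false) then some .down else some .up
  else w0 v

theorem orient_off {w0 : TwoLine} {g : Vertex → Bool} {v : Vertex} (hv : v ∉ W) :
    orient W p r w0 g v = w0 v := if_neg hv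

theorem orient_root (h : Circ W r) {w0 : TwoLine} {g : Vertex → Bool} {m : Vertex}
    (hm : m ∈ roots W r) : orient W p r w0 g m = some (if g m then .up else .down) := by
  have hmW := (mem_roots.1 hm).1
  unfold orient
  rw [if_pos hmW, h.rootOf_eq hm (h.equiv.refl m)]
  cases g m <;> simp

theorem orient_orient (hp : ∀ i, p i = 1 ∨ p i = -1) (h : Circ W r) (w0 : TwoLine)
    (g : Vertex → Bool) : Orient W p r (orient W p r w0 g) where
  act v hv := by
    unfold orient; rw [if_pos hv]; split_ifs <;> simp
  const := by
    have key : ∀ v ∈ W, color p (orient W p r w0 g) v =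
        if g (rootOf W r v) then - p (rootOf W r v).1 else p (rootOf W r v).1 := by
      intro v hv
      have h1 := hp v.1
      have h2 := hp (rootOf W r v).1
      by_cases hc : (p v.1 = p (rootOf W r v).1 ↔ g (rootOf W r v) = false)
      · have : orient W p r w0 g v = some .down := by unfold orient; rw [if_pos hv, if_pos hc]
        rw [color_down this]
        cases hg : g (rootOf W r v) <;> simp [hg] at hc ⊢ <;> omega
      · have : orient W p r w0 g v = some .up := by unfold orient; rw [if_pos hv, if_neg hc]
        rw [color_up this]
        cases hg : g (rootOf W r v) <;> simp [hg] at hc ⊢ <;> omega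
    intro x hx y hxy
    have hy := h.mem _ _ hxy hx
    obtain ⟨h1, h2⟩ := h.rootOf_spec hy
    rw [key x hx, key y hy, h.rootOf_eq h1 (h.equiv.trans hxy h2)]

/-- The product of the colors of the clockwise circles. -/
def chi (W : Finset Vertex) (r : Vertex → Vertex → Prop) (w : TwoLine)
    (ε : Vertex → ℤ) : ℤ :=
  ∏ v ∈ roots W r, if w v = some .up then ε v else 1

/-- The number of clockwise circles minus the number of anti-clockwise circles. -/
def cdeg (W : Finset Vertex) (r : Vertex → Vertex → Prop) (w : TwoLine) : ℤ :=
  ∑ v ∈ roots W r, if w v = some .up then 1 else -1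

/-- The type of the circle through `v`. -/
def ctype (W : Finset Vertex) (r : Vertex → Vertex → Prop) (w : TwoLine)
    (v : Vertex) : CircleType :=
  if w (rootOf W r v) = some .down then .one else .x

/-- A coloring of the vertices which is constant along circles. -/
structure IsColoring (W : Finset Vertex) (r : Vertex → Vertex → Prop) (ε : Vertex → ℤ) : Prop where
  sq : ∀ v ∈ W, ε v = 1 ∨ ε v = -1
  const : ∀ x ∈ W, ∀ y, r x y → ε x = ε y

/-- The circles of `r` with leftmost vertices `m` and `M` are merged into one circle of `r'`. -/
structure Merges (W : Finset Vertex) (r r' : Vertex → Vertex → Prop) (m M : Vertex) : Prop where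
  fine : Circ W r
  coarse : Circ W r'
  hm : m ∈ roots W r
  hM : M ∈ roots W r
  ne : m ≠ M
  roots_eq : roots W r' = (roots W r).erase M
  rel : ∀ x y, r' x y ↔ r x y ∨ ((r m x ∨ r M x) ∧ (r m y ∨ r M y))

theorem exists_merges (h : Circ W r) (h' : Circ W r') {v1 v2 : Vertex} (hv₁ : v1 ∈ W) (hv₂ : v2 ∈ W)
    (hn : ¬ r v1 v2) (hrel : ∀ x y, r' x y ↔ r x y ∨ ((r v1 x ∨ r v2 x) ∧ (r v1 y ∨ r v2 y))) :
    ∃ m M, Merges W r r' m M ∧ ((r v1 m ∧ r v2 M) ∨ (r v1 M ∧ r v2 m)) := by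
  obtain ⟨m₁, hm₁, hr₁⟩ := h.exists_root hv₁
  obtain ⟨m₂, hm₂, hr₂⟩ := h.exists_root hv₂
  have hrel' : ∀ x y, r' x y ↔ r x y ∨ ((r m₁ x ∨ r m₂ x) ∧ (r m₁ y ∨ r m₂ y)) := by
    have e1 : ∀ x, r v1 x ↔ r m₁ x := fun x =>
      ⟨fun h1 => h.equiv.trans (h.equiv.symm hr₁) h1, fun h1 => h.equiv.trans hr₁ h1⟩
    have e2 : ∀ x, r v2 x ↔ r m₂ x := fun x =>
      ⟨fun h1 => h.equiv.trans (h.equiv.symm hr₂) h1, fun h1 => h.equiv.trans hr₂ h1⟩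
    intro x y
    rw [hrel, e1, e2, e1, e2]
  have hn' : ¬ r m₁ m₂ := fun hc => hn (h.equiv.trans hr₁ (h.equiv.trans hc (h.equiv.symm hr₂)))
  have main : ∀ m M, m ∈ roots W r → M ∈ roots W r → ¬ r m M → vkey m < vkey M →
      (∀ x y, r' x y ↔ r x y ∨ ((r m x ∨ r M x) ∧ (r m y ∨ r M y))) → Merges W r r' m M := by
    intro m M hm hM hn hlt hrel
    refine ⟨h, h', hm, hM, fun e => hn (e ▸ h.equiv.refl m), ?_, hrel⟩
    ext v
    rw [mem_roots, mem_erase, mem_roots]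
    constructor
    · rintro ⟨h1, h2⟩
      refine ⟨?_, h1, fun y hy => h2 y ((hrel v y).2 (Or.inl hy))⟩
      rintro rfl
      have := h2 m ((hrel v m).2 (Or.inr ⟨Or.inr (h.equiv.refl _), Or.inl (h.equiv.refl _)⟩))
      omega
    · rintro ⟨h1, h2, h3⟩
      refine ⟨h2, fun y hy => ?_⟩
      rcases (hrel v y).1 hy with h4 | ⟨h4, h5⟩
      · exact h3 y h4
      · have hvm : v = m := by
          rcases h4 with h4 | h4
          · exact (h.root_unique hm (mem_roots.2 ⟨h2, h3⟩) h4).symm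
          · exact (h1 (h.root_unique hM (mem_roots.2 ⟨h2, h3⟩) h4).symm).elim
        subst hvm
        rcases h5 with h5 | h5
        · exact h3 y h5
        · exact hlt.le.trans ((mem_roots.1 hM).2 y h5)
  have hne : vkey m₁ ≠ vkey m₂ := fun e => hn' (by rw [vkey_injective e]; exact h.equiv.refl _)
  rcases lt_or_gt_of_ne hne with hlt | hlt
  · exact ⟨m₁, m₂, main m₁ m₂ hm₁ hm₂ hn' hlt hrel', Or.inl ⟨hr₁, hr₂⟩⟩
  · refine ⟨m₂, m₁, main m₂ m₁ hm₂ hm₁ (fun hc => hn' (h.equiv.symm hc)) hlt fun x y => ?_,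
      Or.inr ⟨hr₁, hr₂⟩⟩
    rw [hrel' x y, or_comm (a := r m₁ x), or_comm (a := r m₁ y)]

namespace Merges

variable {m M : Vertex}

/-- The leftmost vertices of the circles which are not involved. -/
def rest (W : Finset Vertex) (r : Vertex → Vertex → Prop) (m M : Vertex) :
    Finset Vertex := ((roots W r).erase M).erase m

theorem mem_rest {v : Vertex} : v ∈ rest W r m M ↔ v ≠ m ∧ v ≠ M ∧ v ∈ roots W r := by
  simp [rest]

theorem hm' (h : Merges W r r' m M) : m ∈ roots W r' := by
  rw [h.roots_eq]; exact mem_erase.2 ⟨h.ne, h.hm⟩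

theorem rest_coarse (h : Merges W r r' m M) {v : Vertex} (hv : v ∈ rest W r m M) :
    v ∈ roots W r' := by
  rw [mem_rest] at hv
  rw [h.roots_eq]; exact mem_erase.2 hv.2

theorem rel_mM (h : Merges W r r' m M) : r' m M :=
  (h.rel m M).2 (Or.inr ⟨Or.inl (h.fine.equiv.refl _), Or.inr (h.fine.equiv.refl _)⟩)

theorem le (h : Merges W r r' m M) {x y : Vertex} (hr : r x y) : r' x y := (h.rel x y).2 (Or.inl hr)

theorem prod_fine (h : Merges W r r' m M) {R : Type*} [CommMonoid R] (F : Vertex → R) :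
    ∏ v ∈ roots W r, F v = F m * F M * ∏ v ∈ rest W r m M, F v := by
  rw [← mul_prod_erase _ F h.hM, ← mul_prod_erase _ F (h.roots_eq ▸ h.hm'), rest,
    ← mul_assoc, mul_comm (F M)]

theorem prod_coarse (h : Merges W r r' m M) {R : Type*} [CommMonoid R] (F : Vertex → R) :
    ∏ v ∈ roots W r', F v = F m * ∏ v ∈ rest W r m M, F v := by
  rw [← mul_prod_erase _ F h.hm', rest, h.roots_eq]

theorem sum_fine (h : Merges W r r' m M) {R : Type*} [AddCommMonoid R] (F : Vertex → R) :
    ∑ v ∈ roots W r, F v = F m + F M + ∑ v ∈ rest W r m M, F v :=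
  h.prod_fine (R := Multiplicative R) F

theorem sum_coarse (h : Merges W r r' m M) {R : Type*} [AddCommMonoid R] (F : Vertex → R) :
    ∑ v ∈ roots W r', F v = F m + ∑ v ∈ rest W r m M, F v :=
  h.prod_coarse (R := Multiplicative R) F

/-- Labels agreeing outside of the two circles. -/
theorem agree_iff (h : Merges W r r' m M) (hp : ∀ i, p i = 1 ∨ p i = -1) {w w' : TwoLine}
    (hw : Orient W p r w) (hw' : Orient W p r' w') :
    (∀ y, ¬ r m y → ¬ r M y → w' y = w y) ↔
      (∀ v, v ∉ W → w' v = w v) ∧ ∀ v ∈ rest W r m M, w' v = w v := by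
  constructor
  · intro hy
    constructor
    · intro v hv
      refine hy v (fun hc => hv ?_) fun hc => hv ?_
      · exact h.fine.mem _ _ hc (mem_roots.1 h.hm).1
      · exact h.fine.mem _ _ hc (mem_roots.1 h.hM).1
    · intro v hv
      obtain ⟨h1, h2, h3⟩ := mem_rest.1 hv
      exact hy v (fun hc => h1 (h.fine.root_unique h.hm h3 hc).symm)
        fun hc => h2 (h.fine.root_unique h.hM h3 hc).symm
  · rintro ⟨hoff, hrest⟩ y h1 h2
    by_cases hy : y ∈ W
    · obtain ⟨n, hn, hyn⟩ := h.fine.exists_root hy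
      refine label_eq_of_color hp (hw'.act y hy) (hw.act y hy) ?_
      rw [hw.const y hy n hyn, hw'.const y hy n (h.le hyn)]
      refine color_congr (hrest n (mem_rest.2 ⟨?_, ?_, hn⟩))
      · rintro rfl; exact h1 (h.fine.equiv.symm hyn)
      · rintro rfl; exact h2 (h.fine.equiv.symm hyn)
    · exact hoff y hy

end Merges

open Classical in
/-- The outcome of one surgery: the diagrams `ws` occurring in the result, and the lower order terms
`lo` of the deformed surgery. -/
structure StepResult (W : Finset Vertex) (p : ℤ → ℤ) (r r' : Vertex → Vertex → Prop)
    (c : (Vertex → ℤ) → ℤ) (w : TwoLine) (ws lo : Finset TwoLine) : Prop where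
  orient : ∀ w' ∈ ws ∪ lo, Orient W p r' w' ∧ ∀ v, v ∉ W → w' v = w v
  deg_ws : ∀ w' ∈ ws, cdeg W r' w' = cdeg W r w + 1
  deg_lo : ∀ w' ∈ lo, cdeg W r' w' < cdeg W r w + 1
  eval : ∀ ε, IsColoring W r' ε →
    c ε * chi W r w ε = ∑ w' ∈ ws, chi W r' w' ε + ∑ w' ∈ lo, chi W r' w' ε

theorem merge_step {m M : Vertex} (h : Merges W r r' m M) (hp : ∀ i, p i = 1 ∨ p i = -1)
    {w : TwoLine} (hw : Orient W p r w) :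
    ∃ ws lo : Finset TwoLine, StepResult W p r r' (fun _ => 1) w ws lo ∧
      ∀ w', w' ∈ ws ↔ Orient W p r' w' ∧ (∀ y, ¬ r m y → ¬ r M y → w' y = w y) ∧
        MergeRule (ctype W r w m) (ctype W r w M) (ctype W r' w' m) := by
  classical
  -- the orientation with a given label at `m`
  let f : Bool → TwoLine := fun b =>
    orient W p r' w fun v => if v = m then b else decide (w v = some .up)
  have actM := hw.act M (mem_roots.1 h.hM).1
  have actm := hw.act m (mem_roots.1 h.hm).1
  have f1 : ∀ b, Orient W p r' (f b) := fun b => orient_orient hp h.coarse _ _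
  have f2 : ∀ b v, v ∉ W → f b v = w v := fun b v hv => orient_off hv
  have f3 : ∀ b, f b m = some (if b then .up else .down) := fun b => by
    simp only [f]; rw [orient_root h.coarse h.hm']; simp
  have f4 : ∀ b, ∀ v ∈ Merges.rest W r m M, f b v = w v := by
    intro b v hv
    simp only [f]
    rw [orient_root h.coarse (h.rest_coarse hv)]
    obtain ⟨h1, h2, h3⟩ := Merges.mem_rest.1 hv
    rcases hw.act v (mem_roots.1 h3).1 with h4 | h4 <;> simp [h1, h4]
  have huniq : ∀ w', Orient W p r' w' → (∀ y, ¬ r m y → ¬ r M y → w' y = w y) →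
      ∀ b, w' m = f b m → w' = f b := by
    intro w' ho ha b hb
    obtain ⟨ha1, ha2⟩ := (h.agree_iff hp hw ho).1 ha
    refine ho.ext hp h.coarse (f1 b) (fun v hv => (ha1 v hv).trans (f2 b v hv).symm) fun v hv => ?_
    by_cases hvm : v = m
    · rw [hvm, hb]
    · have hvr : v ∈ Merges.rest W r m M := by
        rw [h.roots_eq, mem_erase] at hv
        exact Merges.mem_rest.2 ⟨hvm, hv⟩
      rw [ha2 v hvr, f4 b v hvr]
  have hagree : ∀ b, ∀ y, ¬ r m y → ¬ r M y → f b y = w y := fun b =>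
    (h.agree_iff hp hw (f1 b)).2 ⟨f2 b, f4 b⟩
  have hrm : rootOf W r m = m := h.fine.rootOf_eq h.hm (h.fine.equiv.refl _)
  have hrM : rootOf W r M = M := h.fine.rootOf_eq h.hM (h.fine.equiv.refl _)
  have hrm' : rootOf W r' m = m := h.coarse.rootOf_eq h.hm' (h.coarse.equiv.refl _)
  have chi1 : ∀ b ε, chi W r' (f b) ε =
      (if b then ε m else 1) * ∏ v ∈ Merges.rest W r m M, if w v = some .up then ε v else 1 := by
    intro b ε
    unfold chi
    rw [h.prod_coarse, f3]
    congr 1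
    · cases b <;> simp
    · exact prod_congr rfl fun v hv => by rw [f4 b v hv]
  have deg1 : ∀ b, cdeg W r' (f b) =
      (if b then 1 else -1) + ∑ v ∈ Merges.rest W r m M, if w v = some .up then 1 else -1 := by
    intro b
    unfold cdeg
    rw [h.sum_coarse, f3]
    congr 1
    · cases b <;> simp
    · exact sum_congr rfl fun v hv => by rw [f4 b v hv]
  have chi0 : ∀ ε, chi W r w ε = (if w m = some .up then ε m else 1) *
      (if w M = some .up then ε M else 1) *
      ∏ v ∈ Merges.rest W r m M, if w v = some .up then ε v else 1 := fun ε => h.prod_fine _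
  have deg0 : cdeg W r w = (if w m = some .up then 1 else -1) + (if w M = some .up then 1 else -1) +
      ∑ v ∈ Merges.rest W r m M, if w v = some .up then 1 else -1 := h.sum_fine _
  have hεM : ∀ ε, IsColoring W r' ε → ε M = ε m := fun ε hε =>
    (hε.const m (mem_roots.1 h.hm).1 M h.rel_mM).symm
  have hct : ∀ w', Orient W p r' w' → (ctype W r' w' m = .one ∧ w' m = f false m) ∨
      (ctype W r' w' m = .x ∧ w' m = f true m) := by
    intro w' ho
    unfold ctype
    rw [hrm', f3, f3]
    rcases ho.act m (mem_roots.1 h.hm).1 with h1 | h1 <;> simp [h1]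
  have hctf : ctype W r' (f false) m = .one ∧ ctype W r' (f true) m = .x := by
    unfold ctype
    rw [hrm', f3, f3]; simp
  have mem1 : ∀ b (t1 t2 t3 : CircleType), ctype W r w m = t1 → ctype W r w M = t2 →
      (t3 = if b then .x else .one) →
      (∀ t, MergeRule t1 t2 t ↔ t = t3) → ∀ w', w' ∈ ({f b} : Finset TwoLine) ↔
        Orient W p r' w' ∧ (∀ y, ¬ r m y → ¬ r M y → w' y = w y) ∧
        MergeRule (ctype W r w m) (ctype W r w M) (ctype W r' w' m) := by
    intro b t1 t2 t3 e1 e2 e3 hr w'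
    rw [mem_singleton, e1, e2, hr]
    constructor
    · rintro rfl
      refine ⟨f1 b, hagree b, ?_⟩
      rw [e3]; cases b
      · exact hctf.1
      · exact hctf.2
    · rintro ⟨ho, ha, ht⟩
      refine huniq w' ho ha b ?_
      rcases hct w' ho with h1 | h1 <;> rw [h1.1, e3] at ht <;> cases b <;> simp at ht
      · exact h1.2
      · exact h1.2
  have o : ∀ b, ∀ w' ∈ ({f b} ∪ ∅ : Finset TwoLine), Orient W p r' w' ∧ ∀ v, v ∉ W → w' v = w v := by
    intro b w' hw'
    simp at hw'
    rw [hw']; exact ⟨f1 b, f2 b⟩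
  have dt : ∀ v, w (rootOf W r v) = some .down → ctype W r w v = .one := fun v hv => if_pos hv
  have ut : ∀ v, w (rootOf W r v) = some .up → ctype W r w v = .x := fun v hv => by
    unfold ctype; rw [hv]; simp
  rcases actm with am | am <;> rcases actM with aM | aM
  · refine ⟨{f false}, ∅, ⟨o _, ?_, by simp, ?_⟩, mem1 false _ _ .one (dt m (hrm.symm ▸ am))
      (dt M (hrM.symm ▸ aM)) rfl ?_⟩
    · intro w' hw'; rw [mem_singleton.1 hw', deg1, deg0, am, aM]; simp; ring
    · intro ε hε; rw [chi0, sum_singleton, chi1, am, aM]; simp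
    · intro t; exact ⟨fun h => by cases h; rfl, fun h => h ▸ .one_one⟩
  · refine ⟨{f true}, ∅, ⟨o _, ?_, by simp, ?_⟩, mem1 true _ _ .x (dt m (hrm.symm ▸ am))
      (ut M (hrM.symm ▸ aM)) rfl ?_⟩
    · intro w' hw'; rw [mem_singleton.1 hw', deg1, deg0, am, aM]; simp; ring
    · intro ε hε; rw [chi0, sum_singleton, chi1, am, aM]; simp [hεM ε hε]
    · intro t; exact ⟨fun h => by cases h; rfl, fun h => h ▸ .one_x⟩
  · refine ⟨{f true}, ∅, ⟨o _, ?_, by simp, ?_⟩, mem1 true _ _ .x (ut m (hrm.symm ▸ am))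
      (dt M (hrM.symm ▸ aM)) rfl ?_⟩
    · intro w' hw'; rw [mem_singleton.1 hw', deg1, deg0, am, aM]; simp; ring
    · intro ε hε; rw [chi0, sum_singleton, chi1, am, aM]; simp
    · intro t; exact ⟨fun h => by cases h; rfl, fun h => h ▸ .x_one⟩
  · refine ⟨∅, {f false}, ⟨?_, by simp, ?_, ?_⟩, ?_⟩
    · rw [Finset.union_comm]; exact o _
    · intro w' hw'; rw [mem_singleton.1 hw', deg1, deg0, am, aM]; simp
    · intro ε hε; rw [chi0, sum_singleton, chi1, am, aM]; simp [hεM ε hε]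
      rcases hε.sq m (mem_roots.1 h.hm).1 with h1 | h1 <;> rw [h1] <;> simp
    · intro w'
      rw [ut m (hrm.symm ▸ am), ut M (hrM.symm ▸ aM)]
      constructor
      · simp
      · rintro ⟨_, _, hc⟩; cases hc

theorem split_step {m M : Vertex} (h : Merges W r r' m M) (hp : ∀ i, p i = 1 ∨ p i = -1)
    {w : TwoLine} (hw : Orient W p r' w) :
    ∃ ws lo : Finset TwoLine, StepResult W p r' r (fun ε => ε m + ε M) w ws lo ∧
      ∀ w', w' ∈ ws ↔ Orient W p r w' ∧ (∀ y, ¬ r m y → ¬ r M y → w' y = w y) ∧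
        SplitRule (ctype W r' w m) (ctype W r w' m) (ctype W r w' M) := by
  classical
  let f : Bool → Bool → TwoLine := fun b c =>
    orient W p r w fun v => if v = m then b else if v = M then c else decide (w v = some .up)
  have actm := hw.act m (mem_roots.1 h.hm).1
  have f1 : ∀ b c, Orient W p r (f b c) := fun b c => orient_orient hp h.fine _ _
  have f2 : ∀ b c v, v ∉ W → f b c v = w v := fun b c v hv => orient_off hv
  have f3 : ∀ b c, f b c m = some (if b then .up else .down) := fun b c => by
    simp only [f]; rw [orient_root h.fine h.hm]; simp
  have f3' : ∀ b c, f b c M = some (if c then .up else .down) := fun b c => by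
    simp only [f]; rw [orient_root h.fine h.hM]; simp [h.ne.symm]
  have f4 : ∀ b c, ∀ v ∈ Merges.rest W r m M, f b c v = w v := by
    intro b c v hv
    obtain ⟨h1, h2, h3⟩ := Merges.mem_rest.1 hv
    simp only [f]
    rw [orient_root h.fine h3]
    rcases hw.act v (mem_roots.1 h3).1 with h4 | h4 <;> simp [h1, h2, h4]
  have hagr : ∀ w', Orient W p r w' → ((∀ y, ¬ r m y → ¬ r M y → w' y = w y) ↔
      (∀ v, v ∉ W → w' v = w v) ∧ ∀ v ∈ Merges.rest W r m M, w' v = w v) := by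
    intro w' ho
    have := h.agree_iff hp ho hw
    simp only [eq_comm (a := w _)] at this
    exact this
  have huniq : ∀ w', Orient W p r w' → (∀ y, ¬ r m y → ¬ r M y → w' y = w y) →
      ∀ b c, w' m = f b c m → w' M = f b c M → w' = f b c := by
    intro w' ho ha b c hb hc
    obtain ⟨ha1, ha2⟩ := (hagr w' ho).1 ha
    refine ho.ext hp h.fine (f1 b c) (fun v hv => (ha1 v hv).trans (f2 b c v hv).symm) fun v hv => ?_
    by_cases hvm : v = m
    · rw [hvm, hb]
    by_cases hvM : v = M
    · rw [hvM, hc]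
    have hvr : v ∈ Merges.rest W r m M := Merges.mem_rest.2 ⟨hvm, hvM, hv⟩
    rw [ha2 v hvr, f4 b c v hvr]
  have hagree : ∀ b c, ∀ y, ¬ r m y → ¬ r M y → f b c y = w y := fun b c =>
    (hagr _ (f1 b c)).2 ⟨f2 b c, f4 b c⟩
  have hrm : rootOf W r m = m := h.fine.rootOf_eq h.hm (h.fine.equiv.refl _)
  have hrM : rootOf W r M = M := h.fine.rootOf_eq h.hM (h.fine.equiv.refl _)
  have hrm' : rootOf W r' m = m := h.coarse.rootOf_eq h.hm' (h.coarse.equiv.refl _)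
  have chi1 : ∀ b c ε, chi W r (f b c) ε = (if b then ε m else 1) * (if c then ε M else 1) *
      ∏ v ∈ Merges.rest W r m M, if w v = some .up then ε v else 1 := by
    intro b c ε
    unfold chi
    rw [h.prod_fine, f3, f3']
    congr 1
    · cases b <;> cases c <;> simp
    · exact prod_congr rfl fun v hv => by rw [f4 b c v hv]
  have deg1 : ∀ b c, cdeg W r (f b c) = (if b then 1 else -1) + (if c then 1 else -1) +
      ∑ v ∈ Merges.rest W r m M, if w v = some .up then 1 else -1 := by
    intro b c
    unfold cdeg
    rw [h.sum_fine, f3, f3']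
    congr 1
    · cases b <;> cases c <;> simp
    · exact sum_congr rfl fun v hv => by rw [f4 b c v hv]
  have chi0 : ∀ ε, chi W r' w ε = (if w m = some .up then ε m else 1) *
      ∏ v ∈ Merges.rest W r m M, if w v = some .up then ε v else 1 := fun ε => h.prod_coarse _
  have deg0 : cdeg W r' w = (if w m = some .up then 1 else -1) +
      ∑ v ∈ Merges.rest W r m M, if w v = some .up then 1 else -1 := h.sum_coarse _
  have hct : ∀ w', Orient W p r w' → ∃ b c, w' m = f b c m ∧ w' M = f b c M ∧
      ctype W r w' m = (if b then .x else .one) ∧ ctype W r w' M = (if c then .x else .one) := by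
    intro w' ho
    unfold ctype
    simp only [hrm, hrM, f3, f3']
    rcases ho.act m (mem_roots.1 h.hm).1 with h1 | h1 <;>
      rcases ho.act M (mem_roots.1 h.hM).1 with h2 | h2
    · exact ⟨false, false, by simp [h1, h2]⟩
    · exact ⟨false, true, by simp [h1, h2]⟩
    · exact ⟨true, false, by simp [h1, h2]⟩
    · exact ⟨true, true, by simp [h1, h2]⟩
  have hctf : ∀ b c, ctype W r (f b c) m = (if b then .x else .one) ∧
      ctype W r (f b c) M = (if c then .x else .one) := by
    intro b c
    unfold ctype
    simp only [hrm, hrM, f3, f3']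
    cases b <;> cases c <;> simp
  have memS : ∀ (ws : Finset TwoLine) (t : CircleType), ctype W r' w m = t →
      (∀ w', w' ∈ ws ↔ ∃ b c, w' = f b c ∧
        SplitRule t (if b then .x else .one) (if c then .x else .one)) →
      ∀ w', w' ∈ ws ↔ Orient W p r w' ∧ (∀ y, ¬ r m y → ¬ r M y → w' y = w y) ∧
        SplitRule (ctype W r' w m) (ctype W r w' m) (ctype W r w' M) := by
    intro ws t ht hws w'
    rw [hws, ht]
    constructor
    · rintro ⟨b, c, rfl, hs⟩
      refine ⟨f1 b c, hagree b c, ?_⟩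
      rw [(hctf b c).1, (hctf b c).2]; exact hs
    · rintro ⟨ho, ha, hs⟩
      obtain ⟨b, c, h1, h2, h3, h4⟩ := hct w' ho
      rw [h3, h4] at hs
      exact ⟨b, c, huniq w' ho ha b c h1 h2, hs⟩
  have hsplit : ∀ b c, (SplitRule .one (if b then .x else .one) (if c then .x else .one) ↔ b ≠ c) ∧
      (SplitRule .x (if b then .x else .one) (if c then .x else .one) ↔ b = true ∧ c = true) := by
    intro b c
    cases b <;> cases c <;> refine ⟨?_, ?_⟩ <;> constructor <;> intro hs <;>
      first
      | (simp at hs; done)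
      | (cases hs; done)
      | (simp; done)
      | exact .one_one_x
      | exact .one_x_one
      | exact .x_x_x
  have hne : f true false ≠ f false true := by
    intro e
    have := congrFun e m
    rw [f3, f3] at this
    simp at this
  rcases actm with am | am
  · refine ⟨{f true false, f false true}, ∅, ⟨?_, ?_, by simp, ?_⟩, memS _ .one ?_ ?_⟩
    · intro w' hw'
      simp at hw'
      rcases hw' with rfl | rfl
      · exact ⟨f1 _ _, f2 _ _⟩
      · exact ⟨f1 _ _, f2 _ _⟩
    · intro w' hw'
      simp at hw'
      rcases hw' with rfl | rfl <;> rw [deg1, deg0, am] <;> simp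
    · intro ε hε
      rw [chi0, sum_pair hne, chi1, chi1, am]; simp; ring
    · unfold ctype; rw [hrm', am]; simp
    · intro w'
      simp only [(hsplit _ _).1, mem_insert, mem_singleton]
      constructor
      · rintro (rfl | rfl)
        · exact ⟨true, false, rfl, by simp⟩
        · exact ⟨false, true, rfl, by simp⟩
      · rintro ⟨b, c, rfl, hbc⟩
        cases b <;> cases c <;> simp at hbc ⊢
  · refine ⟨{f true true}, {f false false}, ⟨?_, ?_, ?_, ?_⟩, memS _ .x ?_ ?_⟩
    · intro w' hw'
      simp at hw'
      rcases hw' with rfl | rfl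
      · exact ⟨f1 _ _, f2 _ _⟩
      · exact ⟨f1 _ _, f2 _ _⟩
    · intro w' hw'
      rw [mem_singleton.1 hw', deg1, deg0, am]; simp; ring
    · intro w' hw'
      rw [mem_singleton.1 hw', deg1, deg0, am]; simp
    · intro ε hε
      rw [chi0, sum_singleton, sum_singleton, chi1, chi1, am]; simp
      rcases hε.sq m (mem_roots.1 h.hm).1 with h1 | h1 <;> rw [h1] <;> ring
    · unfold ctype; rw [hrm', am]; simp
    · intro w'
      simp only [(hsplit _ _).2, mem_singleton]
      constructor
      · rintro rfl; exact ⟨true, true, rfl, rfl, rfl⟩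
      · rintro ⟨b, c, rfl, rfl, rfl⟩; rfl

end Circles

/-! ## The surgery procedure -/

/-- Three closed cup diagrams on the same set `E` of active vertices, and a sign function `p`
changing along all the cups. -/
structure Setup (E : Finset ℤ) (p : ℤ → ℤ) (a b d : Labelling) : Prop where
  ca : Closed E a
  cb : Closed E b
  cd : Closed E d
  sq : ∀ i, p i = 1 ∨ p i = -1
  fa : ∀ i ∈ E, p (mate a i) = - p i
  fb : ∀ i ∈ E, p (mate b i) = - p i
  fd : ∀ i ∈ E, p (mate d i) = - p i

/-- The active vertices of a two-line diagram. -/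
def twoLine (E : Finset ℤ) : Finset Vertex := E ×ˢ Finset.univ

theorem mem_twoLine {E : Finset ℤ} {v : Vertex} : v ∈ twoLine E ↔ v.1 ∈ E := by
  simp [twoLine]

/-- The outer cups and caps. -/
def outer (a d : Labelling) (v : Vertex) : Vertex :=
  (mate (if v.2 then d else a) v.1, v.2)

open Classical in
/-- The arcs and line segments of the middle section. -/
def inner (b : Labelling) (t : ℤ) (v : Vertex) : Vertex :=
  if v.1 < t ∨ mate b v.1 < t then (v.1, !v.2) else (mate b v.1, v.2)

/-- A sign changing along all the edges of a two-line diagram. -/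
def flow (p : ℤ → ℤ) (v : Vertex) : ℤ := if v.2 then - p v.1 else p v.1

section Stage

variable {E : Finset ℤ} {p : ℤ → ℤ} {a b d : Labelling} (h : Setup E p a b d)

local notation "Sc" => SameCircle a b d
local notation "WE" => twoLine E

include h

theorem Setup.closedOuter (e : Bool) : Closed E (if e then d else a) := by
  cases e
  · exact h.ca
  · exact h.cd

theorem Setup.sameCircle_iff {t : ℤ} {x y : Vertex} :
    Sc t x y ↔ Joined WE (outer a d) (inner b t) x y := by
  constructor
  · intro hxy
    induction hxy with
    | rel x y hr =>
      rcases hr with hr | hr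
      · cases hr with
        | bottom i j hc =>
          exact .rel _ _ ⟨mem_twoLine.2 ((h.ca.onCup i).1 ⟨j, Or.inl hc⟩), Or.inl (by
            simp [outer, mate_eq (Or.inl hc)])⟩
        | top i j hc =>
          exact .rel _ _ ⟨mem_twoLine.2 ((h.cd.onCup i).1 ⟨j, Or.inl hc⟩), Or.inl (by
            simp [outer, mate_eq (Or.inl hc)])⟩
        | middle i j e hc ht =>
          have := hc.lt
          exact .rel _ _ ⟨mem_twoLine.2 ((h.cb.onCup i).1 ⟨j, Or.inl hc⟩), Or.inr (by
            unfold inner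
            rw [mate_eq (Or.inl hc), if_neg (by dsimp only; omega)])⟩
      · cases hr with
        | left i j hc ht =>
          exact .rel _ _ ⟨mem_twoLine.2 ((h.cb.onCup i).1 ⟨j, Or.inl hc⟩), Or.inr (by
            unfold inner; rw [if_pos (Or.inl ht)]; rfl)⟩
        | right i j hc ht =>
          exact .rel _ _ ⟨mem_twoLine.2 ((h.cb.onCup j).1 ⟨i, Or.inr hc⟩), Or.inr (by
            unfold inner
            rw [mate_eq (Or.inr hc), if_pos (Or.inr ht)]; rfl)⟩
    | refl => exact .refl _
    | symm _ _ _ ih => exact ih.symm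
    | trans _ _ _ _ _ ih1 ih2 => exact ih1.trans _ _ _ ih2
  · intro hxy
    induction hxy with
    | rel x y hr =>
      obtain ⟨i, e⟩ := x
      obtain ⟨hi, rfl | rfl⟩ := hr
      · rw [mem_twoLine] at hi
        cases e
        · rcases mate_spec ((h.ca.onCup i).2 hi) with hc | hc
          · exact .rel _ _ (Or.inl (.bottom _ _ hc))
          · exact .symm _ _ (.rel _ _ (Or.inl (.bottom _ _ hc)))
        · rcases mate_spec ((h.cd.onCup i).2 hi) with hc | hc
          · exact .rel _ _ (Or.inl (.top _ _ hc))
          · exact .symm _ _ (.rel _ _ (Or.inl (.top _ _ hc)))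
      · rw [mem_twoLine] at hi
        dsimp only at hi
        unfold inner
        rcases mate_spec ((h.cb.onCup i).2 hi) with hc | hc
        · have hlt := hc.lt
          by_cases ht : i < t
          · rw [if_pos (Or.inl ht)]
            cases e
            · exact .rel _ _ (Or.inr (.left _ _ hc ht))
            · exact .symm _ _ (.rel _ _ (Or.inr (.left _ _ hc ht)))
          · rw [if_neg (by dsimp only; omega)]
            exact .rel _ _ (Or.inl (.middle _ _ _ hc (by omega)))
        · have hlt := hc.lt
          by_cases ht : mate b i < t
          · rw [if_pos (Or.inr ht)]
            cases e
            · exact .rel _ _ (Or.inr (.right _ _ hc ht))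
            · exact .symm _ _ (.rel _ _ (Or.inr (.right _ _ hc ht)))
          · have hn : ¬ (i < t ∨ mate b i < t) := by omega
            rw [if_neg hn]
            exact .symm _ _ (.rel _ _ (Or.inl (.middle _ _ _ hc (not_lt.1 ht))))
    | refl => exact .refl _
    | symm _ _ _ ih => exact ih.symm
    | trans _ _ _ _ _ ih1 ih2 => exact ih1.trans _ _ _ ih2

theorem Setup.outer_signInvol : SignInvol WE (flow p) (outer a d) where
  maps v hv := by
    rw [mem_twoLine] at hv ⊢; exact (h.closedOuter v.2).mate_mem hv
  invol v _ := Prod.ext (mate_mate _ _) rfl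
  flip v hv := by
    rw [mem_twoLine] at hv
    obtain ⟨i, e⟩ := v
    cases e
    · simp [flow, outer, h.fa i hv]
    · simp [flow, outer, h.fd i hv]

theorem Setup.inner_signInvol (t : ℤ) : SignInvol WE (flow p) (inner b t) where
  maps v hv := by
    rw [mem_twoLine] at hv ⊢
    unfold inner
    split_ifs
    · exact hv
    · exact h.cb.mate_mem hv
  invol v _ := by
    obtain ⟨i, e⟩ := v
    unfold inner
    by_cases hc : i < t ∨ mate b i < t
    · simp [hc]
    · have hc' : ¬ (mate b i < t ∨ i < t) := fun h => hc h.symm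
      simp [hc, mate_mate, hc']
  flip v hv := by
    rw [mem_twoLine] at hv
    obtain ⟨i, e⟩ := v
    unfold inner flow
    split_ifs <;> simp_all [h.fb i hv]

theorem Setup.circ (t : ℤ) : Circ WE (Sc t) where
  equiv := Relation.EqvGen.is_equivalence _
  mem x y hxy hx := by
    refine (Joined.closed (q := (· ∈ WE)) (fun z hz => ?_) (fun z hz => ?_)
      (h.sameCircle_iff.1 hxy)).1 hx
    · exact ⟨fun _ => h.outer_signInvol.maps z hz, fun _ => hz⟩
    · exact ⟨fun _ => (h.inner_signInvol t).maps z hz, fun _ => hz⟩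

theorem Setup.joined_inner {t : ℤ} {x : Vertex} (hx : x ∈ WE) :
    Sc t x (inner b t x) := h.sameCircle_iff.2 (.rel _ _ ⟨hx, Or.inr rfl⟩)

theorem Setup.isOrientation_iff {t : ℤ} {w : TwoLine} :
    IsOrientation a b d t w ↔ Orient WE p (Sc t) w := by
  constructor
  · rintro ⟨h1, h2⟩
    have arc : ∀ x y, Arc a b d t x y ∨ Segment b t x y → color p w x = color p w y := by
      rintro x y (hr | hr)
      · have hp : p y.1 = - p x.1 := by
          cases hr with
          | bottom i j hc =>
            have := h.fa i ((h.ca.onCup i).1 ⟨j, Or.inl hc⟩); rwa [mate_eq (Or.inl hc)] at this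
          | top i j hc =>
            have := h.fd i ((h.cd.onCup i).1 ⟨j, Or.inl hc⟩); rwa [mate_eq (Or.inl hc)] at this
          | middle i j e hc ht =>
            have := h.fb i ((h.cb.onCup i).1 ⟨j, Or.inl hc⟩); rwa [mate_eq (Or.inl hc)] at this
        rcases h1 x y hr with ⟨h3, h4⟩ | ⟨h3, h4⟩
        · rw [color_down h3, color_up h4, hp, neg_neg]
        · rw [color_up h3, color_down h4, hp]
      · have := h2 x y hr
        unfold color
        rw [this]
        cases hr <;> rfl
    refine ⟨fun v hv => ?_, fun x hx y hxy => ?_⟩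
    · obtain ⟨i, e⟩ := v
      rw [mem_twoLine] at hv
      cases e
      · rcases mate_spec ((h.ca.onCup i).2 hv) with hc | hc
        · exact (h1 _ _ (.bottom _ _ hc)).imp And.left And.left
        · exact ((h1 _ _ (.bottom _ _ hc)).imp And.right And.right).symm
      · rcases mate_spec ((h.cd.onCup i).2 hv) with hc | hc
        · exact (h1 _ _ (.top _ _ hc)).imp And.left And.left
        · exact ((h1 _ _ (.top _ _ hc)).imp And.right And.right).symm
    · clear hx
      induction hxy with
      | rel x y hr => exact arc x y hr
      | refl => rfl
      | symm _ _ _ ih => exact ih.symm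
      | trans _ _ _ _ _ ih1 ih2 => exact ih1.trans ih2
  · intro ho
    refine ⟨fun x y hr => ?_, fun x y hr => ?_⟩
    · have hxy : Sc t x y := .rel _ _ (Or.inl hr)
      have hp : x ∈ WE ∧ p y.1 = - p x.1 := by
        rw [mem_twoLine]
        cases hr with
        | bottom i j hc =>
          have hi := (h.ca.onCup i).1 ⟨j, Or.inl hc⟩
          have := h.fa i hi; rw [mate_eq (Or.inl hc)] at this
          exact ⟨hi, this⟩
        | top i j hc =>
          have hi := (h.cd.onCup i).1 ⟨j, Or.inl hc⟩
          have := h.fd i hi; rw [mate_eq (Or.inl hc)] at this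
          exact ⟨hi, this⟩
        | middle i j e hc ht =>
          have hi := (h.cb.onCup i).1 ⟨j, Or.inl hc⟩
          have := h.fb i hi; rw [mate_eq (Or.inl hc)] at this
          exact ⟨hi, this⟩
      have hc := ho.const x hp.1 y hxy
      have hs := h.sq x.1
      rcases ho.act x hp.1 with h1 | h1 <;>
        rcases ho.act y ((h.circ t).mem _ _ hxy hp.1) with h2 | h2
      · rw [color_down h1, color_down h2] at hc; omega
      · exact Or.inl ⟨h1, h2⟩
      · exact Or.inr ⟨h1, h2⟩
      · rw [color_up h1, color_up h2] at hc; omega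
    · have hxy : Sc t x y := .rel _ _ (Or.inr hr)
      have hp : x ∈ WE ∧ y.1 = x.1 := by
        rw [mem_twoLine]
        cases hr with
        | left i j hc ht => exact ⟨(h.cb.onCup i).1 ⟨j, Or.inl hc⟩, rfl⟩
        | right i j hc ht => exact ⟨(h.cb.onCup j).1 ⟨i, Or.inr hc⟩, rfl⟩
      have hc := ho.const x hp.1 y hxy
      have hs := h.sq x.1
      rcases ho.act x hp.1 with h1 | h1 <;>
        rcases ho.act y ((h.circ t).mem _ _ hxy hp.1) with h2 | h2
      · rw [h1, h2]
      · rw [color_down h1, color_up h2, hp.2] at hc; omega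
      · rw [color_up h1, color_down h2, hp.2] at hc; omega
      · rw [h1, h2]

theorem Setup.circleType_eq {t : ℤ} {w : TwoLine}
    (ho : Orient WE p (Sc t) w) {y : Vertex} (hy : y ∈ WE) :
    circleType a b d t w y = ctype WE (Sc t) w y := by
  obtain ⟨h1, h2⟩ := (h.circ t).rootOf_spec hy
  unfold circleType ctype
  congr 1
  rw [eq_iff_iff]
  constructor
  · rintro ⟨z, hz1, hz2, hz3⟩
    have hzW := (h.circ t).mem _ _ hz1 hy
    have e1 := hz2 _ h2
    have hrz := (h.circ t).equiv.trans ((h.circ t).equiv.symm h2) hz1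
    have e2 := vkey_le_fst ((mem_roots.1 h1).2 z hrz)
    have e3 : z.1 = (rootOf WE (Sc t) y).1 := le_antisymm e1 e2
    have hc := ho.const _ (mem_roots.1 h1).1 z hrz
    refine (ho.act _ (mem_roots.1 h1).1).resolve_right fun hu => ?_
    rw [color_up hu, color_down hz3, e3] at hc
    have := h.sq (rootOf WE (Sc t) y).1
    omega
  · intro hd
    exact ⟨_, h2, fun z' hz' => vkey_le_fst ((mem_roots.1 h1).2 z'
      ((h.circ t).equiv.trans ((h.circ t).equiv.symm h2) hz')), hd⟩

omit h in
theorem sameCircle_succ {t : ℤ} (hn : ¬ ∃ j, IsCup b t j) :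
    Sc t = Sc (t + 1) := by
  have e : ∀ x y, Arc a b d t x y ∨ Segment b t x y ↔ Arc a b d (t + 1) x y ∨ Segment b (t + 1) x y := by
    intro x y
    constructor
    · rintro (hr | hr)
      · left
        cases hr with
        | bottom i j hc => exact .bottom i j hc
        | top i j hc => exact .top i j hc
        | middle i j e hc ht =>
          refine .middle i j e hc ?_
          rcases ht.lt_or_eq with h1 | h1
          · omega
          · exact (hn ⟨j, h1 ▸ hc⟩).elim
      · right
        cases hr with
        | left i j hc ht => exact .left i j hc (by omega)
        | right i j hc ht => exact .right i j hc (by omega)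
    · have key : ∀ i j, IsCup b i j → i < t + 1 → i < t := by
        intro i j hc hi
        by_contra hc'
        obtain rfl : i = t := by omega
        exact hn ⟨j, hc⟩
      rintro (hr | hr)
      · left
        cases hr with
        | bottom i j hc => exact .bottom i j hc
        | top i j hc => exact .top i j hc
        | middle i j e hc ht => exact .middle i j e hc (by omega)
      · right
        cases hr with
        | left i j hc ht => exact .left i j hc (key i j hc ht)
        | right i j hc ht => exact .right i j hc (key i j hc ht)
  unfold SameCircle
  simp only [e]

theorem Setup.rewire {t j : ℤ} (hc : IsCup b t j) :
    Rewire WE (flow p) (outer a d) (inner b t) (inner b (t + 1))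
      (t, false) (j, false) (t, true) (j, true) where
  hα := h.outer_signInvol
  hβ := h.inner_signInvol t
  hβ' := h.inner_signInvol (t + 1)
  hu x _ := by unfold flow; have := h.sq x.1; split_ifs <;> omega
  v1_mem := mem_twoLine.2 ((h.cb.onCup t).1 ⟨j, Or.inl hc⟩)
  y2_mem := mem_twoLine.2 ((h.cb.onCup j).1 ⟨t, Or.inr hc⟩)
  b1 := by unfold inner; rw [mate_eq (Or.inl hc), if_neg (by have := hc.lt; dsimp only; omega)]
  b2 := by unfold inner; rw [mate_eq (Or.inr hc), if_neg (by have := hc.lt; dsimp only; omega)]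
  c1 := by unfold inner; rw [if_pos (by dsimp only; omega)]; rfl
  c2 := by unfold inner; rw [mate_eq (Or.inr hc), if_pos (by dsimp only; omega)]; rfl
  sign := by
    have := h.fb t ((h.cb.onCup t).1 ⟨j, Or.inl hc⟩)
    rw [mate_eq (Or.inl hc)] at this
    simp [flow, this]
  ne := by simp
  other x hx h1 h2 h3 h4 := by
    obtain ⟨i, e⟩ := x
    have hit : i ≠ t := by rintro rfl; cases e <;> simp_all
    have hij : i ≠ j := by rintro rfl; cases e <;> simp_all
    have hmi : mate b i ≠ t := by
      intro hm; apply hij; rw [← mate_mate b i, hm, mate_eq (Or.inl hc)]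
    unfold inner
    have : (i < t + 1 ∨ mate b i < t + 1) ↔ (i < t ∨ mate b i < t) := by omega
    simp only [this]

end Stage

open Classical in
/-- The factor by which a single surgery multiplies functions on colorings. -/
def stepFactor (a b d : Labelling) (t : ℤ) (ε : Vertex → ℤ) : ℤ :=
  if (∃ j, IsCup b t j) ∧ SameCircle a b d t (t, false) (t, true) then
    ε (t, false) + ε (mate b t, false) else 1

/-- The factor by which a sequence of surgeries multiplies functions on colorings. -/
def factor (a b d : Labelling) : ℕ → ℤ → (Vertex → ℤ) → ℤ
  | 0, _, _ => 1
  | n + 1, t, ε => stepFactor a b d t ε * factor a b d n (t + 1) ε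

open Classical in
/-- The number of cups with left ends in a given interval satisfying a condition. -/
def cupCount (b : Labelling) (q : ℤ → Prop) : ℕ → ℤ → ℕ
  | 0, _ => 0
  | n + 1, t => (if (∃ j, IsCup b t j) ∧ q t then 1 else 0) + cupCount b q n (t + 1)

/-- `c` counts the ways from `w` to `z` if the degrees fit, and vanishes if that of `z` is too
large. -/
abbrev IsLeading (E : Finset ℤ) (a b d : Labelling) (n : ℕ) (t T : ℤ) (w z : TwoLine) (c : ℤ) :
    Prop :=
  let D := cdeg (twoLine E) (SameCircle a b d t) w + cupCount b (fun _ => True) n t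
  let D' := cdeg (twoLine E) (SameCircle a b d T) z
  (D < D' → c = 0) ∧ (D' = D → c = surgeryCount a b d n t w z) ∧
    (D' ≠ D → surgeryCount a b d n t w z = 0)

section Run

variable {E : Finset ℤ} {p : ℤ → ℤ} {a b d : Labelling} (h : Setup E p a b d)

local notation "Sc" => SameCircle a b d
local notation "WE" => twoLine E

include h

theorem Setup.stage_merges {t j : ℤ} (hc : IsCup b t j) :
    (¬ Sc t (t, false) (t, true) ∧ Sc (t + 1) (t, false) (j, false) ∧
      ∃ m M, Merges WE (Sc t) (Sc (t + 1)) m M ∧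
        ((Sc t (t, false) m ∧ Sc t (t, true) M) ∨
          (Sc t (t, false) M ∧ Sc t (t, true) m))) ∨
    (Sc t (t, false) (t, true) ∧
      ∃ m M, Merges WE (Sc (t + 1)) (Sc t) m M ∧
        ((Sc (t + 1) (t, false) m ∧ Sc (t + 1) (j, false) M) ∨
          (Sc (t + 1) (t, false) M ∧ Sc (t + 1) (j, false) m))) := by
  have hR := h.rewire hc
  have v1W := hR.v1_mem
  have v2W := hR.v2_mem
  have y1W := hR.y1_mem
  by_cases hs : Sc t (t, false) (t, true)
  · right
    refine ⟨hs, ?_⟩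
    have hn : ¬ Sc (t + 1) (t, false) (j, false) := fun hn =>
      hR.split (h.sameCircle_iff.1 hs) (h.sameCircle_iff.1 hn)
    refine exists_merges (h.circ (t + 1)) (h.circ t) v1W y1W hn fun x y => ?_
    simp only [h.sameCircle_iff]
    exact hR.swap.merge (fun hc => hn (h.sameCircle_iff.2 hc)) x y
  · left
    have hm := hR.merge (fun hc => hs (h.sameCircle_iff.2 hc))
    have hm' : ∀ x y, Sc (t + 1) x y ↔ Sc t x y ∨
        ((Sc t (t, false) x ∨ Sc t (t, true) x) ∧
          (Sc t (t, false) y ∨ Sc t (t, true) y)) := by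
      intro x y; simp only [h.sameCircle_iff]; exact hm x y
    refine ⟨hs, ?_, exists_merges (h.circ t) (h.circ (t + 1)) v1W v2W hs hm'⟩
    refine (hm' _ _).2 (Or.inl ?_)
    have := h.joined_inner (t := t) v1W
    rwa [hR.b1] at this

theorem Setup.step_exists {t j : ℤ} (hc : IsCup b t j) {w : TwoLine}
    (ho : Orient WE p (Sc t) w) :
    ∃ ws lo : Finset TwoLine, StepResult WE p (Sc t)
        (Sc (t + 1)) (stepFactor a b d t) w ws lo ∧
      ∀ w', SurgeryStep a b d t w w' ↔ w' ∈ ws := by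
  have hR := h.rewire hc
  have v1W := hR.v1_mem
  have v2W := hR.v2_mem
  have y1W := hR.y1_mem
  have cty : ∀ {s : ℤ} {x y : Vertex} (w : TwoLine), x ∈ WE → Sc s x y →
      ctype WE (Sc s) w x = ctype WE (Sc s) w y := by
    intro s x y w hx hxy
    unfold ctype
    obtain ⟨h1, h2⟩ := (h.circ s).rootOf_spec hx
    rw [(h.circ s).rootOf_eq h1 ((h.circ s).equiv.trans ((h.circ s).equiv.symm hxy) h2)]
  have eqv : ∀ {s : ℤ} {x y : Vertex}, Sc s x y →
      ∀ z, Sc s x z ↔ Sc s y z := fun {s x y} hxy z =>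
    ⟨fun hz => (h.circ s).equiv.trans ((h.circ s).equiv.symm hxy) hz,
      fun hz => (h.circ s).equiv.trans hxy hz⟩
  have unfold_step : ∀ w', SurgeryStep a b d t w w' ↔
      Orient WE p (Sc (t + 1)) w' ∧
      (∀ y, ¬ Sc t (t, false) y → ¬ Sc t (t, true) y → w' y = w y) ∧
      (¬ Sc t (t, false) (t, true) →
        MergeRule (ctype WE (Sc t) w (t, false))
          (ctype WE (Sc t) w (t, true))
          (ctype WE (Sc (t + 1)) w' (t, false))) ∧
      (Sc t (t, false) (t, true) →
        SplitRule (ctype WE (Sc t) w (t, false))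
          (ctype WE (Sc (t + 1)) w' (t, false))
          (ctype WE (Sc (t + 1)) w' (j, false))) := by
    intro w'
    rw [← h.isOrientation_iff]
    constructor
    · rintro ⟨j', hj', h1, h2, h3, h4⟩
      obtain rfl := hc.right_unique hj'
      have ho' := h.isOrientation_iff.1 h1
      rw [h.circleType_eq ho v1W, h.circleType_eq ho v2W, h.circleType_eq ho' v1W] at h3
      rw [h.circleType_eq ho v1W, h.circleType_eq ho' v1W, h.circleType_eq ho' y1W] at h4
      exact ⟨h1, h2, h3, h4⟩
    · rintro ⟨h1, h2, h3, h4⟩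
      have ho' := h.isOrientation_iff.1 h1
      rw [← h.circleType_eq ho v1W, ← h.circleType_eq ho v2W, ← h.circleType_eq ho' v1W] at h3
      rw [← h.circleType_eq ho v1W, ← h.circleType_eq ho' v1W, ← h.circleType_eq ho' y1W] at h4
      exact ⟨j, hc, h1, h2, h3, h4⟩
  rcases h.stage_merges hc with ⟨hs, hvy, m, M, hM, hor⟩ | ⟨hs, m, M, hM, hor⟩
  · obtain ⟨ws, lo, hres, hws⟩ := merge_step hM h.sq ho
    refine ⟨ws, lo, ⟨hres.orient, hres.deg_ws, hres.deg_lo, fun ε hε => ?_⟩, fun w' => ?_⟩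
    · have : stepFactor a b d t ε = 1 := by unfold stepFactor; rw [if_neg fun hc => hs hc.2]
      rw [this]; exact hres.eval ε hε
    · rw [unfold_step, hws]
      have hm' : Sc (t + 1) (t, false) m := by
        rcases hor with ⟨h1, _⟩ | ⟨h1, _⟩
        · exact hM.le h1
        · exact (h.circ (t + 1)).equiv.trans (hM.le h1) ((h.circ (t + 1)).equiv.symm hM.rel_mM)
      rw [cty w' v1W hm']
      simp only [hs, not_false_eq_true, true_imp_iff, false_imp_iff, and_true]
      refine and_congr_right fun _ => ?_
      rcases hor with ⟨h1, h2⟩ | ⟨h1, h2⟩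
      · rw [cty w v1W h1, cty w v2W h2]
        simp only [eqv h1, eqv h2]
      · rw [cty w v1W h1, cty w v2W h2]
        simp only [eqv h1, eqv h2]
        refine and_congr ⟨fun hh y h3 h4 => hh y h4 h3, fun hh y h3 h4 => hh y h4 h3⟩ ?_
        constructor <;> intro hh <;> generalize ctype WE _ w M = t1 at hh ⊢ <;>
          generalize ctype WE _ w m = t2 at hh ⊢ <;>
          generalize ctype WE _ w' m = t3 at hh ⊢ <;> cases hh <;> constructor
  · obtain ⟨ws, lo, hres, hws⟩ := split_step hM h.sq ho
    refine ⟨ws, lo, ⟨hres.orient, hres.deg_ws, hres.deg_lo, fun ε hε => ?_⟩, fun w' => ?_⟩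
    · have : stepFactor a b d t ε = ε m + ε M := by
        unfold stepFactor
        rw [if_pos ⟨⟨j, hc⟩, hs⟩, mate_eq (Or.inl hc)]
        rcases hor with ⟨h1, h2⟩ | ⟨h1, h2⟩
        · rw [hε.const _ v1W _ h1, hε.const _ y1W _ h2]
        · rw [hε.const _ v1W _ h1, hε.const _ y1W _ h2, add_comm]
      rw [this]; exact hres.eval ε hε
    · rw [unfold_step, hws]
      have hm' : Sc t (t, false) m := by
        rcases hor with ⟨h1, _⟩ | ⟨h1, _⟩
        · exact hM.le h1
        · exact (h.circ t).equiv.trans (hM.le h1) ((h.circ t).equiv.symm hM.rel_mM)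
      rw [cty w v1W hm']
      have hs' : ∀ y, Sc t (t, true) y ↔ Sc t (t, false) y :=
        fun y => (eqv hs y).symm
      have hrel : ∀ y, Sc t (t, false) y ↔
          (Sc (t + 1) m y ∨ Sc (t + 1) M y) := by
        intro y
        rw [hM.rel]
        rcases hor with ⟨h1, h2⟩ | ⟨h1, h2⟩
        · rw [eqv h1 y]
          have := (h.circ (t + 1)).equiv.symm h1
          tauto
        · rw [eqv h1 y]
          have := (h.circ (t + 1)).equiv.symm h1
          tauto
      simp only [hs, hs', not_true_eq_false, true_imp_iff, false_imp_iff, true_and, hrel, not_or]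
      refine and_congr_right fun _ => and_congr ?_ ?_
      · constructor
        · exact fun hh y h1 h2 => hh y ⟨h1, h2⟩ ⟨h1, h2⟩
        · exact fun hh y h1 _ => hh y h1.1 h1.2
      · rcases hor with ⟨h1, h2⟩ | ⟨h1, h2⟩
        · rw [cty w' v1W h1, cty w' y1W h2]
        · rw [cty w' v1W h1, cty w' y1W h2]
          constructor <;> intro hh <;> generalize ctype WE _ w' M = t1 at hh ⊢ <;>
            generalize ctype WE _ w' m = t2 at hh ⊢ <;>
            generalize ctype WE _ w m = t3 at hh ⊢ <;> cases hh <;> constructor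

theorem Setup.coloring_of_stepFactor {t : ℤ} {ε : Vertex → ℤ}
    (hε : IsColoring WE (Sc (t + 1)) ε) (hne : stepFactor a b d t ε ≠ 0) :
    IsColoring WE (Sc t) ε := by
  refine ⟨hε.sq, ?_⟩
  by_cases hex : ∃ j, IsCup b t j
  swap
  · rw [sameCircle_succ hex]; exact hε.const
  obtain ⟨j, hc⟩ := hex
  rcases h.stage_merges hc with ⟨hs, hvy, m, M, hM, hor⟩ | ⟨hs, m, M, hM, hor⟩
  · exact fun x hx y hxy => hε.const x hx y (hM.le hxy)
  · have hR := h.rewire hc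
    have v1W := hR.v1_mem
    have y1W := hR.y1_mem
    have hmM : ε m = ε M := by
      unfold stepFactor at hne
      rw [if_pos ⟨⟨j, hc⟩, hs⟩, mate_eq (Or.inl hc)] at hne
      have e1 := hε.sq _ v1W
      have e2 := hε.sq _ y1W
      rcases hor with ⟨h1, h2⟩ | ⟨h1, h2⟩ <;> rw [← hε.const _ v1W _ h1, ← hε.const _ y1W _ h2] <;>
        omega
    have hm := (mem_roots.1 hM.hm).1
    have hMW := (mem_roots.1 hM.hM).1
    have key : ∀ x, (Sc (t + 1) m x ∨ Sc (t + 1) M x) → ε m = ε x := by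
      rintro x (hx | hx)
      · exact hε.const m hm x hx
      · rw [hmM]; exact hε.const M hMW x hx
    intro x hx y hxy
    rcases (hM.rel x y).1 hxy with h1 | ⟨h1, h2⟩
    · exact hε.const x hx y h1
    · rw [← key x h1, ← key y h2]

theorem Setup.coloring_of_factor (n : ℕ) : ∀ {t T : ℤ}, T = t + n → ∀ {ε : Vertex → ℤ},
    IsColoring WE (Sc T) ε → factor a b d n t ε ≠ 0 →
    IsColoring WE (Sc t) ε := by
  induction n with
  | zero => intro t T hT ε hε _; simp at hT; rwa [← hT]
  | succ n ih =>
    intro t T hT ε hε hne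
    rw [factor] at hne
    exact h.coloring_of_stepFactor (ih (by push_cast at hT; omega) hε (right_ne_zero_of_mul hne))
      (left_ne_zero_of_mul hne)

theorem Setup.ext_filter {t : ℤ} {w0 z z' : TwoLine}
    (hz : Orient WE p (Sc t) z ∧ ∀ v, v ∉ WE → z v = w0 v)
    (hz' : Orient WE p (Sc t) z' ∧ ∀ v, v ∉ WE → z' v = w0 v)
    (hzz : {m ∈ roots WE (Sc t) | z m = some .up} =
      {m ∈ roots WE (Sc t) | z' m = some .up}) : z = z' := by
  refine hz.1.ext h.sq (h.circ t) hz'.1 (fun v hv => (hz.2 v hv).trans (hz'.2 v hv).symm) ?_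
  intro m hm
  have := congrArg (m ∈ ·) hzz
  simp only [mem_filter, hm, true_and, eq_iff_iff] at this
  rcases hz.1.act m (mem_roots.1 hm).1 with h1 | h1 <;>
    rcases hz'.1.act m (mem_roots.1 hm).1 with h2 | h2 <;> simp_all

theorem finite_orient (t : ℤ) (w0 : TwoLine) :
    {z : TwoLine | Orient WE p (Sc t) z ∧
      ∀ v, v ∉ WE → z v = w0 v}.Finite :=
  Set.Finite.of_injOn
    (f := fun z : TwoLine => (roots WE (Sc t)).filter (z · = some .up))
    (t := ((roots WE (Sc t)).powerset : Set (Finset Vertex)))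
    (fun _ _ => mem_coe.2 (mem_powerset.2 (filter_subset _ _)))
    (fun _ hz _ hz' => h.ext_filter hz hz') (finite_toSet _)

/-- The finitely many orientations of the diagram at stage `t`. -/
def Setup.orients (t : ℤ) (w0 : TwoLine) : Finset TwoLine :=
  (finite_orient h t w0).toFinset

theorem Setup.mem_orients {t : ℤ} {w0 z : TwoLine} : z ∈ h.orients t w0 ↔
    Orient WE p (Sc t) z ∧ ∀ v, v ∉ WE → z v = w0 v := by
  simp [Setup.orients]

/-- The result of the surgery procedure is the leading part of multiplication by `factor`. -/
theorem Setup.expand (w0 : TwoLine) (n : ℕ) : ∀ {t T : ℤ}, T = t + n → ∀ w ∈ h.orients t w0,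
    ∃ C : TwoLine → ℤ, (∀ ε, IsColoring WE (Sc T) ε →
      factor a b d n t ε * chi WE (Sc t) w ε =
        ∑ z ∈ h.orients T w0, C z * chi WE (Sc T) z ε) ∧
      ∀ z ∈ h.orients T w0, IsLeading E a b d n t T w z (C z) := by
  classical
  induction n with
  | zero =>
    intro t T hT w hw
    obtain rfl : T = t := by simpa using hT
    refine ⟨fun z => if w = z then 1 else 0, fun ε _ => ?_, fun z _ => ?_⟩
    · rw [factor, one_mul, sum_eq_single w]
      · simp
      · intro z _ hz; dsimp only; rw [if_neg hz.symm, zero_mul]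
      · exact fun hc => (hc hw).elim
    · simp only [IsLeading, cupCount, surgeryCount, Nat.cast_zero, add_zero]
      by_cases hwz : w = z
      · subst hwz; simp
      · simp [hwz]
  | succ n ih =>
    intro t T hT w hw
    have hT' : T = (t + 1) + n := by push_cast at hT; omega
    have ho := (h.mem_orients.1 hw).1
    by_cases hex : ∃ j, IsCup b t j
    swap
    · have hsc := sameCircle_succ (a := a) (d := d) hex
      have hw' : w ∈ h.orients (t + 1) w0 := by
        rw [h.mem_orients, ← hsc]; exact h.mem_orients.1 hw
      obtain ⟨C, h1, h2⟩ := ih hT' w hw'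
      refine ⟨C, fun ε hε => ?_, fun z hz => ?_⟩
      · rw [factor, stepFactor, if_neg fun hc => hex hc.1, one_mul, hsc]
        exact h1 ε hε
      · simp only [IsLeading]
        rw [surgeryCount, if_neg hex, cupCount, if_neg fun hc => hex hc.1, zero_add, hsc]
        exact h2 z hz
    · obtain ⟨j, hc⟩ := id hex
      obtain ⟨ws, lo, hres, hws⟩ := h.step_exists hc ho
      have hor : ∀ w' ∈ ws ∪ lo, w' ∈ h.orients (t + 1) w0 := fun w' hw' =>
        h.mem_orients.2 ⟨(hres.orient w' hw').1, fun v hv =>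
          ((hres.orient w' hw').2 v hv).trans ((h.mem_orients.1 hw).2 v hv)⟩
      have hC : ∀ w', ∃ C : TwoLine → ℤ, w' ∈ ws ∪ lo →
          (∀ ε, IsColoring WE (Sc T) ε →
            factor a b d n (t + 1) ε * chi WE (Sc (t + 1)) w' ε =
              ∑ z ∈ h.orients T w0, C z * chi WE (Sc T) z ε) ∧
            ∀ z ∈ h.orients T w0, IsLeading E a b d n (t + 1) T w' z (C z) := by
        intro w'
        by_cases hw' : w' ∈ ws ∪ lo
        · obtain ⟨C, hC⟩ := ih hT' w' (hor w' hw')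
          exact ⟨C, fun _ => hC⟩
        · exact ⟨fun _ => 0, fun hc => (hw' hc).elim⟩
      choose C hC using hC
      have hcount : ∀ z, surgeryCount a b d (n + 1) t w z =
          ∑ w' ∈ ws, surgeryCount a b d n (t + 1) w' z := by
        intro z
        rw [surgeryCount, if_pos hex]
        simp only [hws]
        exact finsum_mem_finset_eq_sum _ ws
      have hcc : cupCount b (fun _ => True) (n + 1) t =
          1 + cupCount b (fun _ => True) n (t + 1) := by
        rw [cupCount, if_pos ⟨hex, trivial⟩]
      refine ⟨fun z => ∑ w' ∈ ws, C w' z + ∑ w' ∈ lo, C w' z, fun ε hε => ?_, fun z hz => ?_⟩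
      · rw [factor]
        by_cases hf : factor a b d n (t + 1) ε = 0
        · rw [hf, mul_zero, zero_mul]
          symm
          have e : ∀ w' ∈ ws ∪ lo, ∑ z ∈ h.orients T w0, C w' z *
              chi WE (Sc T) z ε = 0 := by
            intro w' hw'
            rw [← (hC w' hw').1 ε hε, hf, zero_mul]
          simp only [add_mul, sum_mul, sum_add_distrib]
          rw [sum_comm, sum_comm (t := lo),
            sum_eq_zero fun w' hw' => e w' (mem_union_left _ hw'),
            sum_eq_zero fun w' hw' => e w' (mem_union_right _ hw'), add_zero]
        · have hε' := h.coloring_of_factor n hT' hε hf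
          rw [mul_right_comm, hres.eval ε hε', add_mul, sum_mul, sum_mul]
          simp only [add_mul, sum_mul, sum_add_distrib]
          rw [sum_comm (s := h.orients T w0), sum_comm (s := h.orients T w0) (t := lo)]
          congr 1
          · refine sum_congr rfl fun w' hw' => ?_
            rw [mul_comm, (hC w' (mem_union_left _ hw')).1 ε hε]
          · refine sum_congr rfl fun w' hw' => ?_
            rw [mul_comm, (hC w' (mem_union_right _ hw')).1 ε hε]
      · simp only [IsLeading]
        rw [hcount, hcc]
        push_cast
        refine ⟨fun hz1 => ?_, fun hz1 => ?_, fun hz1 => ?_⟩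
        · rw [sum_eq_zero, sum_eq_zero, add_zero]
          · intro w' hw'
            have := hres.deg_lo w' hw'
            exact ((hC w' (mem_union_right _ hw')).2 z hz).1 (by omega)
          · intro w' hw'
            have := hres.deg_ws w' hw'
            exact ((hC w' (mem_union_left _ hw')).2 z hz).1 (by omega)
        · rw [sum_eq_zero (s := lo), add_zero]
          · refine sum_congr rfl fun w' hw' => ?_
            have := hres.deg_ws w' hw'
            exact ((hC w' (mem_union_left _ hw')).2 z hz).2.1 (by omega)
          · intro w' hw'
            have := hres.deg_lo w' hw'
            exact ((hC w' (mem_union_right _ hw')).2 z hz).1 (by omega)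
        · refine sum_eq_zero fun w' hw' => ?_
          have := hres.deg_ws w' hw'
          exact ((hC w' (mem_union_left _ hw')).2 z hz).2.2 (by omega)

/-- The number of circles of color `c`. -/
def colCount (W : Finset Vertex) (r : Vertex → Vertex → Prop) (ε : Vertex → ℤ)
    (c : ℤ) : ℕ := ∑ v ∈ roots W r, if ε v = c then 1 else 0

omit h in
theorem colCount_merges {W : Finset Vertex} {r r' : Vertex → Vertex → Prop} {m M : Vertex}
    (hM : Merges W r r' m M) {ε : Vertex → ℤ} (hε : ε m = ε M) (c : ℤ) :
    colCount W r ε c = colCount W r' ε c + if ε m = c then 1 else 0 := by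
  unfold colCount
  rw [hM.sum_fine, hM.sum_coarse, hε]
  ring

/-- The value of `factor` at a coloring compatible with all the cups. -/
theorem Setup.factor_eq {ε : Vertex → ℤ}
    (hε : ∀ t, IsColoring WE (Sc t) ε) (n : ℕ) : ∀ {t T : ℤ}, T = t + n →
    ∃ s : ℤ → ℕ, factor a b d n t ε = 2 ^ s 1 * (-2) ^ s (-1) ∧ ∀ c,
      2 * s c + colCount WE (Sc t) ε c =
        cupCount b (fun i => ε (i, false) = c) n t +
          colCount WE (Sc T) ε c := by
  induction n with
  | zero =>
    intro t T hT
    obtain rfl : T = t := by simpa using hT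
    exact ⟨fun _ => 0, by simp [factor], fun c => by simp [cupCount]⟩
  | succ n ih =>
    intro t T hT
    obtain ⟨s, hs1, hs2⟩ := ih (t := t + 1) (T := T) (by push_cast at hT; omega)
    by_cases hex : ∃ j, IsCup b t j
    swap
    · refine ⟨s, ?_, fun c => ?_⟩
      · rw [factor, stepFactor, if_neg fun hc => hex hc.1, one_mul, hs1]
      · rw [cupCount, if_neg fun hc => hex hc.1, zero_add, sameCircle_succ hex, hs2]
    obtain ⟨j, hc⟩ := id hex
    have hR := h.rewire hc
    have v1W := hR.v1_mem
    have hy : ε (j, false) = ε (t, false) := by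
      rw [(hε t).const _ v1W _ (h.joined_inner v1W), hR.b1]
    have hv : ε (t, true) = ε (t, false) := by
      rw [(hε (t + 1)).const _ v1W _ (h.joined_inner v1W), hR.c1]
    have y1W := hR.y1_mem
    have v2W := hR.v2_mem
    rcases h.stage_merges hc with ⟨hs, hvy, m, M, hM, hor⟩ | ⟨hs, m, M, hM, hor⟩
    · have hm : ε m = ε (t, false) ∧ ε M = ε (t, false) := by
        rcases hor with ⟨h1, h2⟩ | ⟨h1, h2⟩
        · exact ⟨((hε t).const _ v1W _ h1).symm, by rw [← (hε t).const _ v2W _ h2, hv]⟩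
        · exact ⟨by rw [← (hε t).const _ v2W _ h2, hv], ((hε t).const _ v1W _ h1).symm⟩
      refine ⟨s, ?_, fun c => ?_⟩
      · rw [factor, stepFactor, if_neg fun hc => hs hc.2, one_mul, hs1]
      · rw [colCount_merges hM (hm.1.trans hm.2.symm), hm.1, cupCount]
        have := hs2 c
        by_cases hcc : ε (t, false) = c
        · simp only [hcc, hex, and_self, if_true]; omega
        · simp only [hcc, and_false, if_false]; omega
    · have hm : ε m = ε (t, false) ∧ ε M = ε (t, false) := by
        rcases hor with ⟨h1, h2⟩ | ⟨h1, h2⟩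
        · exact ⟨((hε _).const _ v1W _ h1).symm, by rw [← (hε _).const _ y1W _ h2, hy]⟩
        · exact ⟨by rw [← (hε _).const _ y1W _ h2, hy], ((hε _).const _ v1W _ h1).symm⟩
      refine ⟨fun c => s c + if ε (t, false) = c then 1 else 0, ?_, fun c => ?_⟩
      · rw [factor, stepFactor, if_pos ⟨hex, hs⟩, mate_eq (Or.inl hc), hy, hs1]
        rcases (hε t).sq _ v1W with h1 | h1 <;> rw [h1] <;> norm_num [pow_succ] <;> ring
      · have e := colCount_merges hM (hm.1.trans hm.2.symm) c
        rw [hm.1] at e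
        have := hs2 c
        rw [cupCount]
        by_cases hcc : ε (t, false) = c
        · simp only [hcc, hex, and_self, if_true] at e ⊢; omega
        · simp only [hcc, and_false, if_false] at e ⊢; omega

end Run

/-! ## Evaluation of closed diagrams at orientations -/

/-- Each cup of `a` has a down and an up in `f`. -/
def CupOr (a f : Labelling) : Prop := ∀ i j, IsCup a i j →
  (f i = some .down ∧ f j = some .up) ∨ (f i = some .up ∧ f j = some .down)

/-- The leftmost vertices of the clockwise circles. -/
def cw (a b f : Labelling) : Set ℤ := {m | IsRoot a b m ∧ f m = some .up}

/-- The left ends of the clockwise cups. -/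
def cwCups (b f : Labelling) : Set ℤ := {i | (∃ j, IsCup b i j) ∧ f i = some .up}

open Classical in
/-- The value at `g` of the oriented circle diagram with circles formed by `a`, `b`
and labels `f`. -/
def circleVal (p : ℤ → ℤ) (a b f g : Labelling) : ℚ :=
  if cw a b f ⊆ cw a b g then ∏ᶠ m ∈ cw a b g \ cw a b f, (-2 * p m : ℚ)⁻¹ else 0

/-- The product of the contributions of all clockwise cups. -/
def cupVal (p : ℤ → ℤ) (b g : Labelling) : ℚ := ∏ᶠ i ∈ cwCups b g, (-2 * p i : ℚ)

theorem stack_self (f : Labelling) (v : Vertex) : stack f f v = f v.1 := by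
  unfold stack; split_ifs <;> rfl

theorem color_stack_self (p : ℤ → ℤ) (f : Labelling) (i : ℤ) (e : Bool) :
    color p (stack f f) (i, e) = color p (stack f f) (i, false) := by
  unfold color; simp only [stack_self]

theorem CupOr.color_eq {E : Finset ℤ} {p : ℤ → ℤ} {a f : Labelling} (ha : Closed E a)
    (hp : ∀ i ∈ E, p (mate a i) = - p i) (h : CupOr a f) {i j : ℤ} (hc : IsCup a i j) :
    color p (stack f f) (i, false) = color p (stack f f) (j, false) := by
  have := hp i ((ha.onCup i).1 ⟨j, Or.inl hc⟩)
  rw [mate_eq (Or.inl hc)] at this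
  rcases h i j hc with ⟨h1, h2⟩ | ⟨h1, h2⟩
  · rw [color_down (by rw [stack_self, h1]), color_up (by rw [stack_self, h2])]; simp [this]
  · rw [color_up (by rw [stack_self, h1]), color_down (by rw [stack_self, h2])]; simp [this]

theorem CupOr.act {E : Finset ℤ} {a f : Labelling} (ha : Closed E a) (h : CupOr a f) {i : ℤ}
    (hi : i ∈ E) : f i = some .down ∨ f i = some .up := by
  rcases mate_spec ((ha.onCup i).2 hi) with hc | hc
  · exact (h _ _ hc).imp And.left And.left
  · exact ((h _ _ hc).imp And.right And.right).symm

section Expand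

variable {E : Finset ℤ} {p : ℤ → ℤ} {a b d : Labelling} (h : Setup E p a b d)

local notation "Sc" => SameCircle a b d
local notation "WE" => twoLine E

include h

/-- Expansion of a product over the clockwise circles into smaller such products. -/
theorem Setup.exists_change {t : ℤ} {w0 w : TwoLine} (hw : w ∈ h.orients t w0) (q : Vertex → ℤ) :
    ∃ K : TwoLine → ℤ, (∀ f : Vertex → ℤ,
      chi WE (Sc t) w (fun v => f v + q v) =
        ∑ u ∈ h.orients t w0, K u * chi WE (Sc t) u f) ∧
      K w = 1 ∧ ∀ u ∈ h.orients t w0, u ≠ w →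
        cdeg WE (Sc t) w ≤ cdeg WE (Sc t) u →
        K u = 0 := by
  classical
  set R := roots WE (Sc t) with hR
  let up : TwoLine → Finset Vertex := fun u => R.filter fun v => u v = some .up
  have hchi : ∀ u f, chi WE (Sc t) u f = ∏ v ∈ up u, f v := fun u f => by
    rw [chi, prod_filter]
  have hinj : ∀ u ∈ h.orients t w0, ∀ u' ∈ h.orients t w0, up u = up u' → u = u' :=
    fun z hz z' hz' => h.ext_filter (h.mem_orients.1 hz) (h.mem_orients.1 hz')
  let G : Finset Vertex → TwoLine := fun s =>
    orient WE p (Sc t) w0 fun v => decide (v ∈ s)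
  have hG : ∀ s ⊆ R, G s ∈ h.orients t w0 ∧ up (G s) = s := by
    intro s hs
    refine ⟨h.mem_orients.2 ⟨orient_orient h.sq (h.circ t) _ _, fun v hv => orient_off hv⟩, ?_⟩
    ext v
    simp only [up, mem_filter]
    constructor
    · rintro ⟨h1, h2⟩
      rw [show G s v = _ from orient_root (h.circ t) h1] at h2
      by_contra hc
      simp [hc] at h2
    · intro hv
      refine ⟨hs hv, ?_⟩
      rw [show G s v = _ from orient_root (h.circ t) (hs hv)]
      simp [hv]
  have hdeg : ∀ u, cdeg WE (Sc t) u = 2 * (up u).card - R.card := by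
    intro u
    unfold cdeg
    have : ∀ v ∈ R, (if u v = some Label.up then (1 : ℤ) else -1) =
        2 * (if u v = some Label.up then 1 else 0) - 1 := by
      intro v _; split_ifs <;> norm_num
    rw [sum_congr rfl this, sum_sub_distrib, ← mul_sum]
    simp [up]
  refine ⟨fun u => if up u ⊆ up w then ∏ v ∈ up w \ up u, q v else 0, fun f => ?_, by simp,
    fun u hu hne hd => ?_⟩
  · rw [hchi, Finset.prod_add]
    simp only [ite_mul, zero_mul, ← sum_filter]
    refine sum_bij' (fun s _ => G s) (fun u _ => up u) ?_ ?_ ?_ ?_ ?_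
    · intro s hs
      rw [mem_powerset] at hs
      have := hG s (hs.trans (filter_subset _ _))
      rw [mem_filter, this.2]
      exact ⟨this.1, hs⟩
    · intro u hu
      rw [mem_powerset]
      exact (mem_filter.1 hu).2
    · intro s hs
      rw [mem_powerset] at hs
      exact (hG s (hs.trans (filter_subset _ _))).2
    · intro u hu
      have h1 := hG (up u) (filter_subset _ _)
      exact hinj _ h1.1 _ (mem_filter.1 hu).1 h1.2
    · intro s hs
      rw [mem_powerset] at hs
      have h1 := hG s (hs.trans (filter_subset _ _))
      rw [hchi, h1.2, mul_comm]
  · simp only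
    rw [if_neg]
    intro hs
    rw [hdeg, hdeg] at hd
    exact hne (hinj _ hu _ hw (Finset.eq_of_subset_of_card_le hs (by omega)))

/-- The surgery procedure in terms of the products of `ε v - p v` over clockwise circles. -/
theorem Setup.expand_shifted (w0 : TwoLine) (n : ℕ) {t T : ℤ} (hT : T = t + n) {w : TwoLine} (hw : w ∈ h.orients t w0) :
    ∃ C : TwoLine → ℤ, (∀ ε, IsColoring WE (Sc T) ε →
      factor a b d n t ε * chi WE (Sc t) w (fun v => ε v - p v.1) =
        ∑ z ∈ h.orients T w0, C z *
          chi WE (Sc T) z (fun v => ε v - p v.1)) ∧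
      ∀ z ∈ h.orients T w0, IsLeading E a b d n t T w z (C z) := by
  classical
  obtain ⟨K, hK, hK1, hK0⟩ := h.exists_change hw (fun v => - p v.1)
  have hC : ∀ u, ∃ C : TwoLine → ℤ, u ∈ h.orients t w0 → _ := fun u => by
    by_cases hu : u ∈ h.orients t w0
    · obtain ⟨C, hC⟩ := h.expand w0 n hT u hu
      exact ⟨C, fun _ => hC⟩
    · exact ⟨fun _ => 0, fun hc => (hu hc).elim⟩
  choose C hC using hC
  have hJ : ∀ z, ∃ J : TwoLine → ℤ, z ∈ h.orients T w0 → _ := fun z => by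
    by_cases hz : z ∈ h.orients T w0
    · obtain ⟨J, hJ⟩ := h.exists_change hz (fun v => p v.1)
      exact ⟨J, fun _ => hJ⟩
    · exact ⟨fun _ => 0, fun hc => (hz hc).elim⟩
  choose J hJ using hJ
  simp only [IsLeading] at hC
  set D := cdeg WE (Sc t)
  set D' := cdeg WE (Sc T)
  have main : ∀ z' ∈ h.orients T w0, D w + cupCount b (fun _ => True) n t ≤ D' z' →
      ∑ u ∈ h.orients t w0, ∑ z ∈ h.orients T w0, K u * (C u z * J z z') = C w z' := by
    intro z' hz' hd
    rw [sum_eq_single_of_mem w hw, sum_eq_single_of_mem z' hz', hK1,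
      (hJ z' hz').2.1, one_mul, mul_one]
    · intro z hz hne
      by_cases hle : D' z ≤ D' z'
      · rw [(hJ z hz).2.2 z' hz' hne.symm hle, mul_zero, mul_zero]
      · rw [((hC w hw).2 z hz).1 (by omega), zero_mul, mul_zero]
    · intro u hu hne
      refine sum_eq_zero fun z hz => ?_
      by_cases hle : D w ≤ D u
      · rw [hK0 u hu hne hle, zero_mul]
      · by_cases hle' : D' z ≤ D' z'
        · by_cases hzz : z' = z
          · rw [((hC u hu).2 z hz).1 (by rw [← hzz]; omega), zero_mul, mul_zero]
          · rw [(hJ z hz).2.2 z' hz' hzz hle', mul_zero, mul_zero]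
        · rw [((hC u hu).2 z hz).1 (by omega), zero_mul, mul_zero]
  refine ⟨fun z' => ∑ u ∈ h.orients t w0, ∑ z ∈ h.orients T w0, K u * (C u z * J z z'),
    fun ε hε => ?_, fun z' hz' => ⟨fun hd => ?_, fun hd => ?_, fun hd => ?_⟩⟩
  · have e1 := hK ε
    simp only [← sub_eq_add_neg] at e1
    rw [e1, mul_sum]
    have e2 : ∀ z ∈ h.orients T w0, chi WE (Sc T) z ε =
        ∑ z' ∈ h.orients T w0, J z z' *
          chi WE (Sc T) z' (fun v => ε v - p v.1) := by
      intro z hz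
      rw [← (hJ z hz).1]; simp only [sub_add_cancel]
    have e3 : ∀ u ∈ h.orients t w0, factor a b d n t ε *
        (K u * chi WE (Sc t) u ε) = ∑ z ∈ h.orients T w0,
          ∑ z' ∈ h.orients T w0, K u * (C u z * J z z') *
          chi WE (Sc T) z' (fun v => ε v - p v.1) := by
      intro u hu
      rw [mul_left_comm, (hC u hu).1 ε hε, mul_sum]
      refine sum_congr rfl fun z hz => ?_
      rw [e2 z hz, mul_sum, mul_sum]
      exact sum_congr rfl fun z' _ => by ring
    rw [sum_congr rfl e3]
    simp only [sum_mul]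
    rw [sum_congr rfl fun u _ => sum_comm, sum_comm]
  · refine (main z' hz' hd.le).trans ?_; exact ((hC w hw).2 z' hz').1 hd
  · refine (main z' hz' hd.ge).trans ?_; exact ((hC w hw).2 z' hz').2.1 hd
  · exact ((hC w hw).2 z' hz').2.2 hd

end Expand

/-! ### The circles before and after all surgeries -/

/-- The inclusion of one of the two number lines. -/
def lineEmb (e : Bool) : ℤ ↪ Vertex := ⟨fun m => (m, e), fun _ _ h => congrArg Prod.fst h⟩

@[simp] theorem lineEmb_apply (e : Bool) (m : ℤ) : lineEmb e m = (m, e) := rfl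

section Ends

variable {E : Finset ℤ} {p : ℤ → ℤ} {a b d : Labelling} (h : Setup E p a b d) {t T : ℤ}

local notation "Sc" => SameCircle a b d
local notation "WE" => twoLine E

theorem sameCircle_start (ht : ∀ i j, IsCup b i j → t ≤ i) {x y : Vertex} :
    Sc t x y ↔
      x.2 = y.2 ∧ Conn (if x.2 then b else a) (if x.2 then d else b) x.1 y.1 := by
  constructor
  · intro hxy
    induction hxy with
    | rel x y hr =>
      rcases hr with hr | hr
      · cases hr with
        | bottom i j hc => exact ⟨rfl, .rel _ _ (Or.inl hc)⟩
        | top i j hc => exact ⟨rfl, .rel _ _ (Or.inr hc)⟩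
        | middle i j e hc ht =>
          refine ⟨rfl, ?_⟩
          cases e
          · exact .rel _ _ (Or.inr hc)
          · exact .rel _ _ (Or.inl hc)
      · cases hr with
        | left i j hc hi => have := ht i j hc; omega
        | right i j hc hi => have := ht i j hc; omega
    | refl => exact ⟨rfl, .refl _⟩
    | symm _ _ _ ih => obtain ⟨h1, h2⟩ := ih; rw [h1] at h2; exact ⟨h1.symm, h2.symm⟩
    | trans _ _ _ _ _ ih1 ih2 =>
      obtain ⟨h1, h2⟩ := ih1
      obtain ⟨h3, h4⟩ := ih2
      rw [← h1] at h4
      exact ⟨h1.trans h3, h2.trans _ _ _ h4⟩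
  · obtain ⟨i, e⟩ := x
    obtain ⟨j, e'⟩ := y
    rintro ⟨h1, h2⟩
    dsimp only at h1 h2
    subst h1
    induction h2 with
    | rel x y hr =>
      cases e
      · rcases hr with hr | hr
        · exact .rel _ _ (Or.inl (.bottom _ _ hr))
        · exact .rel _ _ (Or.inl (.middle _ _ _ hr (ht _ _ hr)))
      · rcases hr with hr | hr
        · exact .rel _ _ (Or.inl (.middle _ _ _ hr (ht _ _ hr)))
        · exact .rel _ _ (Or.inl (.top _ _ hr))
    | refl => exact .refl _
    | symm _ _ _ ih => exact ih.symm
    | trans _ _ _ _ _ ih1 ih2 => exact ih1.trans _ _ _ ih2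

include h

theorem Setup.sameCircle_end (hT : ∀ i j, IsCup b i j → i < T) {x y : Vertex} (hx : x.1 ∈ E) :
    Sc T x y ↔ Conn a d x.1 y.1 := by
  constructor
  · intro hxy
    clear hx
    induction hxy with
    | rel x y hr =>
      rcases hr with hr | hr
      · cases hr with
        | bottom i j hc => exact .rel _ _ (Or.inl hc)
        | top i j hc => exact .rel _ _ (Or.inr hc)
        | middle i j e hc ht => have := hT i j hc; omega
      · cases hr with
        | left i j hc hi => exact .refl _
        | right i j hc hi => exact .refl _
    | refl => exact .refl _
    | symm _ _ _ ih => exact ih.symm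
    | trans _ _ _ _ _ ih1 ih2 => exact ih1.trans _ _ _ ih2
  · have hs : ∀ i ∈ E, ∀ e e', Sc T (i, e) (i, e') := by
      intro i hi e e'
      have : Sc T (i, false) (i, true) := by
        rcases mate_spec ((h.cb.onCup i).2 hi) with hc | hc
        · exact .rel _ _ (Or.inr (.left _ _ hc (hT _ _ hc)))
        · exact .rel _ _ (Or.inr (.right _ _ hc (hT _ _ hc)))
      cases e <;> cases e'
      · exact .refl _
      · exact this
      · exact this.symm
      · exact .refl _
    obtain ⟨i, e⟩ := x
    obtain ⟨j, e'⟩ := y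
    dsimp only at hx ⊢
    intro hc
    have hj : j ∈ E := (h.ca.conn_mem h.cd hc).1 hx
    have key : ∀ i j, Conn a d i j → i ∈ E → Sc T (i, false) (j, false) := by
      intro i j hc
      induction hc with
      | rel x y hr =>
        intro hx
        rcases hr with hr | hr
        · exact .rel _ _ (Or.inl (.bottom _ _ hr))
        · have hy : y ∈ E := (h.cd.onCup y).1 ⟨x, Or.inr hr⟩
          exact (hs x hx false true).trans _ _ _
            (Relation.EqvGen.trans _ (y, true) _ (.rel _ _ (Or.inl (.top _ _ hr)))
              (hs y hy true false))
      | refl => exact fun _ => .refl _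
      | symm x y hxy ih => exact fun hy => (ih ((h.ca.conn_mem h.cd hxy).2 hy)).symm
      | trans x y z hxy hyz ih1 ih2 =>
        exact fun hx => (ih1 hx).trans _ _ _ (ih2 ((h.ca.conn_mem h.cd hxy).1 hx))
    exact ((hs i hx e false).trans _ _ _ (key i j hc hx)).trans _ _ _ (hs j hj false e')

open Classical in
theorem Setup.roots_end (hT : ∀ i j, IsCup b i j → i < T) :
    roots WE (Sc T) =
      (E.filter fun m => IsRoot a d m).map (lineEmb false) := by
  ext ⟨i, e⟩
  simp only [mem_roots, mem_twoLine, mem_map, mem_filter,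
    lineEmb_apply, Prod.mk.injEq]
  constructor
  · rintro ⟨hi, h1⟩
    have he : e = false := by
      have := h1 (i, false) ((h.sameCircle_end hT (x := (i, e)) hi).2 (.refl _))
      cases e
      · rfl
      · simp [vkey] at this
    subst he
    refine ⟨i, ⟨hi, fun k hk => ⟨?_, ?_, ?_⟩⟩, rfl, rfl⟩
    · exact vkey_le_fst (h1 (k, false) ((h.sameCircle_end hT (x := (i, false)) hi).2 hk))
    · exact (h.ca.onCup k).2 ((h.ca.conn_mem h.cd hk).1 hi)
    · exact (h.cd.onCup k).2 ((h.ca.conn_mem h.cd hk).1 hi)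
  · rintro ⟨m, ⟨hm, hr⟩, rfl, rfl⟩
    refine ⟨hm, fun y hy => ?_⟩
    have := (hr _ ((h.sameCircle_end hT (x := (m, false)) hm).1 hy)).1
    unfold vkey
    simp only [Bool.false_eq_true, if_false]
    split_ifs <;> omega

open Classical in
theorem Setup.roots_start (ht : ∀ i j, IsCup b i j → t ≤ i) {R : Type*} [CommMonoid R]
    (F : Vertex → R) : ∏ v ∈ roots WE (Sc t), F v =
      (∏ m ∈ E with IsRoot a b m, F (m, false)) * ∏ m ∈ E with IsRoot b d m, F (m, true) := by
  have hroot : ∀ i e, (i, e) ∈ roots WE (Sc t) ↔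
      i ∈ E ∧ IsRoot (if e then b else a) (if e then d else b) i := by
    intro i e
    rw [mem_roots, mem_twoLine]
    refine and_congr_right fun hi => ?_
    constructor
    · intro h1 k hk
      have hk' : k ∈ E := by
        cases e
        · exact (h.ca.conn_mem h.cb hk).1 hi
        · exact (h.cb.conn_mem h.cd hk).1 hi
      refine ⟨vkey_le_fst (h1 (k, e) ((sameCircle_start ht).2 ⟨rfl, hk⟩)), ?_, ?_⟩
      · cases e
        · exact (h.ca.onCup k).2 hk'
        · exact (h.cb.onCup k).2 hk'
      · cases e
        · exact (h.cb.onCup k).2 hk'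
        · exact (h.cd.onCup k).2 hk'
    · rintro h1 ⟨k, e'⟩ hk
      obtain ⟨h2, h3⟩ := (sameCircle_start ht).1 hk
      dsimp only at h2 h3
      subst h2
      have := (h1 k h3).1
      unfold vkey
      dsimp only
      omega
  have e : roots WE (Sc t) =
      (E.filter fun m => IsRoot a b m).map (lineEmb false) ∪
      (E.filter fun m => IsRoot b d m).map (lineEmb true) := by
    ext ⟨i, e⟩
    rw [hroot]
    cases e <;> simp
  rw [e, Finset.prod_union, prod_map, prod_map]
  · rfl
  · rw [Finset.disjoint_left]
    rintro ⟨i, e⟩ h1 h2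
    simp only [mem_map, lineEmb_apply, Prod.mk.injEq] at h1 h2
    obtain ⟨_, _, _, h3⟩ := h1
    obtain ⟨_, _, _, h4⟩ := h2
    rw [← h3] at h4; cases h4

end Ends

/-! ### Counting cups and circles -/

section Count

open Classical

variable {E : Finset ℤ} {a b : Labelling}

theorem Closed.two_mul_card_left (ha : Closed E a) {q : ℤ → Prop} [DecidablePred q]
    (hq : ∀ i j, IsCup a i j → (q i ↔ q j)) :
    2 * (E.filter fun v => v < mate a v ∧ q v).card = (E.filter q).card := by
  have hqm : ∀ v ∈ E, q v → q (mate a v) := by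
    intro v hv hqv
    rcases mate_spec ((ha.onCup v).2 hv) with hc | hc
    · exact (hq _ _ hc).1 hqv
    · exact (hq _ _ hc).2 hqv
  have hM : Matching (E.filter q) (mate a) :=
    { maps := fun x hx => by
        rw [mem_filter] at hx ⊢
        exact ⟨ha.mate_mem hx.1, hqm x hx.1 hx.2⟩
      invol := fun x _ => mate_mate a x
      ne := fun x hx => ha.matching.ne x (mem_filter.1 hx).1
      nc := fun i hi k hk => ha.matching.nc i (mem_filter.1 hi).1 k
        (mem_filter.1 hk).1 }
  have h0 := hM.sum_eq_zero (lam := fun v => if v < mate a v then 1 else -1) (by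
    intro x hx
    have := hM.ne x hx
    simp only [mate_mate]
    split_ifs <;> omega)
  have : ∀ v ∈ E.filter q, (if v < mate a v then (1 : ℤ) else -1) =
      2 * (if v < mate a v then 1 else 0) - 1 := by
    intro v _; split_ifs <;> norm_num
  rw [sum_congr rfl this, sum_sub_distrib, ← mul_sum] at h0
  simp only [sum_boole, sum_const, nsmul_eq_mul, mul_one, filter_filter] at h0
  have e : (E.filter fun v => v < mate a v ∧ q v) = E.filter fun v => q v ∧ v < mate a v :=
    filter_congr fun _ _ => and_comm
  rw [e]
  omega

theorem Closed.sum_leftEnd (ha : Closed E a) {f : Labelling} {q : ℤ → Prop} [DecidablePred q]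
    (hq : ∀ i j, IsCup a i j → (q i ↔ q j)) :
    2 * ∑ v ∈ E with q v, leftEnd (mate a) (fun v => if f v = some .up then -1 else 1) v +
      4 * ((E.filter fun v => (v < mate a v ∧ q v) ∧ f v = some .up).card : ℤ) =
        (E.filter q).card := by
  have h1 := ha.two_mul_card_left hq
  have e : ∀ v ∈ E.filter q, leftEnd (mate a) (fun v => if f v = some .up then -1 else 1) v =
      (if v < mate a v then 1 else 0) - 2 * (if v < mate a v ∧ f v = some .up then 1 else 0) := by
    intro v _
    unfold leftEnd
    by_cases h1 : v < mate a v <;> by_cases h2 : f v = some .up <;> simp [h1, h2]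
  rw [sum_congr rfl e, sum_sub_distrib, ← mul_sum]
  simp only [sum_boole, filter_filter]
  have e1 : (E.filter fun v => q v ∧ v < mate a v) = E.filter fun v => v < mate a v ∧ q v :=
    filter_congr fun _ _ => and_comm
  have e2 : (E.filter fun v => q v ∧ v < mate a v ∧ f v = some .up) =
      E.filter fun v => (v < mate a v ∧ q v) ∧ f v = some .up :=
    filter_congr fun _ _ => by tauto
  rw [e1, e2]
  omega

theorem Closed.count (ha : Closed E a) (hb : Closed E b) {f : Labelling} (hfa : CupOr a f)
    (hfb : CupOr b f) {q : ℤ → Prop} [DecidablePred q] (hqa : ∀ i j, IsCup a i j → (q i ↔ q j))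
    (hqb : ∀ i j, IsCup b i j → (q i ↔ q j)) :
    2 * (E.filter fun v => (v < mate a v ∧ q v) ∧ f v = some .up).card +
      2 * (E.filter fun v => (v < mate b v ∧ q v) ∧ f v = some .up).card +
      2 * (E.filter fun v => IsRoot a b v ∧ q v).card =
      (E.filter q).card + 4 * (E.filter fun v => (IsRoot a b v ∧ q v) ∧ f v = some .up).card := by
  have flip : ∀ {a : Labelling}, Closed E a → CupOr a f → ∀ x ∈ E,
      (if f (mate a x) = some Label.up then (-1 : ℤ) else 1) =
        - (if f x = some .up then -1 else 1) := by
    intro a ha hfa x hx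
    rcases mate_spec ((ha.onCup x).2 hx) with hc | hc <;>
      rcases hfa _ _ hc with ⟨h1, h2⟩ | ⟨h1, h2⟩ <;> simp [h1, h2]
  have h := ha.turning hb (lam := fun x => if f x = some Label.up then (-1 : ℤ) else 1) (flip ha hfa) (flip hb hfb) q
    (fun i j hij => hij.iff_of_invariant hqa hqb)
  have h1 := ha.sum_leftEnd (f := f) hqa
  have h2 := hb.sum_leftEnd (f := f) hqb
  have e : ∀ v ∈ E.filter fun m => IsRoot a b m ∧ q m,
      (if f v = some Label.up then (-1 : ℤ) else 1) =
        1 - 2 * (if f v = some Label.up then 1 else 0) := by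
    intro v _; split_ifs <;> norm_num
  rw [sum_congr rfl e, sum_sub_distrib, ← mul_sum] at h
  simp only [sum_boole, filter_filter, sum_const, nsmul_eq_mul, mul_one] at h
  omega

theorem Closed.cupCount_eq (hb : Closed E b) (q : ℤ → Prop) [DecidablePred q] (n : ℕ) : ∀ t : ℤ,
    cupCount b q n t = (E.filter fun v => (t ≤ v ∧ v < t + n) ∧ v < mate b v ∧ q v).card := by
  induction n with
  | zero =>
    intro t
    rw [cupCount, eq_comm, Finset.card_eq_zero, Finset.filter_eq_empty_iff]
    intro v _ hv
    have := hv.1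
    simp only [Nat.cast_zero, add_zero] at this
    omega
  | succ n ih =>
    intro t
    rw [cupCount, ih]
    by_cases hc : (∃ j, IsCup b t j) ∧ q t
    · obtain ⟨⟨j, hj⟩, hqt⟩ := id hc
      rw [if_pos hc]
      have : (E.filter fun v => (t ≤ v ∧ v < t + (n + 1 : ℕ)) ∧ v < mate b v ∧ q v) =
          insert t (E.filter fun v => (t + 1 ≤ v ∧ v < t + 1 + n) ∧ v < mate b v ∧ q v) := by
        ext v
        simp only [mem_insert, mem_filter]
        constructor
        · rintro ⟨h1, h2, h3⟩
          by_cases hvt : v = t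
          · exact Or.inl hvt
          · right; push_cast at h2; exact ⟨h1, by omega, h3⟩
        · rintro (rfl | ⟨h1, h2, h3⟩)
          · refine ⟨(hb.onCup v).1 ⟨j, Or.inl hj⟩, by push_cast; omega, ?_, hqt⟩
            rw [mate_eq (Or.inl hj)]; exact hj.lt
          · exact ⟨h1, by push_cast; omega, h3⟩
      rw [this, card_insert_of_notMem, add_comm]
      simp
    · rw [if_neg hc, zero_add]
      congr 1
      refine filter_congr fun v hv => ?_
      push_cast
      constructor
      · rintro ⟨h2, h3⟩; exact ⟨by omega, h3⟩
      · rintro ⟨h2, h3⟩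
        refine ⟨?_, h3⟩
        by_cases hvt : v = t
        · subst hvt
          exact (hc ⟨⟨_, isCup_mate ((hb.onCup v).2 hv) h3.1⟩, h3.2⟩).elim
        · omega

theorem Closed.two_mul_cupCount (hb : Closed E b) {q : ℤ → Prop} [DecidablePred q]
    (hq : ∀ i j, IsCup b i j → (q i ↔ q j)) {t : ℤ} {n : ℕ}
    (ht : ∀ i j, IsCup b i j → t ≤ i ∧ i < t + n) : 2 * cupCount b q n t = (E.filter q).card := by
  rw [← hb.two_mul_card_left hq, hb.cupCount_eq]
  congr 2
  refine filter_congr fun v hv => ⟨And.right, fun hh => ⟨?_, hh⟩⟩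
  exact ht _ _ (isCup_mate ((hb.onCup v).2 hv) hh.1)

theorem Closed.cwCups_eq (hb : Closed E b) (f : Labelling) :
    cwCups b f = ↑(E.filter fun v => v < mate b v ∧ f v = some .up) := by
  ext v
  simp only [cwCups, mem_ofPred_eq, coe_filter]
  constructor
  · rintro ⟨⟨j, hj⟩, h2⟩
    refine ⟨(hb.onCup v).1 ⟨j, Or.inl hj⟩, ?_, h2⟩
    rw [mate_eq (Or.inl hj)]; exact hj.lt
  · rintro ⟨h1, h2, h3⟩
    exact ⟨⟨_, isCup_mate ((hb.onCup v).2 h1) h2⟩, h3⟩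

theorem Closed.cw_eq (ha : Closed E a) (f : Labelling) :
    cw a b f = ↑(E.filter fun v => IsRoot a b v ∧ f v = some .up) := by
  ext v
  simp only [cw, mem_ofPred_eq, coe_filter]
  constructor
  · rintro ⟨h1, h2⟩
    exact ⟨(ha.onCup v).1 (h1 v (.refl _)).2.1, h1, h2⟩
  · exact fun h => h.2

/-- The product over clockwise circles by which `circleVal` is normalized. -/
def circleNorm (p : ℤ → ℤ) (E : Finset ℤ) (a b f : Labelling) : ℚ :=
  ∏ m ∈ E with IsRoot a b m ∧ f m = some .up, (-2 * p m : ℚ)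

theorem Closed.prod_eq_circleVal (ha : Closed E a) {p : ℤ → ℤ} (hp : ∀ i, p i = 1 ∨ p i = -1)
    {f g : Labelling} (hg : ∀ i ∈ E, g i = some .down ∨ g i = some .up) (e : Bool) :
    ∏ m ∈ E with IsRoot a b m,
      ((if f m = some .up then color p (stack g g) (m, e) - p m else 1 : ℤ) : ℚ) =
      circleVal p a b f g * circleNorm p E a b g := by
  rw [circleVal, ha.cw_eq, ha.cw_eq, Finset.coe_subset]
  simp only [Int.cast_ite, Int.cast_one]
  rw [← prod_filter, filter_filter]
  have hne : ∀ m, (-2 * p m : ℚ) ≠ 0 := fun m => by rcases hp m with h | h <;> rw [h] <;> norm_num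
  split_ifs with hs
  · rw [← Finset.coe_sdiff, finprod_mem_coe_finset, circleNorm, ← Finset.prod_sdiff hs, ← mul_assoc,
      ← Finset.prod_mul_distrib]
    rw [prod_congr rfl fun m _ => inv_mul_cancel₀ (hne m)]
    rw [Finset.prod_const_one, one_mul]
    refine prod_congr rfl fun m hm => ?_
    have := (mem_filter.1 (hs hm)).2.2
    rw [color_up (by rw [stack_self, this])]
    push_cast; ring
  · rw [zero_mul]
    obtain ⟨m, hm, hm'⟩ := Finset.not_subset.1 hs
    refine Finset.prod_eq_zero hm ?_
    rw [mem_filter] at hm hm'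
    have hd : g m = some .down := (hg m hm.1).resolve_right fun hu => hm' ⟨hm.1, hm.2.1, hu⟩
    rw [color_down (by rw [stack_self, hd])]
    simp

theorem prod_color {p : ℤ → ℤ} (hp : ∀ i, p i = 1 ∨ p i = -1) {g : Labelling} (S : Finset ℤ)
    (hS : ∀ i ∈ S, g i = some .up) : ∏ m ∈ S, (-2 * p m : ℚ) =
      2 ^ (S.filter fun m => color p (stack g g) (m, false) = 1).card *
        (-2) ^ (S.filter fun m => color p (stack g g) (m, false) = -1).card := by
  rw [← prod_const, ← prod_const, prod_filter, prod_filter,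
    ← Finset.prod_mul_distrib]
  refine prod_congr rfl fun m hm => ?_
  rw [color_up (by rw [stack_self, hS m hm])]
  rcases hp m with h | h <;> simp only [h] <;> norm_num

end Count

/-! ### The product of closed diagrams -/

section Product

open Classical

variable {E : Finset ℤ} {p : ℤ → ℤ} {a b d : Labelling} (h : Setup E p a b d)

theorem finite_labs (ha : Closed E a) (f : Labelling) :
    {z : Labelling | CupOr a z ∧ CupOr d z ∧ ∀ i, i ∉ E → z i = f i}.Finite := by
  refine Set.Finite.of_injOn (f := fun z : Labelling => E.filter fun i => z i = some .up)
    (t := (E.powerset : Set (Finset ℤ))) ?_ ?_ (finite_toSet _)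
  · intro z _
    rw [mem_coe, mem_powerset]
    exact filter_subset _ _
  · intro z hz z' hz' hzz
    funext i
    by_cases hi : i ∈ E
    · have := congrArg (i ∈ ·) hzz
      simp only [mem_filter, hi, true_and, eq_iff_iff] at this
      rcases hz.1.act ha hi with h1 | h1 <;> rcases hz'.1.act ha hi with h2 | h2 <;> simp_all
    · rw [hz.2.2 i hi, hz'.2.2 i hi]

include h

/-- The labellings orienting `a` and `d` which agree with `f` outside of `E`. -/
def Setup.labs (f : Labelling) : Finset Labelling :=
  (finite_labs (d := d) h.ca f).toFinset

theorem Setup.mem_labs {f z : Labelling} : z ∈ h.labs f ↔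
    CupOr a z ∧ CupOr d z ∧ ∀ i, i ∉ E → z i = f i := by
  simp [Setup.labs]

theorem Setup.coloring_end {T : ℤ} (hT : ∀ i j, IsCup b i j → i < T) {f : Labelling}
    (ha : CupOr a f) (hd : CupOr d f) :
    IsColoring (twoLine E) (SameCircle a b d T) (color p (stack f f)) where
  sq v hv := by
    obtain ⟨i, e⟩ := v
    rw [mem_twoLine] at hv
    have := h.sq i
    rcases ha.act h.ca hv with h1 | h1
    · rw [color_down (by rw [stack_self, h1])]; exact this
    · rw [color_up (by rw [stack_self, h1])]; dsimp only; omega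
  const x hx y hxy := by
    have hc := (h.sameCircle_end hT (mem_twoLine.1 hx)).1 hxy
    obtain ⟨i, e⟩ := x
    obtain ⟨j, e'⟩ := y
    rw [color_stack_self p f i e, color_stack_self p f j e']
    dsimp only at hc
    exact (hc.iff_of_invariant (q := fun k => color p (stack f f) (i, false) =
      color p (stack f f) (k, false)) (fun k l hkl => by rw [ha.color_eq h.ca h.fa hkl])
      (fun k l hkl => by rw [hd.color_eq h.cd h.fd hkl])).1 rfl

theorem Setup.coloring_all (t : ℤ) {f : Labelling} (ha : CupOr a f) (hb : CupOr b f)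
    (hd : CupOr d f) : IsColoring (twoLine E) (SameCircle a b d t) (color p (stack f f)) where
  sq v hv := by
    obtain ⟨i, e⟩ := v
    rw [mem_twoLine] at hv
    have := h.sq i
    rcases ha.act h.ca hv with h1 | h1
    · rw [color_down (by rw [stack_self, h1])]; exact this
    · rw [color_up (by rw [stack_self, h1])]; dsimp only; omega
  const x hx y hxy := by
    clear hx
    induction hxy with
    | rel x y hr =>
      obtain ⟨i, e⟩ := x
      obtain ⟨j, e'⟩ := y
      rw [color_stack_self p f i e, color_stack_self p f j e']
      rcases hr with hr | hr
      · cases hr with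
        | bottom _ _ hc => exact ha.color_eq h.ca h.fa hc
        | top _ _ hc => exact hd.color_eq h.cd h.fd hc
        | middle _ _ _ hc _ => exact hb.color_eq h.cb h.fb hc
      · cases hr <;> rfl
    | refl => rfl
    | symm _ _ _ ih => exact ih.symm
    | trans _ _ _ _ _ ih1 ih2 => exact ih1.trans ih2

theorem Setup.cupOr_of_coloring {t : ℤ} (ht : ∀ i j, IsCup b i j → t ≤ i) {f : Labelling}
    (ha : CupOr a f)
    (hc : IsColoring (twoLine E) (SameCircle a b d t) (color p (stack f f))) : CupOr b f := by
  intro i j hij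
  have hi := (h.cb.onCup i).1 ⟨j, Or.inl hij⟩
  have hj := (h.cb.onCup j).1 ⟨i, Or.inr hij⟩
  have hp := h.fb i hi
  rw [mate_eq (Or.inl hij)] at hp
  have hs := h.sq i
  have := hc.const (i, false) (mem_twoLine.2 hi) (j, false)
    (.rel _ _ (Or.inl (.middle _ _ _ hij (ht _ _ hij))))
  rcases ha.act h.ca hi with h1 | h1 <;> rcases ha.act h.ca hj with h2 | h2
  · rw [color_down (by rw [stack_self, h1]), color_down (by rw [stack_self, h2])] at this
    dsimp only at this; omega
  · exact Or.inl ⟨h1, h2⟩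
  · exact Or.inr ⟨h1, h2⟩
  · rw [color_up (by rw [stack_self, h1]), color_up (by rw [stack_self, h2])] at this
    dsimp only at this; omega

theorem Setup.stack_mem_orients {t : ℤ} (ht : ∀ i j, IsCup b i j → t ≤ i) {f g : Labelling}
    (hfa : CupOr a f) (hfb : CupOr b f) (hgb : CupOr b g) (hgd : CupOr d g) :
    stack f g ∈ h.orients t (stack f g) := by
  refine h.mem_orients.2 ⟨⟨fun v hv => ?_, fun x hx y hxy => ?_⟩, fun _ _ => rfl⟩
  · obtain ⟨i, e⟩ := v
    rw [mem_twoLine] at hv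
    cases e
    · exact hfa.act h.ca hv
    · exact hgb.act h.cb hv
  · obtain ⟨h1, h2⟩ := (sameCircle_start ht).1 hxy
    obtain ⟨i, e⟩ := x
    obtain ⟨j, e'⟩ := y
    dsimp only at h1 h2
    subst h1
    cases e
    · change color p (stack f f) (i, false) = color p (stack f f) (j, false)
      exact (h2.iff_of_invariant (q := fun k => color p (stack f f) (i, false) =
        color p (stack f f) (k, false)) (fun k l hkl => by rw [hfa.color_eq h.ca h.fa hkl])
        (fun k l hkl => by rw [hfb.color_eq h.cb h.fb hkl])).1 rfl
    · change color p (stack g g) (i, true) = color p (stack g g) (j, true)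
      rw [color_stack_self, color_stack_self p g j]
      exact (h2.iff_of_invariant (q := fun k => color p (stack g g) (i, false) =
        color p (stack g g) (k, false)) (fun k l hkl => by rw [hgb.color_eq h.cb h.fb hkl])
        (fun k l hkl => by rw [hgd.color_eq h.cd h.fd hkl])).1 rfl

theorem Setup.sum_orients {T : ℤ} (hT : ∀ i j, IsCup b i j → i < T) {f g : Labelling}
    (hfg : ∀ i, i ∉ E → f i = g i) (F : TwoLine → ℤ) :
    ∑ z ∈ h.orients T (stack f g), F z = ∑ z ∈ h.labs f, F (stack z z) := by
  have hst : ∀ z ∈ h.orients T (stack f g),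
      stack (fun i => z (i, false)) (fun i => z (i, false)) = z := by
    intro z hz
    rw [h.mem_orients] at hz
    funext ⟨i, e⟩
    rw [stack_self]
    dsimp only
    by_cases hi : i ∈ E
    · have hc := hz.1.const (i, false) (mem_twoLine.2 hi) (i, e)
        ((h.sameCircle_end hT (x := (i, false)) hi).2 (.refl _))
      have hs := h.sq i
      rcases hz.1.act (i, false) (mem_twoLine.2 hi) with h1 | h1 <;>
        rcases hz.1.act (i, e) (mem_twoLine.2 hi) with h2 | h2
      · rw [h1, h2]
      · rw [color_down h1, color_up h2] at hc; dsimp only at hc; omega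
      · rw [color_up h1, color_down h2] at hc; dsimp only at hc; omega
      · rw [h1, h2]
    · rw [hz.2 _ (by rwa [mem_twoLine]), hz.2 _ (by rwa [mem_twoLine])]
      cases e
      · rfl
      · exact hfg i hi
  refine sum_bij' (fun z _ i => z (i, false)) (fun z _ => stack z z) ?_ ?_ hst ?_ ?_
  · intro z hz
    have hz' := h.mem_orients.1 hz
    rw [h.mem_labs]
    have key : ∀ {i j : ℤ}, i ∈ E → j ∈ E → p j = - p i →
        SameCircle a b d T (i, false) (j, false) →
        (z (i, false) = some .down ∧ z (j, false) = some .up) ∨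
        (z (i, false) = some .up ∧ z (j, false) = some .down) := by
      intro i j hi hj hp hc
      have hc := hz'.1.const _ (mem_twoLine.2 hi) _ hc
      have hs := h.sq i
      rcases hz'.1.act (i, false) (mem_twoLine.2 hi) with h1 | h1 <;>
        rcases hz'.1.act (j, false) (mem_twoLine.2 hj) with h2 | h2
      · rw [color_down h1, color_down h2] at hc; dsimp only at hc; omega
      · exact Or.inl ⟨h1, h2⟩
      · exact Or.inr ⟨h1, h2⟩
      · rw [color_up h1, color_up h2] at hc; dsimp only at hc; omega
    refine ⟨fun i j hij => ?_, fun i j hij => ?_, fun i hi => ?_⟩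
    · have hi := (h.ca.onCup i).1 ⟨j, Or.inl hij⟩
      have hp := h.fa i hi
      rw [mate_eq (Or.inl hij)] at hp
      exact key hi ((h.ca.onCup j).1 ⟨i, Or.inr hij⟩) hp
        ((h.sameCircle_end hT (x := (i, false)) hi).2 (.rel _ _ (Or.inl hij)))
    · have hi := (h.cd.onCup i).1 ⟨j, Or.inl hij⟩
      have hp := h.fd i hi
      rw [mate_eq (Or.inl hij)] at hp
      exact key hi ((h.cd.onCup j).1 ⟨i, Or.inr hij⟩) hp
        ((h.sameCircle_end hT (x := (i, false)) hi).2 (.rel _ _ (Or.inr hij)))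
    · exact hz'.2 (i, false) (by rwa [mem_twoLine])
  · intro z hz
    rw [h.mem_labs] at hz
    have hcol := h.coloring_end hT hz.1 hz.2.1
    refine h.mem_orients.2 ⟨⟨fun v hv => ?_, hcol.const⟩, fun v hv => ?_⟩
    · rw [stack_self]; exact hz.1.act h.ca (mem_twoLine.1 hv)
    · obtain ⟨i, e⟩ := v
      rw [mem_twoLine] at hv
      rw [stack_self]
      refine (hz.2.2 i hv).trans ?_
      cases e
      · rfl
      · exact hfg i hv
  · intro z hz
    funext i
    rw [stack_self]
  · intro z hz
    rw [hst z hz]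

omit h in
/-- The degree of a diagram in terms of circles. -/
theorem Closed.ncard_cwCups_add {E : Finset ℤ} {a b : Labelling} (ha : Closed E a)
    (hb : Closed E b) {f : Labelling} (hfa : CupOr a f) (hfb : CupOr b f) :
    2 * (cwCups a f).ncard + 2 * (cwCups b f).ncard + 2 * (E.filter (IsRoot a b)).card =
      E.card + 4 * (E.filter fun v => IsRoot a b v ∧ f v = some .up).card := by
  have := ha.count hb hfa hfb (q := fun _ => True) (fun _ _ _ => Iff.rfl) (fun _ _ _ => Iff.rfl)
  simp only [and_true, filter_true] at this
  rw [ha.cwCups_eq, hb.cwCups_eq, ncard_coe_finset, ncard_coe_finset]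
  exact this

end Product

section Product

open Classical

variable {E : Finset ℤ} {p : ℤ → ℤ} {a b d : Labelling} (h : Setup E p a b d)

include h

theorem Setup.cdeg_start {t : ℤ} (ht : ∀ i j, IsCup b i j → t ≤ i) {f g : Labelling}
    (hfa : CupOr a f) (hfb : CupOr b f) (hgb : CupOr b g) (hgd : CupOr d g) :
    cdeg (twoLine E) (SameCircle a b d t) (stack f g) =
      ((cwCups a f).ncard + (cwCups b f).ncard + ((cwCups b g).ncard + (cwCups d g).ncard) : ℤ)
        - E.card := by
  have e := h.roots_start (R := Multiplicative ℤ) ht fun v =>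
    Multiplicative.ofAdd (if stack f g v = some .up then (1 : ℤ) else -1)
  have e' : cdeg (twoLine E) (SameCircle a b d t) (stack f g) =
      (∑ m ∈ E with IsRoot a b m, if f m = some .up then (1 : ℤ) else -1) +
        ∑ m ∈ E with IsRoot b d m, if g m = some .up then (1 : ℤ) else -1 := e
  have key : ∀ (a b f : Labelling), (∑ m ∈ E with IsRoot a b m,
      if f m = some Label.up then (1 : ℤ) else -1) =
      2 * (E.filter fun v => IsRoot a b v ∧ f v = some .up).card - (E.filter (IsRoot a b)).card := by
    intro a b f
    have : ∀ v ∈ E.filter (IsRoot a b), (if f v = some Label.up then (1 : ℤ) else -1) =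
        2 * (if f v = some Label.up then 1 else 0) - 1 := by
      intro v _; split_ifs <;> norm_num
    rw [sum_congr rfl this, sum_sub_distrib, ← mul_sum]
    simp [filter_filter]
  rw [e', key, key]
  have h1 := h.ca.ncard_cwCups_add h.cb hfa hfb
  have h2 := h.cb.ncard_cwCups_add h.cd hgb hgd
  omega

theorem Setup.cdeg_end {T : ℤ} (hT : ∀ i j, IsCup b i j → i < T) {f : Labelling}
    (hfa : CupOr a f) (hfd : CupOr d f) :
    2 * cdeg (twoLine E) (SameCircle a b d T) (stack f f) =
      2 * ((cwCups a f).ncard + (cwCups d f).ncard : ℤ) - E.card := by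
  unfold cdeg
  rw [h.roots_end hT, sum_map]
  have : ∀ v ∈ E.filter (IsRoot a d), (if stack f f (lineEmb false v) = some Label.up then (1 : ℤ)
      else -1) = 2 * (if f v = some Label.up then 1 else 0) - 1 := by
    intro v _; rw [stack_self]; simp only [lineEmb_apply]; by_cases hv : f v = some .up <;> simp [hv]
  rw [sum_congr rfl this, sum_sub_distrib, ← mul_sum]
  simp only [sum_boole, filter_filter, sum_const, nsmul_eq_mul, mul_one]
  have h1 := h.ca.ncard_cwCups_add h.cd hfa hfd
  have e : (E.filter fun m => IsRoot a d m) = E.filter (IsRoot a d) := rfl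
  omega

theorem Setup.chi_start {t : ℤ} (ht : ∀ i j, IsCup b i j → t ≤ i) {f g k : Labelling}
    (hk : CupOr a k) : ((chi (twoLine E) (SameCircle a b d t) (stack f g)
      fun v => color p (stack k k) v - p v.1 : ℤ) : ℚ) =
      circleVal p a b f k * circleNorm p E a b k * (circleVal p b d g k * circleNorm p E b d k) := by
  unfold chi
  rw [h.roots_start ht]
  push_cast
  rw [← h.ca.prod_eq_circleVal h.sq (fun i hi => hk.act h.ca hi) false,
    ← h.cb.prod_eq_circleVal h.sq (fun i hi => hk.act h.ca hi) true]
  push_cast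
  rfl

theorem Setup.chi_end {T : ℤ} (hT : ∀ i j, IsCup b i j → i < T) {f k : Labelling}
    (hk : CupOr a k) : ((chi (twoLine E) (SameCircle a b d T) (stack f f)
      fun v => color p (stack k k) v - p v.1 : ℤ) : ℚ) =
      circleVal p a d f k * circleNorm p E a d k := by
  unfold chi
  rw [h.roots_end hT, prod_map, ← h.ca.prod_eq_circleVal h.sq (fun i hi => hk.act h.ca hi)
    false]
  push_cast
  refine prod_congr rfl fun m _ => ?_
  rw [stack_self]
  rfl

theorem Setup.factor_mul {t : ℤ} {n : ℕ} (ht : ∀ i j, IsCup b i j → t ≤ i ∧ i < t + n)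
    {f : Labelling} (hfa : CupOr a f) (hfb : CupOr b f) (hfd : CupOr d f) :
    (factor a b d n t (color p (stack f f)) : ℚ) * circleNorm p E a b f * circleNorm p E b d f =
      cupVal p b f * circleNorm p E a d f := by
  obtain ⟨s, hs1, hs2⟩ := h.factor_eq (fun t => h.coloring_all t hfa hfb hfd) n (t := t) rfl
  have hcv : cupVal p b f = ∏ m ∈ E with m < mate b m ∧ f m = some .up, (-2 * p m : ℚ) := by
    unfold cupVal; rw [h.cb.cwCups_eq, finprod_mem_coe_finset]
  have hN : ∀ c, s c + (E.filter fun v => (IsRoot a b v ∧ f v = some .up) ∧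
      color p (stack f f) (v, false) = c).card + (E.filter fun v => (IsRoot b d v ∧ f v = some .up) ∧
      color p (stack f f) (v, false) = c).card = (E.filter fun v => (v < mate b v ∧ f v = some .up) ∧
      color p (stack f f) (v, false) = c).card + (E.filter fun v => (IsRoot a d v ∧ f v = some .up) ∧
      color p (stack f f) (v, false) = c).card := by
    intro c
    have qa : ∀ i j, IsCup a i j → (color p (stack f f) (i, false) = c ↔
      color p (stack f f) (j, false) = c) := fun i j hij => by rw [hfa.color_eq h.ca h.fa hij]
    have qb : ∀ i j, IsCup b i j → (color p (stack f f) (i, false) = c ↔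
      color p (stack f f) (j, false) = c) := fun i j hij => by rw [hfb.color_eq h.cb h.fb hij]
    have qd : ∀ i j, IsCup d i j → (color p (stack f f) (i, false) = c ↔
      color p (stack f f) (j, false) = c) := fun i j hij => by rw [hfd.color_eq h.cd h.fd hij]
    have n1 := h.ca.count h.cb hfa hfb qa qb
    have n2 := h.cb.count h.cd hfb hfd qb qd
    have n3 := h.ca.count h.cd hfa hfd qa qd
    have n4 := h.cb.two_mul_cupCount qb ht
    have n5 := hs2 c
    have r1 : colCount (twoLine E) (SameCircle a b d t) (color p (stack f f)) c =
        (∑ m ∈ E with IsRoot a b m, if color p (stack f f) (m, false) = c then 1 else 0) +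
        ∑ m ∈ E with IsRoot b d m, if color p (stack f f) (m, true) = c then 1 else 0 :=
      h.roots_start (R := Multiplicative ℕ) (fun i j hij => (ht i j hij).1) fun v =>
        Multiplicative.ofAdd (if color p (stack f f) v = c then (1 : ℕ) else 0)
    have r2 : colCount (twoLine E) (SameCircle a b d (t + n)) (color p (stack f f)) c =
        (∑ m ∈ E with IsRoot a d m, if color p (stack f f) (m, false) = c then 1 else 0) := by
      unfold colCount
      rw [h.roots_end fun i j hij => (ht i j hij).2, sum_map]
      rfl
    rw [r1, r2] at n5
    simp only [color_stack_self p f _ true, ← card_filter, filter_filter] at n5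
    simp only [and_right_comm (c := f _ = some Label.up)] at n1 n2 n3
    omega
  rw [hs1, hcv, circleNorm, circleNorm, circleNorm]
  iterate 4 rw [prod_color (g := f) h.sq _ fun i hi => by exact (mem_filter.1 hi).2.2]
  simp only [filter_filter]
  push_cast
  have h1 := congrArg (fun k => (2 : ℚ) ^ k) (hN 1)
  have h2 := congrArg (fun k => (-2 : ℚ) ^ k) (hN (-1))
  simp only [pow_add] at h1 h2
  linear_combination congrArg₂ (· * ·) h1 h2

theorem Setup.product {t : ℤ} {n : ℕ} (ht : ∀ i j, IsCup b i j → t ≤ i ∧ i < t + n)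
    {f g : Labelling} (hfa : CupOr a f) (hfb : CupOr b f) (hgb : CupOr b g) (hgd : CupOr d g)
    (hfg : ∀ i, i ∉ E → f i = g i) :
    ∃ C : Labelling → ℚ, (∀ k ∈ h.labs f, ∑ z ∈ h.labs f, C z * circleVal p a d z k =
      if CupOr b k then circleVal p a b f k * cupVal p b k * circleVal p b d g k else 0) ∧
      ∀ z ∈ h.labs f,
        ((cwCups a f).ncard + (cwCups b f).ncard + ((cwCups b g).ncard + (cwCups d g).ncard) <
          (cwCups a z).ncard + (cwCups d z).ncard → C z = 0) ∧
        ((cwCups a f).ncard + (cwCups b f).ncard + ((cwCups b g).ncard + (cwCups d g).ncard) =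
          (cwCups a z).ncard + (cwCups d z).ncard →
            C z = surgeryCount a b d n t (stack f g) (stack z z)) ∧
        ((cwCups a f).ncard + (cwCups b f).ncard + ((cwCups b g).ncard + (cwCups d g).ncard) ≠
          (cwCups a z).ncard + (cwCups d z).ncard →
            surgeryCount a b d n t (stack f g) (stack z z) = 0) := by
  have ht1 : ∀ i j, IsCup b i j → t ≤ i := fun i j hij => (ht i j hij).1
  have ht2 : ∀ i j, IsCup b i j → i < t + n := fun i j hij => (ht i j hij).2
  have hw := h.stack_mem_orients ht1 hfa hfb hgb hgd
  obtain ⟨C, hC1, hC2⟩ := h.expand_shifted (stack f g) n rfl hw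
  have hne : ∀ k, circleNorm p E a d k ≠ 0 := by
    intro k
    refine Finset.prod_ne_zero_iff.2 fun m _ => ?_
    rcases h.sq m with h1 | h1 <;> rw [h1] <;> norm_num
  refine ⟨fun z => C (stack z z), fun k hk => ?_, fun z hz => ?_⟩
  · have hk' := h.mem_labs.1 hk
    have e := hC1 _ (h.coloring_end ht2 hk'.1 hk'.2.1)
    rw [h.sum_orients ht2 hfg] at e
    have e' := congrArg (Int.cast : ℤ → ℚ) e
    rw [Int.cast_mul, h.chi_start ht1 hk'.1, Int.cast_sum] at e'
    simp only [Int.cast_mul, h.chi_end ht2 hk'.1] at e'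
    apply mul_right_cancel₀ (hne k)
    rw [sum_mul]
    simp only [mul_assoc] at e' ⊢
    rw [← e']
    split_ifs with hb
    · have := h.factor_mul ht hk'.1 hb hk'.2.1
      linear_combination circleVal p a b f k * circleVal p b d g k * this
    · rw [zero_mul]
      have : factor a b d n t (color p (stack k k)) = 0 := by
        by_contra hne
        exact hb (h.cupOr_of_coloring ht1 hk'.1
          (h.coloring_of_factor n rfl (h.coloring_end ht2 hk'.1 hk'.2.1) hne))
      rw [this]; simp
  · have hz' := h.mem_labs.1 hz
    have hz2 : stack z z ∈ h.orients (t + n) (stack f g) := by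
      refine h.mem_orients.2 ⟨⟨fun v hv => ?_, (h.coloring_end ht2 hz'.1 hz'.2.1).const⟩,
        fun v hv => ?_⟩
      · rw [stack_self]; exact hz'.1.act h.ca (mem_twoLine.1 hv)
      · obtain ⟨i, e⟩ := v
        rw [mem_twoLine] at hv
        rw [stack_self]
        refine (hz'.2.2 i hv).trans ?_
        cases e
        · rfl
        · exact hfg i hv
    have hC := hC2 _ hz2
    have d1 := h.cdeg_start ht1 hfa hfb hgb hgd
    have d2 := h.cdeg_end ht2 hz'.1 hz'.2.1
    have d3 := h.cb.two_mul_cupCount (q := fun _ => True) (fun _ _ _ => Iff.rfl) ht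
    simp only [filter_true] at d3
    refine ⟨fun hd => ?_, fun hd => ?_, fun hd => ?_⟩
    · simp only [Int.cast_eq_zero]; exact hC.1 (by omega)
    · have := hC.2.1 (by omega)
      simp only [this]; norm_cast
    · exact hC.2.2 (by omega)

end Product

/-! ## Closures of bounded weights -/

section Closure

variable {f : Labelling}

/-- The new vertices on the left. -/
def newLeft (f : Labelling) : Set ℤ :=
  Set.Ico (sInf (vertices f) - ({k | f k = some .up}.ncard : ℤ)) (sInf (vertices f))

/-- The new vertices on the right. -/
def newRight (f : Labelling) : Set ℤ :=
  Set.Ioc (sSup (vertices f)) (sSup (vertices f) + ({k | f k = some .down}.ncard : ℤ))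

theorem Act.vertex {i : ℤ} (h : Act f i) : i ∈ vertices f := by
  rcases h with h | h <;> simp [vertices, h]

theorem mem_vertices {i : ℤ} : i ∈ vertices f ↔ f i ≠ none := Iff.rfl

theorem closure_of_mem {i : ℤ} (hi : i ∈ vertices f) : closure f i = f i := if_pos hi

theorem vertex_bounds (hf : (vertices f).Finite) {i : ℤ} (hi : i ∈ vertices f) :
    sInf (vertices f) ≤ i ∧ i ≤ sSup (vertices f) :=
  ⟨csInf_le hf.bddBelow hi, le_csSup hf.bddAbove hi⟩

theorem newLeft_lt (hf : (vertices f).Finite) {i j : ℤ} (hi : i ∈ newLeft f) (hj : j ∈ vertices f) :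
    i < j := hi.2.trans_le (vertex_bounds hf hj).1

theorem lt_newRight (hf : (vertices f).Finite) {i j : ℤ} (hi : i ∈ newRight f)
    (hj : j ∈ vertices f) : j < i := (vertex_bounds hf hj).2.trans_lt hi.1

theorem closure_newLeft (hf : (vertices f).Finite) {i : ℤ} (hi : i ∈ newLeft f) :
    closure f i = some .down := by
  unfold closure
  rw [if_neg (mt mem_vertices.2 fun h => (newLeft_lt hf hi h).false)]
  exact if_pos (Set.mem_Ico.1 hi)

theorem sInf_le_sSup_vertices (hf : (vertices f).Finite) {j : ℤ} (hj : j ∈ vertices f) :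
    sInf (vertices f) ≤ sSup (vertices f) :=
  (vertex_bounds hf hj).1.trans (vertex_bounds hf hj).2

theorem exists_vertex_of_newRight (_ : (vertices f).Finite) {i : ℤ} (hi : i ∈ newRight f) :
    ∃ j, f j = some .down := by
  by_contra hc
  have : {k | f k = some .down} = ∅ := by
    ext k; simp only [mem_ofPred_eq, Set.mem_empty_iff_false, iff_false]; exact fun h => hc ⟨k, h⟩
  have h1 := hi.1
  have h2 := hi.2
  rw [this] at h2
  simp at h2
  omega

theorem closure_newRight (hf : (vertices f).Finite) {i : ℤ} (hi : i ∈ newRight f) :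
    closure f i = some .up := by
  obtain ⟨j, hj⟩ := exists_vertex_of_newRight hf hi
  have hj' : j ∈ vertices f := Act.vertex (Or.inl hj)
  have := lt_newRight hf hi hj'
  have := (vertex_bounds hf hj').1
  unfold closure
  rw [if_neg (mt mem_vertices.2 fun h => (lt_newRight hf hi h).false), if_neg (by rintro ⟨_, h⟩; omega)]
  exact if_pos (Set.mem_Ioc.1 hi)

theorem closure_cases (i : ℤ) (h1 : i ∉ vertices f) (h2 : i ∉ newLeft f) (h3 : i ∉ newRight f) :
    closure f i = none := by
  unfold closure
  rw [if_neg (mt mem_vertices.2 h1), if_neg fun h => h2 (Set.mem_Ico.2 h), if_neg fun h => h3 (Set.mem_Ioc.2 h)]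

theorem mem_vertices_closure (hf : (vertices f).Finite) {i : ℤ} :
    i ∈ vertices (closure f) ↔ i ∈ vertices f ∨ i ∈ newLeft f ∨ i ∈ newRight f := by
  constructor
  · intro h
    by_contra hc
    push Not at hc
    exact h (closure_cases i hc.1 hc.2.1 hc.2.2)
  · rintro (h | h | h)
    · unfold vertices; rw [mem_ofPred_eq, closure_of_mem h]; exact h
    · simp [vertices, closure_newLeft hf h]
    · simp [vertices, closure_newRight hf h]

theorem finite_vertices_closure (hf : (vertices f).Finite) : (vertices (closure f)).Finite := by
  refine (hf.union (((Set.finite_Ico _ _ : (newLeft f).Finite)).union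
    (Set.finite_Ioc _ _ : (newRight f).Finite))).subset fun i hi => ?_
  exact (mem_vertices_closure hf).1 hi

theorem vertices_nonempty_of_closure (hf : (vertices f).Finite) {i : ℤ}
    (hi : i ∈ vertices (closure f)) : (vertices f).Nonempty := by
  rcases (mem_vertices_closure hf).1 hi with h | h | h
  · exact ⟨i, h⟩
  · by_contra hc
    have : {k | f k = some .up} = ∅ := by
      ext k
      simp only [mem_ofPred_eq, Set.mem_empty_iff_false, iff_false]
      exact fun h => hc ⟨k, Act.vertex (Or.inr h)⟩
    have h1 := h.1
    have h2 := h.2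
    rw [this] at h1
    simp at h1
    omega
  · obtain ⟨j, hj⟩ := exists_vertex_of_newRight hf h
    exact ⟨j, Act.vertex (Or.inl hj)⟩

theorem ordConnected_closure (hf : (vertices f).Finite) (hc : (vertices f).OrdConnected) :
    (vertices (closure f)).OrdConnected := by
  refine ⟨fun x hx y hy z hz => ?_⟩
  have hne := vertices_nonempty_of_closure hf hx
  have hA := hne.csInf_mem hf
  have hB := hne.csSup_mem hf
  have hAB := sInf_le_sSup_vertices hf hA
  have bx : sInf (vertices f) - ({k | f k = some .up}.ncard : ℤ) ≤ x := by
    rcases (mem_vertices_closure hf).1 hx with h | h | h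
    · have := (vertex_bounds hf h).1; omega
    · exact h.1
    · have := h.1; omega
  have bY : y ≤ sSup (vertices f) + ({k | f k = some .down}.ncard : ℤ) := by
    rcases (mem_vertices_closure hf).1 hy with h | h | h
    · have := (vertex_bounds hf h).2; omega
    · have := h.2; omega
    · exact h.2
  rw [mem_vertices_closure hf]
  by_cases h1 : z < sInf (vertices f)
  · exact Or.inr (Or.inl ⟨bx.trans hz.1, h1⟩)
  · by_cases h2 : sSup (vertices f) < z
    · exact Or.inr (Or.inr ⟨h2, hz.2.trans bY⟩)
    · exact Or.inl (hc.out hA hB ⟨not_lt.1 h1, not_lt.1 h2⟩)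

theorem cup_range (hf : (vertices f).Finite) (hc : (vertices f).OrdConnected) (i j : ℤ)
    (hij : IsCup (closure f) i j) : sInf (vertices (closure f)) ≤ i ∧
      i < sInf (vertices (closure f)) + ((vertices (closure f)).ncard : ℤ) := by
  have hi : i ∈ vertices (closure f) := Act.vertex (Or.inl hij.left)
  have hfin := finite_vertices_closure hf
  have h1 := (vertex_bounds hfin hi).1
  refine ⟨h1, ?_⟩
  have hsub : Set.Icc (sInf (vertices (closure f))) i ⊆ vertices (closure f) :=
    (ordConnected_closure hf hc).out (Set.Nonempty.csInf_mem ⟨i, hi⟩ hfin) hi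
  have := ncard_le_ncard hsub hfin
  rw [← Finset.coe_Icc, ncard_coe_finset, Int.card_Icc] at this
  omega

theorem ncard_le_of_up_ray {f : Labelling} (hf : (vertices f).Finite) {i : ℤ} (hi : f i = some .up)
    (hr : ¬ OnCup f i) :
    {k | k < i ∧ f k = some .down}.ncard ≤ {k | k < i ∧ f k = some .up}.ncard := by
  refine Set.ncard_le_ncard_of_injOn (mate f) ?_ ?_
    (hf.subset fun k hk => Act.vertex (Or.inr hk.2))
  · rintro k ⟨h1, h2⟩
    have hk : OnCup f k := by
      by_contra hc; exact no_down_up_rays hc hr h1 h2 hi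
    have hc : IsCup f k (mate f k) := (mate_spec hk).resolve_right fun hc => by
      have := hc.right; rw [h2] at this; cases this
    refine ⟨?_, hc.right⟩
    by_contra hge
    rcases (not_lt.1 hge).lt_or_eq with h3 | h3
    · obtain ⟨l, _, _, hl⟩ := hc.inside h1 h3 (Or.inr hi)
      exact hr ⟨l, hl⟩
    · exact hr ⟨k, Or.inr (h3 ▸ hc)⟩
  · intro x _ y _ hxy
    rw [← mate_mate f x, hxy, mate_mate]

theorem ncard_le_of_down_ray {f : Labelling} (hf : (vertices f).Finite) {i : ℤ}
    (hi : f i = some .down) (hr : ¬ OnCup f i) :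
    {k | i < k ∧ f k = some .up}.ncard ≤ {k | i < k ∧ f k = some .down}.ncard := by
  refine Set.ncard_le_ncard_of_injOn (mate f) ?_ ?_
    (hf.subset fun k hk => Act.vertex (Or.inl hk.2))
  · rintro k ⟨h1, h2⟩
    have hk : OnCup f k := by
      by_contra hc; exact no_down_up_rays hr hc h1 hi h2
    have hc : IsCup f (mate f k) k := (mate_spec hk).resolve_left fun hc => by
      have := hc.left; rw [h2] at this; cases this
    refine ⟨?_, hc.left⟩
    by_contra hge
    rcases (not_lt.1 hge).lt_or_eq with h3 | h3
    · obtain ⟨l, _, _, hl⟩ := hc.inside h3 h1 (Or.inl hi)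
      exact hr ⟨l, hl⟩
    · exact hr ⟨k, Or.inl (h3 ▸ hc)⟩
  · intro x _ y _ hxy
    rw [← mate_mate f x, hxy, mate_mate]

theorem ncard_Ico (x y : ℤ) : (Set.Ico x y).ncard = (y - x).toNat := by
  rw [← Finset.coe_Ico, ncard_coe_finset, Int.card_Ico]

theorem ncard_Ioc (x y : ℤ) : (Set.Ioc x y).ncard = (y - x).toNat := by
  rw [← Finset.coe_Ioc, ncard_coe_finset, Int.card_Ioc]

theorem onCup_closure (hf : (vertices f).Finite) {i : ℤ} (hi : Act (closure f) i) :
    OnCup (closure f) i := by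
  by_contra hr
  have hfc := finite_vertices_closure hf
  have hne := vertices_nonempty_of_closure hf hi.vertex
  have hA := hne.csInf_mem hf
  have hAB := sInf_le_sSup_vertices hf hA
  have fu : {k | f k = some .up}.Finite := hf.subset fun k hk => Act.vertex (Or.inr hk)
  have fd : {k | f k = some .down}.Finite := hf.subset fun k hk => Act.vertex (Or.inl hk)
  have cL : (newLeft f).ncard = {k | f k = some .up}.ncard := by
    unfold newLeft; rw [ncard_Ico]; omega
  have cR : (newRight f).ncard = {k | f k = some .down}.ncard := by
    unfold newRight; rw [ncard_Ioc]; omega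
  have mem := (mem_vertices_closure hf).1 hi.vertex
  have up_of : ∀ k, closure f k = some .up → f k = some .up ∨ k ∈ newRight f := by
    intro k hk
    rcases (mem_vertices_closure hf).1 (Act.vertex (Or.inr hk)) with h | h | h
    · rw [closure_of_mem h] at hk; exact Or.inl hk
    · rw [closure_newLeft hf h] at hk; cases hk
    · exact Or.inr h
  have down_of : ∀ k, closure f k = some .down → f k = some .down ∨ k ∈ newLeft f := by
    intro k hk
    rcases (mem_vertices_closure hf).1 (Act.vertex (Or.inl hk)) with h | h | h
    · rw [closure_of_mem h] at hk; exact Or.inl hk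
    · exact Or.inr h
    · rw [closure_newRight hf h] at hk; cases hk
  have cd : ∀ k, f k = some .down → closure f k = some .down := fun k hk => by
    rw [closure_of_mem (Act.vertex (Or.inl hk)), hk]
  have cu : ∀ k, f k = some .up → closure f k = some .up := fun k hk => by
    rw [closure_of_mem (Act.vertex (Or.inr hk)), hk]
  rcases hi with hi | hi
  · have key := ncard_le_of_down_ray hfc hi hr
    have fX : {k | i < k ∧ closure f k = some .up}.Finite :=
      hfc.subset fun k hk => Act.vertex (Or.inr hk.2)
    rcases down_of i hi with h | h
    · have e1 : newRight f ⊆ {k | i < k ∧ closure f k = some .up} := fun k hk =>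
        ⟨lt_newRight hf hk (Act.vertex (Or.inl h)), closure_newRight hf hk⟩
      have e2 : {k | i < k ∧ closure f k = some .down} ⊆ {k | f k = some .down} \ {i} := by
        rintro k ⟨h1, h2⟩
        refine ⟨(down_of k h2).resolve_right fun h3 => ?_, h1.ne'⟩
        have := newLeft_lt hf h3 (Act.vertex (Or.inl h)); omega
      have n1 := ncard_le_ncard e1 fX
      have n2 := ncard_le_ncard e2 fd.sdiff
      have n3 := Set.ncard_sdiff_singleton_lt_of_mem (s := {k | f k = some .down}) (a := i) h fd
      omega
    · have e1 : {k | f k = some .up} ∪ newRight f ⊆ {k | i < k ∧ closure f k = some .up} := by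
        rintro k (hk | hk)
        · exact ⟨newLeft_lt hf h (Act.vertex (Or.inr hk)), cu k hk⟩
        · exact ⟨h.2.trans_le (hAB.trans hk.1.le), closure_newRight hf hk⟩
      have e2 : {k | i < k ∧ closure f k = some .down} ⊆
          {k | f k = some .down} ∪ Set.Ico (i + 1) (sInf (vertices f)) := by
        rintro k ⟨h1, h2⟩
        exact (down_of k h2).imp id fun h3 => ⟨h1, h3.2⟩
      have n1 := ncard_le_ncard e1 fX
      have n2 := ncard_le_ncard e2 (fd.union (Set.finite_Ico _ _))
      have n3 := Set.ncard_union_le {k | f k = some .down} (Set.Ico (i + 1) (sInf (vertices f)))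
      rw [Set.ncard_union_eq (s := {k | f k = some .up}) (Set.disjoint_left.2 fun k hk hk' =>
        (lt_newRight hf hk' (Act.vertex (Or.inr hk))).false) fu (Set.finite_Ioc _ _)] at n1
      rw [ncard_Ico] at n3
      have := h.1
      have := h.2
      omega
  · have key := ncard_le_of_up_ray hfc hi hr
    have fX : {k | k < i ∧ closure f k = some .down}.Finite :=
      hfc.subset fun k hk => Act.vertex (Or.inl hk.2)
    rcases up_of i hi with h | h
    · have e1 : newLeft f ⊆ {k | k < i ∧ closure f k = some .down} := fun k hk =>
        ⟨newLeft_lt hf hk (Act.vertex (Or.inr h)), closure_newLeft hf hk⟩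
      have e2 : {k | k < i ∧ closure f k = some .up} ⊆ {k | f k = some .up} \ {i} := by
        rintro k ⟨h1, h2⟩
        refine ⟨(up_of k h2).resolve_right fun h3 => ?_, h1.ne⟩
        have := lt_newRight hf h3 (Act.vertex (Or.inr h)); omega
      have n1 := ncard_le_ncard e1 fX
      have n2 := ncard_le_ncard e2 fu.sdiff
      have n3 := Set.ncard_sdiff_singleton_lt_of_mem (s := {k | f k = some .up}) (a := i) h fu
      omega
    · have e1 : {k | f k = some .down} ∪ newLeft f ⊆ {k | k < i ∧ closure f k = some .down} := by
        rintro k (hk | hk)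
        · exact ⟨lt_newRight hf h (Act.vertex (Or.inl hk)), cd k hk⟩
        · exact ⟨hk.2.trans_le (hAB.trans h.1.le), closure_newLeft hf hk⟩
      have e2 : {k | k < i ∧ closure f k = some .up} ⊆
          {k | f k = some .up} ∪ Set.Ioc (sSup (vertices f)) (i - 1) := by
        rintro k ⟨h1, h2⟩
        exact (up_of k h2).imp id fun h3 => ⟨h3.1, by omega⟩
      have n1 := ncard_le_ncard e1 fX
      have n2 := ncard_le_ncard e2 (fu.union (Set.finite_Ioc _ _))
      have n3 := Set.ncard_union_le {k | f k = some .up} (Set.Ioc (sSup (vertices f)) (i - 1))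
      rw [Set.ncard_union_eq (s := {k | f k = some .down}) (Set.disjoint_left.2 fun k hk hk' =>
        (newLeft_lt hf hk' (Act.vertex (Or.inl hk))).false) fd (Set.finite_Ico _ _)] at n1
      rw [ncard_Ioc] at n3
      have := h.1
      have := h.2
      omega

end Closure

/-! ### Dominance for closed diagrams -/

theorem downInd_sub {f g : Labelling} {i : ℤ} (hf : Act f i) (hg : Act g i) :
    downInd f i - downInd g i = if f i = g i then 0 else if f i = some .down then 1 else -1 := by
  rcases hf with h1 | h1 <;> rcases hg with h2 | h2 <;> simp [downInd, h1, h2]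

theorem CupOr.mate {a f : Labelling} (h : CupOr a f) {i : ℤ} (hi : OnCup a i) :
    (f i = some .down ∧ f (mate a i) = some .up) ∨ (f i = some .up ∧ f (mate a i) = some .down) := by
  rcases mate_spec hi with hc | hc
  · exact h _ _ hc
  · exact (h _ _ hc).symm.imp And.symm And.symm

theorem CupOr.agree {a f g : Labelling} (hf : CupOr a f) (hg : CupOr a g) {i j : ℤ}
    (hij : IsCup a i j) : f i = g i ↔ f j = g j := by
  rcases hf i j hij with ⟨h1, h2⟩ | ⟨h1, h2⟩ <;> rcases hg i j hij with ⟨h3, h4⟩ | ⟨h3, h4⟩ <;>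
    simp [h1, h2, h3, h4]

/-- Orientations of a circle agreeing at one vertex agree. -/
theorem agree_of_conn {a b f g : Labelling} (hfa : CupOr a f) (hfb : CupOr b f) (hga : CupOr a g)
    (hgb : CupOr b g) {i j : ℤ} (h : Conn a b i j) : f i = g i ↔ f j = g j :=
  h.iff_of_invariant (q := fun i => f i = g i) (fun _ _ => hfa.agree hga) fun _ _ => hfb.agree hgb

/-- Reversing anti-clockwise circles moves downs to the right. -/
theorem Closed.dominance {E : Finset ℤ} {a b f g : Labelling} (ha : Closed E a) (hb : Closed E b)
    (hfa : CupOr a f) (hfb : CupOr b f) (hga : CupOr a g) (hgb : CupOr b g)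
    (hcw : cw a b f ⊆ cw a b g) :
    (∀ i, 0 ≤ ∑ k ∈ E with k ≤ i, (downInd f k - downInd g k)) ∧
      ∑ k ∈ E, (downInd f k - downInd g k) = 0 := by
  classical
  have key : ∀ (q : ℤ → Prop) [DecidablePred q], ∑ k ∈ E with q k, (downInd f k - downInd g k) =
      ∑ m ∈ E with IsRoot a b m, ∑ k ∈ (E.filter (Conn a b m)).filter q,
        (downInd f k - downInd g k) := by
    intro q _
    rw [sum_filter, ha.sum_circles hb]
    refine sum_congr rfl fun m _ => ?_
    rw [sum_filter (p := q)]
  set lam : ℤ → ℤ := fun v => if f v = some .down then 1 else -1 with hlam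
  have flip : ∀ {a}, Closed E a → CupOr a f → ∀ x ∈ E, lam (mate a x) = - lam x := by
    intro a ha hfa x hx
    rcases hfa.mate ((ha.onCup x).2 hx) with ⟨h1, h2⟩ | ⟨h1, h2⟩ <;> simp [hlam, h1, h2]
  have circ : ∀ m ∈ E, IsRoot a b m → ∀ k ∈ E.filter (Conn a b m),
      downInd f k - downInd g k = if f m = g m then 0 else lam k := by
    intro m _ hmr k hk
    obtain ⟨hkE, hk⟩ := mem_filter.1 hk
    rw [downInd_sub (hfa.act ha hkE) (hga.act ha hkE)]
    simp only [← agree_of_conn hfa hfb hga hgb hk, hlam]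
  have part : ∀ m ∈ E, IsRoot a b m → f m ≠ g m → lam m = 1 ∧
      Matching (E.filter (Conn a b m)) (mate a) ∧ Matching (E.filter (Conn a b m)) (mate b) ∧
      Connected (E.filter (Conn a b m)) (mate a) (mate b) := by
    intro m hm hmr hne
    have hC : ∀ k, k ∈ E.filter (Conn a b m) ↔ Conn a b m k := fun k => by
      rw [mem_filter, and_iff_right_iff_imp]
      exact fun h => (ha.conn_mem hb h).1 hm
    have hCE : ∀ k ∈ E.filter (Conn a b m), k ∈ E := fun k hk => (mem_filter.1 hk).1
    refine ⟨?_, component_matching hC fun k hk => (ha.onCup k).2 (hCE k hk),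
      component_matching (a := b) (b := a) (m := m) (fun k => (hC k).trans conn_comm)
        fun k hk => (hb.onCup k).2 (hCE k hk), component_connected hC⟩
    rcases hfa.act ha hm with h1 | h1
    · exact if_pos h1
    · exact (hne (h1.trans (hcw ⟨hmr, h1⟩).2.symm)).elim
  constructor
  · intro i
    rw [key]
    refine Finset.sum_nonneg fun m hm => ?_
    obtain ⟨hmE, hmr⟩ := mem_filter.1 hm
    by_cases hne : f m = g m
    · rw [sum_eq_zero]
      intro k hk
      rw [circ m hmE hmr k (mem_filter.1 hk).1, if_pos hne]
    · obtain ⟨h1, h2, h3, h4⟩ := part m hmE hmr hne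
      obtain ⟨n, hn⟩ := prefix_sum_circle h2 h3 h4
        (fun x hx => flip ha hfa x (mem_filter.1 hx).1)
        (fun x hx => flip hb hfb x (mem_filter.1 hx).1)
        (mem_filter.2 ⟨hmE, .refl _⟩) (fun x hx => (hmr x (mem_filter.1 hx).2).1) i
      rw [sum_congr rfl fun k hk => (circ m hmE hmr k (mem_filter.1 hk).1).trans
        (if_neg hne), hn, h1]
      positivity
  · have e := key (fun _ => True)
    simp only [filter_true] at e
    rw [e]
    refine sum_eq_zero fun m hm => ?_
    obtain ⟨hmE, hmr⟩ := mem_filter.1 hm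
    by_cases hne : f m = g m
    · exact sum_eq_zero fun k hk => by rw [circ m hmE hmr k hk, if_pos hne]
    · obtain ⟨h1, h2, h3, h4⟩ := part m hmE hmr hne
      rw [sum_congr rfl fun k hk => (circ m hmE hmr k hk).trans (if_neg hne)]
      exact h2.sum_eq_zero fun x hx => flip ha hfa x (mem_filter.1 hx).1

/-! ## Passing from weights to closures of their truncations -/

/-- The labellings differ by a permutation of finitely many downs and ups. -/
structure Bal (S : Finset ℤ) (a b : Labelling) : Prop extends FinDiff S a b where
  total : ∑ k ∈ S, (downInd a k - downInd b k) = 0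

theorem Bal.refl (S : Finset ℤ) (a : Labelling) : Bal S a a :=
  ⟨⟨fun _ _ => rfl, fun _ => Iff.rfl, fun _ _ => rfl⟩, by simp⟩

theorem Bal.symm {S : Finset ℤ} {a b : Labelling} (h : Bal S a b) : Bal S b a :=
  ⟨h.toFinDiff.symm, by
    have := h.total
    rw [← neg_eq_zero, ← sum_neg_distrib]
    simpa using this⟩

theorem Bal.trans {S : Finset ℤ} {a b c : Labelling} (h : Bal S a b) (h' : Bal S b c) :
    Bal S a c :=
  ⟨h.toFinDiff.trans h'.toFinDiff, by
    have := congrArg₂ (· + ·) h.total h'.total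
    rw [← sum_add_distrib] at this
    simpa using this⟩

theorem Bal.mono {S T : Finset ℤ} {a b : Labelling} (h : Bal S a b) (hST : S ⊆ T) : Bal T a b :=
  ⟨h.toFinDiff.mono hST, by rw [sum_downInd_mono' h.eq hST]; exact h.total⟩

theorem Bal.shrink {S T : Finset ℤ} {a b : Labelling} (h : Bal S a b)
    (hT : ∀ k, k ∉ T → a k = b k) : Bal T a b :=
  ⟨⟨hT, h.act, h.free⟩, by
    classical
    rw [← sum_downInd_mono' hT subset_union_right (T := S ∪ T),
      sum_downInd_mono' h.eq subset_union_left]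
    exact h.total⟩

theorem SameBlock.exists_bal {a b : Weight} (h : SameBlock a b) : ∃ S, Bal S a.lab b.lab := by
  obtain ⟨c, h1, h2⟩ := h
  obtain ⟨S, hS⟩ := exists_dom_of_le h1
  obtain ⟨T, hT⟩ := exists_dom_of_le h2
  have b1 : Bal S a.lab c.lab := ⟨hS.toFinDiff, hS.total⟩
  have b2 : Bal T b.lab c.lab := ⟨hT.toFinDiff, hT.total⟩
  exact ⟨S ∪ T, (b1.mono subset_union_left).trans (b2.mono subset_union_right).symm⟩

theorem cupOr_self (a : Labelling) : CupOr a a := fun _ _ h => Or.inl ⟨h.left, h.right⟩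

/-- A weight above `a` in the sense of `⊂` agrees with `a` on all rays. -/
theorem Weight.Sub.ray_eq {a w : Weight} (h : a.Sub w) {i : ℤ} (hi : ¬ OnCup a.lab i) :
    w.lab i = a.lab i := by
  classical
  obtain ⟨⟨S₀, hb₀⟩, ho⟩ := And.intro h.1.exists_bal h.2
  have hb := hb₀.mono (subset_union_left : S₀ ⊆ S₀ ∪ S₀.image (mate a.lab))
  set S := S₀ ∪ S₀.image (mate a.lab) with hS
  have hmS : ∀ k ∈ S, mate a.lab k ∈ S := by
    intro k hk
    rcases mem_union.1 hk with hk | hk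
    · exact mem_union_right _ (mem_image_of_mem _ hk)
    · obtain ⟨l, hl, rfl⟩ := mem_image.1 hk
      rw [mate_mate]; exact mem_union_left _ hl
  set F : ℤ → ℤ := fun k => downInd a.lab k - downInd w.lab k with hF
  have hcup : ∑ k ∈ S with OnCup a.lab k, F k = 0 := by
    have e : ∑ k ∈ S with OnCup a.lab k, F k = ∑ k ∈ S with OnCup a.lab k, F (mate a.lab k) := by
      refine sum_bij' (fun k _ => mate a.lab k) (fun k _ => mate a.lab k) ?_ ?_
        (fun k _ => mate_mate _ _) (fun k _ => mate_mate _ _) (fun k _ => by rw [mate_mate])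
      all_goals
        intro k hk
        rw [mem_filter] at hk ⊢
        exact ⟨hmS k hk.1, onCup_mate hk.2⟩
    have e' : ∑ k ∈ S with OnCup a.lab k, F (mate a.lab k) =
        - ∑ k ∈ S with OnCup a.lab k, F k := by
      rw [← sum_neg_distrib]
      refine sum_congr rfl fun k hk => ?_
      have hk := (mem_filter.1 hk).2
      have h1 := (cupOr_self a.lab).mate hk
      have h2 := CupOr.mate ho.cup hk
      simp only [hF]
      rcases h1 with ⟨h1, h1'⟩ | ⟨h1, h1'⟩ <;> rcases h2 with ⟨h2, h2'⟩ | ⟨h2, h2'⟩ <;>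
        simp [downInd, h1, h1', h2, h2']
    omega
  have hray : ∑ k ∈ S with ¬ OnCup a.lab k, F k = 0 := by
    have := Finset.sum_filter_add_sum_filter_not S (fun k => OnCup a.lab k) F
    have ht : ∑ k ∈ S, F k = 0 := hb.total
    rw [hcup, ht] at this
    omega
  by_contra hne
  have hact : Act a.lab i := by
    by_contra hc; exact hne (hb.free i hc).symm
  have hiS : i ∈ S.filter fun k => ¬ OnCup a.lab k :=
    mem_filter.2 ⟨by_contra fun hc => hne (hb.eq i hc).symm, hi⟩
  have isR : ∀ k, ¬ OnCup a.lab k → Act a.lab k → IsRay a.lab k := fun k h1 h2 =>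
    isRay_iff.2 ⟨h2, h1⟩
  have bd : ∀ f k, 0 ≤ downInd f k ∧ downInd f k ≤ 1 := by
    intro f k; unfold downInd; split <;> omega
  rcases hact with ha | ha
  · have hw : w.lab i = some .up := ((hb.act i).1 (Or.inl ha)).resolve_left fun hc =>
      hne (hc.trans ha.symm)
    have hnn : ∀ k ∈ S.filter fun k => ¬ OnCup a.lab k, 0 ≤ F k := by
      intro k hk
      have hkr := (mem_filter.1 hk).2
      simp only [hF]
      by_cases hka : Act a.lab k
      swap
      · rw [downInd_congr (hb.free k hka), sub_self]
      rcases lt_trichotomy k i with hlt | rfl | hlt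
      · rcases (hb.act k).1 hka with h1 | h1
        · exact (ho.rays k i (isR k hkr hka) (isR i hi (Or.inl ha)) hlt ⟨h1, hw⟩).elim
        · rw [downInd_up h1, sub_zero]; exact (bd _ _).1
      · rw [downInd_down ha, downInd_up hw]; norm_num
      · rcases hka with h1 | h1
        · rw [downInd_down h1]; have := (bd w.lab k).2; omega
        · exact (no_down_up_rays hi hkr hlt ha h1).elim
    have := (Finset.sum_eq_zero_iff_of_nonneg hnn).1 hray i hiS
    simp only [hF] at this
    rw [downInd_down ha, downInd_up hw] at this
    omega
  · have hw : w.lab i = some .down := ((hb.act i).1 (Or.inr ha)).resolve_right fun hc =>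
      hne (hc.trans ha.symm)
    have hnn : ∀ k ∈ S.filter fun k => ¬ OnCup a.lab k, F k ≤ 0 := by
      intro k hk
      have hkr := (mem_filter.1 hk).2
      simp only [hF]
      by_cases hka : Act a.lab k
      swap
      · rw [downInd_congr (hb.free k hka), sub_self]
      rcases lt_trichotomy k i with hlt | rfl | hlt
      · rcases hka with h1 | h1
        · exact (no_down_up_rays hkr hi hlt h1 ha).elim
        · rw [downInd_up h1]; have := (bd w.lab k).1; omega
      · rw [downInd_up ha, downInd_down hw]; norm_num
      · rcases (hb.act k).1 hka with h1 | h1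
        · rw [downInd_down h1]; have := (bd a.lab k).2; omega
        · exact (ho.rays i k (isR i hi (Or.inr ha)) (isR k hkr hka) hlt ⟨hw, h1⟩).elim
    have := (Finset.sum_eq_zero_iff_of_nonpos hnn).1 hray i hiS
    simp only [hF] at this
    rw [downInd_up ha, downInd_down hw] at this
    omega

/-! ### Truncation -/

/-- The closure of a truncation. -/
def cl (N : ℕ) (f : Labelling) : Labelling := closure (truncate N f)

/-- The window `[-N, N]`. -/
abbrev win (N : ℕ) : Finset ℤ := Finset.Icc (-(N : ℤ)) N

theorem mem_win {N : ℕ} {i : ℤ} : i ∈ win N ↔ |i| ≤ (N : ℤ) := by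
  rw [mem_Icc, abs_le]

theorem mem_core {N : ℕ} {f : Labelling} {i : ℤ} :
    i ∈ vertices (truncate N f) ↔ i ∈ win N ∧ i ∈ vertices f := by
  rw [mem_win]
  unfold truncate vertices
  simp only [mem_ofPred_eq]
  split_ifs with h <;> simp [h]

theorem finite_core (N : ℕ) (f : Labelling) : (vertices (truncate N f)).Finite :=
  (win N).finite_toSet.subset fun _ hi => (mem_core.1 hi).1

theorem ordConnected_core {N : ℕ} {f : Labelling} (hf : (vertices f).OrdConnected) :
    (vertices (truncate N f)).OrdConnected := by
  refine ⟨fun x hx y hy z hz => ?_⟩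
  rw [mem_core] at hx hy ⊢
  rw [mem_Icc] at *
  exact ⟨⟨hx.1.1.trans hz.1, hz.2.trans hy.1.2⟩, hf.out hx.2 hy.2 hz⟩

theorem truncate_of_mem {N : ℕ} {f : Labelling} {i : ℤ} (hi : i ∈ win N) : truncate N f i = f i :=
  if_pos (mem_win.1 hi)

theorem cl_core {N : ℕ} {f : Labelling} {i : ℤ} (hi : i ∈ vertices (truncate N f)) :
    cl N f i = f i := by
  unfold cl; rw [closure_of_mem hi, truncate_of_mem (mem_core.1 hi).1]

theorem truncate_eq_some {N : ℕ} {f : Labelling} {i : ℤ} {l : Label} :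
    truncate N f i = some l ↔ i ∈ win N ∧ f i = some l := by
  rw [mem_win]
  unfold truncate
  split_ifs with h <;> simp [h]

theorem ncard_truncate (N : ℕ) (f : Labelling) (l : Label) :
    {k | truncate N f k = some l}.ncard = ((win N).filter fun k => f k = some l).card := by
  rw [← ncard_coe_finset]
  congr 1
  ext k
  simp only [mem_ofPred_eq, truncate_eq_some, coe_filter]

section Near

variable {N : ℕ} {f g : Labelling}

theorem Bal.core_eq (h : Bal (win N) f g) : vertices (truncate N f) = vertices (truncate N g) := by
  ext i; rw [mem_core, mem_core, vertices_eq_of_finDiff h.toFinDiff]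

theorem Bal.ncard_down (h : Bal (win N) f g) :
    {k | truncate N f k = some .down}.ncard = {k | truncate N g k = some .down}.ncard := by
  have e : ∀ f : Labelling, (((win N).filter fun k => f k = some .down).card : ℤ) =
      ∑ k ∈ win N, downInd f k := by
    intro f
    rw [card_filter]
    push_cast
    refine sum_congr rfl fun k _ => ?_
    unfold downInd
    split <;> simp_all
  have := h.total
  rw [sum_sub_distrib, ← e, ← e] at this
  rw [ncard_truncate, ncard_truncate]
  omega

theorem Bal.ncard_up (h : Bal (win N) f g) :
    {k | truncate N f k = some .up}.ncard = {k | truncate N g k = some .up}.ncard := by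
  classical
  have e : ∀ f : Labelling, ((win N).filter fun k => f k = some .down).card +
      ((win N).filter fun k => f k = some .up).card = ((win N).filter (Act f)).card := by
    intro f
    rw [← Finset.card_union_of_disjoint, ← Finset.filter_or]
    · congr 1; ext; simp [Act]
    · rw [Finset.disjoint_filter]
      intro k _ h1 h2
      rw [h1] at h2; cases h2
  have e1 := e f
  have e2 := e g
  have hd := h.ncard_down
  rw [ncard_truncate, ncard_truncate] at *
  rw [filter_congr fun k _ => h.act k] at e1
  omega

theorem Bal.newLeft_eq (h : Bal (win N) f g) : newLeft (truncate N f) = newLeft (truncate N g) := by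
  unfold newLeft; rw [h.core_eq, h.ncard_up]

theorem Bal.newRight_eq (h : Bal (win N) f g) :
    newRight (truncate N f) = newRight (truncate N g) := by
  unfold newRight; rw [h.core_eq, h.ncard_down]

theorem Bal.cl_eq (h : Bal (win N) f g) {i : ℤ} (hi : i ∉ vertices (truncate N f)) :
    cl N f i = cl N g i := by
  unfold cl
  by_cases h1 : i ∈ newLeft (truncate N f)
  · rw [closure_newLeft (finite_core N f) h1, closure_newLeft (finite_core N g) (h.newLeft_eq ▸ h1)]
  by_cases h2 : i ∈ newRight (truncate N f)
  · rw [closure_newRight (finite_core N f) h2,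
      closure_newRight (finite_core N g) (h.newRight_eq ▸ h2)]
  rw [closure_cases i hi h1 h2,
    closure_cases i (h.core_eq ▸ hi) (h.newLeft_eq ▸ h1) (h.newRight_eq ▸ h2)]

theorem Bal.cl_act (h : Bal (win N) f g) (i : ℤ) : Act (cl N f) i ↔ Act (cl N g) i := by
  by_cases hi : i ∈ vertices (truncate N f)
  · unfold Act
    rw [cl_core hi, cl_core (h.core_eq ▸ hi)]
    exact h.act i
  · unfold Act; rw [h.cl_eq hi]

end Near

theorem finite_act_cl (N : ℕ) (f : Labelling) : {i | Act (cl N f) i}.Finite :=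
  (finite_vertices_closure (finite_core N f)).subset fun _ hi => Act.vertex hi

/-- The active vertices of the closure. -/
def actives (N : ℕ) (f : Labelling) : Finset ℤ := (finite_act_cl N f).toFinset

theorem mem_actives {N : ℕ} {f : Labelling} {i : ℤ} : i ∈ actives N f ↔ Act (cl N f) i := by
  simp [actives]

theorem Bal.closed {N : ℕ} {f g : Labelling} (h : Bal (win N) f g) :
    Closed (actives N f) (cl N g) where
  onCup i := by
    rw [mem_actives, h.cl_act]
    exact ⟨OnCup.act, onCup_closure (finite_core N g)⟩

/-! ### Signs -/

open Classical in
/-- Some vertex. -/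
def base (f : Labelling) : ℤ := if h : (vertices f).Nonempty then h.choose else 0

theorem base_mem {f : Labelling} {i : ℤ} (hi : i ∈ vertices f) : base f ∈ vertices f := by
  unfold base; rw [dif_pos ⟨i, hi⟩]; exact Set.Nonempty.some_mem _

/-- A sign alternating along the active vertices. -/
def psign (f : Labelling) (i : ℤ) : ℤ :=
  (-1) ^ {k | Act f k ∧ ((base f ≤ k ∧ k < i) ∨ (i ≤ k ∧ k < base f))}.ncard

theorem psign_congr {f g : Labelling} (h : ∀ i, Act f i ↔ Act g i) (hv : vertices f = vertices g) :
    psign f = psign g := by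
  have hb : base f = base g := by
    unfold base
    revert hv
    generalize vertices f = S
    generalize vertices g = T
    rintro rfl
    rfl
  funext i
  unfold psign
  simp only [h, hb]

theorem rankSign_eq (C : Finset ℤ) (v : ℤ) : rankSign C v = 1 ∨ rankSign C v = -1 := by
  unfold rankSign; exact neg_one_pow_eq_or ℤ _

/-- The sign alternating along the active vertices of the closure. -/
def winSign (N : ℕ) (f : Labelling) (i : ℤ) : ℤ :=
  rankSign (actives N f) (base f) * rankSign (actives N f) i

theorem rankSign_mul {C : Finset ℤ} {x y : ℤ} (hxy : x ≤ y) :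
    rankSign C x * rankSign C y = (-1) ^ (C.filter fun k => x ≤ k ∧ k < y).card := by
  classical
  unfold rankSign
  have e : C.filter (· < y) = C.filter (· < x) ∪ C.filter fun k => x ≤ k ∧ k < y := by
    ext k; simp only [mem_filter, mem_union]
    constructor
    · rintro ⟨h1, h2⟩
      by_cases h3 : k < x
      · exact Or.inl ⟨h1, h3⟩
      · exact Or.inr ⟨h1, not_lt.1 h3, h2⟩
    · rintro (⟨h1, h2⟩ | ⟨h1, h2⟩)
      · exact ⟨h1, h2.trans_le hxy⟩
      · exact ⟨h1, h2.2⟩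
  rw [e, Finset.card_union_of_disjoint, pow_add, ← mul_assoc, ← pow_add, ← two_mul,
    Even.neg_one_pow ⟨_, two_mul _⟩, one_mul]
  rw [Finset.disjoint_filter]
  intro k _ h1 h2
  omega

theorem winSign_eq {N : ℕ} {f : Labelling} (hc : (vertices f).OrdConnected) (hb : base f ∈ win N)
    {i : ℤ} (hi : i ∈ vertices (truncate N f)) : winSign N f i = psign f i := by
  have hbc : base f ∈ vertices (truncate N f) :=
    mem_core.2 ⟨hb, base_mem (mem_core.1 hi).2⟩
  have key : ∀ x ∈ vertices (truncate N f), ∀ y ∈ vertices (truncate N f),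
      ((actives N f).filter fun k => x ≤ k ∧ k < y).card =
        {k | Act f k ∧ x ≤ k ∧ k < y}.ncard := by
    intro x hx y hy
    rw [← ncard_coe_finset]
    congr 1
    ext k
    simp only [coe_filter, mem_actives, mem_ofPred_eq]
    refine and_congr_left fun hk => ?_
    have hk' := (ordConnected_core hc).out hx hy ⟨hk.1, hk.2.le⟩
    unfold Act
    rw [cl_core hk']
  unfold winSign psign
  rcases le_total (base f) i with h | h
  · rw [rankSign_mul h, key _ hbc _ hi]
    congr 2
    ext k
    simp only [mem_ofPred_eq]
    refine and_congr_right fun _ => ⟨Or.inl, fun h' => h'.resolve_right fun h'' => by omega⟩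
  · rw [mul_comm, rankSign_mul h, key _ hi _ hbc]
    congr 2
    ext k
    simp only [mem_ofPred_eq]
    refine and_congr_right fun _ => ⟨Or.inr, fun h' => h'.resolve_left fun h'' => by omega⟩

/-- The labelling `a` defines a cup diagram with all cups inside of the window; the labelling
`f` is a reference point in its block. -/
structure Fits (N : ℕ) (f a : Labelling) : Prop where
  bal : Bal (win N) f a
  cups : ∀ i, OnCup a i → i ∈ win N
  conn : (vertices a).OrdConnected
  base_mem : base f ∈ win N

theorem Fits.setup {N : ℕ} {f a b d : Labelling} (ha : Fits N f a) (hb : Fits N f b)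
    (hd : Fits N f d) : Setup (actives N f) (winSign N f) (cl N a) (cl N b) (cl N d) where
  ca := ha.bal.closed
  cb := hb.bal.closed
  cd := hd.bal.closed
  sq i := by
    unfold winSign
    rcases rankSign_eq (actives N f) (base f) with h | h <;>
      rcases rankSign_eq (actives N f) i with h' | h' <;> simp [h, h']
  fa i hi := by unfold winSign; rw [ha.bal.closed.matching.rankSign_flip hi]; ring
  fb i hi := by unfold winSign; rw [hb.bal.closed.matching.rankSign_flip hi]; ring
  fd i hi := by unfold winSign; rw [hd.bal.closed.matching.rankSign_flip hi]; ring

section Fits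

variable {N : ℕ} {f a b d : Labelling}

theorem Fits.core_eq (ha : Fits N f a) : vertices (truncate N a) = vertices (truncate N f) :=
  ha.bal.core_eq.symm

theorem Fits.core (ha : Fits N f a) {i : ℤ} (hi : OnCup a i) : i ∈ vertices (truncate N f) := by
  rw [← ha.core_eq]
  exact mem_core.2 ⟨ha.cups i hi, hi.act.vertex⟩

theorem Fits.isCup_cl (ha : Fits N f a) {i j : ℤ} (hi : i ∈ vertices (truncate N f))
    (hj : j ∈ vertices (truncate N f)) : IsCup (cl N a) i j ↔ IsCup a i j := by
  rw [← ha.core_eq] at hi hj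
  exact isCup_congr fun k h1 h2 => cl_core ((ordConnected_core ha.conn).out hi hj ⟨h1, h2⟩)

theorem Fits.cup_cl (ha : Fits N f a) {i j : ℤ} (h : IsCup a i j) : IsCup (cl N a) i j :=
  (ha.isCup_cl (ha.core ⟨j, Or.inl h⟩) (ha.core ⟨i, Or.inr h⟩)).2 h

theorem Fits.mate_cl (ha : Fits N f a) {i : ℤ} (hi : OnCup a i) : mate (cl N a) i = mate a i :=
  mate_eq ((mate_spec hi).imp ha.cup_cl ha.cup_cl)

theorem Fits.onCup_cl (ha : Fits N f a) {i : ℤ} (hi : OnCup a i) : OnCup (cl N a) i := by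
  obtain ⟨j, h⟩ := hi
  exact ⟨j, h.imp ha.cup_cl ha.cup_cl⟩

theorem Fits.vertex_cl (ha : Fits N f a) {i : ℤ} (hi : i ∈ vertices (cl N a)) :
    i ∈ vertices (truncate N f) ∨ i ∈ newLeft (truncate N f) ∨ i ∈ newRight (truncate N f) := by
  have := (mem_vertices_closure (finite_core N a)).1 hi
  rwa [ha.core_eq, ← ha.bal.newLeft_eq, ← ha.bal.newRight_eq] at this

theorem Bal.cl_newLeft {w : Labelling} (h : Bal (win N) f w) {i : ℤ}
    (hi : i ∈ newLeft (truncate N f)) : cl N w i = some .down :=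
  closure_newLeft (finite_core N w) (h.newLeft_eq ▸ hi)

theorem Bal.cl_newRight {w : Labelling} (h : Bal (win N) f w) {i : ℤ}
    (hi : i ∈ newRight (truncate N f)) : cl N w i = some .up :=
  closure_newRight (finite_core N w) (h.newRight_eq ▸ hi)

theorem Bal.cl_core' {w : Labelling} (h : Bal (win N) f w) {i : ℤ}
    (hi : i ∈ vertices (truncate N f)) : cl N w i = w i := cl_core (h.core_eq ▸ hi)

theorem Fits.cup_cases (ha : Fits N f a) {i j : ℤ} (h : IsCup (cl N a) i j) :
    IsCup a i j ∨
    (i ∈ newLeft (truncate N f) ∧ j ∈ newRight (truncate N f)) ∨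
    (i ∈ newLeft (truncate N f) ∧ j ∈ vertices (truncate N f) ∧ ¬ OnCup a j ∧ a j = some .up) ∨
    (i ∈ vertices (truncate N f) ∧ ¬ OnCup a i ∧ a i = some .down ∧ j ∈ newRight (truncate N f)) := by
  rcases ha.vertex_cl (Act.vertex (Or.inl h.left)) with hi | hi | hi
  · rcases ha.vertex_cl (Act.vertex (Or.inr h.right)) with hj | hj | hj
    · exact Or.inl ((ha.isCup_cl hi hj).1 h)
    · have := h.right
      rw [ha.bal.cl_newLeft hj] at this; cases this
    · refine Or.inr (Or.inr (Or.inr ⟨hi, fun hc => ?_, ?_, hj⟩))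
      · have e := ha.mate_cl hc
        rw [mate_eq (Or.inl h)] at e
        have := ha.core (onCup_mate hc)
        rw [← e] at this
        exact (lt_newRight (finite_core N f) hj this).false
      · rw [← ha.bal.cl_core' hi]; exact h.left
  · rcases ha.vertex_cl (Act.vertex (Or.inr h.right)) with hj | hj | hj
    · refine Or.inr (Or.inr (Or.inl ⟨hi, hj, fun hc => ?_, ?_⟩))
      · have e := ha.mate_cl hc
        rw [mate_eq (Or.inr h)] at e
        have := ha.core (onCup_mate hc)
        rw [← e] at this
        exact (newLeft_lt (finite_core N f) hi this).false
      · rw [← ha.bal.cl_core' hj]; exact h.right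
    · have := h.right
      rw [ha.bal.cl_newLeft hj] at this; cases this
    · exact Or.inr (Or.inl ⟨hi, hj⟩)
  · have := h.left
    rw [ha.bal.cl_newRight hi] at this; cases this

/-- Clockwise circles in the closure do not contain new vertices. -/
theorem core_of_cw (ha : Fits N f a) (hd : Fits N f d) {w : Labelling} (hw : Bal (win N) f w)
    (hwa : CupOr (cl N a) (cl N w)) (hwd : CupOr (cl N d) (cl N w)) {m k : ℤ}
    (hm : m ∈ cw (cl N a) (cl N d) (cl N w)) (hk : Conn (cl N a) (cl N d) m k) :
    k ∈ vertices (truncate N f) := by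
  classical
  obtain ⟨hr, hu⟩ := hm
  set E := actives N f
  have hA := ha.bal.closed
  have hD := hd.bal.closed
  have hmE : m ∈ E := (hA.onCup m).1 (hr m (.refl _)).2.1
  have hv : ∀ k, Conn (cl N a) (cl N d) m k → _ := fun k hk =>
    ha.vertex_cl (hr k hk).2.1.act.vertex
  have hmc : m ∈ vertices (truncate N f) := by
    rcases hv m (.refl _) with h | h | h
    · exact h
    · rw [hw.cl_newLeft h] at hu; cases hu
    · have hle := (hr _ (conn_mate_left _ _ m)).1
      have hon := (hr m (.refl _)).2.1
      have := (isCup_mate hon (hle.lt_of_ne (mate_ne hon).symm)).left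
      rw [ha.bal.cl_newRight h] at this; cases this
  rcases hv k hk with h | h | h
  · exact h
  · exact absurd (newLeft_lt (finite_core N f) h hmc) (not_lt.2 (hr k hk).1)
  · exfalso
    have hC : ∀ k, k ∈ E.filter (Conn (cl N a) (cl N d) m) ↔ Conn (cl N a) (cl N d) m k :=
      fun k => by
        rw [mem_filter, and_iff_right_iff_imp]
        exact fun h => (hA.conn_mem hD h).1 hmE
    have hne : (E.filter (Conn (cl N a) (cl N d) m)).Nonempty := ⟨k, (hC k).2 hk⟩
    set M := (E.filter (Conn (cl N a) (cl N d) m)).max' hne with hM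
    have hMC := max'_mem _ hne
    have hkM : k ≤ M := le_max' _ _ ((hC k).2 hk)
    have hMr : M ∈ newRight (truncate N f) := by
      rcases hv M ((hC M).1 hMC) with h' | h' | h'
      · exact absurd (lt_newRight (finite_core N f) h h') (not_lt.2 hkM)
      · exact absurd (newLeft_lt (finite_core N f) h' hmc)
          (not_lt.2 (hr M ((hC M).1 hMC)).1)
      · exact h'
    set lam : ℤ → ℤ := fun v => if cl N w v = some .down then 1 else -1 with hlam
    have flip : ∀ a, (∀ x ∈ E, OnCup a x) → CupOr a (cl N w) → ∀ x ∈ E, lam (mate a x) = - lam x := by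
      intro a ha hfa x hx
      rcases hfa.mate (ha x hx) with ⟨h1, h2⟩ | ⟨h1, h2⟩ <;> simp [hlam, h1, h2]
    have hCE : ∀ x ∈ E.filter (Conn (cl N a) (cl N d) m), x ∈ E := fun x hx =>
      (mem_filter.1 hx).1
    have := label_max (lam := lam) (component_matching hC fun k hk => (hA.onCup k).2 (hCE k hk))
      (component_matching (a := cl N d) (b := cl N a) (m := m) (fun k => (hC k).trans conn_comm)
        fun k hk => (hD.onCup k).2 (hCE k hk))
      (component_connected hC)
      (fun x hx => flip _ (fun x => (hA.onCup x).2) hwa x (hCE x hx))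
      (fun x hx => flip _ (fun x => (hD.onCup x).2) hwd x (hCE x hx))
      ((hC m).2 (.refl _)) (fun x hx => (hr x ((hC x).1 hx)).1) hMC
      (fun x hx => le_max' _ _ hx)
    rw [← hM] at this
    simp [hlam, hu, hw.cl_newRight hMr] at this

theorem Fits.mate_of_core (ha : Fits N f a) {i : ℤ} (hi : OnCup (cl N a) i)
    (h1 : i ∈ vertices (truncate N f)) (h2 : mate (cl N a) i ∈ vertices (truncate N f)) :
    OnCup a i ∧ mate a i = mate (cl N a) i := by
  have : IsCup a i (mate (cl N a) i) ∨ IsCup a (mate (cl N a) i) i :=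
    (mate_spec hi).imp (ha.isCup_cl h1 h2).1 (ha.isCup_cl h2 h1).1
  exact ⟨⟨_, this⟩, mate_eq this⟩

theorem cw_cl (ha : Fits N f a) (hd : Fits N f d) {w : Labelling} (hw : Bal (win N) f w)
    (hwa : CupOr (cl N a) (cl N w)) (hwd : CupOr (cl N d) (cl N w)) :
    cw (cl N a) (cl N d) (cl N w) = cw a d w := by
  ext m
  constructor
  · intro hm
    have hcore := fun k => core_of_cw ha hd hw hwa hwd hm (k := k)
    obtain ⟨hr, hu⟩ := hm
    have on : ∀ k, Conn (cl N a) (cl N d) m k → OnCup a k ∧ OnCup d k := fun k hk =>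
      ⟨(ha.mate_of_core (hr k hk).2.1 (hcore k hk)
        (hcore _ (hk.trans _ _ _ (conn_mate_left _ _ k)))).1,
      (hd.mate_of_core (hr k hk).2.2 (hcore k hk)
        (hcore _ (hk.trans _ _ _ (conn_mate_right _ _ k)))).1⟩
    refine ⟨fun k hk => ?_, ?_⟩
    · have hk' : Conn (cl N a) (cl N d) m k := by
        clear on hcore hu hr
        induction hk with
        | rel x y h => exact .rel _ _ (h.imp ha.cup_cl hd.cup_cl)
        | refl => exact .refl _
        | symm _ _ _ ih => exact ih.symm
        | trans _ _ _ _ _ h1 h2 => exact h1.trans _ _ _ h2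
      exact ⟨(hr k hk').1, on k hk'⟩
    · rw [← hw.cl_core' (hcore m (.refl _))]; exact hu
  · rintro ⟨hr, hu⟩
    have hconn : ∀ k, Conn (cl N a) (cl N d) m k → Conn a d m k := by
      intro k hk
      refine (Conn.mate_closed (q := fun k => Conn a d m k) (fun i hi => ?_) (fun i hi => ?_) hk).1
        (.refl _)
      · rw [ha.mate_cl (hr i hi).2.1]; exact hi.trans _ _ _ (conn_mate_left _ _ i)
      · rw [hd.mate_cl (hr i hi).2.2]; exact hi.trans _ _ _ (conn_mate_right _ _ i)
    refine ⟨fun k hk => ?_, ?_⟩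
    · obtain ⟨h1, h2, h3⟩ := hr k (hconn k hk)
      exact ⟨h1, ha.onCup_cl h2, hd.onCup_cl h3⟩
    · rw [hw.cl_core' (ha.core (hr m (.refl _)).2.1)]; exact hu

theorem sum_eq_of_inter {S T : Finset ℤ} {F G : ℤ → ℤ} (h : ∀ i ∈ S, i ∈ T → F i = G i)
    (hF : ∀ i ∈ S, i ∉ T → F i = 0) (hG : ∀ i ∈ T, i ∉ S → G i = 0) :
    ∑ i ∈ S, F i = ∑ i ∈ T, G i := by
  classical
  rw [← sum_subset (Finset.inter_subset_left (s₁ := S) (s₂ := T)),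
    ← sum_subset (Finset.inter_subset_right (s₁ := S) (s₂ := T))]
  · exact sum_congr rfl fun i hi =>
      h i (mem_inter.1 hi).1 (mem_inter.1 hi).2
  · exact fun i hi hn => hG i hi fun hc => hn (mem_inter.2 ⟨hc, hi⟩)
  · exact fun i hi hn => hF i hi fun hc => hn (mem_inter.2 ⟨hi, hc⟩)

theorem dom_of_closure {z w : Labelling} (hz : Bal (win N) f z) (hw : Bal (win N) f w)
    (h : ∀ i, 0 ≤ ∑ k ∈ actives N f with k ≤ i, (downInd (cl N z) k - downInd (cl N w) k)) :
    Dom (win N) z w where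
  toFinDiff := (hz.symm.trans hw).toFinDiff
  total := (hz.symm.trans hw).total
  prefix_nonneg i := by
    refine (h i).trans_eq ?_
    rw [sum_filter, sum_filter, eq_comm]
    have hzw := hz.symm.trans hw
    have off : ∀ k, k ∉ vertices (truncate N f) → downInd (cl N z) k - downInd (cl N w) k = 0 :=
      fun k hk => by rw [downInd_congr (hzw.cl_eq (hz.core_eq ▸ hk)), sub_self]
    have on : ∀ k, k ∈ vertices (truncate N f) → downInd (cl N z) k - downInd (cl N w) k =
        downInd z k - downInd w k := fun k hk => by
      rw [downInd_congr (hz.cl_core' hk), downInd_congr (hw.cl_core' hk)]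
    refine sum_eq_of_inter (fun k hk hkE => ?_) (fun k hk hkE => ?_) fun k hk hkE => ?_
    · by_cases hc : k ∈ vertices (truncate N f)
      · rw [on k hc]
      · have : z k = w k := hzw.free k fun hact => hc (by
          rw [hz.core_eq]; exact mem_core.2 ⟨hk, hact.vertex⟩)
        rw [off k hc, downInd_congr this, sub_self]
    · have : z k = w k := hzw.free k fun hact => hkE (by
        rw [mem_actives, hz.cl_act]
        unfold Act
        rw [cl_core (mem_core.2 ⟨hk, hact.vertex⟩)]
        exact hact)
      rw [downInd_congr this, sub_self, ite_self]
    · rw [off k fun hc => hkE (mem_core.1 hc).1, ite_self]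

theorem Fits.bal_of_sub {a w : Weight} (ha : Fits N f a.lab) (h : a.Sub w) :
    Bal (win N) f w.lab := by
  obtain ⟨S, hS⟩ := h.1.exists_bal
  exact ha.bal.trans (hS.shrink fun k hk => (h.ray_eq fun hc => hk (ha.cups k hc)).symm)

theorem Fits.cupOr_of_sub {a w : Weight} (ha : Fits N f a.lab) (h : a.Sub w) :
    CupOr (cl N a.lab) (cl N w.lab) := by
  have hw := ha.bal_of_sub h
  intro i j hij
  rcases ha.cup_cases hij with hc | ⟨hi, hj⟩ | ⟨hi, hj, hr, hu⟩ | ⟨hi, hr, hu, hj⟩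
  · rw [hw.cl_core' (ha.core ⟨j, Or.inl hc⟩), hw.cl_core' (ha.core ⟨i, Or.inr hc⟩)]
    exact h.2.cup i j hc
  · exact Or.inl ⟨hw.cl_newLeft hi, hw.cl_newRight hj⟩
  · exact Or.inl ⟨hw.cl_newLeft hi, by rw [hw.cl_core' hj, h.ray_eq hr, hu]⟩
  · exact Or.inl ⟨by rw [hw.cl_core' hi, h.ray_eq hr, hu], hw.cl_newRight hj⟩

theorem cw_self (a : Labelling) : cw a a a = ∅ := by
  ext m
  simp only [cw, mem_ofPred_eq, Set.mem_empty_iff_false, iff_false, not_and]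
  intro hr hu
  obtain ⟨hle, hon, _⟩ := hr _ (conn_mate_left a a m)
  have hm := (hr m (.refl _)).2.1
  have := (isCup_mate hm (hle.lt_of_ne (mate_ne hm).symm)).left
  rw [hu] at this; cases this

theorem Fits.sub_of_cupOr {a w : Weight} (ha : Fits N f a.lab) (hw : Bal (win N) f w.lab)
    (h : CupOr (cl N a.lab) (cl N w.lab)) : a.Sub w := by
  have hA := ha.bal.closed
  have haw := ha.bal.symm.trans hw
  have hdom := dom_of_closure ha.bal hw (hA.dominance hA (cupOr_self _) (cupOr_self _) h h (by
    rw [cw_self]; exact Set.empty_subset _)).1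
  have ray : ∀ i, Act a.lab i → ¬ OnCup a.lab i → w.lab i = a.lab i := by
    intro i hi hr
    by_cases hc : i ∈ vertices (truncate N f)
    swap
    · exact (haw.eq i fun hw => hc (by rw [ha.bal.core_eq]; exact mem_core.2 ⟨hw, hi.vertex⟩)).symm
    have hon : OnCup (cl N a.lab) i := by
      rw [hA.onCup, mem_actives, ha.bal.cl_act]
      unfold Act
      rw [ha.bal.cl_core' hc]
      exact hi
    rw [← hw.cl_core' hc]
    rcases mate_spec hon with hij | hij
    · rcases ha.cup_cases hij with h' | ⟨h', _⟩ | ⟨h', _⟩ | ⟨_, _, h1, h2⟩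
      · exact (hr ⟨_, Or.inl h'⟩).elim
      · exact ((newLeft_lt (finite_core N f) h' hc).false).elim
      · exact ((newLeft_lt (finite_core N f) h' hc).false).elim
      · rcases h _ _ hij with ⟨h3, _⟩ | ⟨_, h3⟩
        · rw [h3, h1]
        · rw [hw.cl_newRight h2] at h3; cases h3
    · rcases ha.cup_cases hij with h' | ⟨_, h'⟩ | ⟨h1, _, _, h2⟩ | ⟨_, _, _, h'⟩
      · exact (hr ⟨_, Or.inr h'⟩).elim
      · exact ((lt_newRight (finite_core N f) h' hc).false).elim
      · rcases h _ _ hij with ⟨_, h3⟩ | ⟨h3, _⟩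
        · rw [h3, h2]
        · rw [hw.cl_newLeft h1] at h3; cases h3
      · exact ((lt_newRight (finite_core N f) h' hc).false).elim
  refine ⟨⟨w, le_of_dom hdom, le_rfl⟩, vertices_eq_of_finDiff haw.toFinDiff, fun i hi => ?_,
    fun i j hij => ?_, fun i hi => ?_, fun i j hi hj hij hc => ?_⟩
  · rw [← haw.free i (by rintro (h | h) <;> rcases hi with hi | hi <;> rw [hi] at h <;> cases h)]
    exact hi
  · have := h i j (ha.cup_cl hij)
    rwa [hw.cl_core' (ha.core ⟨j, Or.inl hij⟩), hw.cl_core' (ha.core ⟨i, Or.inr hij⟩)] at this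
  · exact (haw.act i).1 hi.1
  · rw [isRay_iff] at hi hj
    rw [ray i hi.1 hi.2, ray j hj.1 hj.2] at hc
    exact no_down_up_rays hi.2 hj.2 hij hc.1 hc.2

theorem Fits.cwCups_cl {a w : Weight} (ha : Fits N f a.lab) (h : a.Sub w) :
    cwCups (cl N a.lab) (cl N w.lab) = cwCups a.lab w.lab := by
  have hw := ha.bal_of_sub h
  ext i
  constructor
  · rintro ⟨⟨j, hij⟩, hu⟩
    rcases ha.cup_cases hij with hc | ⟨hi, hj⟩ | ⟨hi, hj, hr, _⟩ | ⟨hi, hr, hd, hj⟩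
    · rw [hw.cl_core' (ha.core ⟨j, Or.inl hc⟩)] at hu
      exact ⟨⟨j, hc⟩, hu⟩
    · rw [hw.cl_newLeft hi] at hu; cases hu
    · rw [hw.cl_newLeft hi] at hu; cases hu
    · rw [hw.cl_core' hi, h.ray_eq hr, hd] at hu; cases hu
  · rintro ⟨⟨j, hij⟩, hu⟩
    exact ⟨⟨j, ha.cup_cl hij⟩, by rw [hw.cl_core' (ha.core ⟨j, Or.inl hij⟩)]; exact hu⟩

theorem cupDegree_eq (a w : Weight) : cupDegree a w = (cwCups a.lab w.lab).ncard := by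
  have e : cwCups a.lab w.lab =
      Prod.fst '' {p : ℤ × ℤ | IsCup a.lab p.1 p.2 ∧ w.lab p.1 = some .up} := by
    ext i
    constructor
    · rintro ⟨⟨j, hj⟩, hu⟩; exact ⟨(i, j), ⟨hj, hu⟩, rfl⟩
    · rintro ⟨⟨i, j⟩, ⟨hj, hu⟩, rfl⟩; exact ⟨⟨j, hj⟩, hu⟩
  rw [e, Set.InjOn.ncard_image]
  · rfl
  · rintro ⟨i, j⟩ ⟨h1, _⟩ ⟨i', j'⟩ ⟨h2, _⟩ h
    dsimp only at h h1 h2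
    subst h
    rw [h1.right_unique h2]

/-- An orientation of the closure with all clockwise circles among those of the closure of a
weight is itself the closure of a weight. -/
theorem exists_weight_of_labs {w s : Weight} (ha : Fits N f a) (hd : Fits N f d)
    (hw : Bal (win N) f w.lab) (hs : Bal (win N) f s.lab) (hwa : CupOr (cl N a) (cl N w.lab))
    (hwd : CupOr (cl N d) (cl N w.lab)) (hsa : CupOr (cl N a) (cl N s.lab)) {k : Labelling}
    (hka : CupOr (cl N a) k) (hkd : CupOr (cl N d) k)
    (hoff : ∀ i, i ∉ actives N f → k i = cl N s.lab i)
    (hcw : cw (cl N a) (cl N d) k ⊆ cw (cl N a) (cl N d) (cl N w.lab)) :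
    ∃ z : Weight, Bal (win N) f z.lab ∧ k = cl N z.lab := by
  classical
  have hA := ha.bal.closed
  have hD := hd.bal.closed
  have hk : ∀ i, i ∉ vertices (truncate N f) → k i = cl N s.lab i := by
    intro i hi
    by_cases hiE : i ∈ actives N f
    swap
    · exact hoff i hiE
    obtain ⟨m, hmE, hmr, hmc⟩ := hA.exists_root hD hiE
    have hkw : k m = cl N w.lab m := by
      rcases hka.act hA hmE with h1 | h1 <;> rcases hwa.act hA hmE with h2 | h2
      · rw [h1, h2]
      · exact (hi (core_of_cw ha hd hw hwa hwd ⟨hmr, h2⟩ hmc)).elim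
      · exact (hcw ⟨hmr, h1⟩).2.symm ▸ h1
      · rw [h1, h2]
    rw [(agree_of_conn hka hkd hwa hwd hmc).1 hkw, ← hw.cl_eq hi, hs.cl_eq hi]
  let z : Labelling := fun i => if i ∈ vertices (truncate N f) then k i else s.lab i
  have hzin : ∀ i ∈ vertices (truncate N f), z i = k i := fun i hi => if_pos hi
  have hzout : ∀ i, i ∉ vertices (truncate N f) → z i = s.lab i := fun i hi => if_neg hi
  have hactE : ∀ i ∈ vertices (truncate N f), (Act s.lab i ↔ i ∈ actives N f) := by
    intro i hi
    rw [mem_actives, hs.cl_act]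
    unfold Act
    rw [hs.cl_core' hi]
  have hnE : ∀ i ∈ vertices (truncate N f), i ∉ actives N f → k i = s.lab i := fun i hi hiE => by
    rw [hoff i hiE, hs.cl_core' hi]
  have hfd : FinDiff (win N) s.lab z := by
    refine ⟨fun i hi => (hzout i fun hc => hi (mem_core.1 hc).1).symm, fun i => ?_, fun i hi => ?_⟩
    · by_cases hc : i ∈ vertices (truncate N f)
      · unfold Act
        rw [hzin i hc]
        by_cases hiE : i ∈ actives N f
        · exact iff_of_true ((hactE i hc).2 hiE) (hka.act hA hiE)
        · rw [hnE i hc hiE]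
      · unfold Act; rw [hzout i hc]
    · by_cases hc : i ∈ vertices (truncate N f)
      · rw [hzin i hc, hnE i hc fun hiE => hi ((hactE i hc).2 hiE)]
      · rw [hzout i hc]
  have htot : ∑ i ∈ win N, (downInd s.lab i - downInd z i) = 0 := by
    have e : ∑ i ∈ actives N f, (downInd (cl N s.lab) i - downInd k i) = 0 := by
      refine hA.matching.sum_eq_zero fun x hx => ?_
      rcases hsa.mate ((hA.onCup x).2 hx) with ⟨h1, h2⟩ | ⟨h1, h2⟩ <;>
        rcases hka.mate ((hA.onCup x).2 hx) with ⟨h3, h4⟩ | ⟨h3, h4⟩ <;>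
          simp [downInd, h1, h2, h3, h4]
    rw [← e]
    refine sum_eq_of_inter (fun i hi hiE => ?_) (fun i hi hiE => ?_) fun i hi hiE => ?_
    · by_cases hc : i ∈ vertices (truncate N f)
      · rw [downInd_congr (hzin i hc), downInd_congr (hs.cl_core' hc)]
      · rw [downInd_congr (hzout i hc), downInd_congr (hk i hc), sub_self, sub_self]
    · by_cases hc : i ∈ vertices (truncate N f)
      · rw [downInd_congr ((hzin i hc).trans (hnE i hc hiE)), sub_self]
      · rw [downInd_congr (hzout i hc), sub_self]
    · rw [downInd_congr (hk i fun hc => hiE (mem_core.1 hc).1), sub_self]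
  have hb : Bal (win N) s.lab z := ⟨hfd, htot⟩
  refine ⟨s.modify z (win N) hfd, hs.trans hb, ?_⟩
  funext i
  by_cases hc : i ∈ vertices (truncate N f)
  · rw [(hs.trans hb : Bal (win N) f (s.modify z (win N) hfd).lab).cl_core' hc]
    exact (hzin i hc).symm
  · rw [hk i hc]
    exact hb.cl_eq (hs.core_eq ▸ hc)

end Fits

/-! ## Evaluation of oriented circle diagrams -/

theorem Weight.Sub.refl (a : Weight) : a.Sub a where
  left := ⟨a, le_rfl, le_rfl⟩
  right := {
    line := rfl
    free := fun _ => id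
    cup := cupOr_self _
    ray := fun _ h => h.1
    rays := fun _ _ hi hj hij h =>
      no_down_up_rays (isRay_iff.1 hi).2 (isRay_iff.1 hj).2 hij h.1 h.2 }

open Classical in
/-- The value at `w` of the oriented circle diagram `(a s b)`. -/
def gval (a b s w : Weight) : ℚ :=
  if a.Sub w ∧ b.Sub w then circleVal (psign w.lab) a.lab b.lab s.lab w.lab else 0

/-- The value at `w` of the cap-cup pairs formed by `b`. -/
def hval (b w : Weight) : ℚ := cupVal (psign w.lab) b.lab w.lab

theorem psign_ne_zero (f : Labelling) (i : ℤ) : (-2 * psign f i : ℚ) ≠ 0 := by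
  unfold psign
  push_cast
  exact mul_ne_zero (by norm_num) (pow_ne_zero _ (by norm_num))

theorem finprod_mem_ne_zero {S : Set ℤ} {F : ℤ → ℚ} (h : ∀ i, F i ≠ 0) :
    ∏ᶠ i ∈ S, F i ≠ 0 :=
  finprod_induction (· ≠ 0) one_ne_zero (fun _ _ => mul_ne_zero) fun i =>
    finprod_induction (· ≠ 0) one_ne_zero (fun _ _ => mul_ne_zero) fun _ => h i

theorem gval_ne_zero_iff {a b s w : Weight} : gval a b s w ≠ 0 ↔
    (a.Sub w ∧ b.Sub w) ∧ cw a.lab b.lab s.lab ⊆ cw a.lab b.lab w.lab := by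
  unfold gval circleVal
  split_ifs with h1 h2
  · exact iff_of_true (finprod_mem_ne_zero fun i => inv_ne_zero (psign_ne_zero _ i)) ⟨h1, h2⟩
  · simp [h2]
  · simp [h1]

theorem gval_self {a b w : Weight} (ha : a.Sub w) (hb : b.Sub w) : gval a b w w = 1 := by
  unfold gval circleVal
  rw [if_pos ⟨ha, hb⟩, if_pos subset_rfl, Set.sdiff_self]
  simp

theorem cw_comm (a b f : Labelling) : cw a b f = cw b a f := by
  unfold cw; simp only [isRoot_comm (a := a)]

theorem gval_comm (a b s w : Weight) : gval a b s w = gval b a s w := by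
  classical
  unfold gval circleVal
  rw [cw_comm a.lab, cw_comm a.lab b.lab w.lab]
  exact if_congr and_comm rfl rfl

theorem cw_self_eq (a f : Labelling) : cw a a f = cwCups a f := by
  ext m
  refine and_congr_left fun _ => ⟨fun h => ?_, fun ⟨j, hj⟩ k hk => ?_⟩
  · obtain ⟨h1, _⟩ := h _ (conn_mate_left a a m)
    have hm := (h m (.refl _)).2.1
    exact ⟨_, isCup_mate hm (h1.lt_of_ne (mate_ne hm).symm)⟩
  · have hm : mate a m = j := mate_eq (Or.inl hj)
    have hq : m = k ∨ j = k := by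
      refine (Conn.mate_closed (a := a) (b := a) (q := fun k => m = k ∨ j = k) ?_ ?_ hk).1
        (Or.inl rfl)
      all_goals
        rintro i (rfl | rfl)
        · exact Or.inr hm.symm
        · exact Or.inl (by rw [← hm, mate_mate])
    rcases hq with rfl | rfl
    · exact ⟨le_rfl, ⟨_, Or.inl hj⟩, ⟨_, Or.inl hj⟩⟩
    · exact ⟨hj.lt.le, ⟨_, Or.inr hj⟩, ⟨_, Or.inr hj⟩⟩

/-- The weight has finitely many cups. -/
def Weight.FinCups (a : Weight) : Prop := {i | OnCup a.lab i}.Finite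

/-- Idempotents have constant value one. -/
theorem gval_mul_hval {a w : Weight} (ha : a.FinCups) (h : a.Sub w) : gval a a a w * hval a w = 1 := by
  unfold gval circleVal hval cupVal
  rw [if_pos ⟨h, h⟩, cw_self, if_pos (Set.empty_subset _), Set.sdiff_empty, cw_self_eq]
  rw [finprod_mem_inv_distrib _ (ha.subset fun i hi => ⟨_, Or.inl hi.1.choose_spec⟩)]
  exact inv_mul_cancel₀ (finprod_mem_ne_zero fun i => psign_ne_zero _ i)

theorem eventually_subset_win (S : Finset ℤ) : ∀ᶠ N in Filter.atTop, S ⊆ win N := by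
  obtain ⟨M, hM⟩ := exists_Icc_superset S
  filter_upwards [Filter.eventually_ge_atTop M] with N hN
  exact hM.trans (Finset.Icc_subset_Icc (by simpa using hN) (by simpa using hN))

theorem eventually_fits {f : Labelling} {a : Weight} (ha : a.FinCups) {S : Finset ℤ}
    (h : Bal S f a.lab) : ∀ᶠ N in Filter.atTop, Fits N f a.lab := by
  classical
  filter_upwards [eventually_subset_win S, eventually_subset_win ha.toFinset,
    eventually_subset_win {base f}] with N h1 h2 h3
  exact ⟨h.mono h1, fun i hi => h2 (ha.mem_toFinset.2 hi), a.consecutive,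
    h3 (Finset.mem_singleton_self _)⟩

theorem Weight.Sub.eventually_fits {a b s : Weight} (ha : a.Sub s) (hb : b.Sub s) (hbf : b.FinCups)
    {f : Labelling} {S : Finset ℤ} (h : Bal S f a.lab) :
    (∃ T, Bal T f b.lab) ∧ ∀ᶠ N in Filter.atTop, Fits N f b.lab := by
  classical
  obtain ⟨S1, h1⟩ := ha.1.exists_bal
  obtain ⟨S2, h2⟩ := hb.1.exists_bal
  have h12 : Bal (S1 ∪ S2) a.lab b.lab :=
    (h1.mono subset_union_left).trans (h2.mono subset_union_right).symm
  have := (h.mono subset_union_left).trans (h12.mono (subset_union_right (s₁ := S)))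
  exact ⟨⟨_, this⟩, ArcAlgebra.eventually_fits hbf this⟩

theorem finite_sub {a : Weight} (ha : a.FinCups) : {w | a.Sub w}.Finite := by
  refine (finite_finDiff ha.toFinset a).subset fun w hw => ?_
  obtain ⟨S, hS⟩ := hw.1.exists_bal
  exact (hS.shrink fun k hk => (hw.ray_eq fun hc => hk (ha.mem_toFinset.2 hc)).symm).toFinDiff

theorem Weight.Sub.le {a w : Weight} (ha : a.FinCups) (h : a.Sub w) : a ≤ w := by
  obtain ⟨N, hN⟩ := (ArcAlgebra.eventually_fits ha (Bal.refl ∅ a.lab)).exists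
  have hw := hN.bal_of_sub h
  have hA := hN.bal.closed
  exact le_of_dom (dom_of_closure hN.bal hw (hA.dominance hA (cupOr_self _) (cupOr_self _)
    (hN.cupOr_of_sub h) (hN.cupOr_of_sub h) (by rw [cw_self]; exact Set.empty_subset _)).1)

/-- Evaluation is unitriangular with respect to the Bruhat order. -/
theorem le_of_gval_ne_zero {a b s w : Weight} (ha : a.FinCups) (hb : b.FinCups) (has : a.Sub s)
    (hbs : b.Sub s) (h : gval a b s w ≠ 0) : s ≤ w := by
  obtain ⟨⟨haw, hbw⟩, hcw⟩ := gval_ne_zero_iff.1 h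
  obtain ⟨N, hA, hB⟩ := ((eventually_fits ha (Bal.refl ∅ a.lab)).and
    (has.eventually_fits hbs hb (Bal.refl ∅ a.lab)).2).exists
  have hs := hA.bal_of_sub has
  have hw := hA.bal_of_sub haw
  have c1 := hA.cupOr_of_sub has
  have c2 := hB.cupOr_of_sub hbs
  have c3 := hA.cupOr_of_sub haw
  have c4 := hB.cupOr_of_sub hbw
  refine le_of_dom (dom_of_closure hs hw (hA.bal.closed.dominance hB.bal.closed c1 c2 c3 c4 ?_).1)
  rwa [cw_cl hA hB hs c1 c2, cw_cl hA hB hw c3 c4]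

theorem Bal.cl_off {N : ℕ} {f w : Labelling} (h : Bal (win N) f w) {i : ℤ}
    (hi : i ∉ actives N f) : cl N w i = cl N f i := by
  by_cases hc : i ∈ vertices (truncate N f)
  · rw [h.cl_core' hc, cl_core hc, h.free]
    rw [mem_actives] at hi
    unfold Act at hi ⊢
    rwa [cl_core hc] at hi
  · exact (h.cl_eq hc).symm

theorem cl_injective {N : ℕ} {f : Labelling} {z w : Weight} (hz : Bal (win N) f z.lab)
    (hw : Bal (win N) f w.lab) (h : cl N z.lab = cl N w.lab) : z = w := by
  refine Weight.ext' (funext fun i => ?_)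
  by_cases hc : i ∈ vertices (truncate N f)
  · rw [← hz.cl_core' hc, h, hw.cl_core' hc]
  · by_cases hi : i ∈ win N
    · have h1 : i ∉ vertices f := fun hv => hc (mem_core.2 ⟨hi, hv⟩)
      have h2 := h1
      rw [vertices_eq_of_finDiff hz.toFinDiff] at h1
      rw [vertices_eq_of_finDiff hw.toFinDiff] at h2
      rw [mem_vertices, not_not] at h1 h2
      rw [h1, h2]
    · exact (hz.eq i hi).symm.trans (hw.eq i hi)

section Transfer

variable {N : ℕ} {f : Labelling} {a b d : Weight}

theorem Fits.sign_eq (ha : Fits N f a.lab) {w : Weight} (hw : Bal (win N) f w.lab) {i : ℤ}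
    (hi : OnCup a.lab i) : winSign N f i = psign w.lab i := by
  have hv := vertices_eq_of_finDiff hw.toFinDiff
  rw [winSign_eq (hv ▸ w.consecutive) ha.base_mem (ha.core hi), psign_congr hw.act hv]

theorem Fits.circleVal_cl (ha : Fits N f a.lab) (hb : Fits N f b.lab) {s w : Weight}
    (has : a.Sub s) (hbs : b.Sub s) (haw : a.Sub w) (hbw : b.Sub w) :
    circleVal (winSign N f) (cl N a.lab) (cl N b.lab) (cl N s.lab) (cl N w.lab) = gval a b s w := by
  classical
  have hw := ha.bal_of_sub haw
  unfold gval circleVal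
  rw [if_pos (⟨haw, hbw⟩ : a.Sub w ∧ b.Sub w), cw_cl ha hb hw (ha.cupOr_of_sub haw) (hb.cupOr_of_sub hbw),
    cw_cl ha hb (ha.bal_of_sub has) (ha.cupOr_of_sub has) (hb.cupOr_of_sub hbs)]
  refine if_congr Iff.rfl (finprod_mem_congr rfl fun m hm => ?_) rfl
  rw [ha.sign_eq hw (hm.1.1 m (.refl _)).2.1]

theorem Fits.cupVal_cl (hb : Fits N f b.lab) {w : Weight} (hbw : b.Sub w) :
    cupVal (winSign N f) (cl N b.lab) (cl N w.lab) = hval b w := by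
  unfold hval cupVal
  rw [hb.cwCups_cl hbw]
  refine finprod_mem_congr rfl fun m hm => ?_
  obtain ⟨j, hj⟩ := hm.1
  rw [hb.sign_eq (hb.bal_of_sub hbw) ⟨j, Or.inl hj⟩]

open Classical in
/-- The weights orienting both cup diagrams. -/
def above (a d : Weight) : Finset Weight :=
  if h : {w | a.Sub w ∧ d.Sub w}.Finite then h.toFinset else ∅

theorem mem_above (ha : a.FinCups) {w : Weight} : w ∈ above a d ↔ a.Sub w ∧ d.Sub w := by
  have : {w | a.Sub w ∧ d.Sub w}.Finite := (finite_sub ha).subset fun w h => h.1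
  unfold above
  rw [dif_pos this]
  simp

/-- The multiplication rule for the truncated weights. -/
theorem Fits.product (hac : a.FinCups) (ha : Fits N f a.lab) (hb : Fits N f b.lab)
    (hd : Fits N f d.lab) {s t : Weight} (has : a.Sub s) (hbs : b.Sub s) (hbt : b.Sub t)
    (hdt : d.Sub t) : ∃ C : Weight → ℚ,
      (∀ w, ∑ z ∈ above a d, C z * gval a d z w = gval a b s w * hval b w * gval b d t w) ∧
      ∀ z ∈ above a d,
        (cupDegree a s + cupDegree b s + (cupDegree b t + cupDegree d t) <
          cupDegree a z + cupDegree d z → C z = 0) ∧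
        (cupDegree a s + cupDegree b s + (cupDegree b t + cupDegree d t) =
          cupDegree a z + cupDegree d z → C z =
            boundedCoeff (truncate N a.lab) (truncate N s.lab) (truncate N b.lab)
              (truncate N t.lab) (truncate N d.lab) (truncate N z.lab)) ∧
        (cupDegree a s + cupDegree b s + (cupDegree b t + cupDegree d t) ≠
          cupDegree a z + cupDegree d z →
            boundedCoeff (truncate N a.lab) (truncate N s.lab) (truncate N b.lab)
              (truncate N t.lab) (truncate N d.lab) (truncate N z.lab) = 0) := by
  classical
  have hS := ha.setup hb hd
  have bs := ha.bal_of_sub has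
  have bt := hb.bal_of_sub hbt
  obtain ⟨C, hC1, hC2⟩ := hS.product
    (cup_range (finite_core N b.lab) (ordConnected_core hb.conn))
    (ha.cupOr_of_sub has) (hb.cupOr_of_sub hbs) (hb.cupOr_of_sub hbt) (hd.cupOr_of_sub hdt)
    (fun i hi => (bs.cl_off hi).trans (bt.cl_off hi).symm)
  have hlab : ∀ z ∈ above a d, cl N z.lab ∈ hS.labs (cl N s.lab) := fun z hz => by
    rw [mem_above hac] at hz
    exact hS.mem_labs.2 ⟨ha.cupOr_of_sub hz.1, hd.cupOr_of_sub hz.2, fun i hi =>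
      ((ha.bal_of_sub hz.1).cl_off hi).trans (bs.cl_off hi).symm⟩
  refine ⟨fun z => C (cl N z.lab), fun w => ?_, fun z hz => ?_⟩
  · by_cases hw : a.Sub w ∧ d.Sub w
    swap
    · have e1 : ∀ z, gval a d z w = 0 := fun z => by unfold gval; rw [if_neg hw]
      have e2 : gval a b s w * gval b d t w = 0 := by
        by_contra hne
        have h1 := (gval_ne_zero_iff.1 (left_ne_zero_of_mul hne)).1
        have h2 := (gval_ne_zero_iff.1 (right_ne_zero_of_mul hne)).1
        exact hw ⟨h1.1, h2.2⟩
      rw [mul_right_comm, e2, zero_mul]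
      exact sum_eq_zero fun z _ => by rw [e1, mul_zero]
    have bw := ha.bal_of_sub hw.1
    have key := hC1 _ (hlab w ((mem_above hac).2 hw))
    have himg : ∑ z ∈ above a d, C (cl N z.lab) * gval a d z w =
        ∑ z ∈ hS.labs (cl N s.lab),
          C z * circleVal (winSign N f) (cl N a.lab) (cl N d.lab) z (cl N w.lab) := by
      rw [← sum_subset (Finset.image_subset_iff.2 hlab)]
      · rw [Finset.sum_image]
        · refine sum_congr rfl fun z hz => ?_
          rw [mem_above hac] at hz
          rw [ha.circleVal_cl hd hz.1 hz.2 hw.1 hw.2]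
        · intro z hz z' hz' h
          rw [mem_coe, mem_above hac] at hz hz'
          exact cl_injective (ha.bal_of_sub hz.1) (ha.bal_of_sub hz'.1) h
      · intro k hk hki
        rw [mul_eq_zero]
        right
        unfold circleVal
        refine if_neg fun hcw => hki ?_
        have hk := hS.mem_labs.1 hk
        obtain ⟨z, hz, rfl⟩ := exists_weight_of_labs ha hd bw bs (ha.cupOr_of_sub hw.1)
          (hd.cupOr_of_sub hw.2) (ha.cupOr_of_sub has) hk.1 hk.2.1 hk.2.2 hcw
        exact mem_image_of_mem _ ((mem_above hac).2
          ⟨ha.sub_of_cupOr hz hk.1, hd.sub_of_cupOr hz hk.2.1⟩)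
    rw [himg, key]
    by_cases hbw : b.Sub w
    · rw [if_pos (hb.cupOr_of_sub hbw), ha.circleVal_cl hb has hbs hw.1 hbw,
        hb.circleVal_cl hd hbt hdt hbw hw.2, hb.cupVal_cl hbw]
    · rw [if_neg fun hc => hbw (hb.sub_of_cupOr bw hc)]
      have : gval a b s w = 0 := by unfold gval; rw [if_neg fun h => hbw h.2]
      rw [this, zero_mul, zero_mul]
  · have := hC2 _ (hlab z hz)
    rw [mem_above hac] at hz
    simp only [ha.cwCups_cl has, hb.cwCups_cl hbs, hb.cwCups_cl hbt, hd.cwCups_cl hdt,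
      ha.cwCups_cl hz.1, hd.cwCups_cl hz.2, ← cupDegree_eq] at this
    exact this

end Transfer

/-- The evaluations are linearly independent. -/
theorem eq_zero_of_sum_gval {a d : Weight} (ha : a.FinCups) (hd : d.FinCups) {C : Weight → ℚ}
    (h : ∀ w, ∑ z ∈ above a d, C z * gval a d z w = 0) : ∀ z ∈ above a d, C z = 0 := by
  classical
  by_contra! hc
  obtain ⟨z, hz, hmin⟩ := ((above a d).filter fun z => C z ≠ 0).exists_minimal
    (by obtain ⟨z, h1, h2⟩ := hc; exact ⟨z, mem_filter.2 ⟨h1, h2⟩⟩)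
  rw [mem_filter] at hz
  refine hz.2 ?_
  have hz' := (mem_above ha).1 hz.1
  rw [← h z, sum_eq_single z, gval_self hz'.1 hz'.2, mul_one]
  · intro w hw hne
    by_contra hcw
    have hw' := (mem_above ha).1 hw
    have hle := le_of_gval_ne_zero ha hd hw'.1 hw'.2 (right_ne_zero_of_mul hcw)
    exact hne (le_antisymm hle (hmin (mem_filter.2 ⟨hw, left_ne_zero_of_mul hcw⟩) hle))
  · exact fun h => (h hz.1).elim

theorem eventualValue_eq {F : ℕ → ℕ} {c : ℕ} (h : ∀ᶠ N in Filter.atTop, F N = c) :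
    eventualValue F = c := by
  unfold eventualValue
  have hex : ∃ c, ∀ᶠ N in Filter.atTop, F N = c := ⟨c, h⟩
  rw [dif_pos hex]
  obtain ⟨N, h1, h2⟩ := (h.and hex.choose_spec).exists
  exact h2.symm.trans h1

/-- `C` gives the coefficients of the deformed product of `(a s b)` and `(b t d)`. -/
structure IsCoeff (a s b t d : Weight) (C : Weight → ℚ) : Prop where
  eval : ∀ w, ∑ z ∈ above a d, C z * gval a d z w = gval a b s w * hval b w * gval b d t w
  zero : ∀ z ∈ above a d, cupDegree a s + cupDegree b s + (cupDegree b t + cupDegree d t) <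
    cupDegree a z + cupDegree d z → C z = 0
  eq : ∀ z ∈ above a d, cupDegree a s + cupDegree b s + (cupDegree b t + cupDegree d t) =
    cupDegree a z + cupDegree d z → C z = structCoeff a s b t d z
  ne : ∀ z ∈ above a d, cupDegree a s + cupDegree b s + (cupDegree b t + cupDegree d t) ≠
    cupDegree a z + cupDegree d z → structCoeff a s b t d z = 0

theorem exists_isCoeff {a b d s t : Weight} (ha : a.FinCups) (hb : b.FinCups) (hd : d.FinCups)
    (has : a.Sub s) (hbs : b.Sub s) (hbt : b.Sub t) (hdt : d.Sub t) :
    ∃ C, IsCoeff a s b t d C := by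
  have e1 := eventually_fits ha (Bal.refl ∅ a.lab)
  obtain ⟨⟨T, hT⟩, e2⟩ := has.eventually_fits hbs hb (Bal.refl ∅ a.lab)
  have e3 := (hbt.eventually_fits hdt hd hT).2
  have ev := (e1.and (e2.and e3)).mono fun N h =>
    h.1.product ha h.2.1 h.2.2 has hbs hbt hdt
  obtain ⟨N₀, C, hC, hN₀⟩ := ev.exists
  have stable : ∀ z ∈ above a d, structCoeff a s b t d z =
      boundedCoeff (truncate N₀ a.lab) (truncate N₀ s.lab) (truncate N₀ b.lab)
        (truncate N₀ t.lab) (truncate N₀ d.lab) (truncate N₀ z.lab) := by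
    intro z hz
    refine eventualValue_eq (ev.mono ?_)
    rintro N ⟨C', hC', hN⟩
    have hCC : C' z = C z := by
      have := eq_zero_of_sum_gval ha hd (C := fun z => C' z - C z) (fun w => by
        simp only [sub_mul, sum_sub_distrib, hC, hC', sub_self]) z hz
      exact sub_eq_zero.1 this
    obtain ⟨_, h2, h3⟩ := hN₀ z hz
    obtain ⟨_, h2', h3'⟩ := hN z hz
    by_cases hdeg : cupDegree a s + cupDegree b s + (cupDegree b t + cupDegree d t) =
          cupDegree a z + cupDegree d z
    · have := (h2' hdeg).symm.trans (hCC.trans (h2 hdeg))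
      exact_mod_cast this
    · rw [h3 hdeg, h3' hdeg]
  refine ⟨C, hC, fun z hz => (hN₀ z hz).1, fun z hz h => ?_, fun z hz h => ?_⟩
  · rw [stable z hz]; exact (hN₀ z hz).2.1 h
  · rw [stable z hz]; exact (hN₀ z hz).2.2 h

/-! ## Blocks of finite defect -/

theorem exists_sorted (S : Finset ℤ) (a : Weight) : ∃ c, a ≤ c ∧ Bal S a.lab c.lab ∧
    ∀ i ∈ S, ∀ j ∈ S, i < j → ¬ (c.lab i = some .down ∧ c.lab j = some .up) := by
  have hfin : {c : Weight | a ≤ c ∧ Bal S a.lab c.lab}.Finite :=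
    (finite_finDiff S a).subset fun c hc => hc.2.toFinDiff
  obtain ⟨c, hc⟩ := hfin.exists_maximal ⟨a, le_rfl, Bal.refl _ _⟩
  refine ⟨c, hc.1.1, hc.1.2, fun i hi j hj hij h => ?_⟩
  have hd := dom_of_swap (b := update (update c.lab i (some .up)) j (some .down))
    hij h.1 h.2 (by rw [update_of_ne hij.ne, Function.update_self])
    (Function.update_self ..)
    (fun k h1 h2 => by rw [update_of_ne h2, update_of_ne h1])
  have hsub : ({i, j} : Finset ℤ) ⊆ S := by
    intro k hk
    rcases mem_insert.1 hk with rfl | hk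
    · exact hi
    · rwa [mem_singleton.1 hk]
  have hdS := hd.mono hsub
  have hle : c ≤ c.modify _ S hdS.toFinDiff := le_of_dom hdS
  have := hc.2 ⟨hc.1.1.trans hle, hc.1.2.trans ⟨hdS.toFinDiff, hdS.total⟩⟩ hle
  have e := congrArg (fun w : Weight => w.lab i) (le_antisymm hle this)
  change c.lab i = update (update c.lab i (some .up)) j (some .down) i at e
  rw [update_of_ne hij.ne, Function.update_self, h.1] at e
  cases e

theorem sameBlock_of_bal {S : Finset ℤ} {a b : Weight} (h : Bal S a.lab b.lab) : SameBlock a b := by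
  obtain ⟨c, h1, h2, h3⟩ := exists_sorted S a
  obtain ⟨d, h4, h5, h6⟩ := exists_sorted S b
  suffices c = d from ⟨c, h1, this ▸ h4⟩
  have hcd : Bal S c.lab d.lab := h2.symm.trans (h.trans h5)
  have key : ∀ c d : Weight, Bal S c.lab d.lab →
      (∀ i ∈ S, ∀ j ∈ S, i < j → ¬ (c.lab i = some .down ∧ c.lab j = some .up)) →
      (∀ i ∈ S, ∀ j ∈ S, i < j → ¬ (d.lab i = some .down ∧ d.lab j = some .up)) →
      ∀ i ∈ S, ¬ (c.lab i = some .down ∧ d.lab i = some .up) := by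
    rintro c d hb hc hd i hi ⟨e1, e2⟩
    have hnn : ∀ k ∈ S, 0 ≤ downInd c.lab k - downInd d.lab k := by
      intro k hk
      by_cases hka : Act c.lab k
      swap
      · rw [downInd_congr (hb.free k hka), sub_self]
      have hkd := (hb.act k).1 hka
      rcases hka with h1 | h1 <;> rcases hkd with h2 | h2 <;> simp only [downInd, h1, h2] <;>
        try norm_num
      rcases lt_trichotomy k i with hlt | rfl | hlt
      · exact hd k hk i hi hlt ⟨h2, e2⟩
      · rw [e1] at h1; cases h1
      · exact hc i hi k hk hlt ⟨e1, h1⟩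
    have := (Finset.sum_eq_zero_iff_of_nonneg hnn).1 hb.total i hi
    rw [downInd_down e1, downInd_up e2] at this
    omega
  refine Weight.ext' (funext fun i => ?_)
  by_cases hi : i ∈ S
  swap
  · exact hcd.eq i hi
  by_cases hia : Act c.lab i
  swap
  · exact hcd.free i hia
  have hid := (hcd.act i).1 hia
  rcases hia with e1 | e1 <;> rcases hid with e2 | e2
  · rw [e1, e2]
  · exact (key c d hcd h3 h6 i hi ⟨e1, e2⟩).elim
  · exact (key d c hcd.symm h6 h3 i hi ⟨e2, e1⟩).elim
  · rw [e1, e2]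

theorem SameBlock.trans {a b c : Weight} (h : SameBlock a b) (h' : SameBlock b c) :
    SameBlock a c := by
  classical
  obtain ⟨S, hS⟩ := h.exists_bal
  obtain ⟨T, hT⟩ := h'.exists_bal
  exact sameBlock_of_bal ((hS.mono (subset_union_left (s₂ := T))).trans
    (hT.mono subset_union_right))

/-- The active vertices between two vertices. -/
def between (f : Labelling) (i j : ℤ) : Set ℤ := {k | Act f k ∧ i < k ∧ k < j}

theorem finite_between (f : Labelling) (i j : ℤ) : (between f i j).Finite :=
  (Set.finite_Ioo i j).subset fun _ h => h.2

theorem finite_near_left (f : Labelling) (n : ℕ) (j : ℤ) :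
    {i | i < j ∧ Act f i ∧ (between f i j).ncard ≤ n}.Finite := by
  classical
  by_contra hinf
  obtain ⟨T, hT, hc⟩ := Set.Infinite.exists_subset_card_eq hinf (n + 2)
  have hne : T.Nonempty := card_pos.1 (by omega)
  have hm := min'_mem T hne
  have hsub : ((T.erase (T.min' hne) : Finset ℤ) : Set ℤ) ⊆ between f (T.min' hne) j := by
    intro k hk
    have hk := mem_erase.1 hk
    exact ⟨(hT hk.2).2.1, lt_of_le_of_ne (min'_le _ _ hk.2) hk.1.symm, (hT hk.2).1⟩
  have := ncard_le_ncard hsub (finite_between _ _ _)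
  rw [ncard_coe_finset, Finset.card_erase_of_mem hm] at this
  have := (hT hm).2.2
  omega

theorem finite_near_right (f : Labelling) (n : ℕ) (i : ℤ) :
    {j | i < j ∧ Act f j ∧ (between f i j).ncard ≤ n}.Finite := by
  classical
  by_contra hinf
  obtain ⟨T, hT, hc⟩ := Set.Infinite.exists_subset_card_eq hinf (n + 2)
  have hne : T.Nonempty := card_pos.1 (by omega)
  have hm := max'_mem T hne
  have hsub : ((T.erase (T.max' hne) : Finset ℤ) : Set ℤ) ⊆ between f i (T.max' hne) := by
    intro k hk
    have hk := mem_erase.1 hk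
    exact ⟨(hT hk.2).2.1, (hT hk.2).1, lt_of_le_of_ne (le_max' _ _ hk.2) hk.1⟩
  have := ncard_le_ncard hsub (finite_between _ _ _)
  rw [ncard_coe_finset, Finset.card_erase_of_mem hm] at this
  have := (hT hm).2.2
  omega

theorem finite_up_down (w : Weight) (n : ℕ) : {p : ℤ × ℤ | p.1 < p.2 ∧ w.lab p.1 = some .up ∧
    w.lab p.2 = some .down ∧ (between w.lab p.1 p.2).ncard ≤ n}.Finite := by
  obtain ⟨F, hF, hw⟩ := w.ultimately
  suffices ∃ X : Set ℤ, X.Finite ∧ ∀ i j, i < j → w.lab i = some .up → w.lab j = some .down →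
      (between w.lab i j).ncard ≤ n → i ∈ X by
    obtain ⟨X, hX, h⟩ := this
    refine (hX.biUnion fun i _ => (Set.finite_singleton i).prod
      (finite_near_right w.lab n i)).subset ?_
    rintro ⟨i, j⟩ ⟨h1, h2, h3, h4⟩
    exact Set.mem_biUnion (h i j h1 h2 h3 h4) ⟨rfl, h1, Or.inl h3, h4⟩
  have hL := hF.biUnion fun j _ => finite_near_left w.lab n j
  by_cases hex : ∃ i j, i < j ∧ w.lab i = some .up ∧ w.lab j = some .down ∧ i ∉ F ∧ j ∉ F
  · obtain ⟨i₀, j₀, -, hi, hj, hiF, hjF⟩ := hex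
    refine ⟨_, ((hF.union hL).union (finite_near_left w.lab n i₀)).union (Set.finite_Ico i₀ j₀),
      fun i j h1 h2 h3 h4 => ?_⟩
    by_cases hi' : i ∈ F
    · exact Or.inl (Or.inl (Or.inl hi'))
    by_cases hj' : j ∈ F
    · exact Or.inl (Or.inl (Or.inr (Set.mem_biUnion hj' ⟨h1, Or.inr h2, h4⟩)))
    rcases lt_or_ge i i₀ with hlt | hge
    · refine Or.inl (Or.inr ⟨hlt, Or.inr h2, (ncard_le_ncard (fun k hk => ?_)
        (finite_between _ _ _)).trans h4⟩)
      have : i₀ ≤ j := not_lt.1 fun hc => hw j i₀ hj' hiF hc ⟨h3, hi⟩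
      exact ⟨hk.1, hk.2.1, hk.2.2.trans_le this⟩
    · refine Or.inr ⟨hge, lt_of_le_of_ne (not_lt.1 fun hc => hw j₀ i hjF hi' hc ⟨hj, h2⟩) ?_⟩
      rintro rfl
      rw [h2] at hj; cases hj
  · push Not at hex
    refine ⟨_, hF.union hL, fun i j h1 h2 h3 h4 => ?_⟩
    by_cases hi' : i ∈ F
    · exact Or.inl hi'
    · exact Or.inr (Set.mem_biUnion (hex i j h1 h2 h3 hi') ⟨h1, Or.inr h2, h4⟩)

theorem finite_below (w : Weight) (n : ℕ) :
    {a : Weight | a.Sub w ∧ {i | OnCup a.lab i}.Finite ∧ {i | OnCup a.lab i}.ncard ≤ n}.Finite := by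
  classical
  set Q := (finite_up_down w n).toFinset with hQ
  refine (finite_finDiff (Q.image Prod.fst ∪ Q.image Prod.snd) w).subset ?_
  rintro a ⟨ha, hfin, hn⟩
  obtain ⟨S, hS⟩ := ha.1.exists_bal
  refine (hS.shrink fun k hk => ?_).toFinDiff.symm
  by_contra hne
  have hbt : ∀ i j, IsCup a.lab i j → w.lab i = some .up → w.lab j = some .down →
      (i, j) ∈ Q := by
    intro i j hij h1 h2
    rw [hQ, Set.Finite.mem_toFinset]
    refine ⟨hij.lt, h1, h2, (ncard_le_ncard (fun k hk => ?_) hfin).trans hn⟩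
    obtain ⟨l, _, _, hl⟩ := hij.inside hk.2.1 hk.2.2 ((hS.act k).2 hk.1)
    exact ⟨l, hl⟩
  by_cases hc : OnCup a.lab k
  · refine hk ?_
    obtain ⟨j, hj | hj⟩ := hc
    · rcases ha.2.cup _ _ hj with ⟨h1, _⟩ | ⟨h1, h2⟩
      · exact (hne (by rw [h1, hj.left])).elim
      · exact mem_union_left _ (mem_image_of_mem Prod.fst (hbt _ _ hj h1 h2))
    · rcases ha.2.cup _ _ hj with ⟨_, h2⟩ | ⟨h1, h2⟩
      · exact (hne (by rw [h2, hj.right])).elim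
      · exact mem_union_right _ (mem_image_of_mem Prod.snd (hbt _ _ hj h1 h2))
  · exact hne (ha.ray_eq hc).symm

/-- Blocks of finite defect have these properties. -/
class FiniteBlock (Λ : Set Weight) : Prop where
  mem_of_sub : ∀ {a w : Weight}, a ∈ Λ → a.Sub w → w ∈ Λ
  cups : ∀ {a : Weight}, a ∈ Λ → a.FinCups
  below : ∀ w : Weight, {a | a ∈ Λ ∧ a.Sub w}.Finite

theorem IsBlock.finiteBlock {Λ : Set Weight} (hΛ : IsBlock Λ) (hdef : defect Λ < ⊤) :
    FiniteBlock Λ := by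
  obtain ⟨n, hn⟩ := ENat.ne_top_iff_exists.1 hdef.ne
  have key : ∀ a ∈ Λ, {i | OnCup a.lab i}.encard ≤ (2 * n : ℕ) := by
    intro a ha
    have h1 : {p : ℤ × ℤ | IsCup a.lab p.1 p.2}.encard ≤ n := by
      rw [hn]; exact le_iSup₂_of_le a ha le_rfl
    have h2 : {i | OnCup a.lab i} ⊆ Prod.fst '' {p : ℤ × ℤ | IsCup a.lab p.1 p.2} ∪
        Prod.snd '' {p : ℤ × ℤ | IsCup a.lab p.1 p.2} := by
      rintro i ⟨j, h | h⟩
      · exact Or.inl ⟨(i, j), h, rfl⟩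
      · exact Or.inr ⟨(j, i), h, rfl⟩
    refine (Set.encard_le_encard h2).trans ((Set.encard_union_le _ _).trans ?_)
    push_cast
    rw [two_mul]
    exact add_le_add ((Set.encard_image_le _ _).trans h1) ((Set.encard_image_le _ _).trans h1)
  have fin : ∀ a ∈ Λ, {i | OnCup a.lab i}.Finite := fun a ha =>
    Set.finite_of_encard_le_coe (key a ha)
  obtain ⟨a₀, rfl⟩ := hΛ
  refine ⟨fun h h' => SameBlock.trans h h'.1, fun h => fin _ h, fun w => ?_⟩
  refine (finite_below w (2 * n)).subset fun a ha => ⟨ha.2, fin a ha.1, ?_⟩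
  have := key a ha.1
  rw [← (fin a ha.1).cast_ncard_eq] at this
  exact_mod_cast this

/-! ## The algebra of a block of finite defect -/

variable {Λ : Set Weight}

theorem CircleDiagram.ext' {x y : CircleDiagram Λ} (h1 : x.bot = y.bot) (h2 : x.wt = y.wt)
    (h3 : x.top = y.top) : x = y := by
  cases x; cases y; cases h1; cases h2; cases h3; rfl

open Classical in
/-- The structure constants with respect to the basis of circle diagrams. -/
def sc (x y z : CircleDiagram Λ) : ℕ :=
  if x.top = y.bot ∧ z.bot = x.bot ∧ z.top = y.top then
    structCoeff x.bot.1 x.wt.1 x.top.1 y.wt.1 y.top.1 z.wt.1 else 0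

variable [FiniteBlock Λ]

theorem finCups (a : Λ) : a.1.FinCups := FiniteBlock.cups a.2

theorem finite_diagrams (a d : Λ) : {z : CircleDiagram Λ | z.bot = a ∧ z.top = d}.Finite := by
  refine Set.Finite.of_finite_image ((finite_sub (finCups a)).subset
    (t := (fun z : CircleDiagram Λ => z.wt.1) '' {z | z.bot = a ∧ z.top = d}) ?_) ?_
  · rintro _ ⟨z, ⟨rfl, _⟩, rfl⟩; exact z.bot_sub
  · rintro z ⟨h1, h2⟩ z' ⟨h1', h2'⟩ h
    exact CircleDiagram.ext' (h1.trans h1'.symm) (Subtype.ext h) (h2.trans h2'.symm)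

/-- The circle diagrams with given cup and cap diagrams. -/
def diagrams (a d : Λ) : Finset (CircleDiagram Λ) := (finite_diagrams a d).toFinset

theorem mem_diagrams {a d : Λ} {z : CircleDiagram Λ} :
    z ∈ diagrams a d ↔ z.bot = a ∧ z.top = d := by
  simp [diagrams]

theorem finite_top (a : Λ) : {z : CircleDiagram Λ | z.top = a}.Finite := by
  have h : (⋃ w ∈ {w | a.1.Sub w}, {b | b ∈ Λ ∧ b.Sub w}).Finite :=
    (finite_sub (finCups a)).biUnion fun w _ => FiniteBlock.below w
  have h' := h.preimage (f := ((↑) : Λ → Weight)) Subtype.val_injective.injOn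
  refine (h'.biUnion fun b _ => finite_diagrams b a).subset fun z hz => ?_
  have hz : z.top = a := hz
  refine Set.mem_biUnion ?_ (⟨rfl, hz⟩ : z.bot = z.bot ∧ z.top = a)
  exact Set.mem_biUnion (show a.1.Sub z.wt.1 from hz ▸ z.top_sub) ⟨z.bot.2, z.bot_sub⟩

theorem sum_above {a d : Λ} (F : Weight → ℚ) :
    ∑ z ∈ above a.1 d.1, F z = ∑ z ∈ diagrams a d, F z.wt.1 := by
  symm
  refine sum_bij (fun z _ => z.wt.1) ?_ ?_ ?_ fun _ _ => rfl
  · intro z hz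
    rw [mem_diagrams] at hz
    exact (mem_above (finCups a)).2 ⟨hz.1 ▸ z.bot_sub, hz.2 ▸ z.top_sub⟩
  · intro z hz z' hz' h
    rw [mem_diagrams] at hz hz'
    exact CircleDiagram.ext' (hz.1.trans hz'.1.symm) (Subtype.ext h) (hz.2.trans hz'.2.symm)
  · intro w hw
    rw [mem_above (finCups a)] at hw
    exact ⟨⟨a, ⟨w, FiniteBlock.mem_of_sub a.2 hw.1⟩, d, hw.1, hw.2⟩, mem_diagrams.2 ⟨rfl, rfl⟩, rfl⟩

/-- The value of a circle diagram at a weight. -/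
def CircleDiagram.val (z : CircleDiagram Λ) (w : Weight) : ℚ :=
  gval z.bot.1 z.top.1 z.wt.1 w

omit [FiniteBlock Λ] in
theorem CircleDiagram.val_self (z : CircleDiagram Λ) : z.val z.wt.1 = 1 :=
  gval_self z.bot_sub z.top_sub

theorem CircleDiagram.le_of_val_ne_zero {z : CircleDiagram Λ} {w : Weight} (h : z.val w ≠ 0) :
    z.wt.1 ≤ w :=
  le_of_gval_ne_zero (finCups _) (finCups _) z.bot_sub z.top_sub h

/-- The coefficients of the deformed product of two circle diagrams. -/
structure IsDefCoeff (x y : CircleDiagram Λ) (C : CircleDiagram Λ → ℚ) : Prop where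
  eval : ∀ w, ∑ z ∈ diagrams x.bot y.top, C z * z.val w = x.val w * hval x.top.1 w * y.val w
  zero : ∀ z ∈ diagrams x.bot y.top, x.degree + y.degree < z.degree → C z = 0
  eq : ∀ z ∈ diagrams x.bot y.top, z.degree = x.degree + y.degree → C z = sc x y z
  ne : ∀ z ∈ diagrams x.bot y.top, z.degree ≠ x.degree + y.degree → sc x y z = 0

variable {x y z : CircleDiagram Λ} {C : CircleDiagram Λ → ℚ}

theorem exists_isDefCoeff (h : x.top = y.bot) : ∃ C, IsDefCoeff x y C := by
  obtain ⟨a, s, b, ha, hb⟩ := x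
  obtain ⟨b', t, d, hb', hd⟩ := y
  obtain rfl : b = b' := h
  obtain ⟨C, hC⟩ := exists_isCoeff (finCups a) (finCups b) (finCups d) ha hb hb' hd
  have mem : ∀ z ∈ diagrams a d, z.wt.1 ∈ above a.1 d.1 := fun z hz => by
    rw [mem_diagrams] at hz
    exact (mem_above (finCups a)).2 ⟨hz.1 ▸ z.bot_sub, hz.2 ▸ z.top_sub⟩
  refine ⟨fun z => C z.wt.1, fun w => ?_, fun z hz h => ?_, fun z hz h => ?_, fun z hz h => ?_⟩
  · refine Eq.trans (sum_congr rfl fun z hz => ?_)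
      ((sum_above (a := a) (d := d) fun z => C z * gval a.1 d.1 z w).symm.trans (hC.eval w))
    obtain ⟨h1, h2⟩ := mem_diagrams.1 hz
    unfold CircleDiagram.val
    rw [h1, h2]
  all_goals
    have hz' := mem z hz
    obtain ⟨h1, h2⟩ := mem_diagrams.1 hz
    dsimp only at h1 h2
    subst h1 h2
    dsimp only [CircleDiagram.degree] at h
  · exact hC.zero _ hz' (by omega)
  · unfold sc
    rw [if_pos ⟨rfl, rfl, rfl⟩]
    exact hC.eq _ hz' (by omega)
  · unfold sc
    rw [if_pos ⟨rfl, rfl, rfl⟩]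
    exact hC.ne _ hz' (by omega)

variable (Λ) in
theorem exists_coeffs : ∃ C : CircleDiagram Λ → CircleDiagram Λ → CircleDiagram Λ → ℚ,
    ∀ x y, x.top = y.bot → IsDefCoeff x y (C x y) := by
  have (x y : CircleDiagram Λ) : ∃ C, x.top = y.bot → IsDefCoeff x y C := by
    by_cases h : x.top = y.bot
    · exact (exists_isDefCoeff h).imp fun _ hC _ => hC
    · exact ⟨0, fun h' => (h h').elim⟩
  choose C hC using this
  exact ⟨C, hC⟩

theorem IsDefCoeff.mul_eq (hC : IsDefCoeff x y C) (hz : z ∈ diagrams x.bot y.top) {r : ℚ} {s : ℕ}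
    (h0 : z.degree < x.degree + y.degree → r = 0)
    (h1 : z.degree = x.degree + y.degree → r = s) : C z * r = ((sc x y z * s : ℕ) : ℚ) := by
  rcases lt_trichotomy z.degree (x.degree + y.degree) with h | h | h
  · rw [h0 h, hC.ne z hz h.ne]; simp
  · rw [h1 h, hC.eq z hz h]; simp
  · rw [hC.zero z hz h, hC.ne z hz h.ne']; simp

theorem eq_of_sum_val {a d : Λ} {C C' : CircleDiagram Λ → ℚ}
    (h : ∀ w, ∑ z ∈ diagrams a d, C z * z.val w = ∑ z ∈ diagrams a d, C' z * z.val w) :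
    ∀ z ∈ diagrams a d, C z = C' z := by
  classical
  by_contra! hc
  obtain ⟨z, hz, hmin⟩ := ((diagrams a d).filter fun z => C z ≠ C' z).exists_minimalFor
    (fun z => z.wt.1) (by obtain ⟨z, h1, h2⟩ := hc; exact ⟨z, mem_filter.2 ⟨h1, h2⟩⟩)
  rw [mem_filter] at hz
  have := h z.wt.1
  rw [← sub_eq_zero, ← sum_sub_distrib, sum_eq_single z, z.val_self, mul_one, mul_one,
    sub_eq_zero] at this
  · exact hz.2 this
  · intro w hw hne
    by_contra hcw
    rw [← sub_mul] at hcw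
    have hle := w.le_of_val_ne_zero (right_ne_zero_of_mul hcw)
    have := le_antisymm hle (hmin (mem_filter.2 ⟨hw, sub_ne_zero.1 (left_ne_zero_of_mul hcw)⟩) hle)
    rw [mem_diagrams] at hw hz
    exact hne (CircleDiagram.ext' (hw.1.trans hz.1.1.symm) (Subtype.ext this) (hw.2.trans hz.1.2.symm))
  · exact fun h => (h hz.1).elim

omit [FiniteBlock Λ] in
theorem sc_cond (h : sc x y z ≠ 0) :
    x.top = y.bot ∧ z.bot = x.bot ∧ z.top = y.top := by
  by_contra hc
  exact h (if_neg hc)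

theorem degree_of_sc (h : sc x y z ≠ 0) :
    z.degree = x.degree + y.degree := by
  obtain ⟨h1, h2⟩ := sc_cond h
  obtain ⟨C, hC⟩ := exists_isDefCoeff h1
  by_contra hne
  exact h (hC.ne z (mem_diagrams.2 h2) hne)

theorem IsDefCoeff.val_ne_zero (hC : IsDefCoeff x y C) (hz : z ∈ diagrams x.bot y.top) (h : C z ≠ 0) :
    x.wt.1 ≤ z.wt.1 ∧ y.wt.1 ≤ z.wt.1 := by
  classical
  obtain ⟨_, hwz, hw, hw2⟩ := (((diagrams x.bot y.top).filter fun z => C z ≠ 0).image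
    fun z => z.wt.1).exists_le_minimal
      (mem_image_of_mem (fun z => z.wt.1) (mem_filter.2 ⟨hz, h⟩))
  obtain ⟨w, hw1, rfl⟩ := mem_image.1 hw
  rw [mem_filter] at hw1
  have := hC.eval w.wt.1
  rw [sum_eq_single w, w.val_self, mul_one] at this
  · have hne := hw1.2
    rw [this] at hne
    exact ⟨(x.le_of_val_ne_zero (left_ne_zero_of_mul (left_ne_zero_of_mul hne))).trans hwz,
      (y.le_of_val_ne_zero (right_ne_zero_of_mul hne)).trans hwz⟩
  · intro v hv hne
    by_contra hcv
    have hle := v.le_of_val_ne_zero (right_ne_zero_of_mul hcv)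
    have := le_antisymm hle (hw2 (mem_image_of_mem (fun z => z.wt.1)
      (mem_filter.2 ⟨hv, left_ne_zero_of_mul hcv⟩)) hle)
    have hw1 := hw1.1
    rw [mem_diagrams] at hv hw1
    exact hne (CircleDiagram.ext' (hv.1.trans hw1.1.symm) (Subtype.ext this) (hv.2.trans hw1.2.symm))
  · exact fun h => (h hw1.1).elim

theorem IsDefCoeff.ne_zero_of_sc (hC : IsDefCoeff x y C) (h : sc x y z ≠ 0) : C z ≠ 0 := by
  rw [hC.eq z (mem_diagrams.2 (sc_cond h).2) (degree_of_sc h)]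
  exact_mod_cast h

theorem wt_le_of_sc (h : sc x y z ≠ 0) :
    x.wt.1 ≤ z.wt.1 ∧ y.wt.1 ≤ z.wt.1 := by
  obtain ⟨C, hC⟩ := exists_isDefCoeff (sc_cond h).1
  exact hC.val_ne_zero (mem_diagrams.2 (sc_cond h).2) (hC.ne_zero_of_sc h)

/-- The coefficient at a diagram with the lowest possible weight. -/
theorem IsDefCoeff.eq_of_wt (hC : IsDefCoeff x y C) (hz : z ∈ diagrams x.bot y.top)
    (h : z.wt = y.wt) : C z = x.val y.wt.1 * hval x.top.1 y.wt.1 := by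
  have := hC.eval y.wt.1
  rw [sum_eq_single z, y.val_self, mul_one, ← h, z.val_self, mul_one] at this
  · rw [this, h]
  · intro v hv hne
    by_contra hcv
    have hle := v.le_of_val_ne_zero (right_ne_zero_of_mul hcv)
    have hle' := (hC.val_ne_zero hv (left_ne_zero_of_mul hcv)).2
    rw [mem_diagrams] at hv hz
    exact hne (CircleDiagram.ext' (hv.1.trans hz.1.symm)
      ((Subtype.ext (le_antisymm hle hle')).trans h.symm) (hv.2.trans hz.2.symm))
  · exact fun h => (h hz).elim

/-- The structure constants of cell modules do not depend on the cap diagram. -/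
theorem sc_cell {x y y' z z' : CircleDiagram Λ} (hy : y.bot = y'.bot) (hw : y.wt = y'.wt)
    (hz : z.wt = y.wt) (hz' : z'.wt = y'.wt) (hb : z.bot = z'.bot) (ht : z.top = y.top)
    (ht' : z'.top = y'.top) : sc x y z = sc x y' z' := by
  by_cases hc : x.top = y.bot ∧ z.bot = x.bot
  swap
  · unfold sc
    rw [if_neg (fun h => hc ⟨h.1, h.2.1⟩), if_neg (fun h => hc ⟨h.1.trans hy.symm, hb.trans h.2.1⟩)]
  obtain ⟨C, hC⟩ := exists_isDefCoeff hc.1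
  obtain ⟨C', hC'⟩ := exists_isDefCoeff (hc.1.trans hy)
  have m := mem_diagrams.2 ⟨hc.2, ht⟩
  have m' := mem_diagrams.2 ⟨hb.symm.trans hc.2, ht'⟩
  have e := hC.eq_of_wt m hz
  have e' := hC'.eq_of_wt m' hz'
  have hdeg : z.degree = x.degree + y.degree ↔ z'.degree = x.degree + y'.degree := by
    unfold CircleDiagram.degree
    rw [hz, hz', ← hw, ht, ht', ← hb, ← hy]
    constructor <;> intro h <;> linarith
  by_cases hd : z.degree = x.degree + y.degree
  · have h1 := hC.eq z m hd
    have h2 := hC'.eq z' m' (hdeg.1 hd)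
    rw [e] at h1
    rw [e', ← hw, h1] at h2
    exact_mod_cast h2
  · rw [hC.ne z m hd, hC'.ne z' m' (mt hdeg.2 hd)]

theorem sc_generate (hx : x.wt = y.wt) (hxt : x.top = y.bot)
    (hy : y.bot = y.wt) (hz : z.wt = y.wt) (hb : z.bot = x.bot) (ht : z.top = y.top) :
    sc x y z = 1 := by
  obtain ⟨C, hC⟩ := exists_isDefCoeff hxt
  have m := mem_diagrams.2 ⟨hb, ht⟩
  have e := hC.eq_of_wt m hz
  have h0 : ∀ a : Weight, cwCups a.lab a.lab = ∅ := fun a => by rw [← cw_self_eq, cw_self]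
  have hd : z.degree = x.degree + y.degree := by
    unfold CircleDiagram.degree
    rw [hz, hx, hxt, hb, ht, hy, cupDegree_eq y.wt.1 y.wt.1, h0]
    simp
  rw [hC.eq z m hd, ← hx, x.val_self, hx, hxt, hy] at e
  unfold hval cupVal at e
  rw [h0] at e
  simpa using e

variable (x y z) in
theorem sc_mirror : sc x y z = sc y.mirror x.mirror z.mirror := by
  have hval : ∀ x : CircleDiagram Λ, x.mirror.val = x.val := fun x => funext fun w => gval_comm ..
  have hdeg : ∀ x : CircleDiagram Λ, x.mirror.degree = x.degree := fun x => add_comm _ _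
  by_cases hc : x.top = y.bot ∧ z.bot = x.bot ∧ z.top = y.top
  swap
  · unfold sc
    rw [if_neg hc, if_neg fun h => hc ⟨h.1.symm, h.2.2, h.2.1⟩]
  obtain ⟨C, hC⟩ := exists_isDefCoeff hc.1
  obtain ⟨C', hC'⟩ := exists_isDefCoeff (x := y.mirror) (y := x.mirror) hc.1.symm
  have m := mem_diagrams.2 hc.2
  have m' : z.mirror ∈ diagrams y.mirror.bot x.mirror.top := mem_diagrams.2 ⟨hc.2.2, hc.2.1⟩
  have hCC : C z = C' z.mirror := by
    refine eq_of_sum_val (C' := fun z => C' z.mirror) (fun w => ?_) z m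
    have e := hC'.eval w
    rw [hval, hval, show y.mirror.top = x.top from hc.1.symm] at e
    rw [hC.eval, show x.val w * ArcAlgebra.hval x.top.1 w * y.val w =
      y.val w * ArcAlgebra.hval x.top.1 w * x.val w by ring, ← e]
    refine sum_bij (fun z _ => z.mirror) ?_ ?_ ?_ ?_
    · intro z hz
      rw [mem_diagrams] at hz ⊢
      exact ⟨hz.2, hz.1⟩
    · intro z _ z' _ h
      exact congrArg CircleDiagram.mirror h
    · intro z hz
      rw [mem_diagrams] at hz
      exact ⟨z.mirror, mem_diagrams.2 ⟨hz.2, hz.1⟩, rfl⟩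
    · intro z _
      rw [show z.mirror.mirror = z from rfl, hval]
  by_cases hd : z.degree = x.degree + y.degree
  · have h1 := hC.eq z m hd
    have h2 := hC'.eq z.mirror m' (by rw [hdeg, hdeg, hdeg, hd, add_comm])
    rw [hCC, h2] at h1
    exact_mod_cast h1.symm
  · rw [hC.ne z m hd, hC'.ne z.mirror m' (by rw [hdeg, hdeg, hdeg, add_comm]; exact hd)]

theorem sc_idem {e y z : CircleDiagram Λ} (he : IsIdem y.bot e) (hz : z.bot = y.bot ∧ z.top = y.top)
    [Decidable (z = y)] : sc e y z = if z = y then 1 else 0 := by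
  classical
  obtain ⟨C, hC⟩ := exists_isDefCoeff he.2.2
  have m : ∀ {z : CircleDiagram Λ}, z.bot = y.bot ∧ z.top = y.top → z ∈ diagrams e.bot y.top :=
    fun h => mem_diagrams.2 ⟨h.1.trans he.1.symm, h.2⟩
  have hCz := eq_of_sum_val (C := C) (C' := fun z => if z = y then 1 else 0) (fun w => by
    rw [hC.eval]
    simp only [ite_mul, one_mul, zero_mul]
    rw [sum_ite_eq' _ y, if_pos (m ⟨rfl, rfl⟩)]
    by_cases hw : y.val w = 0
    · rw [hw, mul_zero]
    · unfold CircleDiagram.val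
      rw [he.1, he.2.1, he.2.2, gval_mul_hval (finCups _) (gval_ne_zero_iff.1 hw).1.1, one_mul])
    z (m hz)
  have h0 : e.degree = 0 := by
    unfold CircleDiagram.degree
    rw [he.1, he.2.1, he.2.2, cupDegree_eq, ← cw_self_eq, cw_self]
    simp
  by_cases hd : z.degree = e.degree + y.degree
  · rw [hC.eq z (m hz) hd] at hCz
    split_ifs at hCz ⊢ <;> exact_mod_cast hCz
  · rw [hC.ne z (m hz) hd, if_neg]
    rintro rfl
    exact hd (by rw [h0, zero_add])

theorem sc_assoc (x y w v : CircleDiagram Λ) :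
    ∑ z ∈ diagrams x.bot y.top, sc x y z * sc z w v =
      ∑ z ∈ diagrams y.bot w.top, sc y w z * sc x z v := by
  by_cases hc : (x.top = y.bot ∧ y.top = w.bot) ∧ v.bot = x.bot ∧ v.top = w.top
  swap
  · rw [sum_eq_zero, sum_eq_zero]
    all_goals
      intro z _
      by_contra hne
      have := sc_cond (left_ne_zero_of_mul hne)
      have := sc_cond (right_ne_zero_of_mul hne)
      grind
  obtain ⟨⟨hxy, hyw⟩, hv⟩ := hc
  by_cases hd : v.degree = x.degree + y.degree + w.degree
  swap
  · rw [sum_eq_zero, sum_eq_zero]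
    all_goals
      intro z _
      by_contra hne
      have h1 := degree_of_sc (left_ne_zero_of_mul hne)
      have h2 := degree_of_sc (right_ne_zero_of_mul hne)
      exact hd (by linarith)
  obtain ⟨C, hC⟩ := exists_coeffs Λ
  have key : ∑ z ∈ diagrams x.bot y.top, C x y z * C z w v =
      ∑ z ∈ diagrams y.bot w.top, C y w z * C x z v := by
    refine eq_of_sum_val (C := fun v => ∑ z ∈ diagrams x.bot y.top, C x y z * C z w v)
      (C' := fun v => ∑ z ∈ diagrams y.bot w.top, C y w z * C x z v) (fun u => ?_) v
      (mem_diagrams.2 hv)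
    simp only [sum_mul, mul_assoc]
    rw [sum_comm, sum_comm (s := diagrams x.bot w.top)]
    simp only [← mul_sum]
    have r1 : ∀ z ∈ diagrams x.bot y.top, C x y z * ∑ v ∈ diagrams x.bot w.top, C z w v * v.val u =
        (C x y z * z.val u) * (hval y.top.1 u * w.val u) := fun z hz => by
      obtain ⟨h1, h2⟩ := mem_diagrams.1 hz
      rw [← h1, (hC z w (h2.trans hyw)).eval, h2]; ring
    have r2 : ∀ z ∈ diagrams y.bot w.top, C y w z * ∑ v ∈ diagrams x.bot w.top, C x z v * v.val u =
        (C y w z * z.val u) * (x.val u * hval x.top.1 u) := fun z hz => by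
      obtain ⟨h1, h2⟩ := mem_diagrams.1 hz
      rw [← h2, (hC x z (hxy.trans h1.symm)).eval]; ring
    rw [sum_congr rfl r1, sum_congr rfl r2, ← sum_mul, ← sum_mul,
      (hC x y hxy).eval, (hC y w hyw).eval]
    ring
  have t1 : ∀ z ∈ diagrams x.bot y.top, C x y z * C z w v = ((sc x y z * sc z w v : ℕ) : ℚ) := by
    intro z hz
    obtain ⟨h1, h2⟩ := mem_diagrams.1 hz
    have h := hC z w (h2.trans hyw)
    have hvz := mem_diagrams.2 ⟨hv.1.trans h1.symm, hv.2⟩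
    exact (hC x y hxy).mul_eq hz (fun _ => h.zero v hvz (by linarith))
      fun _ => h.eq v hvz (by linarith)
  have t2 : ∀ z ∈ diagrams y.bot w.top, C y w z * C x z v = ((sc y w z * sc x z v : ℕ) : ℚ) := by
    intro z hz
    obtain ⟨h1, h2⟩ := mem_diagrams.1 hz
    have h := hC x z (hxy.trans h1.symm)
    have hvz := mem_diagrams.2 ⟨hv.1, hv.2.trans h2.symm⟩
    exact (hC y w hyw).mul_eq hz (fun _ => h.zero v hvz (by linarith))
      fun _ => h.eq v hvz (by linarith)
  rw [sum_congr rfl t1, sum_congr rfl t2] at key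
  exact_mod_cast key

omit [FiniteBlock Λ] in
theorem degree_nonneg (x : CircleDiagram Λ) : 0 ≤ x.degree := by
  unfold CircleDiagram.degree; positivity

theorem Weight.Sub.eq_of_degree {a w : Weight} (ha : a.FinCups) (h : a.Sub w)
    (h0 : cupDegree a w = 0) : w = a := by
  rw [cupDegree_eq, Set.ncard_eq_zero (ha.subset fun i hi => ⟨_, Or.inl hi.1.choose_spec⟩)] at h0
  have no : ∀ i j, IsCup a.lab i j → w.lab i ≠ some .up := fun i j hij hu =>
    (h0 ▸ (⟨⟨j, hij⟩, hu⟩ : i ∈ cwCups a.lab w.lab) : i ∈ (∅ : Set ℤ))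
  refine Weight.ext' (funext fun k => ?_)
  by_cases hc : OnCup a.lab k
  · obtain ⟨j, hj | hj⟩ := hc
    · rcases h.2.cup _ _ hj with ⟨h1, _⟩ | ⟨h1, _⟩
      · rw [h1, hj.left]
      · exact (no _ _ hj h1).elim
    · rcases h.2.cup _ _ hj with ⟨_, h1⟩ | ⟨h1, _⟩
      · rw [h1, hj.right]
      · exact (no _ _ hj h1).elim
  · exact h.ray_eq hc

theorem isIdem_of_degree {x : CircleDiagram Λ} (h : x.degree = 0) : IsIdem x.top x := by
  unfold CircleDiagram.degree at h
  have h1 := x.bot_sub.eq_of_degree (finCups _) (by omega)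
  have h2 := x.top_sub.eq_of_degree (finCups _) (by omega)
  have h1 : x.wt = x.bot := Subtype.ext h1
  have h2 : x.wt = x.top := Subtype.ext h2
  exact ⟨h1.symm.trans h2, h2, rfl⟩

omit [FiniteBlock Λ] in
theorem IsIdem.degree {a : Λ} {x : CircleDiagram Λ} (h : IsIdem a x) : x.degree = 0 := by
  unfold CircleDiagram.degree
  rw [h.1, h.2.1, h.2.2, cupDegree_eq, ← cw_self_eq, cw_self]
  simp

omit [FiniteBlock Λ] in
/-- The diagram of the idempotent of a weight. -/
def idemDiagram (a : Λ) : CircleDiagram Λ := ⟨a, a, a, .refl _, .refl _⟩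

omit [FiniteBlock Λ] in
theorem isIdem_iff {a : Λ} {x : CircleDiagram Λ} : IsIdem a x ↔ x = idemDiagram a :=
  ⟨fun h => CircleDiagram.ext' h.1 h.2.1 h.2.2, by rintro rfl; exact ⟨rfl, rfl, rfl⟩⟩

section Field

variable (K : Type u) [Field K]

omit [FiniteBlock Λ] in
theorem idem_eq (a : Λ) : idem K Λ a = single (idemDiagram a) 1 := by
  have h : ∃ x : CircleDiagram Λ, IsIdem a x := ⟨_, isIdem_iff.2 rfl⟩
  unfold idem
  rw [dif_pos h, isIdem_iff.1 h.choose_spec]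

theorem basisMul_eq (x y : CircleDiagram Λ) :
    basisMul K Λ x y = ∑ z ∈ diagrams x.bot y.top, single z (sc x y z : K) := by
  unfold basisMul
  split_ifs with h
  · refine (finsum_mem_eq_finite_toFinset_sum _ (finite_diagrams x.bot y.top)).trans ?_
    refine sum_congr rfl fun z hz => ?_
    unfold sc
    rw [if_pos ⟨h, mem_diagrams.1 hz⟩]
  · refine (sum_eq_zero fun z _ => ?_).symm
    unfold sc
    rw [if_neg fun hc => h hc.1]
    simp

theorem kmul_single (x y : CircleDiagram Λ) (c d : K) :
    kmul K Λ (single x c) (single y d) =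
      (c * d) • ∑ z ∈ diagrams x.bot y.top, single z (sc x y z : K) := by
  rw [kmul, Finsupp.linearCombination_single, LinearMap.smul_apply,
    Finsupp.linearCombination_single, basisMul_eq, smul_smul]

theorem kmul_apply (x y z : CircleDiagram Λ) :
    kmul K Λ (single x 1) (single y 1) z = (sc x y z : K) := by
  classical
  rw [kmul_single, mul_one, one_smul, Finsupp.finsetSum_apply]
  simp only [Finsupp.single_apply]
  rw [sum_ite_eq']
  split_ifs with h
  · rfl
  · rw [mem_diagrams] at h
    unfold sc
    rw [if_neg fun hc => h hc.2, Nat.cast_zero]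

omit [FiniteBlock Λ] in
/-- Linear maps on `K` are determined on the basis. -/
theorem kalg_ext {M : Type*} [AddCommMonoid M] [Module K M] {f g : KAlg K Λ →ₗ[K] M}
    (h : ∀ x, f (single x 1) = g (single x 1)) : f = g :=
  Finsupp.lhom_ext' fun x => LinearMap.ext_ring (h x)

theorem kmul_assoc (x y z : KAlg K Λ) :
    kmul K Λ (kmul K Λ x y) z = kmul K Λ x (kmul K Λ y z) := by
  suffices ((kmul K Λ).compr₂ (kmul K Λ)) =
      (LinearMap.llcomp K (KAlg K Λ) (KAlg K Λ) (KAlg K Λ)).compl₁₂ (kmul K Λ) (kmul K Λ) from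
    congrArg (fun f => f x y z) this
  refine kalg_ext K fun x => kalg_ext K fun y => kalg_ext K fun w => Finsupp.ext fun v => ?_
  change kmul K Λ (kmul K Λ (single x 1) (single y 1)) (single w 1) v =
    kmul K Λ (single x 1) (kmul K Λ (single y 1) (single w 1)) v
  have s : ∀ (z : CircleDiagram Λ) (c : K), single z c = c • single z 1 := by simp
  rw [kmul_single, kmul_single]
  simp only [mul_one, one_smul, map_sum, LinearMap.sum_apply, Finsupp.finsetSum_apply]
  simp only [s _ ((_ : ℕ) : K), map_smul, LinearMap.smul_apply, Finsupp.smul_apply, kmul_apply,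
    smul_eq_mul]
  exact_mod_cast congrArg (Nat.cast : ℕ → K) (sc_assoc x y w v)

theorem idem_kmul_single (a : Λ) (y : CircleDiagram Λ) [Decidable (y.bot = a)] :
    kmul K Λ (idem K Λ a) (single y 1) = if y.bot = a then single y 1 else 0 := by
  classical
  refine Finsupp.ext fun z => ?_
  rw [idem_eq, kmul_apply]
  split_ifs with h
  · by_cases hz : z.bot = y.bot ∧ z.top = y.top
    · rw [sc_idem (isIdem_iff.2 (by rw [h])) hz, Finsupp.single_apply]
      simp only [eq_comm (a := y)]
      split_ifs <;> simp
    · unfold sc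
      rw [if_neg fun hc => hz ⟨hc.2.1.trans h.symm, hc.2.2⟩, Finsupp.single_apply, if_neg]
      · simp
      · rintro rfl; exact hz ⟨rfl, rfl⟩
  · unfold sc
    rw [if_neg fun hc => h hc.1.symm]
    simp

omit [FiniteBlock Λ] in
theorem kstar_single (x : CircleDiagram Λ) (c : K) :
    kstar K Λ (single x c) = single x.mirror c := by
  simp [kstar, Finsupp.lmapDomain_apply, Finsupp.mapDomain_single]

theorem kstar_kmul (x y : KAlg K Λ) :
    kstar K Λ (kmul K Λ x y) = kmul K Λ (kstar K Λ y) (kstar K Λ x) := by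
  suffices (kmul K Λ).compr₂ (kstar K Λ) =
      ((kmul K Λ).flip.compl₁₂ (kstar K Λ) (kstar K Λ)) from congrArg (fun f => f x y) this
  refine kalg_ext K fun x => kalg_ext K fun y => Finsupp.ext fun z => ?_
  change kstar K Λ (kmul K Λ (single x 1) (single y 1)) z =
    kmul K Λ (kstar K Λ (single y 1)) (kstar K Λ (single x 1)) z
  rw [kstar_single, kstar_single, kmul_apply,
    show z = z.mirror.mirror from rfl, ← sc_mirror, ← kmul_apply]
  exact Finsupp.mapDomain_apply (Function.LeftInverse.injective (g := CircleDiagram.mirror) fun _ => rfl)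
    _ _

omit [FiniteBlock Λ] in
theorem kstar_kstar (x : KAlg K Λ) : kstar K Λ (kstar K Λ x) = x := by
  suffices kstar K Λ ∘ₗ kstar K Λ = LinearMap.id from congrArg (fun f => f x) this
  refine kalg_ext K fun x => ?_
  rw [LinearMap.comp_apply, kstar_single, kstar_single]
  rfl

omit [FiniteBlock Λ] in
theorem kstar_idem (a : Λ) : kstar K Λ (idem K Λ a) = idem K Λ a := by
  rw [idem_eq, kstar_single]; rfl

theorem kmul_idem_single (a : Λ) (y : CircleDiagram Λ) [Decidable (y.top = a)] :
    kmul K Λ (single y 1) (idem K Λ a) = if y.top = a then single y 1 else 0 := by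
  classical
  have := congrArg (kstar K Λ) (idem_kmul_single K a y.mirror)
  rw [kstar_kmul, kstar_idem, kstar_single] at this
  refine this.trans ?_
  by_cases h : y.top = a
  · rw [if_pos (show y.mirror.bot = a from h), if_pos h, kstar_single]; rfl
  · rw [if_neg (show ¬ y.mirror.bot = a from h), if_neg h, map_zero]

theorem idem_kmul_idem (a b : Λ) [Decidable (a = b)] :
    kmul K Λ (idem K Λ a) (idem K Λ b) = if a = b then idem K Λ a else 0 := by
  classical
  rw [idem_eq K a, kmul_idem_single]
  exact if_congr Iff.rfl rfl rfl

end Field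

/-! ## The category of finite dimensional graded modules is abelian -/

section Projections

variable {K : Type*} [Field K] {V ι : Type*} [AddCommGroup V] [Module K V]

theorem exists_proj [FiniteDimensional K V] {W : ι → Submodule K V} (hi : iSupIndep W)
    (ht : ⨆ i, W i = ⊤) : ∃ π : ι → V →ₗ[K] V, (∀ i m, π i m ∈ W i) ∧
      (∀ i, ∀ m ∈ W i, π i m = m) ∧ (∀ i j, i ≠ j → ∀ m ∈ W j, π i m = 0) ∧
      ∃ G : Finset ι, ∀ m, ∑ i ∈ G, π i m = m := by
  classical
  have h := (DirectSum.isInternal_submodule_iff_iSupIndep_and_iSup_eq_top W).2 ⟨hi, ht⟩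
  let e := LinearEquiv.ofBijective (DirectSum.coeLinearMap W) h
  have he : ∀ i (m : W i), e.symm m = DirectSum.lof K ι (fun i => W i) i m := fun i m =>
    (LinearEquiv.symm_apply_eq _).2 (DirectSum.coeLinearMap_lof W i m).symm
  let π : ι → V →ₗ[K] V := fun i =>
    (W i).subtype ∘ₗ DirectSum.component K ι (fun i => W i) i ∘ₗ e.symm.toLinearMap
  have h1 : ∀ i, ∀ m ∈ W i, π i m = m := fun i m hm => by
    have := he i ⟨m, hm⟩
    simp only [π, LinearMap.comp_apply, LinearEquiv.coe_coe, this, DirectSum.component.lof_self]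
    rfl
  have h2 : ∀ i j, i ≠ j → ∀ m ∈ W j, π i m = 0 := fun i j hij m hm => by
    have := he j ⟨m, hm⟩
    simp only [π, LinearMap.comp_apply, LinearEquiv.coe_coe, this]
    rw [DirectSum.component.of, dif_neg hij.symm, map_zero]
  have hG : {i | W i ≠ ⊥}.Finite := WellFoundedGT.finite_ne_bot_of_iSupIndep hi
  refine ⟨π, fun i m => SetLike.coe_mem _, h1, h2, hG.toFinset, fun m => ?_⟩
  have hm : m ∈ ⨆ i, W i := ht ▸ Submodule.mem_top
  induction hm using Submodule.iSup_induction' with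
  | mem i m hm =>
    by_cases hi : W i = ⊥
    · rw [hi, Submodule.mem_bot] at hm
      simp [hm]
    · rw [sum_eq_single i (fun j _ hj => h2 j i hj m hm)
        (fun hc => (hc (hG.mem_toFinset.2 hi)).elim), h1 i m hm]
  | zero => simp
  | add x y _ _ hx hy => simp only [map_add, sum_add_distrib, hx, hy]

theorem iSupIndep_of_proj {π : ι → V →ₗ[K] V} (h : ∀ i j, i ≠ j → ∀ m, π i (π j m) = 0)
    (hi : ∀ i m, π i (π i m) = π i m) : iSupIndep fun i => LinearMap.range (π i) := by
  intro i
  rw [Submodule.disjoint_def]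
  rintro _ ⟨m, rfl⟩ hx
  have hle : ⨆ j, ⨆ (_ : j ≠ i), LinearMap.range (π j) ≤ LinearMap.ker (π i) :=
    iSup₂_le fun j hj => by rintro _ ⟨n, rfl⟩; exact h i j hj.symm n
  rw [← hi]
  exact hle hx

theorem iSup_eq_top_of_proj {π : ι → V →ₗ[K] V} (h : ∃ G : Finset ι, ∀ m, ∑ i ∈ G, π i m = m) :
    ⨆ i, LinearMap.range (π i) = ⊤ := by
  obtain ⟨G, hG⟩ := h
  refine eq_top_iff.2 fun m _ => ?_
  rw [← hG m]
  exact Submodule.sum_mem _ fun i _ =>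
    le_iSup (fun i => LinearMap.range (π i)) i (LinearMap.mem_range_self _ _)

theorem sum_proj_of_subset {π : ι → V →ₗ[K] V} (h : ∀ i j, i ≠ j → ∀ m, π i (π j m) = 0)
    {G G' : Finset ι} (hG : ∀ m, ∑ i ∈ G, π i m = m) (hGG : G ⊆ G') (m : V) :
    ∑ i ∈ G', π i m = m := by
  rw [← sum_subset hGG, hG]
  intro i _ hi
  rw [← hG m, map_sum]
  exact sum_eq_zero fun j hj => h i j (fun e => hi (e ▸ hj)) m

end Projections

set_option linter.unusedSectionVars false

namespace FinGrMod

variable {K : Type u} [Field K] {Λ : Set Weight} [FiniteBlock Λ]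

/-- The action of basis vectors. -/
abbrev bact (M : FinGrMod K Λ) (x : CircleDiagram Λ) : M.carrier →ₗ[K] M.carrier :=
  M.act (single x 1)

theorem act_mem {V : Type*} [AddCommGroup V] [Module K V] {act : KAlg K Λ →ₗ[K] V →ₗ[K] V}
    {W : Submodule K V} {m : V} (h : ∀ x, act (single x 1) m ∈ W) (x : KAlg K Λ) :
    act x m ∈ W := by
  have : ⊤ ≤ W.comap (act.flip m) := by
    rw [← Finsupp.span_single_eq_top, Submodule.span_le]
    rintro _ ⟨x, c, rfl⟩
    rw [← mul_one c, ← smul_eq_mul, ← smul_single]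
    exact Submodule.smul_mem _ c (h x)
  exact this (Submodule.mem_top (x := x))

/-- Constructing a module from projections onto the homogeneous components. -/
def ofProj (V : Type u) [AddCommGroup V] [Module K V] [FiniteDimensional K V]
    (act : KAlg K Λ →ₗ[K] V →ₗ[K] V) (act_mul : ∀ x y m, act (kmul K Λ x y) m = act x (act y m))
    (hidem : ∃ F : Finset Λ, ∀ m, ∑ a ∈ F, act (idem K Λ a) m = m) (π : ℤ → V →ₗ[K] V)
    (h0 : ∀ i j, i ≠ j → ∀ m, π i (π j m) = 0) (h1 : ∀ i m, π i (π i m) = π i m)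
    (hπ : ∃ G : Finset ℤ, ∀ m, ∑ j ∈ G, π j m = m)
    (hact : ∀ (x : CircleDiagram Λ) j m, π (x.degree + j) (act (single x 1) m) =
      act (single x 1) (π j m)) : FinGrMod K Λ where
  carrier := V
  finite := inferInstance
  act := act
  act_mul := act_mul
  idem_indep := by
    classical
    refine iSupIndep_of_proj (fun a b hab m => ?_) fun a m => ?_
    · rw [← act_mul, idem_kmul_idem, if_neg hab, map_zero, LinearMap.zero_apply]
    · rw [← act_mul, idem_kmul_idem, if_pos rfl]
  idem_top := iSup_eq_top_of_proj hidem
  deg j := LinearMap.range (π j)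
  deg_indep := iSupIndep_of_proj h0 h1
  deg_top := iSup_eq_top_of_proj hπ
  act_deg i j x hx := by
    rintro _ ⟨m, rfl⟩
    rw [kdeg, Finsupp.supported_eq_span_single] at hx
    have : Submodule.span K ((fun x : CircleDiagram Λ => single x (1 : K)) ''
        {x | x.degree = i}) ≤ (LinearMap.range (π (i + j))).comap (act.flip (π j m)) := by
      rw [Submodule.span_le]
      rintro _ ⟨x, rfl, rfl⟩
      exact ⟨_, hact x j m⟩
    exact this hx

variable (M N : FinGrMod K Λ)

/-- The projections onto the homogeneous components. -/
def proj : ℤ → M.carrier →ₗ[K] M.carrier :=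
  (exists_proj M.deg_indep M.deg_top).choose

theorem proj_spec : (∀ i m, M.proj i m ∈ M.deg i) ∧ (∀ i, ∀ m ∈ M.deg i, M.proj i m = m) ∧
    (∀ i j, i ≠ j → ∀ m ∈ M.deg j, M.proj i m = 0) ∧
      ∃ G : Finset ℤ, ∀ m, ∑ i ∈ G, M.proj i m = m :=
  (exists_proj M.deg_indep M.deg_top).choose_spec

theorem proj_mem (i : ℤ) (m : M.carrier) : M.proj i m ∈ M.deg i := M.proj_spec.1 i m

variable {M N}

theorem proj_of_mem {i : ℤ} {m : M.carrier} (h : m ∈ M.deg i) : M.proj i m = m :=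
  M.proj_spec.2.1 i m h

theorem proj_of_ne {i j : ℤ} {m : M.carrier} (h : m ∈ M.deg j) (hij : i ≠ j) : M.proj i m = 0 :=
  M.proj_spec.2.2.1 i j hij m h

theorem mem_deg {i : ℤ} {m : M.carrier} : m ∈ M.deg i ↔ M.proj i m = m :=
  ⟨proj_of_mem, fun h => h ▸ M.proj_mem i m⟩

theorem bact_deg (x : CircleDiagram Λ) {j : ℤ} {m : M.carrier} (h : m ∈ M.deg j) :
    M.bact x m ∈ M.deg (x.degree + j) :=
  M.act_deg _ _ _ (Finsupp.single_mem_supported K _ rfl) _ h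

theorem proj_bact (x : CircleDiagram Λ) (j : ℤ) (m : M.carrier) :
    M.proj (x.degree + j) (M.bact x m) = M.bact x (M.proj j m) := by
  obtain ⟨G, hG⟩ := M.proj_spec.2.2.2
  rw [← hG m, map_sum, map_sum, map_sum, map_sum]
  refine sum_congr rfl fun k _ => ?_
  by_cases hk : j = k
  · rw [hk, proj_of_mem (bact_deg x (M.proj_mem k m)), proj_of_mem (M.proj_mem k m)]
  · rw [proj_of_ne (bact_deg x (M.proj_mem k m)) (by omega), proj_of_ne (M.proj_mem k m) hk,
      map_zero]

theorem proj_idem (a : Λ) (j : ℤ) (m : M.carrier) :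
    M.proj j (M.act (idem K Λ a) m) = M.act (idem K Λ a) (M.proj j m) := by
  have := proj_bact (M := M) (idemDiagram a) j m
  rwa [(isIdem_iff.2 rfl).degree, zero_add, bact, ← idem_eq] at this

theorem lin_proj (f : M ⟶ N) (j : ℤ) (m : M.carrier) :
    lin f (M.proj j m) = N.proj j (lin f m) := by
  obtain ⟨G, hG⟩ := M.proj_spec.2.2.2
  conv_rhs => rw [← hG m]
  conv_lhs => rw [← hG m]
  simp only [map_sum]
  refine sum_congr rfl fun k _ => ?_
  have hk := Hom.map_deg f k _ (M.proj_mem k m)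
  by_cases h : j = k
  · subst h
    rw [proj_of_mem (M.proj_mem j m)]
    exact (proj_of_mem hk).symm
  · rw [proj_of_ne (M.proj_mem k m) h, map_zero]
    exact (proj_of_ne hk h).symm

theorem lin_act (f : M ⟶ N) (x : KAlg K Λ) (m : M.carrier) :
    lin f (M.act x m) = N.act x (lin f m) := Hom.map_act f x m

/-- Decomposition of the identity into idempotents. -/
theorem exists_sum_idem (M : FinGrMod K Λ) :
    ∃ F : Finset Λ, ∀ m, ∑ a ∈ F, M.act (idem K Λ a) m = m := by
  classical
  obtain ⟨π, h1, -, -, G, hG⟩ := exists_proj M.idem_indep M.idem_top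
  refine ⟨G, fun m => ?_⟩
  conv_rhs => rw [← hG m]
  refine sum_congr rfl fun a ha => ?_
  conv_lhs => rw [← hG m]
  rw [map_sum, sum_eq_single_of_mem a ha]
  · obtain ⟨n, hn⟩ := h1 a m
    rw [← hn, ← M.act_mul, idem_kmul_idem, if_pos rfl]
  · intro b _ hb
    obtain ⟨n, hn⟩ := h1 b m
    rw [← hn, ← M.act_mul, idem_kmul_idem, if_neg hb.symm, map_zero, LinearMap.zero_apply]

/-! ### Submodules and quotients -/

/-- Graded submodules. -/
structure IsSub (M : FinGrMod K Λ) (W : Submodule K M.carrier) : Prop where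
  act : ∀ x, ∀ m ∈ W, M.act x m ∈ W
  proj : ∀ j, ∀ m ∈ W, M.proj j m ∈ W

variable {W : Submodule K M.carrier}

/-- A submodule as an object. -/
def sub (h : IsSub M W) : FinGrMod K Λ :=
  ofProj W (LinearMap.mk₂ K (fun x m => ⟨M.act x m.1, h.act x _ m.2⟩)
      (fun _ _ _ => Subtype.ext (by simp)) (fun _ _ _ => Subtype.ext (by simp))
      (fun _ _ _ => Subtype.ext (by simp)) (fun _ _ _ => Subtype.ext (by simp)))
    (fun x y m => Subtype.ext (M.act_mul x y m.1))
    (by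
      obtain ⟨F, hF⟩ := M.exists_sum_idem
      exact ⟨F, fun m => Subtype.ext (by simpa using hF m.1)⟩)
    (fun j => (M.proj j).restrict (h.proj j))
    (fun i j hij m => Subtype.ext (proj_of_ne (M.proj_mem j m.1) hij))
    (fun i m => Subtype.ext (proj_of_mem (M.proj_mem i m.1)))
    (by
      obtain ⟨G, hG⟩ := M.proj_spec.2.2.2
      exact ⟨G, fun m => Subtype.ext (by simpa using hG m.1)⟩)
    (fun x j m => Subtype.ext (proj_bact x j m.1))

/-- The inclusion of a submodule. -/
def subι (h : IsSub M W) : sub h ⟶ M :=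
  ⟨W.subtype, fun _ _ => rfl, fun j m hm => by
    obtain ⟨n, rfl⟩ := hm
    exact M.proj_mem j n.1⟩

theorem subι_injective (h : IsSub M W) : Function.Injective (lin (subι h)) :=
  Subtype.val_injective

theorem exists_subι (h : IsSub M W) {m : M.carrier} : (∃ n, lin (subι h) n = m) ↔ m ∈ W :=
  ⟨by rintro ⟨n, rfl⟩; exact n.2, fun hm => ⟨⟨m, hm⟩, rfl⟩⟩

/-- A quotient as an object. -/
def quot (h : IsSub M W) : FinGrMod K Λ :=
  ofProj (M.carrier ⧸ W)
    { toFun := fun x => W.mapQ W (M.act x) (h.act x)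
      map_add' := fun x y => by ext m; simp
      map_smul' := fun c x => by ext m; simp }
    (fun x y m => by
      obtain ⟨m, rfl⟩ := W.mkQ_surjective m
      exact congrArg W.mkQ (M.act_mul x y m))
    (by
      obtain ⟨F, hF⟩ := M.exists_sum_idem
      refine ⟨F, fun m => ?_⟩
      obtain ⟨m, rfl⟩ := W.mkQ_surjective m
      conv_rhs => rw [← hF m, map_sum]
      rfl)
    (fun j => W.mapQ W (M.proj j) (h.proj j))
    (fun i j hij m => by
      obtain ⟨m, rfl⟩ := W.mkQ_surjective m
      exact (congrArg W.mkQ (proj_of_ne (M.proj_mem j m) hij)).trans (map_zero _))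
    (fun i m => by
      obtain ⟨m, rfl⟩ := W.mkQ_surjective m
      exact congrArg W.mkQ (proj_of_mem (M.proj_mem i m)))
    (by
      obtain ⟨G, hG⟩ := M.proj_spec.2.2.2
      refine ⟨G, fun m => ?_⟩
      obtain ⟨m, rfl⟩ := W.mkQ_surjective m
      conv_rhs => rw [← hG m, map_sum]
      rfl)
    (fun x j m => by
      obtain ⟨m, rfl⟩ := W.mkQ_surjective m
      exact congrArg W.mkQ (proj_bact x j m))

/-- The projection onto a quotient. -/
def quotπ (h : IsSub M W) : M ⟶ quot h :=
  ⟨W.mkQ, fun _ _ => rfl, fun _ m hm => ⟨W.mkQ m, congrArg W.mkQ (proj_of_mem hm)⟩⟩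

theorem quotπ_surjective (h : IsSub M W) : Surjective (lin (quotπ h)) := W.mkQ_surjective

theorem quotπ_eq_zero (h : IsSub M W) {m : M.carrier} : lin (quotπ h) m = 0 ↔ m ∈ W :=
  Submodule.Quotient.mk_eq_zero W

theorem isSub_ker (f : M ⟶ N) : IsSub M (LinearMap.ker (lin f)) :=
  ⟨fun x m hm => by rw [mem_ker] at *; rw [lin_act, hm, map_zero],
    fun _ m hm => by rw [mem_ker] at *; rw [lin_proj, hm, map_zero]⟩

theorem IsSub.map {W : Submodule K M.carrier} (h : IsSub M W) (f : M ⟶ N) :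
    IsSub N (W.map (lin f)) := by
  constructor
  · rintro x _ ⟨m, hm, rfl⟩
    exact ⟨_, h.act x m hm, lin_act f x m⟩
  · rintro j _ ⟨m, hm, rfl⟩
    exact ⟨_, h.proj j m hm, lin_proj f j m⟩

theorem isSub_top (M : FinGrMod K Λ) : IsSub M ⊤ := ⟨fun _ _ _ => trivial, fun _ _ _ => trivial⟩

/-! ### Lifting and descending morphisms -/

variable {X Y Z : FinGrMod K Λ}

theorem exists_lift {i : Y ⟶ X} (hi : Function.Injective (lin i)) (f : Z ⟶ X)
    (h : ∀ z, ∃ y, lin i y = lin f z) : ∃ g : Z ⟶ Y, g ≫ i = f := by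
  let e := LinearEquiv.ofInjective (lin i) hi
  let g : Z.carrier →ₗ[K] Y.carrier := e.symm.toLinearMap ∘ₗ (lin f).codRestrict _ h
  have hg : ∀ z, lin i (g z) = lin f z := fun z =>
    congrArg Subtype.val (e.apply_symm_apply ⟨lin f z, h z⟩)
  refine ⟨⟨g, fun x m => hi ?_, fun j m hm => mem_deg.2 (hi ?_)⟩, hom_ext (LinearMap.ext hg)⟩
  · rw [hg, lin_act, lin_act, hg]
  · rw [lin_proj, hg, ← lin_proj, proj_of_mem hm]

theorem exists_desc {p : X ⟶ Y} (hp : Surjective (lin p)) (f : X ⟶ Z)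
    (h : ∀ x, lin p x = 0 → lin f x = 0) : ∃ g : Y ⟶ Z, p ≫ g = f := by
  let e := (lin p).quotKerEquivOfSurjective hp
  let g : Y.carrier →ₗ[K] Z.carrier :=
    (LinearMap.ker (lin p)).liftQ (lin f) (fun x hx => h x hx) ∘ₗ e.symm.toLinearMap
  have hg : ∀ x, g (lin p x) = lin f x := fun x => by
    have : e.symm (lin p x) = (LinearMap.ker (lin p)).mkQ x :=
      (LinearEquiv.symm_apply_eq _).2 rfl
    simp only [g, LinearMap.comp_apply, LinearEquiv.coe_coe, this]
    rfl
  refine ⟨⟨g, fun x m => ?_, fun j m hm => ?_⟩, hom_ext (LinearMap.ext hg)⟩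
  · obtain ⟨m, rfl⟩ := hp m
    rw [← lin_act, hg, hg, lin_act]
  · obtain ⟨m, rfl⟩ := hp m
    rw [← proj_of_mem hm, ← lin_proj, hg]
    exact Hom.map_deg f j _ (X.proj_mem j m)

theorem mono_of_injective {f : X ⟶ Y} (h : Function.Injective (lin f)) : Mono f :=
  ⟨fun _ _ e => hom_ext (LinearMap.ext fun m => h (congrArg (fun k => lin k m) e))⟩

theorem epi_of_surjective {f : X ⟶ Y} (h : Surjective (lin f)) : Epi f :=
  ⟨fun _ _ e => hom_ext (LinearMap.ext fun m => by
    obtain ⟨m, rfl⟩ := h m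
    exact congrArg (fun k => lin k m) e)⟩

theorem injective_of_mono (f : X ⟶ Y) [Mono f] : Function.Injective (lin f) := by
  have h : subι (isSub_ker f) ≫ f = 0 := hom_ext (LinearMap.ext fun m => m.2)
  have h0 := zero_of_comp_mono f h
  refine (injective_iff_map_eq_zero _).2 fun m hm => ?_
  exact congrArg (fun k => lin k (⟨m, hm⟩ : LinearMap.ker (lin f))) h0

theorem surjective_of_epi (f : X ⟶ Y) [Epi f] : Surjective (lin f) := by
  have hs := (isSub_top X).map f
  have h : f ≫ quotπ hs = 0 := hom_ext (LinearMap.ext fun m =>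
    (quotπ_eq_zero hs).2 ⟨m, trivial, rfl⟩)
  have h0 := zero_of_epi_comp f h
  intro m
  obtain ⟨n, -, hn⟩ := (quotπ_eq_zero hs).1 (congrArg (fun k => lin k m) h0)
  exact ⟨n, hn⟩

theorem isIso_of_bijective {f : X ⟶ Y} (h : Function.Bijective (lin f)) : IsIso f := by
  have := mono_of_injective h.1
  obtain ⟨g, hg⟩ := exists_lift h.1 (𝟙 Y) fun z => h.2 z
  exact ⟨g, by rw [← cancel_mono f, Category.assoc, hg]; simp, hg⟩

theorem isZero_of_forall (h : ∀ m : X.carrier, m = 0) : IsZero X :=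
  (IsZero.iff_id_eq_zero X).2 (hom_ext (LinearMap.ext fun m => h m))

theorem eq_zero_of_isZero (h : IsZero X) (m : X.carrier) : m = 0 :=
  congrArg (fun k => lin k m) ((IsZero.iff_id_eq_zero X).1 h)

/-- Exactness at an injective map. -/
theorem nonempty_isLimit {i : Y ⟶ X} {p : X ⟶ Z} (w : i ≫ p = 0)
    (hi : Function.Injective (lin i)) (h : ∀ m, lin p m = 0 → ∃ n, lin i n = m) :
    Nonempty (IsLimit (KernelFork.ofι i w)) := by
  have := mono_of_injective hi
  have H : ∀ {T : FinGrMod K Λ} (f : T ⟶ X), f ≫ p = 0 → ∃ g : T ⟶ Y, g ≫ i = f := fun f hf =>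
    exists_lift hi f fun z => h _ (congrArg (fun k => lin k z) hf)
  exact ⟨KernelFork.IsLimit.ofι i w (fun f hf => (H f hf).choose) (fun f hf => (H f hf).choose_spec)
    fun f hf m hm => by rw [← cancel_mono i, hm, (H f hf).choose_spec]⟩

theorem nonempty_isColimit {i : Y ⟶ X} {p : X ⟶ Z} (w : i ≫ p = 0)
    (hp : Surjective (lin p)) (h : ∀ m, lin p m = 0 → ∃ n, lin i n = m) :
    Nonempty (IsColimit (CokernelCofork.ofπ p w)) := by
  have := epi_of_surjective hp
  have H : ∀ {T : FinGrMod K Λ} (f : X ⟶ T), i ≫ f = 0 → ∃ g : Z ⟶ T, p ≫ g = f := fun f hf =>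
    exists_desc hp f fun z hz => by
      obtain ⟨y, rfl⟩ := h z hz
      exact congrArg (fun k => lin k y) hf
  exact ⟨CokernelCofork.IsColimit.ofπ p w (fun f hf => (H f hf).choose)
    (fun f hf => (H f hf).choose_spec)
    fun f hf m hm => by rw [← cancel_epi p, hm, (H f hf).choose_spec]⟩

instance : HasKernels (FinGrMod K Λ) := ⟨fun f => by
  have w : subι (isSub_ker f) ≫ f = 0 := hom_ext (LinearMap.ext fun m => m.2)
  exact ⟨⟨⟨_, (nonempty_isLimit w (subι_injective _) fun m hm =>
    (exists_subι (isSub_ker f)).2 hm).some⟩⟩⟩⟩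

instance : HasCokernels (FinGrMod K Λ) := ⟨fun f => by
  have hs := (isSub_top _).map f
  have w : f ≫ quotπ hs = 0 := hom_ext (LinearMap.ext fun m =>
    (quotπ_eq_zero hs).2 ⟨m, trivial, rfl⟩)
  exact ⟨⟨⟨_, (nonempty_isColimit w (quotπ_surjective _) fun m hm => by
    obtain ⟨n, -, hn⟩ := (quotπ_eq_zero hs).1 hm
    exact ⟨n, hn⟩).some⟩⟩⟩⟩

instance : IsNormalMonoCategory (FinGrMod K Λ) := ⟨fun f _ => by
  have hs := (isSub_top _).map f
  have w : f ≫ quotπ hs = 0 := hom_ext (LinearMap.ext fun m =>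
    (quotπ_eq_zero hs).2 ⟨m, trivial, rfl⟩)
  exact ⟨⟨_, _, w, (nonempty_isLimit w (injective_of_mono f) fun m hm => by
    obtain ⟨n, -, hn⟩ := (quotπ_eq_zero hs).1 hm
    exact ⟨n, hn⟩).some⟩⟩⟩

instance : IsNormalEpiCategory (FinGrMod K Λ) := ⟨fun f _ => by
  have w : subι (isSub_ker f) ≫ f = 0 := hom_ext (LinearMap.ext fun m => m.2)
  exact ⟨⟨_, _, w, (nonempty_isColimit w (surjective_of_epi f) fun m hm =>
    (exists_subι (isSub_ker f)).2 hm).some⟩⟩⟩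

theorem idem_idem_of_ne (M : FinGrMod K Λ) (a b : Λ) (h : a ≠ b) (m : M.carrier) :
    M.act (idem K Λ a) (M.act (idem K Λ b) m) = 0 := by
  classical
  rw [← M.act_mul, idem_kmul_idem, if_neg h, map_zero, LinearMap.zero_apply]

theorem idem_idem (M : FinGrMod K Λ) (a : Λ) (m : M.carrier) :
    M.act (idem K Λ a) (M.act (idem K Λ a) m) = M.act (idem K Λ a) m := by
  classical
  rw [← M.act_mul, idem_kmul_idem, if_pos rfl]

/-- The direct sum of two modules. -/
def sum (M N : FinGrMod K Λ) : FinGrMod K Λ :=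
  ofProj (M.carrier × N.carrier)
    (LinearMap.mk₂ K (fun x m => (M.act x m.1, N.act x m.2)) (fun _ _ _ => by simp)
      (fun _ _ _ => by simp) (fun _ _ _ => by simp) (fun _ _ _ => by simp))
    (fun x y m => Prod.ext (M.act_mul x y m.1) (N.act_mul x y m.2))
    (by
      classical
      obtain ⟨F, hF⟩ := M.exists_sum_idem
      obtain ⟨F', hF'⟩ := N.exists_sum_idem
      refine ⟨F ∪ F', fun m => Prod.ext ?_ ?_⟩
      · rw [Prod.fst_sum]
        exact sum_proj_of_subset (π := fun a => M.act (idem K Λ a)) M.idem_idem_of_ne hF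
          subset_union_left m.1
      · rw [Prod.snd_sum]
        exact sum_proj_of_subset (π := fun a => N.act (idem K Λ a)) N.idem_idem_of_ne hF'
          subset_union_right m.2)
    (fun j => (M.proj j).prodMap (N.proj j))
    (fun i j hij m => Prod.ext (proj_of_ne (M.proj_mem j m.1) hij)
      (proj_of_ne (N.proj_mem j m.2) hij))
    (fun i m => Prod.ext (proj_of_mem (M.proj_mem i m.1)) (proj_of_mem (N.proj_mem i m.2)))
    (by
      obtain ⟨G, hG⟩ := M.proj_spec.2.2.2
      obtain ⟨G', hG'⟩ := N.proj_spec.2.2.2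
      refine ⟨G ∪ G', fun m => Prod.ext ?_ ?_⟩
      · rw [Prod.fst_sum]
        exact sum_proj_of_subset (fun i j h m => proj_of_ne (M.proj_mem j m) h) hG
          subset_union_left m.1
      · rw [Prod.snd_sum]
        exact sum_proj_of_subset (fun i j h m => proj_of_ne (N.proj_mem j m) h) hG'
          subset_union_right m.2)
    (fun x j m => Prod.ext (proj_bact x j m.1) (proj_bact x j m.2))

instance : HasBinaryBiproducts (FinGrMod K Λ) := ⟨fun M N => by
  let b : BinaryBicone M N :=
    { pt := sum M N
      fst := ⟨LinearMap.fst _ _ _, fun _ _ => rfl, by rintro j _ ⟨m, rfl⟩; exact M.proj_mem j m.1⟩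
      snd := ⟨LinearMap.snd _ _ _, fun _ _ => rfl, by rintro j _ ⟨m, rfl⟩; exact N.proj_mem j m.2⟩
      inl := ⟨LinearMap.inl _ _ _, fun x m => Prod.ext rfl (map_zero (N.act x)).symm,
        fun j m hm => ⟨(m, 0), Prod.ext (proj_of_mem hm) (map_zero (N.proj j))⟩⟩
      inr := ⟨LinearMap.inr _ _ _, fun x m => Prod.ext (map_zero (M.act x)).symm rfl,
        fun j m hm => ⟨(0, m), Prod.ext (map_zero (M.proj j)) (proj_of_mem hm)⟩⟩
      inl_fst := rfl
      inl_snd := rfl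
      inr_fst := rfl
      inr_snd := rfl }
  exact hasBinaryBiproduct_of_total b (hom_ext (LinearMap.ext fun m =>
    Prod.ext (add_zero m.1) (zero_add m.2)))⟩

instance : HasZeroObject (FinGrMod K Λ) := by
  let Z : FinGrMod K Λ := ofProj PUnit 0 (fun _ _ _ => rfl) ⟨∅, fun _ => rfl⟩ 0
    (fun _ _ _ _ => rfl) (fun _ _ => rfl) ⟨∅, fun _ => rfl⟩ fun _ _ _ => rfl
  exact ⟨⟨Z, isZero_of_forall fun _ => rfl⟩⟩

instance : HasFiniteProducts (FinGrMod K Λ) := hasFiniteProducts_of_has_binary_and_terminal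

instance : Abelian (FinGrMod K Λ) where

theorem shortExact {i : Y ⟶ X} {p : X ⟶ Z} (w : i ≫ p = 0) (hi : Function.Injective (lin i))
    (hp : Surjective (lin p)) (h : ∀ m, lin p m = 0 → ∃ n, lin i n = m) :
    (ShortComplex.mk i p w).ShortExact :=
  { exact := ShortComplex.exact_of_f_is_kernel _ (nonempty_isLimit w hi h).some
    mono_f := mono_of_injective hi
    epi_g := epi_of_surjective hp }

/-- The underlying subspace of a subobject. -/
theorem strictMono_range (X : FinGrMod K Λ) :
    StrictMono fun S : Subobject X => LinearMap.range (lin S.arrow) := by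
  intro S T hST
  refine lt_of_le_of_ne ?_ fun h => hST.not_ge ?_
  · rintro _ ⟨m, rfl⟩
    exact ⟨lin (Subobject.ofLE S T hST.le) m,
      congrArg (fun k => lin k m) (Subobject.ofLE_arrow hST.le)⟩
  · obtain ⟨g, hg⟩ := exists_lift (injective_of_mono S.arrow) T.arrow fun z => by
      have : lin T.arrow z ∈ LinearMap.range (lin T.arrow) := ⟨z, rfl⟩
      exact h.ge this
    exact Subobject.le_of_comm g hg

theorem isArtinianObject (X : FinGrMod K Λ) : IsArtinianObject X :=
  ⟨(strictMono_range X).wellFoundedLT⟩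

theorem isNoetherianObject (X : FinGrMod K Λ) : IsNoetherianObject X :=
  ⟨(strictMono_range X).wellFoundedGT⟩

theorem finite_hom (M N : FinGrMod K Λ) : FiniteDimensional K (M ⟶ N) := by
  let f : (M ⟶ N) →ₗ[K] (M.carrier →ₗ[K] N.carrier) :=
    { toFun := lin, map_add' := fun _ _ => rfl, map_smul' := fun _ _ => rfl }
  exact FiniteDimensional.of_injective f fun _ _ h => hom_ext h

end FinGrMod

set_option linter.unusedSectionVars false

namespace FinGrMod

variable {K : Type u} [Field K] {Λ : Set Weight} [FiniteBlock Λ] {M N X Y : FinGrMod K Λ}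

/-- Constructing morphisms by checking linearity on basis vectors. -/
def homMk (f : M.carrier →ₗ[K] N.carrier) (h : ∀ x m, f (M.bact x m) = N.bact x (f m))
    (hd : ∀ j, ∀ m ∈ M.deg j, f m ∈ N.deg j) : M ⟶ N :=
  ⟨f, fun x m => congrArg (fun g => g x)
    (kalg_ext K (f := f ∘ₗ M.act.flip m) (g := N.act.flip (f m)) fun x => h x m), hd⟩

/-! ### Duality -/

/-- The graded dual of a module. -/
def dual (M : FinGrMod K Λ) : FinGrMod K Λ :=
  ofProj (Dual K M.carrier)
    (LinearMap.mk₂ K (fun x f => f ∘ₗ M.act (kstar K Λ x))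
      (fun _ _ _ => by rw [map_add, map_add]; exact LinearMap.comp_add ..)
      (fun _ _ _ => by rw [map_smul, map_smul]; exact LinearMap.comp_smul ..)
      (fun _ _ _ => rfl) (fun _ _ _ => rfl))
    (fun x y f => LinearMap.ext fun m => congrArg f (by
      rw [kstar_kmul, M.act_mul]))
    (by
      obtain ⟨F, hF⟩ := M.exists_sum_idem
      refine ⟨F, fun f => LinearMap.ext fun m => ?_⟩
      conv_rhs => rw [← hF m, map_sum]
      simp [kstar_idem])
    (fun j => (M.proj (-j)).dualMap)
    (fun i j hij f => LinearMap.ext fun m =>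
      (congrArg f (proj_of_ne (M.proj_mem (-i) m) (by omega))).trans (map_zero f))
    (fun i f => LinearMap.ext fun m => congrArg f (proj_of_mem (M.proj_mem (-i) m)))
    (by
      obtain ⟨G, hG⟩ := M.proj_spec.2.2.2
      refine ⟨G.map (Equiv.neg ℤ).toEmbedding, fun f => LinearMap.ext fun m => ?_⟩
      conv_rhs => rw [← hG m, map_sum]
      simp)
    (fun x j f => LinearMap.ext fun m => congrArg f (by
      have := proj_bact (M := M) x.mirror (-(x.degree + j)) m
      rw [show x.mirror.degree + -(x.degree + j) = -j by
        rw [show x.mirror.degree = x.degree from add_comm _ _]; ring] at this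
      rw [kstar_single]
      exact this.symm))

theorem mem_dual_deg {f : Dual K M.carrier} {j : ℤ} :
    f ∈ M.dual.deg j ↔ ∀ i, i ≠ -j → ∀ m ∈ M.deg i, f m = 0 := by
  constructor
  · rintro ⟨g, rfl⟩ i hi m hm
    exact (congrArg g (proj_of_ne hm hi.symm)).trans (map_zero g)
  · intro h
    refine ⟨f, LinearMap.ext fun m => ?_⟩
    obtain ⟨G, hG⟩ := M.proj_spec.2.2.2
    change f (M.proj (-j) m) = f m
    rw [← hG m, map_sum, map_sum, map_sum]
    refine sum_congr rfl fun k _ => ?_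
    by_cases hk : k = -j
    · rw [hk, proj_of_mem (M.proj_mem (-j) m)]
    · rw [proj_of_ne (M.proj_mem k m) (Ne.symm hk), map_zero]
      exact (h k hk _ (M.proj_mem k m)).symm

/-- The transpose of a morphism. -/
def dualMap (f : M ⟶ N) : dual N ⟶ dual M :=
  ⟨(lin f).dualMap, fun _ (g : Dual K N.carrier) => LinearMap.ext fun m => congrArg g (lin_act f _ m).symm,
    fun _ _ hg => mem_dual_deg.2 fun i hi m hm =>
      mem_dual_deg.1 hg i hi _ (Hom.map_deg f i m hm)⟩

/-- The evaluation isomorphism. -/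
def ev (M : FinGrMod K Λ) : M ≅ dual (dual M) :=
  isoMk (Module.evalEquiv K M.carrier)
    (fun x m => LinearMap.ext fun f =>
      congrArg (fun y => (show Dual K M.carrier from f) (M.act y m)) (kstar_kstar K x).symm)
    (fun j m => by
      refine ⟨fun hm => mem_dual_deg.2 fun i hi f hf => mem_dual_deg.1 hf j (by omega) m hm,
        fun h => ?_⟩
      obtain ⟨G, hG⟩ := M.proj_spec.2.2.2
      rw [← hG m]
      refine Submodule.sum_mem _ fun k _ => ?_
      by_cases hk : k = j
      · exact hk ▸ M.proj_mem k m
      · have : M.proj k m = 0 := (forall_dual_apply_eq_zero_iff K _).1 fun φ =>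
          mem_dual_deg.1 h (-k) (by omega) (φ ∘ₗ M.proj k) (mem_dual_deg.2 fun i hi n hn => by
            rw [LinearMap.comp_apply, proj_of_ne hn (by omega), map_zero])
        rw [this]
        exact Submodule.zero_mem _)

variable (K Λ) in
/-- The duality. -/
def duality : FinGrMod K Λ ≌ (FinGrMod K Λ)ᵒᵖ :=
  let F : FinGrMod K Λ ⥤ (FinGrMod K Λ)ᵒᵖ :=
    { obj := fun M => .op (dual M)
      map := fun f => (dualMap f).op
      map_id := fun _ => rfl
      map_comp := fun _ _ => rfl }
  CategoryTheory.Equivalence.mk F F.leftOp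
    (NatIso.ofComponents ev fun _ => rfl)
    (NatIso.ofComponents (fun M => (ev M.unop).op) fun _ => rfl)

theorem mono_iff_dual (f : M ⟶ N) : Mono f ↔ Epi (dualMap f) := by
  rw [← (duality K Λ).functor.mono_map_iff_mono f]
  exact op_mono_iff (dualMap f)

theorem epi_iff_dual (f : M ⟶ N) : Epi f ↔ Mono (dualMap f) := by
  rw [← (duality K Λ).functor.epi_map_iff_epi f]
  exact op_epi_iff (dualMap f)

/-- Transposition of a pairing. -/
def flip (f : X ⟶ dual Y) : Y ⟶ dual X := (ev Y).hom ≫ dualMap f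

theorem epi_flip (f : X ⟶ dual Y) [Mono f] : Epi (flip f) := by
  have := (mono_iff_dual f).1 inferInstance
  exact epi_comp _ _

theorem projective_iff_dual : Injective (dual M) ↔ Projective M := by
  rw [Injective.injective_iff_projective_op]
  exact (duality K Λ).map_projective_iff M

def dualShift (M : FinGrMod K Λ) (j : ℤ) : dual (M⟦j⟧) ≅ (dual M)⟦-j⟧ :=
  isoMk (LinearEquiv.refl K (Dual K M.carrier)) (fun _ _ => rfl) fun k f => by
    refine mem_dual_deg.trans (Iff.trans ?_ (mem_dual_deg (j := k - -j)).symm)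
    refine ⟨fun h i hi m hm => h (i + j) (by omega) m ?_, fun h i hi m hm =>
      h (i - j) (by omega) m hm⟩
    change m ∈ M.deg (i + j - j)
    rwa [add_sub_cancel_right]

/-! ### Subquotients of the regular module -/

/-- Sets of circle diagrams spanning subquotients of `K`. -/
structure IsConvex (R : Set (CircleDiagram Λ)) : Prop where
  finite : R.Finite
  conv : ∀ {x y z x' v}, y ∈ R → v ∈ R → sc x y z ≠ 0 → sc x' z v ≠ 0 → z ∈ R

section Mod

variable {R R' : Set (CircleDiagram Λ)} (h : IsConvex R) (h' : IsConvex R')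

variable (K) in
/-- The inclusion of the span of `R`. -/
def emb (R : Set (CircleDiagram Λ)) : (R →₀ K) →ₗ[K] KAlg K Λ :=
  lmapDomain K K Subtype.val

variable (K) in
/-- The projection onto the span of `R`. -/
def res (R : Set (CircleDiagram Λ)) : KAlg K Λ →ₗ[K] (R →₀ K) :=
  Finsupp.lsubtypeDomain R

theorem emb_single (y : R) (c : K) : emb K R (single y c) = single y.1 c :=
  Finsupp.mapDomain_single

theorem emb_apply (m : R →₀ K) (y : R) : emb K R m y.1 = m y :=
  Finsupp.mapDomain_apply Subtype.val_injective _ _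

theorem res_emb (m : R →₀ K) : res K R (emb K R m) = m := Finsupp.ext (emb_apply m)

theorem emb_res {n : KAlg K Λ} (hn : ∀ z, z ∉ R → n z = 0) : emb K R (res K R n) = n := by
  refine Finsupp.ext fun z => ?_
  by_cases hz : z ∈ R
  · exact emb_apply _ ⟨z, hz⟩
  · rw [hn z hz]
    exact mapDomain_of_notMem_range _ _ (by rintro ⟨y, rfl⟩; exact hz y.2)

theorem ext_single {V : Type*} [AddCommGroup V] [Module K V] {α : Type*}
    {f g : (α →₀ K) →ₗ[K] V} (h : ∀ y, f (single y 1) = g (single y 1)) : f = g :=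
  Finsupp.lhom_ext' fun y => LinearMap.ext_ring (h y)

include h in
theorem res_kmul (x y : KAlg K Λ) (m : R →₀ K) :
    res K R (kmul K Λ x (emb K R (res K R (kmul K Λ y (emb K R m))))) =
      res K R (kmul K Λ x (kmul K Λ y (emb K R m))) := by
  revert x
  let W : Submodule K (KAlg K Λ) := ⨅ x, LinearMap.eqLocus
    (res K R ∘ₗ kmul K Λ x ∘ₗ emb K R ∘ₗ res K R) (res K R ∘ₗ kmul K Λ x)
  suffices kmul K Λ y (emb K R m) ∈ W from fun x => (mem_iInf _).1 this x
  refine act_mem (fun y => ?_) y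
  induction m using Finsupp.induction_linear with
  | zero => simp
  | add m n hm hn => rw [map_add, map_add]; exact W.add_mem hm hn
  | single w c =>
    rw [emb_single, kmul_single]
    refine W.smul_mem _ (W.sum_mem fun z _ => (mem_iInf _).2 fun x => ?_)
    change res K R (kmul K Λ x (emb K R (res K R (single z _)))) =
      res K R (kmul K Λ x (single z _))
    by_cases hz : z ∈ R
    · rw [emb_res fun v hv => single_eq_of_ne fun e => hv (e ▸ hz)]
    have h0 : res K R (single z (sc y w z : K)) = 0 := Finsupp.ext fun v =>
      single_eq_of_ne fun e => hz (e ▸ v.2)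
    rw [h0, map_zero, map_zero, map_zero, eq_comm, ← mem_ker]
    by_cases hs : sc y w z = 0
    · rw [hs]; simp
    refine act_mem (act := kmul K Λ) (W := LinearMap.ker (res K R)) (fun x => ?_) x
    rw [← mul_one (sc y w z : K), ← smul_eq_mul, ← smul_single, map_smul]
    refine Submodule.smul_mem _ _ (Finsupp.ext fun v => (kmul_apply K x z v.1).trans ?_)
    by_contra hv
    exact hz (h.conv w.2 v.2 hs fun e => hv (by rw [e]; simp))

variable (K) in
/-- The action on the span of `R`. -/
def modAct (R : Set (CircleDiagram Λ)) :
    KAlg K Λ →ₗ[K] (R →₀ K) →ₗ[K] (R →₀ K) :=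
  ((kmul K Λ).compl₂ (emb K R)).compr₂ (res K R)

theorem modAct_apply (x : CircleDiagram Λ) (y v : R) :
    modAct K R (single x 1) (single y 1) v = (sc x y.1 v.1 : K) := by
  rw [← kmul_apply, ← emb_single]; rfl

open Classical in
/-- The projection onto the span of the diagrams of degree `j - d`. -/
def modProj (R : Set (CircleDiagram Λ)) (d j : ℤ) : (R →₀ K) →ₗ[K] (R →₀ K) where
  toFun m := m.filter fun y => y.1.degree + d = j
  map_add' _ _ := Finsupp.filter_add
  map_smul' _ _ := Finsupp.filter_smul

open Classical in
theorem modProj_apply (d j : ℤ) (m : R →₀ K) (v : R) :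
    modProj R d j m v = if v.1.degree + d = j then m v else 0 := Finsupp.filter_apply ..

variable (K) in
open Classical in
/-- The subquotient of `K` spanned by `R`, with degrees shifted by `d`. -/
def mod (d : ℤ) : FinGrMod K Λ :=
  haveI := h.finite.to_subtype
  ofProj (R →₀ K) (modAct K R)
    (fun x y m => by
      change res K R (kmul K Λ (kmul K Λ x y) (emb K R m)) = _
      rw [kmul_assoc, ← res_kmul h]; rfl)
    (by
      refine ⟨h.finite.toFinset.image CircleDiagram.bot, fun m => ?_⟩
      have := ext_single (K := K) (f := ∑ a ∈ h.finite.toFinset.image CircleDiagram.bot,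
        modAct K R (idem K Λ a)) (g := LinearMap.id) fun y => by
          rw [LinearMap.sum_apply, sum_eq_single_of_mem y.1.bot
            (mem_image_of_mem _ (h.finite.mem_toFinset.2 y.2))]
          · change res K R (kmul K Λ _ (emb K R _)) = _
            rw [emb_single, idem_kmul_single, if_pos rfl, ← emb_single, res_emb]; rfl
          · intro a _ ha
            change res K R (kmul K Λ _ (emb K R _)) = _
            rw [emb_single, idem_kmul_single, if_neg ha.symm, map_zero]
      simpa using congrArg (fun f => f m) this)
    (modProj R d)
    (fun i j hij m => Finsupp.ext fun v => by
      rw [modProj_apply, modProj_apply]; split_ifs <;> first | rfl | omega)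
    (fun i m => Finsupp.ext fun v => by
      rw [modProj_apply, modProj_apply]; split_ifs <;> rfl)
    (by
      refine ⟨h.finite.toFinset.image fun y => y.degree + d, fun m => Finsupp.ext fun v => ?_⟩
      rw [Finsupp.finsetSum_apply]
      simp only [modProj_apply]
      rw [Finset.sum_ite_eq, if_pos (mem_image_of_mem _ (h.finite.mem_toFinset.2 v.2))])
    (fun x j m => by
      refine congrArg (fun f => f m) (ext_single (K := K)
        (f := modProj R d (x.degree + j) ∘ₗ modAct K R (single x 1))
        (g := modAct K R (single x 1) ∘ₗ modProj R d j) fun y => Finsupp.ext fun v => ?_)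
      rw [LinearMap.comp_apply, LinearMap.comp_apply, modProj_apply, modAct_apply]
      by_cases hy : y.1.degree + d = j
      · rw [show modProj R d j (single y (1 : K)) = single y 1 from
          Finsupp.filter_single_of_pos _ hy, modAct_apply]
        split_ifs with hv
        · rfl
        · by_contra hs
          have := degree_of_sc fun e => hs (by rw [e, Nat.cast_zero])
          omega
      · rw [show modProj R d j (single y (1 : K)) = 0 from
          Finsupp.filter_single_of_neg _ hy, map_zero]
        split_ifs with hv
        · by_contra hs
          have := degree_of_sc fun e => hs (by rw [e, Nat.cast_zero]; rfl)
          omega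
        · rfl)

variable {d d' : ℤ}

theorem mem_mod_deg {j : ℤ} {m : R →₀ K} : m ∈ (mod K h d).deg j ↔
    ∀ v : R, m v ≠ 0 → v.1.degree + d = j := by
  constructor
  · rintro ⟨n, rfl⟩ v hv
    by_contra hc
    exact hv ((modProj_apply d j n v).trans (if_neg hc))
  · refine fun hm => ⟨m, Finsupp.ext fun v => (modProj_apply d j _ v).trans ?_⟩
    split_ifs with hv
    · rfl
    · by_contra h0
      exact hv (hm v (Ne.symm h0))

/-- Shifting twice. -/
def modShift (j : ℤ) : mod K h (d + j) ≅ (mod K h d)⟦j⟧ :=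
  isoMk (LinearEquiv.refl K (R →₀ K)) (fun _ _ => rfl) fun k m => by
    refine (mem_mod_deg h).trans (Iff.trans ?_ (mem_mod_deg h (d := d) (j := k - j)).symm)
    exact forall₂_congr fun v _ => by constructor <;> intro _ <;> omega

/-- Restriction to a subset closed under passing to predecessors. -/
def comapHom (e : R' → R) (he : Function.Injective e)
    (hd : ∀ v, (e v).1.degree + d = v.1.degree + d')
    (h1 : ∀ x u v, sc x (e u).1 (e v).1 = sc x u.1 v.1)
    (h2 : ∀ x y v, y ∉ Set.range e → sc x y.1 (e v).1 = 0) : mod K h d ⟶ mod K h' d' :=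
  homMk (lcomapDomain e he)
    (fun x m => congrArg (fun f => f m) (ext_single (K := K)
      (f := lcomapDomain e he ∘ₗ modAct K R (single x 1))
      (g := modAct K R' (single x 1) ∘ₗ lcomapDomain e he)
      fun y => Finsupp.ext fun v => by
        refine (modAct_apply x y (e v)).trans ?_
        rw [LinearMap.comp_apply]
        by_cases hy : y ∈ Set.range e
        · obtain ⟨u, rfl⟩ := hy
          rw [show lcomapDomain e he (single (e u) (1 : K)) = single u 1
            from Finsupp.comapDomain_single _ _ _ _, modAct_apply, h1]
        · rw [show lcomapDomain e he (single y (1 : K)) = 0 from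
            Finsupp.ext fun u => single_eq_of_ne fun e' => hy ⟨u, e'⟩, map_zero, h2 x y v hy]
          simp))
    fun j m hm => (mem_mod_deg h').2 fun v hv => by
      rw [← hd]; exact (mem_mod_deg h).1 hm (e v) hv

/-- Inclusion of a subset closed under passing to successors. -/
def mapHom (e : R' → R) (he : Function.Injective e)
    (hd : ∀ v, (e v).1.degree + d = v.1.degree + d')
    (h1 : ∀ x u v, sc x (e u).1 (e v).1 = sc x u.1 v.1)
    (h2 : ∀ x u y, y ∉ Set.range e → sc x (e u).1 y.1 = 0) : mod K h' d' ⟶ mod K h d :=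
  homMk (lmapDomain K K e)
    (fun x m => congrArg (fun f => f m) (ext_single (K := K)
      (f := lmapDomain K K e ∘ₗ modAct K R' (single x 1))
      (g := modAct K R (single x 1) ∘ₗ lmapDomain K K e)
      fun u => Finsupp.ext fun y => by
        rw [LinearMap.comp_apply, LinearMap.comp_apply,
          show lmapDomain K K e (single u (1 : K)) = single (e u) 1 from
            Finsupp.mapDomain_single, modAct_apply]
        by_cases hy : y ∈ Set.range e
        · obtain ⟨v, rfl⟩ := hy
          rw [h1, ← modAct_apply]
          exact Finsupp.mapDomain_apply he _ _
        · rw [h2 x u y hy, Nat.cast_zero]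
          exact mapDomain_of_notMem_range _ _ hy))
    fun j m hm => (mem_mod_deg h).2 fun y hy => by
      by_cases hr : y ∈ Set.range e
      · obtain ⟨v, rfl⟩ := hr
        rw [hd]
        refine (mem_mod_deg h').1 hm v fun h0 => hy ?_
        exact (Finsupp.mapDomain_apply he _ _).trans h0
      · exact (hy (mapDomain_of_notMem_range _ _ hr)).elim

end Mod

end FinGrMod

set_option linter.unusedSectionVars false

/-- An object whose endomorphisms are scalars is indecomposable. -/
theorem isIndecomposable_of_end {K : Type*} [Field K] {C : Type u} [Category.{v} C]
    [Preadditive C] [Linear K C] {X : C} (h0 : ¬ IsZero X)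
    (h : ∀ f : X ⟶ X, ∃ c : K, f = c • 𝟙 X) : IsIndecomposable X := by
  refine ⟨h0, fun Y Z b _ ⟨e⟩ => ?_⟩
  obtain ⟨c, hc⟩ := h (e.inv ≫ b.fst ≫ b.inl ≫ e.hom)
  have hc' : b.fst ≫ b.inl = c • 𝟙 b.pt := by
    rw [← cancel_epi e.inv, ← cancel_mono e.hom]
    simpa using hc
  by_cases h1 : c = 0
  · left
    rw [h1, zero_smul] at hc'
    rw [IsZero.iff_id_eq_zero]
    have := congrArg (fun f => b.inl ≫ f ≫ b.fst) hc'
    simpa using this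
  · right
    rw [IsZero.iff_id_eq_zero]
    have := congrArg (fun f => b.inr ≫ f ≫ b.snd) hc'
    simpa [h1] using this.symm

theorem IsIndecomposable.of_iso {C : Type u} [Category.{v} C] [HasZeroMorphisms C] {X Y : C}
    (e : X ≅ Y) (h : IsIndecomposable X) : IsIndecomposable Y :=
  ⟨fun hY => h.1 (hY.of_iso e), fun A B b hb ⟨e'⟩ => h.2 A B b hb ⟨e' ≪≫ e.symm⟩⟩

/-- A nonzero retract of an indecomposable object. -/
theorem IsIndecomposable.nonempty_iso {C : Type u} [Category.{v} C] [Abelian C] {X S : C}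
    (h : IsIndecomposable S) (hX : ¬ IsZero X) {s : X ⟶ S} {r : S ⟶ X} (hs : s ≫ r = 𝟙 X) :
    Nonempty (S ≅ X) := by
  have : IsSplitEpi r := ⟨⟨s, hs⟩⟩
  have hk := kernelIsKernel r
  rcases h.2 _ _ (binaryBiconeOfIsSplitEpiOfKernel hk) ⟨isBilimitBinaryBiconeOfIsSplitEpiOfKernel hk⟩
    ⟨Iso.refl _⟩ with h | h
  · have : Mono r := Preadditive.mono_of_kernel_zero (h.eq_of_src _ _)
    have := isIso_of_mono_of_epi r
    exact ⟨asIso r⟩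
  · exact (hX h).elim

namespace FinGrMod

variable {K : Type u} [Field K] {Λ : Set Weight} [FiniteBlock Λ]
  {M N P S T X Y Q : FinGrMod K Λ} {a b : Λ} {j k : ℤ}

/-! ### Weight vectors -/

/-- The homogeneous elements of degree `j` of `e_a M`. -/
structure IsWt (M : FinGrMod K Λ) (a : Λ) (j : ℤ) (m : M.carrier) : Prop where
  deg : m ∈ M.deg j
  idem : M.act (idem K Λ a) m = m

theorem isWt_proj (a : Λ) (j : ℤ) (m : M.carrier) :
    IsWt M a j (M.act (idem K Λ a) (M.proj j m)) :=
  ⟨by rw [← proj_idem]; exact M.proj_mem _ _, idem_idem M a _⟩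

theorem IsWt.proj_eq {m : M.carrier} (h : IsWt M a j m) :
    M.act (ArcAlgebra.idem K Λ a) (M.proj j m) = m := by
  rw [proj_of_mem h.deg, h.idem]

theorem exists_proj_ne_zero {m : M.carrier} (hm : m ≠ 0) :
    ∃ a j, M.act (idem K Λ a) (M.proj j m) ≠ 0 := by
  by_contra! h
  obtain ⟨G, hG⟩ := M.proj_spec.2.2.2
  obtain ⟨F, hF⟩ := M.exists_sum_idem
  refine hm ?_
  rw [← hG m]
  refine sum_eq_zero fun j _ => ?_
  rw [← hF (M.proj j m)]
  exact sum_eq_zero fun a _ => h a j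

theorem IsWt.map {m : M.carrier} (h : IsWt M a j m) (f : M ⟶ N) : IsWt N a j (lin f m) :=
  ⟨Hom.map_deg f j m h.deg, by rw [← lin_act, h.idem]⟩

theorem lin_wt (f : M ⟶ N) (a : Λ) (j : ℤ) (m : M.carrier) :
    lin f (M.act (idem K Λ a) (M.proj j m)) = N.act (idem K Λ a) (N.proj j (lin f m)) := by
  rw [lin_act, lin_proj]

theorem IsWt.smul {m : M.carrier} (h : IsWt M a j m) (c : K) : IsWt M a j (c • m) :=
  ⟨Submodule.smul_mem _ c h.deg, by rw [map_smul, h.idem]⟩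

theorem IsWt.unique {m : M.carrier} (h : IsWt M a j m) (h' : IsWt M b k m) (hm : m ≠ 0) :
    a = b ∧ j = k := by
  constructor
  · by_contra hab
    apply hm
    rw [← h.idem, ← h'.idem, idem_idem_of_ne M a b hab]
  · by_contra hjk
    apply hm
    rw [← proj_of_mem h.deg, proj_of_ne h'.deg hjk]

theorem IsWt.bact_of_ne {m : M.carrier} (h : IsWt M a j m) {x : CircleDiagram Λ}
    (hx : x.top ≠ a) : M.bact x m = 0 := by
  classical
  rw [← h.idem, bact, ← M.act_mul, kmul_idem_single, if_neg hx, map_zero, LinearMap.zero_apply]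

theorem exists_lowest (hM : ¬ IsZero M) :
    ∃ a j, (∃ m, IsWt M a j m ∧ m ≠ 0) ∧ ∀ k < j, ∀ m, M.proj k m = 0 := by
  obtain ⟨G, hG⟩ := M.proj_spec.2.2.2
  have hG' : ∀ k m, M.proj k m ≠ 0 → k ∈ G := fun k m hm => by
    by_contra hk
    apply hm
    rw [← hG m, map_sum]
    exact sum_eq_zero fun i hi => proj_of_ne (M.proj_mem i m) fun e => hk (e ▸ hi)
  classical
  have hne : (G.filter fun k => ∃ m, M.proj k m ≠ 0).Nonempty := by
    by_contra hc
    refine hM (isZero_of_forall fun m => ?_)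
    rw [← hG m]
    refine sum_eq_zero fun k hk => ?_
    by_contra h
    exact hc ⟨k, mem_filter.2 ⟨hk, m, h⟩⟩
  obtain ⟨-, m, hm⟩ := mem_filter.1 (min'_mem _ hne)
  set j := Finset.min' _ hne
  obtain ⟨a, i, h⟩ := exists_proj_ne_zero hm
  have hij : i = j := by
    by_contra hij
    exact h (by rw [proj_of_ne (M.proj_mem j m) hij, map_zero])
  subst hij
  refine ⟨a, _, ⟨_, isWt_proj a _ _, h⟩, fun k hk m => ?_⟩
  by_contra h
  exact (min'_le _ _ (mem_filter.2 ⟨hG' k m h, m, h⟩)).not_gt hk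

/-- The submodule of elements of degree at least `j`. -/
theorem isSub_ge (M : FinGrMod K Λ) (j : ℤ) :
    IsSub M (⨅ k, ⨅ _ : k < j, LinearMap.ker (M.proj k)) := by
  constructor
  · refine fun x m hm => act_mem (fun x => ?_) x
    simp only [mem_iInf, mem_ker] at hm ⊢
    intro k hk
    have := proj_bact x (k - x.degree) m
    rw [add_sub_cancel, hm _ (by have := degree_nonneg x; omega), map_zero] at this
    exact this
  · intro i m hm
    simp only [mem_iInf, mem_ker] at hm ⊢
    intro k hk
    by_cases hik : k = i
    · rw [← hik, hm k hk, map_zero]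
    · exact proj_of_ne (M.proj_mem i m) hik

/-! ### Irreducible modules -/

/-- `M` is `L(a)⟨j⟩`, with basis vector `g`. -/
structure IsIrrAt (a : Λ) (j : ℤ) (M : FinGrMod K Λ) (g : M.carrier) : Prop where
  ne : g ≠ 0
  span : ∀ m, ∃ c : K, m = c • g
  wt : IsWt M a j g

section Irr

variable {g : S.carrier} (hS : IsIrrAt a j S g)

include hS

theorem IsIrrAt.bact_eq_zero {x : CircleDiagram Λ} (hx : x ≠ idemDiagram a) (m : S.carrier) :
    S.bact x m = 0 := by
  obtain ⟨c, rfl⟩ := hS.span m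
  rw [map_smul]
  by_cases ha : x.top = a
  · have hd : x.degree ≠ 0 := fun hd => hx (by rw [← ha]; exact isIdem_iff.1 (isIdem_of_degree hd))
    obtain ⟨c', hc⟩ := hS.span (S.bact x g)
    have h1 := bact_deg x hS.wt.deg
    have h2 : S.bact x g ∈ S.deg j := hc ▸ Submodule.smul_mem _ _ hS.wt.deg
    rw [← proj_of_mem h1, proj_of_ne h2 (by omega), smul_zero]
  · rw [hS.wt.bact_of_ne ha, smul_zero]

theorem IsIrrAt.wt_eq {m : S.carrier} (h : IsWt S b k m) (hm : m ≠ 0) : b = a ∧ k = j := by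
  obtain ⟨c, rfl⟩ := hS.span m
  exact h.unique (hS.wt.smul c) hm

theorem IsIrrAt.surjective {f : M ⟶ S} {m : M.carrier} (h : lin f m ≠ 0) :
    Surjective (lin f) := by
  intro s
  obtain ⟨c, hc⟩ := hS.span (lin f m)
  obtain ⟨d, rfl⟩ := hS.span s
  have hc0 : c ≠ 0 := fun h0 => h (by rw [hc, h0, zero_smul])
  refine ⟨(d * c⁻¹) • m, ?_⟩
  rw [map_smul, hc, smul_smul, inv_mul_cancel_right₀ hc0]

theorem IsIrrAt.not_isZero : ¬ IsZero S := fun h => hS.ne (eq_zero_of_isZero h g)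

theorem IsIrrAt.simple : Simple S where
  mono_isIso_iff_nonzero {Y} f _ := by
    constructor
    · rintro hf rfl
      refine hS.ne (eq_zero_of_isZero ?_ g)
      exact (IsZero.iff_id_eq_zero S).2 (isIsoZeroEquiv Y S hf).2
    · intro hf
      have : ∃ m, lin f m ≠ 0 := by
        by_contra! h
        exact hf (hom_ext (LinearMap.ext h))
      obtain ⟨m, hm⟩ := this
      exact isIso_of_bijective ⟨injective_of_mono f, hS.surjective hm⟩

theorem exists_toIrr (hM : ∀ k < j, ∀ m, M.proj k m = 0) {m₀ : M.carrier} (h : IsWt M a j m₀)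
    (h0 : m₀ ≠ 0) : ∃ f : M ⟶ S, lin f m₀ ≠ 0 := by
  obtain ⟨φ, hφ⟩ : ∃ φ : Dual K M.carrier, φ m₀ ≠ 0 := by
    by_contra! hc
    exact h0 ((forall_dual_apply_eq_zero_iff K m₀).1 hc)
  let f : M.carrier →ₗ[K] S.carrier :=
    (φ ∘ₗ M.act (idem K Λ a) ∘ₗ M.proj j).smulRight g
  have hf : ∀ m, f m = φ (M.act (idem K Λ a) (M.proj j m)) • g := fun _ => rfl
  refine ⟨homMk f (fun x m => ?_) fun i m hm => ?_, ?_⟩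
  · by_cases hx : x = idemDiagram a
    · rw [hx, bact, bact, ← idem_eq, hf, hf, map_smul, hS.wt.idem, proj_idem, idem_idem]
    · rw [hS.bact_eq_zero hx, hf]
      convert zero_smul K g
      convert map_zero φ
      have hp := proj_bact (M := M) x (j - x.degree) m
      rw [add_sub_cancel] at hp
      rw [hp]
      by_cases hd : x.degree = 0
      · have hx' := isIdem_iff.1 (isIdem_of_degree hd)
        have ha : a ≠ x.top := fun h => hx (by rw [h]; exact hx')
        rw [hx', bact, ← idem_eq]
        exact idem_idem_of_ne M _ _ ha _
      · rw [hM _ (by have := degree_nonneg x; omega), map_zero, map_zero]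
  · rw [hf]
    by_cases hi : j = i
    · exact Submodule.smul_mem _ _ (hi ▸ hS.wt.deg)
    · rw [proj_of_ne hm hi, map_zero, map_zero, zero_smul]
      exact Submodule.zero_mem _
  · change f m₀ ≠ 0
    rw [hf, h.proj_eq]
    exact smul_ne_zero hφ hS.ne

theorem IsIrrAt.of_iso (e : S ≅ T) : IsIrrAt a j T (lin e.hom g) := by
  have h1 : ∀ m, lin e.inv (lin e.hom m) = m := fun m =>
    congrArg (fun f => lin f m) e.hom_inv_id
  have h2 : ∀ m, lin e.hom (lin e.inv m) = m := fun m =>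
    congrArg (fun f => lin f m) e.inv_hom_id
  refine ⟨fun h => hS.ne ?_, fun m => ?_, hS.wt.map _⟩
  · rw [← h1 g, h, map_zero]
  · obtain ⟨c, hc⟩ := hS.span (lin e.inv m)
    exact ⟨c, by rw [← h2 m, hc, map_smul]⟩

theorem IsIrrAt.proj_eq_zero : ∀ k < j, ∀ m, S.proj k m = 0 := fun k hk m => by
  obtain ⟨c, rfl⟩ := hS.span m
  rw [map_smul, proj_of_ne hS.wt.deg hk.ne, smul_zero]

theorem IsIrrAt.nonempty_iso {g' : T.carrier} (hT : IsIrrAt a j T g') : Nonempty (S ≅ T) := by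
  obtain ⟨f, hf⟩ := exists_toIrr hT hS.proj_eq_zero hS.wt hS.ne
  have := hS.simple
  have := hT.simple
  have := isIso_of_hom_simple (f := f) fun h => hf (by rw [h]; rfl)
  exact ⟨asIso f⟩

theorem isCompFactor {m : M.carrier} (hm : IsWt M a j m) (h0 : m ≠ 0) : IsCompFactor S M := by
  have hs := isSub_ge M j
  have hm' : m ∈ ⨅ k, ⨅ _ : k < j, LinearMap.ker (M.proj k) := by
    simp only [mem_iInf, mem_ker]
    exact fun k hk => proj_of_ne hm.deg hk.ne
  obtain ⟨n, rfl⟩ := (exists_subι hs).2 hm'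
  have hinj := subι_injective hs
  have hn : IsWt (sub hs) a j n := by
    have := lin_wt (subι hs) a j n
    rw [hm.proj_eq] at this
    rw [← hinj this]
    exact isWt_proj a j n
  obtain ⟨f, hf⟩ := exists_toIrr hS (M := sub hs) (fun k hk n => hinj (by
    rw [lin_proj, map_zero]
    have : lin (subι hs) n ∈ _ := (exists_subι hs).1 ⟨n, rfl⟩
    simp only [mem_iInf, mem_ker] at this
    exact this k hk)) hn fun h => h0 (by rw [h, map_zero])
  exact ⟨hS.simple, _, subι hs, f, mono_of_injective hinj, epi_of_surjective (hS.surjective hf)⟩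

theorem isRadicalFactor {m : M.carrier} (hm : IsWt M a j m) (h0 : m ≠ 0)
    (hk : ∀ (T : FinGrMod K Λ) (f : M ⟶ T), Simple T → lin f m = 0) : IsRadicalFactor S M := by
  have hs : IsSub M (⨅ (T : FinGrMod K Λ), ⨅ (f : M ⟶ T), ⨅ (_ : Simple T),
      LinearMap.ker (lin f)) := by
    constructor <;> intro _ m hm <;> simp only [mem_iInf] at hm ⊢ <;> intro T f hT
    · exact (isSub_ker f).act _ m (hm T f hT)
    · exact (isSub_ker f).proj _ m (hm T f hT)
  have hm' : m ∈ ⨅ (T : FinGrMod K Λ), ⨅ (f : M ⟶ T), ⨅ (_ : Simple T),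
      LinearMap.ker (lin f) := by
    simp only [mem_iInf]
    exact hk
  obtain ⟨n, rfl⟩ := (exists_subι hs).2 hm'
  have hinj := subι_injective hs
  have hn : IsWt (sub hs) a j n := by
    have := lin_wt (subι hs) a j n
    rw [hm.proj_eq] at this
    rw [← hinj this]
    exact isWt_proj a j n
  refine ⟨_, subι hs, mono_of_injective hinj, fun T f hT => hom_ext (LinearMap.ext fun n => ?_),
    isCompFactor hS hn fun h => h0 (by rw [h, map_zero])⟩
  have : lin (subι hs) n ∈ _ := (exists_subι hs).1 ⟨n, rfl⟩
  simp only [mem_iInf] at this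
  exact this T f hT

end Irr

/-! ### Projective modules -/

/-- `M` is `P(a)⟨j⟩`, with generator `g`. -/
structure IsProjAt (a : Λ) (j : ℤ) (P : FinGrMod K Λ) (g : P.carrier) : Prop where
  ne : g ≠ 0
  wt : IsWt P a j g
  span : ∀ m, IsWt P a j m → ∃ c : K, m = c • g
  gen : ∀ m, ∃ x, m = P.act x g
  lift : ∀ (M : FinGrMod K Λ) m, IsWt M a j m → ∃ f : P ⟶ M, lin f g = m
  pos : ∀ k < j, ∀ m, P.proj k m = 0

section Proj

variable {g : P.carrier} (hP : IsProjAt a j P g)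

include hP

theorem IsProjAt.hom_ext {f f' : P ⟶ M} (h : lin f g = lin f' g) : f = f' :=
  FinGrMod.hom_ext (LinearMap.ext fun m => by
    obtain ⟨x, rfl⟩ := hP.gen m
    rw [lin_act, lin_act, h])

theorem IsProjAt.not_isZero : ¬ IsZero P := fun h => hP.ne (eq_zero_of_isZero h g)

theorem IsProjAt.projective : Projective P where
  factors {E X} f e he := by
    obtain ⟨y, hy⟩ := surjective_of_epi e (lin f g)
    obtain ⟨h, hh⟩ := hP.lift E _ (isWt_proj a j y)
    refine ⟨h, hP.hom_ext ?_⟩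
    rw [lin_comp, LinearMap.comp_apply, hh, lin_wt, hy, (hP.wt.map f).proj_eq]

theorem IsProjAt.isIndecomposable : IsIndecomposable P :=
  isIndecomposable_of_end (K := K) hP.not_isZero fun f => by
    obtain ⟨c, hc⟩ := hP.span _ (hP.wt.map f)
    exact ⟨c, hP.hom_ext hc⟩

theorem IsProjAt.isProjectiveCover {p : P ⟶ S} (hp : lin p g ≠ 0) [Epi p] :
    IsProjectiveCover p := by
  refine ⟨hP.projective, inferInstance, fun Y f _ => epi_of_surjective fun m => ?_⟩
  obtain ⟨y, hy⟩ := surjective_of_epi (f ≫ p) (lin p g)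
  obtain ⟨c, hc⟩ := hP.span _ ((isWt_proj a j y).map f)
  have h1 : lin p (lin f (Y.act (idem K Λ a) (Y.proj j y))) = lin p g := by
    rw [lin_wt, lin_wt]
    rw [lin_comp, LinearMap.comp_apply] at hy
    rw [hy, (hP.wt.map p).proj_eq]
  have hc0 : c ≠ 0 := fun h0 => hp (by rw [← h1, hc, h0, zero_smul, map_zero])
  obtain ⟨x, rfl⟩ := hP.gen m
  refine ⟨Y.act x (c⁻¹ • Y.act (idem K Λ a) (Y.proj j y)), ?_⟩
  rw [lin_act, map_smul, hc, smul_smul, inv_mul_cancel₀ hc0, one_smul]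

theorem IsProjAt.exists_cover {g' : S.carrier} (hS : IsIrrAt a j S g') :
    ∃ p : P ⟶ S, lin p g ≠ 0 ∧ IsProjectiveCover p := by
  obtain ⟨p, hp⟩ := exists_toIrr hS hP.pos hP.wt hP.ne
  have := epi_of_surjective (hS.surjective hp)
  exact ⟨p, hp, hP.isProjectiveCover hp⟩

theorem IsProjAt.unique {g' : Q.carrier} (hQ : IsProjAt b k Q g') {g'' : S.carrier}
    (hS : IsIrrAt b k S g'') (e : P ≅ Q) : a = b ∧ j = k := by
  obtain ⟨p, -, -, hp, -⟩ := hQ.exists_cover hS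
  have hp' : lin (e.hom ≫ p) g ≠ 0 := fun h0 => by
    have h1 : e.hom ≫ p = 0 := hP.hom_ext (h0.trans rfl)
    refine hS.not_isZero (IsZero.of_epi_eq_zero p ?_)
    rw [← cancel_epi e.hom, h1, comp_zero]
  exact hS.wt_eq (hP.wt.map (e.hom ≫ p)) hp'

end Proj

/-- A projective module has a split epimorphism onto some `P(a)⟨j⟩`. -/
theorem exists_retract (hQ : Projective Q) (h0 : ¬ IsZero Q)
    {L P : Λ → ℤ → FinGrMod K Λ} (hL : ∀ a j, ∃ g, IsIrrAt a j (L a j) g)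
    (hP : ∀ a j, ∃ g, IsProjAt a j (P a j) g) :
    ∃ a j, ∃ (s : P a j ⟶ Q) (r : Q ⟶ P a j), s ≫ r = 𝟙 _ := by
  obtain ⟨a, j, ⟨m, hm, hm0⟩, hlow⟩ := exists_lowest h0
  obtain ⟨g, hg⟩ := hL a j
  obtain ⟨g', hg'⟩ := hP a j
  obtain ⟨q, hq⟩ := exists_toIrr hg hlow hm hm0
  have : Epi q := epi_of_surjective (hg.surjective hq)
  obtain ⟨p, -, hp, _, hcov⟩ := hg'.exists_cover hg
  have : Epi (Projective.factorThru q p) := hcov _ _ (by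
    rw [Projective.factorThru_comp]; infer_instance)
  exact ⟨a, j, Projective.factorThru (𝟙 _) (Projective.factorThru q p), _,
    Projective.factorThru_comp _ _⟩

/-! ### Duality for weight vectors -/

theorem IsWt.exists_dual {m : M.carrier} (h : IsWt M a j m) (h0 : m ≠ 0) :
    ∃ φ : Dual K M.carrier, IsWt (dual M) a (-j) φ ∧ φ m ≠ 0 := by
  obtain ⟨φ, hφ⟩ : ∃ φ : Dual K M.carrier, φ m ≠ 0 := by
    by_contra! hc
    exact h0 ((forall_dual_apply_eq_zero_iff K m).1 hc)
  refine ⟨φ ∘ₗ M.proj j ∘ₗ M.act (ArcAlgebra.idem K Λ a),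
    ⟨mem_dual_deg.2 fun i hi n hn => ?_, LinearMap.ext fun n => ?_⟩, ?_⟩
  · rw [LinearMap.comp_apply, LinearMap.comp_apply, proj_idem, proj_of_ne hn (by omega), map_zero,
      map_zero]
  · change φ (M.proj j (M.act _ (M.act (kstar K Λ (ArcAlgebra.idem K Λ a)) n))) = φ (M.proj j (M.act _ n))
    rw [kstar_idem, idem_idem]
  · rw [LinearMap.comp_apply, LinearMap.comp_apply, h.idem, proj_of_mem h.deg]
    exact hφ

theorem IsIrrAt.dual {g : S.carrier} (h : IsIrrAt a j S g) : ∃ φ, IsIrrAt a (-j) (dual S) φ := by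
  obtain ⟨φ, hφ, h0⟩ := h.wt.exists_dual h.ne
  refine ⟨φ, fun h' => h0 (congrArg (fun f : Dual K S.carrier => f g) h'),
    fun (ψ : Dual K S.carrier) => ⟨ψ g / φ g, LinearMap.ext fun m => ?_⟩, hφ⟩
  obtain ⟨c, rfl⟩ := h.span m
  change ψ (c • g) = (ψ g / φ g) * φ (c • g)
  rw [map_smul, map_smul, smul_eq_mul, smul_eq_mul]
  field_simp

end FinGrMod

set_option linter.unusedSectionVars false

namespace FinGrMod

variable {K : Type u} [Field K] {Λ : Set Weight} [FiniteBlock Λ]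
  {M N P S T X Y Q : FinGrMod K Λ} {a b : Λ} {j k : ℤ}

/-! ### Shifts -/

theorem isWt_shift {m : M.carrier} : IsWt (M⟦j⟧) a k m ↔ IsWt M a (k - j) m :=
  ⟨fun h => ⟨h.deg, h.idem⟩, fun h => ⟨h.deg, h.idem⟩⟩

theorem IsIrrAt.shift {g : S.carrier} (h : IsIrrAt a 0 S g) (j : ℤ) : IsIrrAt a j (S⟦j⟧) g :=
  ⟨h.ne, h.span, isWt_shift.2 (by rw [sub_self]; exact h.wt)⟩

theorem IsProjAt.shift {g : P.carrier} (h : IsProjAt a 0 P g) (j : ℤ) : IsProjAt a j (P⟦j⟧) g where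
  ne := h.ne
  wt := isWt_shift.2 (by rw [sub_self]; exact h.wt)
  span m hm := h.span m (by rw [← sub_self j]; exact isWt_shift.1 hm)
  gen := h.gen
  lift M m hm := by
    obtain ⟨f, hf⟩ := h.lift (M⟦-j⟧) m (isWt_shift.2 (by rw [zero_sub, neg_neg]; exact hm))
    let F : P.carrier →ₗ[K] (M⟦-j⟧).carrier := lin f
    refine ⟨⟨F, Hom.map_act f, fun i n hn => ?_⟩, hf⟩
    have : F n ∈ M.deg (i - j - -j) := Hom.map_deg f (i - j) n hn
    rwa [sub_neg_eq_add, sub_add_cancel] at this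
  pos i hi m := by
    have : (P⟦j⟧).proj i m ∈ P.deg (i - j) := (P⟦j⟧).proj_mem i m
    exact (proj_of_mem this).symm.trans (h.pos _ (by omega) _)

/-! ### Spans of circle diagrams -/

section Mod

variable {R : Set (CircleDiagram Λ)} (h : IsConvex R) {d : ℤ}

theorem idem_kmul_apply (n : KAlg K Λ) (z : CircleDiagram Λ) [Decidable (z.bot = a)] :
    kmul K Λ (idem K Λ a) n z = if z.bot = a then n z else 0 := by
  classical
  induction n using Finsupp.induction_linear with
  | zero => simp
  | add m n hm hn => rw [map_add, Finsupp.add_apply, hm, hn]; split_ifs <;> simp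
  | single w c =>
    rw [← mul_one c, ← smul_eq_mul, ← smul_single, map_smul, idem_kmul_single]
    by_cases hw : w = z
    · subst hw; split_ifs <;> simp
    · split_ifs <;> simp [single_eq_of_ne' hw]

theorem kmul_idem_apply (n : KAlg K Λ) (z : CircleDiagram Λ) [Decidable (z.top = a)] :
    kmul K Λ n (idem K Λ a) z = if z.top = a then n z else 0 := by
  classical
  induction n using Finsupp.induction_linear with
  | zero => simp
  | add m n hm hn =>
    rw [map_add, LinearMap.add_apply, Finsupp.add_apply, hm, hn]; split_ifs <;> simp
  | single w c =>
    rw [← mul_one c, ← smul_eq_mul, ← smul_single, map_smul, LinearMap.smul_apply,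
      kmul_idem_single]
    by_cases hw : w = z
    · subst hw; split_ifs <;> simp
    · split_ifs <;> simp [single_eq_of_ne' hw]

theorem isWt_mod {m : R →₀ K} (hm : IsWt (mod K h d) a j m) {v : R} (hv : m v ≠ 0) :
    v.1.bot = a ∧ v.1.degree + d = j := by
  classical
  refine ⟨?_, (mem_mod_deg h).1 hm.deg v hv⟩
  by_contra hc
  have := idem_kmul_apply (a := a) (emb K R m) v.1
  rw [if_neg hc] at this
  exact hv ((congrArg (fun n : R →₀ K => n v) hm.idem).symm.trans this)

theorem isWt_single (y : R) :
    IsWt (mod K h d) y.1.bot (y.1.degree + d) (single y (1 : K)) := by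
  classical
  constructor
  · refine (mem_mod_deg h).2 fun v hv => ?_
    by_cases hy : y = v
    · rw [hy]
    · exact (hv (single_eq_of_ne' hy)).elim
  · change res K R (kmul K Λ _ (emb K R _)) = _
    rw [emb_single, idem_kmul_single, if_pos rfl, ← emb_single, res_emb]

end Mod

/-! ### Irreducible, projective and standard modules -/

theorem isConvex_idem (a : Λ) : IsConvex {idemDiagram a} where
  finite := Set.finite_singleton _
  conv {x y z x' w} hy hv h h' := by
    obtain rfl : y = _ := hy
    obtain rfl : w = _ := hv
    have h1 := degree_of_sc h
    have h2 := degree_of_sc h'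
    rw [(isIdem_iff.2 rfl).degree] at h1 h2
    have := degree_nonneg x
    have := degree_nonneg x'
    have h3 := isIdem_iff.1 (isIdem_of_degree (x := z) (by omega))
    rw [(sc_cond h).2.2] at h3
    exact h3

/-- The circle diagrams with upper cup diagram given by `a` and weight in `T`. -/
def topSet (a : Λ) (T : Set Λ) : Set (CircleDiagram Λ) := {z | z.top = a ∧ z.wt ∈ T}

theorem isConvex_topSet (a : Λ) {T : Set Λ} (hT : T.OrdConnected) : IsConvex (topSet a T) where
  finite := (finite_top a).subset fun _ h => h.1
  conv hy hv h h' := ⟨(sc_cond h).2.2.trans hy.1,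
    hT.out hy.2 hv.2 ⟨(wt_le_of_sc h).2, (wt_le_of_sc h').2⟩⟩

theorem top_le_wt (z : CircleDiagram Λ) : z.top ≤ z.wt := z.top_sub.le (finCups _)

theorem bot_le_wt (z : CircleDiagram Λ) : z.bot ≤ z.wt := z.bot_sub.le (finCups _)

variable (K) in
/-- The irreducible module `L(a)`. -/
def irr (a : Λ) : FinGrMod K Λ := mod K (isConvex_idem a) 0

variable (K) in
/-- The projective module `P(a)`. -/
def stdProj (a : Λ) : FinGrMod K Λ :=
  mod K (isConvex_topSet a (ordConnected_Ici (a := a))) 0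

variable (K) in
/-- The cell module `V(a)`. -/
def cell (a : Λ) : FinGrMod K Λ :=
  mod K (isConvex_topSet a (ordConnected_singleton (a := a))) 0

theorem exists_isIrrAt_zero (a : Λ) : ∃ g, IsIrrAt a 0 (irr K a) g := by
  let y : ({idemDiagram a} : Set (CircleDiagram Λ)) := ⟨idemDiagram a, rfl⟩
  refine ⟨single y (1 : K), fun h => ?_, fun (m : _ →₀ K) => ⟨m y, ?_⟩, ?_⟩
  · exact one_ne_zero (Finsupp.single_eq_zero.1 h)
  · refine Finsupp.ext fun v => ?_
    have hv : v = y := Subtype.ext v.2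
    change m v = m y * single y (1 : K) v
    rw [hv, Finsupp.single_eq_same, mul_one]
  · have := isWt_single (K := K) (isConvex_idem a) (d := 0) y
    rw [(isIdem_iff.2 rfl).degree (a := a)] at this
    exact this

theorem exists_isIrrAt (a : Λ) (j : ℤ) : ∃ g, IsIrrAt a j ((irr K a)⟦j⟧) g :=
  (exists_isIrrAt_zero a).imp fun _ h => h.shift j

theorem IsIrrAt.isIrr {g : S.carrier} (h : IsIrrAt a 0 S g) : S.IsIrr a := by
  refine ⟨g, h.ne, eq_top_iff.2 fun m _ => ?_, h.wt.deg, fun x => ⟨fun hx => ?_, fun hx =>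
    h.bact_eq_zero (fun e => hx (isIdem_iff.2 e)) g⟩⟩
  · obtain ⟨c, rfl⟩ := h.span m
    exact Submodule.smul_mem _ _ (Submodule.mem_span_singleton_self g)
  · rw [isIdem_iff.1 hx, ← idem_eq, h.wt.idem]

section StdProj

theorem emb_topSet_apply (m : topSet a (Ici a) →₀ K) {z : CircleDiagram Λ} (hz : z.top ≠ a) :
    emb K _ m z = 0 :=
  mapDomain_of_notMem_range _ _ (by rintro ⟨y, rfl⟩; exact hz y.2.1)

theorem emb_kmul_idem (m : topSet a (Ici a) →₀ K) :
    kmul K Λ (emb K _ m) (idem K Λ a) = emb K _ m := by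
  classical
  refine Finsupp.ext fun z => ?_
  rw [kmul_idem_apply]
  split_ifs with hz
  · rfl
  · rw [emb_topSet_apply m hz]

theorem emb_res_kmul_idem (n : KAlg K Λ) :
    emb K (topSet a (Ici a)) (res K _ (kmul K Λ n (idem K Λ a))) =
      kmul K Λ n (idem K Λ a) := by
  classical
  refine emb_res fun z hz => ?_
  rw [kmul_idem_apply, if_neg]
  rintro rfl
  exact hz ⟨rfl, top_le_wt z⟩

theorem emb_modAct (x : KAlg K Λ) (m : topSet a (Ici a) →₀ K) :
    emb K _ (modAct K _ x m) = kmul K Λ x (emb K _ m) := by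
  change emb K _ (res K _ (kmul K Λ x (emb K _ m))) = _
  rw [← emb_kmul_idem m, ← kmul_assoc, emb_res_kmul_idem]

theorem emb_mem_kdeg {m : topSet a (Ici a) →₀ K} (hm : m ∈ (stdProj K a).deg j) :
    emb K _ m ∈ kdeg K Λ j := by
  refine (Finsupp.mem_supported K _).2 fun z hz => ?_
  have hz := Finsupp.mem_support_iff.1 hz
  have ha : z.top = a := by
    by_contra ha
    exact hz (emb_topSet_apply m ha)
  let v : topSet a (Ici a) := ⟨z, ha, ha ▸ top_le_wt z⟩
  have := (mem_mod_deg _).1 hm v (by rwa [← emb_apply])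
  rwa [add_zero] at this

theorem isProj_stdProj (a : Λ) : (stdProj K a).IsProj a := by
  refine ⟨emb K _, Function.LeftInverse.injective res_emb, ?_, emb_modAct,
    fun j m hm => emb_mem_kdeg hm⟩
  ext n
  constructor
  · rintro ⟨m, rfl⟩
    exact ⟨emb K _ m, emb_kmul_idem m⟩
  · rintro ⟨n, rfl⟩
    exact ⟨_, emb_res_kmul_idem n⟩

/-- The basis vector of `topSet a T` at `a`. -/
def topSetIdem {T : Set Λ} (ha : a ∈ T) : topSet a T := ⟨idemDiagram a, rfl, ha⟩

variable (K) in
/-- The generator of `P(a)`. -/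
def gen (a : Λ) : (stdProj K a).carrier :=
  single (topSetIdem (Set.self_mem_Ici (a := a))) (1 : K)

theorem emb_topSetIdem {T : Set Λ} (ha : a ∈ T) :
    emb K _ (single (topSetIdem ha) 1) = idem K Λ a :=
  (emb_single _ _).trans (idem_eq K a).symm

theorem act_gen (m : topSet a (Ici a) →₀ K) :
    (stdProj K a).act (emb K _ m) (gen K a) = m := by
  change res K _ (kmul K Λ (emb K _ m) (emb K _ (single (topSetIdem _) 1))) = m
  rw [emb_topSetIdem, emb_kmul_idem, res_emb]

theorem isWt_zero {T : Set Λ} {hT : T.OrdConnected} (ha : a ∈ T) {m : topSet a T →₀ K}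
    (hm : IsWt (mod K (isConvex_topSet a hT) 0) a 0 m) :
    m = m (topSetIdem ha) • single (topSetIdem ha) (1 : K) := by
  refine Finsupp.ext fun v => ?_
  rw [smul_single, smul_eq_mul, mul_one]
  by_cases hv : m v = 0
  · by_cases he : topSetIdem ha = v
    · subst he; simp
    · rw [hv, single_eq_of_ne' he]
  · have hd := (isWt_mod _ hm hv).2
    have : v = topSetIdem ha := Subtype.ext (by
      rw [isIdem_iff.1 (isIdem_of_degree (x := v.1) (by omega)), v.2.1]; rfl)
    rw [this]; simp

theorem isProjAt_gen (a : Λ) : IsProjAt a 0 (stdProj K a) (gen K a) where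
  ne h := one_ne_zero (Finsupp.single_eq_zero.1 h)
  wt := by
    have := isWt_single (K := K) (d := 0) (isConvex_topSet a (ordConnected_Ici (a := a)))
      (topSetIdem (Set.self_mem_Ici (a := a)))
    rwa [show (topSetIdem _).1.degree = 0 from (isIdem_iff.2 rfl : IsIdem a _).degree] at this
  span m hm := ⟨_, isWt_zero (hT := ordConnected_Ici) Set.self_mem_Ici hm⟩
  gen m := ⟨_, (act_gen m).symm⟩
  lift M m hm := by
    refine ⟨⟨M.act.flip m ∘ₗ emb K _, fun x n => ?_, fun i n hn => ?_⟩, ?_⟩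
    · change M.act (emb K _ (modAct K _ x n)) m = M.act x (M.act (emb K _ n) m)
      exact (congrArg (fun y => M.act y m) (emb_modAct x n)).trans (M.act_mul _ _ _)
    · have := M.act_deg i 0 _ (emb_mem_kdeg hn) m hm.deg
      rwa [add_zero] at this
    · exact (congrArg (fun y => M.act y m) (emb_topSetIdem _)).trans hm.idem
  pos k hk m := by
    refine Finsupp.ext fun v => ?_
    by_contra hv
    have := (mem_mod_deg _).1 ((stdProj K a).proj_mem k m) v hv
    have := degree_nonneg v.1
    omega

end StdProj

theorem isCell_cell (a : Λ) : (cell K a).IsCell a := by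
  have hs : ∀ {z : CircleDiagram Λ}, z ∈ topSet a {a} → z.bot.1.Sub a.1 := fun {z} hz =>
    (show z.wt = a from hz.2) ▸ z.bot_sub
  let e : {c : Λ // c.1.Sub a.1} ≃ topSet a {a} :=
    { toFun := fun c => ⟨⟨c.1, a, a, c.2, .refl _⟩, rfl, rfl⟩
      invFun := fun z => ⟨z.1.bot, hs z.2⟩
      left_inv := fun _ => rfl
      right_inv := fun z => Subtype.ext (CircleDiagram.ext' rfl z.2.2.symm z.2.1.symm) }
  let v : Module.Basis {c : Λ // c.1.Sub a.1} K (cell K a).carrier :=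
    (Finsupp.basisSingleOne (ι := topSet a {a}) (R := K)).reindex e.symm
  have hv : ∀ c, v c = single (e c) (1 : K) := fun c =>
    (Module.Basis.reindex_apply (Finsupp.basisSingleOne (ι := topSet a {a}) (R := K)) e.symm
      c).trans (congrFun Finsupp.coe_basisSingleOne (e c))
  have hdeg : cupDegree a.1 a.1 = 0 := by
    have := (isIdem_iff.2 rfl : IsIdem a (idemDiagram a)).degree
    unfold CircleDiagram.degree at this
    change (cupDegree a.1 a.1 : ℤ) + cupDegree a.1 a.1 = 0 at this
    omega
  have hact : ∀ x c (w : topSet a {a}), 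
      (show topSet a {a} →₀ K from (cell K a).act (single x 1) (v c)) w =
      (sc x (e c).1 w.1 : K) := fun x c w => by
    rw [hv]
    exact modAct_apply x (e c) w
  refine ⟨v, fun c => ?_, fun x c => ⟨fun h hx => ?_, fun hn => ?_⟩⟩
  · have := (isWt_single (K := K) (d := 0) (isConvex_topSet a ordConnected_singleton)
      (e c)).deg
    rw [hv]
    rwa [show (e c).1.degree + 0 = cupDegree c.1.1 a.1 by
      change (cupDegree c.1.1 a.1 : ℤ) + cupDegree a.1 a.1 + 0 = _
      rw [hdeg]; simp] at this
  · refine Finsupp.ext fun w => (hact x c w).trans ?_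
    rw [hv]
    change (sc x (e c).1 w.1 : K) = _ * single (e ⟨x.bot, h⟩) (1 : K) w
    have hw : w.1.wt = a := w.2.2
    by_cases hb : w.1.bot = x.bot
    · have : e ⟨x.bot, h⟩ = w := Subtype.ext (CircleDiagram.ext' hb.symm hw.symm w.2.1.symm)
      rw [this, Finsupp.single_eq_same, mul_one, sc, if_pos ⟨hx, hb, w.2.1⟩, hw]
      rfl
    · rw [sc, if_neg fun h => hb h.2.1, single_eq_of_ne, Nat.cast_zero, mul_zero]
      exact fun h => hb (congrArg (fun z => z.1.bot) h)
  · refine Finsupp.ext fun w => (hact x c w).trans ?_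
    have hw : w.1.wt = a := w.2.2
    rw [sc, if_neg, Nat.cast_zero]
    · rfl
    rintro ⟨h1, h2, -⟩
    exact hn ⟨h2 ▸ hs w.2, h1⟩

end FinGrMod

set_option linter.unusedSectionVars false

namespace FinGrMod

variable {K : Type u} [Field K] {Λ : Set Weight} [FiniteBlock Λ]
  {M N P S T X Y Q : FinGrMod K Λ} {a b : Λ} {j k : ℤ}

/-! ### Composition factors -/

theorem exists_isIrrAt_of_simple (hS : Simple S) : ∃ a j g, IsIrrAt a j S g := by
  obtain ⟨a, j, ⟨m, hm, hm0⟩, hlow⟩ := exists_lowest (Simple.not_isZero S)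
  obtain ⟨g, hg⟩ := exists_isIrrAt (K := K) a j
  obtain ⟨f, hf⟩ := exists_toIrr hg hlow hm hm0
  have := hg.simple
  have := isIso_of_hom_simple (f := f) fun h => hf (by rw [h]; rfl)
  exact ⟨a, j, _, hg.of_iso (asIso f).symm⟩

theorem IsIrrAt.iso_irr {g : S.carrier} (hS : IsIrrAt a j S g) :
    Nonempty (S ≅ (irr K a)⟦j⟧) :=
  hS.nonempty_iso (exists_isIrrAt a j).choose_spec

theorem IsIrrAt.unique {g : S.carrier} (hS : IsIrrAt a j S g) (e : S ≅ (irr K b)⟦k⟧) :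
    a = b ∧ j = k :=
  (exists_isIrrAt b k).choose_spec.wt_eq (hS.of_iso e).wt (hS.of_iso e).ne

theorem exists_isWt_of_isCompFactor (h : IsCompFactor S X) :
    ∃ a j g m, IsIrrAt a j S g ∧ IsWt X a j m ∧ m ≠ 0 := by
  obtain ⟨hS, Y, i, p, _, _⟩ := h
  obtain ⟨a, j, g, hg⟩ := exists_isIrrAt_of_simple hS
  obtain ⟨y, hy⟩ := surjective_of_epi p g
  refine ⟨a, j, g, _, hg, (isWt_proj a j y).map i, fun h0 => hg.ne ?_⟩
  rw [map_eq_zero_iff _ (injective_of_mono i)] at h0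
  rw [← hg.wt.proj_eq, ← hy, ← lin_wt, h0, map_zero]

variable (K) in
/-- Being a shift of some `L(y)` with `y < x`. -/
def IsLower (x : Λ) (S : FinGrMod K Λ) : Prop :=
  ∃ y < x, ∃ j : ℤ, Nonempty (S ≅ (irr K y)⟦j⟧)

theorem IsIrrAt.lt_of_isLower {x : Λ} {g : S.carrier} (hS : IsIrrAt a j S g)
    (h : IsLower K x S) : a < x := by
  obtain ⟨y, hy, k, ⟨e⟩⟩ := h
  rwa [(hS.unique e).1]

/-! ### Filtrations by standard modules -/

section Filtration

variable {T T' : Set Λ} {ν : Λ}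

theorem bot_sub_of_mem {z : CircleDiagram Λ} (hz : z ∈ topSet a {ν}) : z.bot.1.Sub ν.1 :=
  (show z.wt = ν from hz.2) ▸ z.bot_sub

/-- The embedding of the basis of `V(ν)` into the basis of a subquotient of `P(a)`. -/
def cellEmb (ha : a.1.Sub ν.1) (hν : ν ∈ T) (z : topSet ν {ν}) : topSet a T :=
  ⟨⟨z.1.bot, ν, a, bot_sub_of_mem z.2, ha⟩, rfl, hν⟩

theorem exists_shortExact (hT : IsUpperSet T) (hT' : IsUpperSet T') (hTT : T' ⊆ T)
    (hν : ∀ z ∈ topSet a T, z.wt ∉ T' ↔ z.wt = ν) (hνT : ν ∈ T) (hνT' : ν ∉ T')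
    (ha : a.1.Sub ν.1) {d : ℤ} (hd : cupDegree a.1 ν.1 = cupDegree ν.1 ν.1 + d) :
    ∃ (i : mod K (isConvex_topSet a hT'.ordConnected) 0 ⟶
        mod K (isConvex_topSet a hT.ordConnected) 0)
      (p : mod K (isConvex_topSet a hT.ordConnected) 0 ⟶
        mod K (isConvex_topSet ν (ordConnected_singleton (a := ν))) d) (w : i ≫ p = 0),
      (ShortComplex.mk i p w).ShortExact ∧
        ∀ m : topSet a T →₀ K, lin p m = 0 → ∀ r, r.1.wt = ν → m r = 0 := by
  let e : topSet ν {ν} → topSet a T := cellEmb ha hνT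
  have he : Function.Injective e := fun u v huv => Subtype.ext (CircleDiagram.ext'
    (congrArg (fun z => z.1.bot) huv) (Eq.trans u.2.2 (Eq.symm v.2.2)) (u.2.1.trans v.2.1.symm))
  have her : ∀ r, r.1.wt = ν → r ∈ Set.range e := fun r hr =>
    ⟨⟨⟨r.1.bot, ν, ν, hr ▸ r.1.bot_sub, .refl _⟩, rfl, rfl⟩,
      Subtype.ext (CircleDiagram.ext' rfl hr.symm r.2.1.symm)⟩
  let e' : topSet a T' → topSet a T := fun z => ⟨z.1, z.2.1, hTT z.2.2⟩
  have he' : Function.Injective e' := fun u v huv => Subtype.ext (congrArg (fun z => z.1) huv)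
  have her' : ∀ r, r.1.wt ∈ T' → r ∈ Set.range e' := fun r hr => ⟨⟨r.1, r.2.1, hr⟩, rfl⟩
  let p : mod K (isConvex_topSet a hT.ordConnected) 0 ⟶
      mod K (isConvex_topSet ν (ordConnected_singleton (a := ν))) d :=
    comapHom _ _ e he
      (fun v => by
        have hv : v.1.wt = ν := v.2.2
        have hv' : v.1.top = ν := v.2.1
        change (cupDegree v.1.bot.1 ν.1 : ℤ) + cupDegree a.1 ν.1 + 0 = _
        rw [CircleDiagram.degree, hv, hv', hd]; ring)
      (fun x u v => sc_cell rfl (Eq.symm u.2.2) rfl (Eq.trans v.2.2 (Eq.symm u.2.2)) rfl rfl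
        (v.2.1.trans u.2.1.symm))
      (fun x y v hy => by
        by_contra hs
        have hy' : y.1.wt ∈ T' := by
          by_contra hc
          exact hy (her y ((hν y.1 y.2).1 hc))
        exact hνT' (hT' (wt_le_of_sc hs).2 hy'))
  let i : mod K (isConvex_topSet a hT'.ordConnected) 0 ⟶
      mod K (isConvex_topSet a hT.ordConnected) 0 :=
    mapHom _ _ e' he' (fun _ => rfl) (fun _ _ _ => rfl) fun x u y hy => by
      by_contra hs
      exact hy (her' y (hT' (wt_le_of_sc hs).2 u.2.2))
  have hpm : ∀ (m : topSet a T →₀ K) v, (show topSet ν {ν} →₀ K from lin p m) v = m (e v) :=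
    fun _ _ => rfl
  have hker : ∀ m : topSet a T →₀ K, lin p m = 0 → ∀ r, r.1.wt = ν → m r = 0 := by
    intro m hm r hr
    obtain ⟨v, rfl⟩ := her r hr
    exact (hpm m v).symm.trans (congrArg (fun n : topSet ν {ν} →₀ K => n v) hm)
  have w : i ≫ p = 0 := hom_ext (LinearMap.ext fun n => Finsupp.ext fun v =>
    mapDomain_of_notMem_range _ _ (by
      rintro ⟨u, hu⟩
      have h : u.1.wt = ν := congrArg (fun z => z.1.wt) hu
      exact hνT' (h ▸ u.2.2)))
  refine ⟨i, p, w, shortExact w (Finsupp.mapDomain_injective he') (fun n =>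
    ⟨Finsupp.mapDomain e n, Finsupp.comapDomain_mapDomain _ he n⟩)
    fun m hm => ⟨Finsupp.comapDomain e' m he'.injOn, Finsupp.mapDomain_comapDomain _ he' m ?_⟩, hker⟩
  intro r hr
  refine her' r ?_
  by_contra hc
  exact Finsupp.mem_support_iff.1 hr (hker m hm r ((hν r.1 r.2).1 hc))

theorem hasFiltration (x : Λ) (hT : IsUpperSet T) (hx : T ⊆ Set.Ioi x) :
    HasFiltration (fun Z => ∃ y > x, ∃ j : ℤ, Nonempty (Z ≅ (cell K y)⟦j⟧))
      (mod K (isConvex_topSet a hT.ordConnected) 0) := by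
  induction hn : (topSet a T).ncard using Nat.strong_induction_on generalizing T with
  | _ n ih =>
  have hfin : (topSet a T).Finite := (isConvex_topSet a hT.ordConnected).finite
  by_cases hne : (topSet a T).Nonempty
  swap
  · exact .zero _ (isZero_of_forall fun m => Finsupp.ext fun z => (hne ⟨z.1, z.2⟩).elim)
  obtain ⟨z, hz, hmin⟩ := Set.Finite.exists_minimalFor CircleDiagram.wt _ hfin hne
  let T' : Set Λ := {μ | μ ∈ T ∧ ¬ μ ≤ z.wt}
  have hT' : IsUpperSet T' := fun μ ν hμ h => ⟨hT hμ h.1, fun h' => h.2 (hμ.trans h')⟩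
  have hz' : z.wt ∉ T' := fun h => h.2 le_rfl
  obtain ⟨i, p, w, hse, -⟩ := exists_shortExact (K := K) hT hT' (fun _ h => h.1)
    (fun y hy => ⟨fun h => by
      have hle : y.wt ≤ z.wt := by
        by_contra hc
        exact h ⟨hy.2, hc⟩
      exact le_antisymm hle (hmin hy hle), fun h => h ▸ hz'⟩) hz.2 hz'
    (hz.1 ▸ z.top_sub) (d := cupDegree a.1 z.wt.1 - cupDegree z.wt.1 z.wt.1) (by ring)
  refine .step _ _ _ i p w hse (ih _ ?_ hT' (fun μ h => hx h.1) rfl) ⟨z.wt, hx hz.2,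
    (cupDegree a.1 z.wt.1 : ℤ) - cupDegree z.wt.1 z.wt.1, ⟨?_⟩⟩
  · rw [← hn]
    exact Set.ncard_lt_ncard ⟨fun y h => ⟨h.1, h.2.1⟩, fun h => hz' (h hz).2⟩ hfin
  · have e := modShift (K := K) (isConvex_topSet z.wt (ordConnected_singleton (a := z.wt)))
      (d := 0) ((cupDegree a.1 z.wt.1 : ℤ) - cupDegree z.wt.1 z.wt.1)
    rw [zero_add] at e
    exact e

end Filtration

/-! ### Standard modules as quotients -/

theorem isLower_of_isRadicalFactor (x : Λ) (h : IsRadicalFactor S (cell K x)) :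
    IsLower K x S := by
  obtain ⟨R, i, hi, hk, hcf⟩ := h
  obtain ⟨y, j, g, m, hg, hm, hm0⟩ := exists_isWt_of_isCompFactor hcf
  have hm1 : lin i m ≠ 0 := fun h => hm0 ((map_eq_zero_iff _ (injective_of_mono i)).1 h)
  have hm' := hm.map i
  set n : topSet x {x} →₀ K := lin i m
  obtain ⟨v, hv⟩ := Finsupp.ne_iff.1 hm1
  have hb := isWt_mod _ hm' hv
  have hw : v.1.wt = x := v.2.2
  refine ⟨y, lt_of_le_of_ne ?_ ?_, j, hg.iso_irr⟩
  · exact hb.1 ▸ (bot_le_wt v.1).trans hw.le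
  · intro hyx
    have hid : IsIdem x v.1 := ⟨hb.1.trans hyx, hw, v.2.1⟩
    have hj : j = 0 := by rw [← hb.2, hid.degree, add_zero]
    rw [hyx, hj] at hm'
    obtain ⟨g', hg'⟩ := exists_isIrrAt_zero (K := K) x
    obtain ⟨f, hf⟩ := exists_toIrr hg' (M := cell K x) (fun k hk m => by
      refine Finsupp.ext fun u => ?_
      by_contra hu
      have := (mem_mod_deg _).1 ((cell K x).proj_mem k m) u hu
      have := degree_nonneg u.1
      omega) hm' hm1
    exact hf (congrArg (fun f => lin f m) (hk _ f hg'.simple))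

theorem isLargestQuotient {x : Λ} (p : stdProj K x ⟶ cell K x) [Epi p]
    (hp : ∀ m : topSet x (Ici x) →₀ K, lin p m = 0 → ∀ r, r.1.wt = x → m r = 0) :
    IsLargestQuotient (IsLower K x) p := by
  refine ⟨inferInstance, fun S hS => isLower_of_isRadicalFactor x hS, fun Q q _ hQ =>
    exists_desc (surjective_of_epi p) q fun (m : topSet x (Ici x) →₀ K) hm => ?_⟩
  by_contra hq
  let q' : (topSet x (Ici x) →₀ K) →ₗ[K] Q.carrier := lin q
  let B : topSet x (Ici x) → Q.carrier := fun r => q' (single r 1)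
  have hsum : ∀ n : topSet x (Ici x) →₀ K, q' n = ∑ r ∈ n.support, n r • B r := fun n => by
    conv_lhs => rw [← Finsupp.sum_single n, Finsupp.sum, map_sum]
    refine sum_congr rfl fun r _ => ?_
    rw [← map_smul, smul_single, smul_eq_mul, mul_one]
  have hB : ∃ r, r.1.wt ≠ x ∧ B r ≠ 0 := by
    by_contra! hc
    refine hq ((hsum m).trans (sum_eq_zero fun r hr => ?_))
    rw [hc r fun h => Finsupp.mem_support_iff.1 hr (hp m hm r h), smul_zero]
  have hfin : {r : topSet x (Ici x) | r.1.wt ≠ x ∧ B r ≠ 0}.Finite :=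
    have := (isConvex_topSet x (ordConnected_Ici (a := x))).finite.to_subtype
    Set.toFinite _
  obtain ⟨r, ⟨hrx, hr0⟩, hmax⟩ := Set.Finite.exists_maximalFor (fun r => r.1.wt) _ hfin hB
  set ν := r.1.wt with hν
  let t : topSet x (Ici x) :=
    ⟨⟨ν, ν, x, .refl _, r.2.1 ▸ r.1.top_sub⟩, rfl, r.2.2⟩
  have ht : B r = Q.bact ⟨r.1.bot, ν, ν, r.1.bot_sub, .refl _⟩ (B t) := by
    let y : CircleDiagram Λ := ⟨r.1.bot, ν, ν, r.1.bot_sub, .refl _⟩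
    let n : topSet x (Ici x) →₀ K := modAct K _ (single y 1) (single t 1)
    have hn : ∀ v, n v = (sc y t.1 v.1 : K) := modAct_apply y t
    refine Eq.trans ?_ (lin_act q (single y 1) (single t (1 : K)))
    refine Eq.trans ?_ (hsum n).symm
    have hr1 : n r = 1 := by
      rw [hn, sc_generate (x := y) (y := t.1) (z := r.1) rfl rfl rfl rfl rfl r.2.1, Nat.cast_one]
    rw [sum_eq_single_of_mem r (Finsupp.mem_support_iff.2 (hr1 ▸ one_ne_zero)), hr1,
      one_smul]
    intro v hv hvr
    have hs : sc y t.1 v.1 ≠ 0 := fun h => Finsupp.mem_support_iff.1 hv (by rw [hn, h]; simp)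
    have hle : ν ≤ v.1.wt := (wt_le_of_sc hs).1
    have hne : v.1.wt ≠ ν := fun h => hvr (Subtype.ext (CircleDiagram.ext' (sc_cond hs).2.1 h
      (v.2.1.trans r.2.1.symm)))
    by_contra hB0
    refine hne (le_antisymm (hmax ⟨fun h => hrx ?_, fun h => hB0 (by rw [h, smul_zero])⟩ hle) hle)
    exact le_antisymm (h ▸ hle) r.2.2
  have ht0 : B t ≠ 0 := fun h => hr0 (by rw [ht, h, map_zero])
  have hwt : IsWt Q ν (t.1.degree + 0) (B t) := (isWt_single (K := K) (d := 0) _ t).map q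
  obtain ⟨g, hg⟩ := exists_isIrrAt (K := K) ν (t.1.degree + 0)
  refine absurd (hg.lt_of_isLower (hQ _ (isRadicalFactor hg hwt ht0 fun S f hS => ?_)))
    (not_lt_of_ge r.2.2)
  obtain ⟨b, j, g', hg'⟩ := exists_isIrrAt_of_simple hS
  have hgen : single t (1 : K) = (stdProj K x).bact t.1 (gen K x) := by
    have := act_gen (single t (1 : K))
    rw [emb_single] at this
    exact this.symm
  have : B t = Q.bact t.1 (lin q (gen K x)) := (congrArg (lin q) hgen).trans (lin_act q _ _)
  rw [this, lin_act]
  refine hg'.bact_eq_zero (fun h => hrx ?_) _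
  have h' := isIdem_iff.2 h
  exact h'.2.1.trans h'.2.2.symm

end FinGrMod

set_option linter.unusedSectionVars false

namespace FinGrMod

variable {K : Type u} [Field K] {Λ : Set Weight} [FiniteBlock Λ]
  {M N P S T X Y Q V I : FinGrMod K Λ} {a b : Λ} {j k : ℤ}

theorem dual_simple (hT : Simple T) : Simple (dual T) := by
  obtain ⟨a, j, g, hg⟩ := exists_isIrrAt_of_simple hT
  exact hg.dual.choose_spec.simple

theorem exists_standard (x : Λ) :
    ∃ (M : FinGrMod K Λ) (i : M ⟶ stdProj K x) (p : stdProj K x ⟶ cell K x) (w : i ≫ p = 0),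
      IsLargestQuotient (IsLower K x) p ∧ (ShortComplex.mk i p w).ShortExact ∧
        HasFiltration (fun Z => ∃ y > x, ∃ j : ℤ, Nonempty (Z ≅ (cell K y)⟦j⟧)) M := by
  obtain ⟨i, p, w, hse, hp⟩ := exists_shortExact (K := K) (isUpperSet_Ici x) (isUpperSet_Ioi x)
    Set.Ioi_subset_Ici_self
    (fun z hz => ⟨fun h => (eq_of_le_of_not_lt hz.2 h).symm, fun h => h ▸ lt_irrefl x⟩)
    (Set.self_mem_Ici (a := x)) (lt_irrefl x) (.refl _) (d := 0) (by simp)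
  have : @Epi _ _ (stdProj K x) (cell K x) p := hse.epi_g
  exact ⟨_, i, p, w, isLargestQuotient p hp, hse, hasFiltration x (isUpperSet_Ioi x) subset_rfl⟩

/-! ### Duals of radicals and socles -/

theorem isRadicalFactor_of_dual (h : IsSocleQuotientFactor S (dual V)) :
    ∃ a j g, IsIrrAt a j S g ∧ IsRadicalFactor ((irr K a)⟦-j⟧) V := by
  obtain ⟨Q, p, hp, hk, hcf⟩ := h
  obtain ⟨a, j, g, m, hg, hm, hm0⟩ := exists_isWt_of_isCompFactor hcf
  obtain ⟨φ, hφ, hφ0⟩ := hm.exists_dual hm0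
  have := (epi_iff_dual p).1 hp
  refine ⟨a, j, g, hg, dual Q, dualMap p ≫ (ev V).inv, mono_comp _ _, fun T f hT => ?_,
    isCompFactor (exists_isIrrAt a (-j)).choose_spec hφ fun h => hφ0 ?_⟩
  · have h0 := hk _ (dualMap f) (dual_simple hT)
    have hi : (dualMap p ≫ (ev V).inv) ≫ (ev V).hom = dualMap p := by simp
    refine hom_ext (LinearMap.ext fun ψ => (forall_dual_apply_eq_zero_iff K _).1 fun τ => ?_)
    refine (congrArg (fun F : Dual K (dual V).carrier => F (lin (dualMap f) τ))
      (congrArg (fun g => lin g ψ) hi)).trans ?_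
    exact (congrArg (show Dual K Q.carrier from ψ)
      (congrArg (fun g => lin g τ) h0)).trans (map_zero (show Dual K Q.carrier from ψ))
  · exact congrArg (fun ψ : Dual K Q.carrier => ψ m) h

theorem isSocleQuotientFactor_of_dual (h : IsRadicalFactor S (dual V)) :
    ∃ a j g, IsIrrAt a j S g ∧ IsSocleQuotientFactor ((irr K a)⟦-j⟧) V := by
  obtain ⟨R, i, hi, hk, hcf⟩ := h
  obtain ⟨a, j, g, m, hg, hm, hm0⟩ := exists_isWt_of_isCompFactor hcf
  obtain ⟨φ, hφ, hφ0⟩ := hm.exists_dual hm0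
  refine ⟨a, j, g, hg, dual R, flip i, epi_flip i, fun T f hT => ?_,
    isCompFactor (exists_isIrrAt a (-j)).choose_spec hφ fun h => hφ0 ?_⟩
  · have h0 := hk _ (dualMap f) (dual_simple hT)
    refine hom_ext (LinearMap.ext fun t => LinearMap.ext fun r => ?_)
    exact congrArg (fun ψ : Dual K T.carrier => ψ t) (congrArg (fun f => lin f r) h0)
  · exact congrArg (fun ψ : Dual K R.carrier => ψ m) h

theorem isLargestSubobject {x : Λ} {p : stdProj K x ⟶ cell K x}
    (hp : IsLargestQuotient (IsLower K x) p) :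
    IsLargestSubobject (IsLower K x) (dualMap p) := by
  obtain ⟨he, hlow, hmax⟩ := hp
  refine ⟨(epi_iff_dual p).1 he, fun S hS => ?_, fun B f hf hB => ?_⟩
  · obtain ⟨a, j, g, hg, hr⟩ := isRadicalFactor_of_dual hS
    exact ⟨a, (exists_isIrrAt a (-j)).choose_spec.lt_of_isLower (hlow _ hr), j, hg.iso_irr⟩
  · obtain ⟨h, hh⟩ := hmax _ (flip f) (epi_flip f) fun S hS => by
      obtain ⟨a, j, g, hg, hr⟩ := isSocleQuotientFactor_of_dual hS
      exact ⟨a, (exists_isIrrAt a (-j)).choose_spec.lt_of_isLower (hB _ hr), j, hg.iso_irr⟩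
    refine ⟨flip h, hom_ext (LinearMap.ext fun b => LinearMap.ext fun m => ?_)⟩
    exact congrArg (fun ψ : Dual K B.carrier => ψ b) (congrArg (fun f => lin f m) hh)

/-! ### Injective modules -/

theorem IsProjAt.isIndecomposable_dual {g : P.carrier} (hP : IsProjAt a j P g) :
    IsIndecomposable (dual P) := by
  obtain ⟨φ, hφ, h0⟩ := hP.wt.exists_dual hP.ne
  refine isIndecomposable_of_end (K := K) (fun h => h0 ?_) fun f => ?_
  · exact congrArg (fun ψ : Dual K P.carrier => ψ g) (eq_zero_of_isZero h φ)
  · obtain ⟨c, hc⟩ := hP.span _ (hP.wt.map (flip f ≫ (ev P).inv))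
    have h1 : flip f ≫ (ev P).inv = c • 𝟙 P := hP.hom_ext hc
    have h2 : flip f = c • (ev P).hom := by
      rw [← cancel_mono (ev P).inv, h1, Linear.smul_comp, Iso.hom_inv_id]
    refine ⟨c, FinGrMod.hom_ext (LinearMap.ext fun φ => LinearMap.ext fun m => ?_)⟩
    exact congrArg (fun ψ : Dual K (dual P).carrier => ψ φ) (congrArg (fun f => lin f m) h2)

theorem isInjectiveHull_dual {p : P ⟶ S} (hp : IsProjectiveCover p) {i : S ⟶ dual P} [Mono i]
    (e : S ≅ dual S) (hi : i = e.hom ≫ dualMap p) : IsInjectiveHull i := by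
  obtain ⟨hP, he, hcov⟩ := hp
  refine ⟨projective_iff_dual.2 hP, inferInstance, fun Y f hf => ?_⟩
  have h1 : Mono (dualMap p ≫ f) := by
    rw [hi, Category.assoc] at hf
    have := mono_comp e.inv (e.hom ≫ dualMap p ≫ f)
    rwa [Iso.inv_hom_id_assoc] at this
  have h2 := (mono_iff_dual _).1 h1
  have h3 : (dualMap f ≫ (ev P).inv) ≫ p = dualMap (dualMap p ≫ f) ≫ (ev S).inv := by
    have hn : p ≫ (ev S).hom = (ev P).hom ≫ dualMap (dualMap p) := rfl
    have hd : dualMap (dualMap p ≫ f) = dualMap f ≫ dualMap (dualMap p) := rfl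
    rw [← cancel_mono (ev S).hom, Category.assoc, Category.assoc, hn, Iso.inv_hom_id_assoc, hd,
      Category.assoc, Iso.inv_hom_id, Category.comp_id]
  have h4 : Epi ((dualMap f ≫ (ev P).inv) ≫ p) := by
    rw [h3]
    exact epi_comp _ _
  have h5 := hcov _ _ h4
  have h6 := epi_comp (dualMap f ≫ (ev P).inv) (ev P).hom
  rw [Category.assoc, Iso.inv_hom_id, Category.comp_id] at h6
  exact (mono_iff_dual f).2 h6

theorem irr_self_dual (x : Λ) : Nonempty (dual (irr K x) ≅ irr K x) := by
  obtain ⟨g, hg⟩ := exists_isIrrAt_zero (K := K) x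
  obtain ⟨φ, hφ⟩ := hg.dual
  rw [neg_zero] at hφ
  exact hφ.nonempty_iso hg

theorem simple_complete :
    IsCompleteUpToShift (fun S : FinGrMod K Λ => Simple S) (irr K) := by
  refine ⟨fun x j => (exists_isIrrAt x j).choose_spec.simple, fun S hS => ?_, fun x y j k ⟨e⟩ => ?_⟩
  · obtain ⟨a, j, g, hg⟩ := exists_isIrrAt_of_simple hS
    exact ⟨a, j, hg.iso_irr⟩
  · exact (exists_isIrrAt x j).choose_spec.unique e

theorem stdProj_unique {x y : Λ} (e : (stdProj K x)⟦j⟧ ≅ (stdProj K y)⟦k⟧) : x = y ∧ j = k :=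
  ((isProjAt_gen x).shift j).unique ((isProjAt_gen y).shift k) (exists_isIrrAt y k).choose_spec e

theorem exists_stdProj_retract (hQ : Projective Q) (h0 : ¬ IsZero Q) :
    ∃ (a : Λ) (j : ℤ) (s : (stdProj K a)⟦j⟧ ⟶ Q) (r : Q ⟶ (stdProj K a)⟦j⟧), s ≫ r = 𝟙 _ :=
  exists_retract hQ h0 (L := fun a j => (irr K a)⟦j⟧) (P := fun a j => (stdProj K a)⟦j⟧)
    exists_isIrrAt fun a j => ⟨_, (isProjAt_gen a).shift j⟩

theorem projective_complete : IsCompleteUpToShift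
    (fun M : FinGrMod K Λ => Projective M ∧ IsIndecomposable M) (stdProj K) := by
  refine ⟨fun x j => ⟨((isProjAt_gen x).shift j).projective,
    ((isProjAt_gen x).shift j).isIndecomposable⟩, fun Q ⟨hQ, hi⟩ => ?_,
    fun x y j k ⟨e⟩ => stdProj_unique e⟩
  obtain ⟨a, j, s, r, hs⟩ := exists_stdProj_retract hQ hi.1
  exact ⟨a, j, hi.nonempty_iso ((isProjAt_gen a).shift j).not_isZero hs⟩

/-- `P(x)⟨-j⟩^⊛` is `P(x)^⊛⟨j⟩`. -/
def dualStdProjShift (x : Λ) (j : ℤ) :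
    dual ((stdProj K x)⟦-j⟧) ≅ (dual (stdProj K x))⟦j⟧ :=
  dualShift _ (-j) ≪≫ eqToIso (by rw [neg_neg])

theorem injective_complete : IsCompleteUpToShift
    (fun M : FinGrMod K Λ => Injective M ∧ IsIndecomposable M)
    (fun x => dual (stdProj K x)) := by
  refine ⟨fun x j => ?_, fun I ⟨hI, hi⟩ => ?_, fun x y j k ⟨e⟩ => ?_⟩
  · have hP := (isProjAt_gen (K := K) x).shift (-j)
    exact ⟨Injective.of_iso (dualStdProjShift x j) (projective_iff_dual.2 hP.projective),
      hP.isIndecomposable_dual.of_iso (dualStdProjShift x j)⟩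
  · have h0 : ¬ IsZero (dual I) := fun h => hi.1 (isZero_of_forall fun m =>
      (forall_dual_apply_eq_zero_iff K m).1 fun φ => by
        rw [show φ = 0 from eq_zero_of_isZero h φ]; rfl)
    obtain ⟨a, j, s, r, hs⟩ := exists_stdProj_retract
      (projective_iff_dual.1 (Injective.of_iso (ev I) hI)) h0
    have hs' : (dualMap r ≫ (ev I).inv) ≫ ((ev I).hom ≫ dualMap s) = 𝟙 _ := by
      rw [Category.assoc, Iso.inv_hom_id_assoc]
      exact congrArg dualMap hs
    obtain ⟨e⟩ := hi.nonempty_iso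
      ((isProjAt_gen (K := K) a).shift j).isIndecomposable_dual.1 hs'
    exact ⟨a, -j, ⟨e ≪≫ dualShift _ j⟩⟩
  · have e' := dualStdProjShift x j ≪≫ e ≪≫ (dualStdProjShift y k).symm
    have h := stdProj_unique ((duality K Λ).functor.preimageIso
      (X := (stdProj K y)⟦-k⟧) (Y := (stdProj K x)⟦-j⟧) e'.op)
    exact ⟨h.1.symm, (neg_injective h.2).symm⟩

theorem exists_projectiveCover (x : Λ) : ∃ p : stdProj K x ⟶ irr K x, IsProjectiveCover p := by
  obtain ⟨p, -, hp⟩ := (isProjAt_gen x).exists_cover (exists_isIrrAt_zero (K := K) x).choose_spec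
  exact ⟨p, hp⟩

theorem exists_injectiveHull (x : Λ) :
    ∃ i : irr K x ⟶ dual (stdProj K x), IsInjectiveHull i := by
  obtain ⟨p, hp⟩ := exists_projectiveCover (K := K) x
  obtain ⟨e⟩ := irr_self_dual (K := K) x
  have := (epi_iff_dual p).1 hp.2.1
  have := mono_comp e.inv (dualMap p)
  exact ⟨_, isInjectiveHull_dual hp e.symm rfl⟩

theorem isPosGradedHighestWeightCategory :
    IsPosGradedHighestWeightCategory K (FinGrMod K Λ) Λ (duality K Λ) (irr K) (stdProj K)
      (cell K) where
  interval_finite x y := (interval_finite_weight x.1 y.1).preimage Subtype.val_injective.injOn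
  finite_products := inferInstance
  kernels := inferInstance
  cokernels := inferInstance
  normal_mono := inferInstance
  normal_epi := inferInstance
  artinian := isArtinianObject
  noetherian := isNoetherianObject
  hom_finite := finite_hom
  shift_add _ _ _ _ _ := rfl
  shift_smul _ _ _ _ _ := rfl
  dual_add _ _ f g := hom_ext (LinearMap.ext fun φ => LinearMap.comp_add (lin f) (lin g) φ)
  dual_smul _ _ c f := hom_ext (LinearMap.ext fun φ => LinearMap.comp_smul φ c (lin f))
  dual_shift M j := ⟨dualShift M j⟩
  irr_dual := irr_self_dual
  irr_complete := simple_complete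
  proj_cover := exists_projectiveCover
  proj_pos x S hS := by
    obtain ⟨a, j, g, m, hg, hm, hm0⟩ := exists_isWt_of_isCompFactor hS
    obtain ⟨v, hv⟩ := Finsupp.ne_iff.1 hm0
    have := (isWt_mod _ hm hv).2
    have := degree_nonneg v.1
    exact ⟨a, j, by omega, hg.iso_irr⟩
  standard := exists_standard

end FinGrMod

end

end ArcAlgebra

theorem theorem5p3 {𝕜 : Type u} [Field 𝕜] (Λ : Set Weight) (hΛ : IsBlock Λ)
    (hdef : defect Λ < ⊤) :
    ∃ (D : FinGrMod 𝕜 Λ ≌ (FinGrMod 𝕜 Λ)ᵒᵖ) (L V P : Λ → FinGrMod 𝕜 Λ),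
      FinGrMod.IsGradedDuality D ∧
      (∀ x, (L x).IsIrr x) ∧ (∀ x, (V x).IsCell x) ∧ (∀ x, (P x).IsProj x) ∧
      IsPosGradedHighestWeightCategory 𝕜 (FinGrMod 𝕜 Λ) Λ D L P V ∧
      IsCompleteUpToShift (fun M : FinGrMod 𝕜 Λ => Projective M ∧ IsIndecomposable M) P ∧
      IsCompleteUpToShift (fun M : FinGrMod 𝕜 Λ => Injective M ∧ IsIndecomposable M)
        (fun x => (D.functor.obj (P x)).unop) ∧
      (∀ x, ∃ i : L x ⟶ (D.functor.obj (P x)).unop, IsInjectiveHull i) ∧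
      (∀ x, ∃ i : (D.functor.obj (V x)).unop ⟶ (D.functor.obj (P x)).unop,
        IsLargestSubobject (fun S => ∃ y < x, ∃ j : ℤ, Nonempty (S ≅ (L y)⟦j⟧)) i) := by
  have := hΛ.finiteBlock hdef
  refine ⟨FinGrMod.duality 𝕜 Λ, FinGrMod.irr 𝕜, FinGrMod.cell 𝕜, FinGrMod.stdProj 𝕜,
    ⟨fun M => LinearEquiv.refl 𝕜 (Module.Dual 𝕜 M.carrier), fun _ _ _ _ => rfl,
      fun _ _ _ => FinGrMod.mem_dual_deg, fun _ _ _ _ => rfl⟩,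
    fun x => (FinGrMod.exists_isIrrAt_zero x).choose_spec.isIrr, FinGrMod.isCell_cell,
    FinGrMod.isProj_stdProj, FinGrMod.isPosGradedHighestWeightCategory,
    FinGrMod.projective_complete, FinGrMod.injective_complete, FinGrMod.exists_injectiveHull,
    fun x => ?_⟩
  obtain ⟨M, i, p, w, hp, -⟩ := FinGrMod.exists_standard (K := 𝕜) x
  exact ⟨_, FinGrMod.isLargestSubobject hp⟩
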